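/- **Conventions.** $\lambda$ is the security parameter. $f$ is negligible if for every $c\in\mathbb N$, $f(\lambda)<\lambda^{-c}$ for all large $\lambda$; $f={\rm poly}(\lambda)$ if $f(\lambda)<\lambda^{c}$ for some $c$ and all large $\lambda$. A PPT algorithm is a family (one for each $\lambda$) of Boolean circuits of size ${\rm poly}(\lambda)$ with uniformly random coins; a QPT algorithm is a family of quantum circuits of size ${\rm poly}(\lambda)$ over the gates $X,H,T,\mathrm{CNOT},\mathrm{Toffoli}$, with work qubits initialised to $|0\rangle$. A protocol between a PPT sender and a QPT receiver has ${\rm poly}(\lambda)$ rounds of classical messages: in each round the sender sends a message, and the receiver replies with the result of a computational-basis measurement of the message register, after applying a quantum circuit to that register and its own qubits. A malicious receiver is any QPT receiver for the same message register and number of rounds. **Trapdoor claw-free function (TCF).** It consists of PPT algorithms $\mathsf{Gen}(1^\lambda)\to(\mathsf{pp},\mathsf{sp})$ and $\mathsf{Invert}(\mathsf{sp},y)$, PPT-computable functions $F_{\mathsf{pp}}:\{0,1\}^{n(\lambda)}\to\{0,1\}^{m(\lambda)}$ and distributions $\mathcal D_{\mathsf{pp}}$ on $\{0,1\}^{n(\lambda)}$,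 such that: 1. (Efficient state preparation.) There are a QPT algorithm and a negligible $\varepsilon$ such that for every possible output $(\mathsf{pp},\cdot)$ of $\mathsf{Gen}(1^\lambda)$ the algorithm, given $\mathsf{pp}$, outputs a state within trace distance $\varepsilon(\lambda)$ of $\sum_x\sqrt{\mathcal D_{\mathsf{pp}}(x)}\,|x\rangle$. 2. (Efficient inversion.) There is a negligible $\varepsilon$ as follows. Let $\mathsf{Claw}_{\lambda}$ be the set of $y$ with exactly two preimages $x_0\ne x_1$ under $F_{\mathsf{pp}}$, for which $\left|\frac{\mathcal D_{\mathsf{pp}}(x_0)-\mathcal D_{\mathsf{pp}}(x_1)}{\mathcal D_{\mathsf{pp}}(x_0)+\mathcal D_{\mathsf{pp}}(x_1)}\right|\le\varepsilon(\lambda)$ (with $0/0=0$). Then $\mathsf{Invert}(\mathsf{sp},y)=\bot$ for every possible output $(\mathsf{pp},\mathsf{sp})$ of $\mathsf{Gen}(1^\lambda)$ and every $y\notin\mathsf{Claw}_\lambda$; and for some $c$ and all large $\lambda$, with probability at least $\lambda^{-c}$ over $(\mathsf{pp},\mathsf{sp})\gets\mathsf{Gen}(1^\lambda)$, $x\gets\mathcal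 D_{\mathsf{pp}}$, $y:=F_{\mathsf{pp}}(x)$ and the coins of $\mathsf{Invert}$, $\mathsf{Invert}(\mathsf{sp},y)$ is a pair $\{x_0,x_1\}$ with $x_0\neq x_1$ and $F_{\mathsf{pp}}(x_0)=F_{\mathsf{pp}}(x_1)=y$. 3. (Claw-freeness.) Every QPT adversary, given $\mathsf{pp}$ for $(\mathsf{pp},\mathsf{sp})\gets\mathsf{Gen}(1^\lambda)$, outputs $x_0\ne x_1$ with $F_{\mathsf{pp}}(x_0)=F_{\mathsf{pp}}(x_1)$ with negligible probability only. **Oblivious state preparation (OSP).** A protocol between a PPT sender with input $b\in\{0,1\}$ and output $s\in\{0,1\}$ and a QPT receiver that outputs a qubit $|\psi\rangle$. Correctness: for each $b$, $1-\mathbb E\big[\|\,H^b|s\rangle\langle s|H^b\,|\psi\rangle\|\big]$ is negligible. Security: for every QPT malicious receiver outputting a bit $b'$, $\big|\Pr[b'=0\mid b=0]-\Pr[b'=0\mid b=1]\big|$ is negligible. In *random-input OSP* the sender has no input and outputs $(s,b)$; correctness is that $1-\mathbb E\big[\|\,H^b|s\rangle\langle s|H^b\,|\psi\rangle\|\big]$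 is negligible, and security is that $|\Pr[b'=b]-\frac12|$ is negligible for every QPT malicious receiver. (In all correctness conditions the projectors act on the output qubits of the receiver's final pure state, given the messages, and as the identity on its other qubits.) **Claw-state generator (CSG) with search security.** A protocol between a PPT sender without input, who outputs $x_0,x_1\in\{0,1\}^{n(\lambda)}$ and $z\in\{0,1\}$, and a QPT receiver that outputs $n(\lambda)$ qubits $|\psi\rangle$. Correctness: $1-\mathbb E\big[\|\Pi_{x_0,x_1,z}|\psi\rangle\|\big]$ is negligible, where $\Pi_{x_0,x_1,z}$ is the projector onto $\frac1{\sqrt2}(|x_0\rangle+(-1)^z|x_1\rangle)$ if $x_0\neq x_1$, and $0$ if $x_0=x_1$. Search security: every QPT malicious receiver outputs $(x_0,x_1)$ with negligible probability only. **Theorem.** * If a TCF exists, then an OSP protocol exists. * If a CSG with search security exists, then an OSP protocol exists. Moreover, the following implications between existence statements hold: TCF $\Rightarrow$ CSG with search security; CSG with search security $\Rightarrow$ random-input OSP; random-input OSP $\Rightarrow$ OSP. -/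

import Mathlib

open scoped BigOperators

/-- Bit strings indexed by `ι`. -/
abbrev Bits (ι : Type) : Type := ι → Bool

/-! ### Asymptotics -/

/-- `f` is negligible: for every `c`, eventually `f k < k ^ (-c)`. -/
def Negligible (f : ℕ → ℝ) : Prop :=
  ∀ c : ℕ, ∃ N : ℕ, ∀ k : ℕ, N < k → f k < ((k : ℝ) ^ c)⁻¹

/-- `f = poly(k)`: there are `c` and `N` with `f k < k ^ c` for all `k > N`. -/
def PolyBounded (f : ℕ → ℝ) : Prop :=
  ∃ c N : ℕ, ∀ k : ℕ, N < k → f k < (k : ℝ) ^ c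

/-! ### Randomized classical circuits -/

/-- A Boolean gate of fan-in two: `dst := op l r`. -/
structure BGate (α : Type) where
  op : Bool → Bool → Bool
  l : α
  r : α
  dst : α

/-- The effect of a list of Boolean gates, executed from left to right, on the contents of
the wires. -/
def bRun {α : Type} [DecidableEq α] (gs : List (BGate α)) (s : Bits α) : Bits α :=
  gs.foldl (fun s g => Function.update s g.dst (g.op (s g.l) (s g.r))) s

/-- A randomized Boolean circuit with input bits `ι` and output bits `ο`. Besides the input
wires it has wires holding uniformly random coins and work wires initialised to `0`. -/
structure RandCircuit (ι ο : Type) where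
  coins : ℕ
  anc : ℕ
  gates : List (BGate (ι ⊕ Fin coins ⊕ Fin anc))
  out : ο → ι ⊕ Fin coins ⊕ Fin anc

namespace RandCircuit

variable {ι ο : Type}

/-- The output on input `x` and coins `r`. -/
def run [DecidableEq ι] (C : RandCircuit ι ο) (x : Bits ι) (r : Bits (Fin C.coins)) : Bits ο :=
  fun o => bRun C.gates (Sum.elim x (Sum.elim r fun _ => false)) (C.out o)

/-- Number of wires, outputs and gates. -/
def size [Fintype ι] [Fintype ο] (C : RandCircuit ι ο) : ℕ :=
  Fintype.card ι + Fintype.card ο + C.coins + C.anc + C.gates.length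

end RandCircuit

/-! ### Quantum circuits -/

/-- (Possibly unnormalised) pure states of qubits indexed by `α`, as amplitude vectors. -/
abbrev QVec (α : Type) : Type := Bits α → ℂ

/-- Quantum gates: Pauli `X`, Hadamard, `T = diag(1, exp(iπ/4))`, `CNOT` and Toffoli. -/
inductive QGate (α : Type) where
  | pauliX (t : α)
  | hadamard (t : α)
  | phaseT (t : α)
  | cnot (c t : α) (hct : c ≠ t)
  | toffoli (c₁ c₂ t : α) (h12 : c₁ ≠ c₂) (h1t : c₁ ≠ t) (h2t : c₂ ≠ t)

section
variable {α : Type} [DecidableEq α]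

/-- The action of a gate on state vectors. -/
noncomputable def QGate.apply : QGate α → QVec α → QVec α
  | .pauliX t, ψ => fun s => ψ (Function.update s t (!(s t)))
  | .hadamard t, ψ => fun s =>
      ((√2 : ℝ) : ℂ)⁻¹ * (ψ (Function.update s t false) +
        (if s t then -1 else 1) * ψ (Function.update s t true))
  | .phaseT t, ψ => fun s =>
      (if s t then Complex.exp (Complex.I * (Real.pi / 4 : ℝ)) else 1) * ψ s
  | .cnot c t _, ψ => fun s => ψ (Function.update s t (xor (s t) (s c)))
  | .toffoli c₁ c₂ t _ _ _, ψ => fun s => ψ (Function.update s t (xor (s t) (s c₁ && s c₂)))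

/-- The action of a list of gates, applied from left to right. -/
noncomputable def qRun (gs : List (QGate α)) (ψ : QVec α) : QVec α :=
  gs.foldl (fun ψ g => g.apply ψ) ψ

end

/-- The computational basis state `|s⟩`. -/
def ket {α : Type} [Fintype α] [DecidableEq α] (s : Bits α) : QVec α :=
  fun s' => if s' = s then 1 else 0

/-- The Euclidean norm of a state vector. -/
noncomputable def qNorm {α : Type} [Fintype α] [DecidableEq α] (ψ : QVec α) : ℝ :=
  √(∑ s, ‖ψ s‖ ^ 2)

/-- A (purified) quantum circuit with classical input `ι` and output qubits `ο`: the input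
qubits start in `|x⟩`, the output and work qubits in `|0⟩`. -/
structure QCircuit (ι ο : Type) where
  anc : ℕ
  gates : List (QGate (ι ⊕ ο ⊕ Fin anc))

namespace QCircuit

variable {ι ο : Type} [Fintype ι] [Fintype ο] [DecidableEq ι] [DecidableEq ο]

/-- The final pure state on all qubits, on input `x`. -/
noncomputable def final (C : QCircuit ι ο) (x : Bits ι) : QVec (ι ⊕ ο ⊕ Fin C.anc) :=
  qRun C.gates (ket (Sum.elim x fun _ => false))

/-- The reduced density matrix of the output qubits, all other qubits being traced out. -/
noncomputable def density (C : QCircuit ι ο) (x : Bits ι) : Matrix (Bits ο) (Bits ο) ℂ :=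
  fun y y' => ∑ u : Bits ι, ∑ v : Bits (Fin C.anc),
    C.final x (Sum.elim u (Sum.elim y v)) * star (C.final x (Sum.elim u (Sum.elim y' v)))

/-- The probability of outcome `y` when the output qubits are measured. -/
noncomputable def prob (C : QCircuit ι ο) (x : Bits ι) (y : Bits ο) : ℝ :=
  ∑ u : Bits ι, ∑ v : Bits (Fin C.anc), ‖C.final x (Sum.elim u (Sum.elim y v))‖ ^ 2

/-- Number of qubits and gates. -/
def size (C : QCircuit ι ο) : ℕ :=
  Fintype.card ι + Fintype.card ο + C.anc + C.gates.length

end QCircuit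

section TraceDistance
open scoped MatrixOrder ComplexOrder

/-- The trace norm `Tr √(A† A)`. -/
noncomputable def traceNorm {σ : Type} [Fintype σ] [DecidableEq σ] (A : Matrix σ σ ℂ) : ℝ :=
  (Matrix.trace (CFC.sqrt (A.conjTranspose * A))).re

/-- The trace distance `½ ‖ρ₀ - ρ₁‖₁`. -/
noncomputable def traceDist {σ : Type} [Fintype σ] [DecidableEq σ] (ρ₀ ρ₁ : Matrix σ σ ℂ) : ℝ :=
  (1 / 2) * traceNorm (ρ₀ - ρ₁)

end TraceDistance

/-! ### Trapdoor claw-free functions -/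

/-- The data of a keyed function family with trapdoors: parameter generation
`Gen(1^k) → (pp, sp)`, functions `F_pp : {0,1}^n → {0,1}^m`, input distributions `D_pp` and
`Invert(sp, y)`. The values of `F` and `D` at strings `pp` that `Gen` cannot output play no
role. The first output bit of `invert` says whether the output is a pair `{x₀, x₁}` (`true`)
or `⊥` (`false`). -/
structure TCFData where
  n : ℕ → ℕ
  m : ℕ → ℕ
  ppLen : ℕ → ℕ
  spLen : ℕ → ℕ
  gen : ∀ k, RandCircuit Empty (Fin (ppLen k) ⊕ Fin (spLen k))
  F : ∀ k, Bits (Fin (ppLen k)) → Bits (Fin (n k)) → Bits (Fin (m k))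
  D : ∀ k, Bits (Fin (ppLen k)) → PMF (Bits (Fin (n k)))
  invert : ∀ k, RandCircuit (Fin (spLen k) ⊕ Fin (m k)) (Unit ⊕ Fin (n k) ⊕ Fin (n k))

namespace TCFData

variable (X : TCFData) (k : ℕ)

/-- The coins of `Gen(1^k)`. -/
abbrev GenCoins : Type := Bits (Fin (X.gen k).coins)

/-- The public parameters output by `Gen(1^k)` on coins `r`. -/
def pp (r : X.GenCoins k) : Bits (Fin (X.ppLen k)) :=
  fun i => (X.gen k).run Empty.elim r (Sum.inl i)

/-- The secret parameters output by `Gen(1^k)` on coins `r`. -/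
def sp (r : X.GenCoins k) : Bits (Fin (X.spLen k)) :=
  fun i => (X.gen k).run Empty.elim r (Sum.inr i)

/-- `Invert(sp, y)` on coins `r`; `none` is `⊥`. -/
def Invert (sp : Bits (Fin (X.spLen k))) (y : Bits (Fin (X.m k)))
    (r : Bits (Fin (X.invert k).coins)) : Option (Bits (Fin (X.n k)) × Bits (Fin (X.n k))) :=
  let o := (X.invert k).run (Sum.elim sp y) r
  if o (Sum.inl ()) then
    some (fun i => o (Sum.inr (Sum.inl i)), fun i => o (Sum.inr (Sum.inr i)))
  else none

/-- The probability mass of `x` under `D_pp`. -/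
noncomputable def mass (pp : Bits (Fin (X.ppLen k))) (x : Bits (Fin (X.n k))) : ℝ :=
  (X.D k pp x).toReal

/-- The state `|ψ_pp⟩ = ∑ x, √(D_pp x) |x⟩`. -/
noncomputable def psi (pp : Bits (Fin (X.ppLen k))) : QVec (Fin (X.n k)) :=
  fun x => ((√(X.mass k pp x) : ℝ) : ℂ)

/-- `{x₀, x₁}` is a claw for `pp` with image `y`. -/
def IsClaw (pp : Bits (Fin (X.ppLen k))) (y : Bits (Fin (X.m k)))
    (x₀ x₁ : Bits (Fin (X.n k))) : Prop :=
  x₀ ≠ x₁ ∧ X.F k pp x₀ = y ∧ X.F k pp x₁ = y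

/-- The images with exactly two preimages, whose relative weights differ by at most `ε`. -/
def ClawSet (ε : ℝ) (pp : Bits (Fin (X.ppLen k))) : Set (Bits (Fin (X.m k))) :=
  {y | ∃ x₀ x₁, X.IsClaw k pp y x₀ x₁ ∧ (∀ x, X.F k pp x = y → x = x₀ ∨ x = x₁) ∧
    |X.mass k pp x₀ / (X.mass k pp x₀ + X.mass k pp x₁) -
      X.mass k pp x₁ / (X.mass k pp x₀ + X.mass k pp x₁)| ≤ ε}

open Classical in
/-- The probability, over `(pp, sp) ← Gen(1^k)`, `x ← D_pp` and the coins of `Invert`, that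
`Invert(sp, F_pp(x))` is a claw with image `F_pp(x)`. -/
noncomputable def invertProb : ℝ :=
  𝔼 r : X.GenCoins k, ∑ x, X.mass k (X.pp k r) x *
    𝔼 r' : Bits (Fin (X.invert k).coins),
      if ∃ x₀ x₁, X.Invert k (X.sp k r) (X.F k (X.pp k r) x) r' = some (x₀, x₁) ∧
        X.IsClaw k (X.pp k r) (X.F k (X.pp k r) x) x₀ x₁ then 1 else 0

open Classical in
/-- The probability that `A`, given `pp`, outputs a claw. -/
noncomputable def clawProb (A : QCircuit (Fin (X.ppLen k)) (Fin (X.n k) ⊕ Fin (X.n k))) : ℝ :=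
  𝔼 r : X.GenCoins k, ∑ x₀, ∑ x₁,
    if x₀ ≠ x₁ ∧ X.F k (X.pp k r) x₀ = X.F k (X.pp k r) x₁ then
      A.prob (X.pp k r) (Sum.elim x₀ x₁) else 0

/-- A (plain) trapdoor claw-free function. -/
structure IsTCF (X : TCFData) : Prop where
  /-- `Gen` and `Invert` are PPT. -/
  gen_ppt : PolyBounded fun k => ((X.gen k).size : ℝ)
  invert_ppt : PolyBounded fun k => ((X.invert k).size : ℝ)
  /-- The functions `F_pp` are PPT computable. -/
  eval_ppt : ∃ E : ∀ k, RandCircuit (Fin (X.ppLen k) ⊕ Fin (X.n k)) (Fin (X.m k)),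
    (PolyBounded fun k => ((E k).size : ℝ)) ∧
    ∀ k r x r', (E k).run (Sum.elim (X.pp k r) x) r' = X.F k (X.pp k r) x
  /-- Efficient state preparation. -/
  state_preparation : ∃ Q : ∀ k, QCircuit (Fin (X.ppLen k)) (Fin (X.n k)),
    (PolyBounded fun k => ((Q k).size : ℝ)) ∧
    ∃ ε : ℕ → ℝ, Negligible ε ∧ ∀ k r,
      traceDist ((Q k).density (X.pp k r))
        (Matrix.vecMulVec (X.psi k (X.pp k r)) (star (X.psi k (X.pp k r)))) ≤ ε k
  /-- Efficient inversion: success with inverse-polynomial probability, and `⊥` on every image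
  that is not a balanced two-element claw. -/
  inversion : ∃ ε : ℕ → ℝ, Negligible ε ∧
    (∃ c N : ℕ, ∀ k, N < k → ((k : ℝ) ^ c)⁻¹ ≤ X.invertProb k) ∧
    ∀ k r y r', y ∉ X.ClawSet k (ε k) (X.pp k r) → X.Invert k (X.sp k r) y r' = none
  /-- Claw-freeness. -/
  claw_free : ∀ A : ∀ k, QCircuit (Fin (X.ppLen k)) (Fin (X.n k) ⊕ Fin (X.n k)),
    (PolyBounded fun k => ((A k).size : ℝ)) → Negligible fun k => X.clawProb k (A k)

end TCFData

/-! ### Protocols between a classical sender and a quantum receiver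

The parties share a register of `q` message bits. In each of the `T` rounds the sender applies
a Boolean circuit to its private wires and the message register, whose contents then go to the
receiver; the receiver applies a quantum circuit to the message register and its own qubits,
and the message register is measured in the computational basis and goes back to the sender.
After the last round the sender applies a final circuit and reads off its output. -/

/-- A sender with input bits `ι` and output bits `ο`. -/
structure Sender (q T : ℕ) (ι ο : Type) where
  coins : ℕ
  anc : ℕ
  step : Fin T → List (BGate ((ι ⊕ Fin coins ⊕ Fin anc) ⊕ Fin q))
  final : List (BGate ((ι ⊕ Fin coins ⊕ Fin anc) ⊕ Fin q))
  out : ο → (ι ⊕ Fin coins ⊕ Fin anc) ⊕ Fin q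

/-- A receiver (honest or malicious) whose output is held by the qubits `κ`; all of its
own qubits start in `|0⟩`. -/
structure Receiver (q T : ℕ) (κ : Type) where
  anc : ℕ
  step : Fin T → List (QGate (Fin q ⊕ κ ⊕ Fin anc))

section Protocols

variable {q T : ℕ} {ι ο κ : Type}

/-- The wires of the sender: private wires and the message register. -/
abbrev Sender.Wires (S : Sender q T ι ο) : Type := (ι ⊕ Fin S.coins ⊕ Fin S.anc) ⊕ Fin q

/-- The receiver's own qubits. -/
abbrev Receiver.Work (R : Receiver q T κ) : Type := κ ⊕ Fin R.anc

/-- Number of rounds, wires, outputs and gates. -/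
def Sender.size [Fintype ι] [Fintype ο] (S : Sender q T ι ο) : ℕ :=
  q + T + Fintype.card ι + Fintype.card ο + S.coins + S.anc +
    ∑ i, (S.step i).length + S.final.length

/-- Number of rounds, qubits and gates. -/
def Receiver.size [Fintype κ] (R : Receiver q T κ) : ℕ :=
  q + T + Fintype.card κ + R.anc + ∑ i, (R.step i).length

variable [DecidableEq ι] [Fintype κ] [DecidableEq κ]

/-- The unnormalised state of the receiver's own qubits after round `i`, if `msg` is received,
`ψ` is the previous state, and `reply` is the result of measuring the message register. -/
noncomputable def Receiver.respond (R : Receiver q T κ) (i : Fin T) (msg reply : Bits (Fin q))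
    (ψ : QVec R.Work) : QVec R.Work :=
  fun w => qRun (R.step i)
    (fun s => if s ∘ Sum.inl = msg then ψ (s ∘ Sum.inr) else 0) (Sum.elim reply w)

/-- The joint configuration after the last round, if the sender has input `x` and coins `r` and
the receiver's replies are `t`: the contents of the sender's wires, and the unnormalised state
of the receiver's qubits. The squared norm of the latter is the probability of the replies `t`
(given `x` and `r`), and its normalisation is the receiver's state in that event. -/
noncomputable def execute (S : Sender q T ι ο) (R : Receiver q T κ) (x : Bits ι)
    (r : Bits (Fin S.coins)) (t : Fin T → Bits (Fin q)) : Bits S.Wires × QVec R.Work :=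
  Fin.foldl T
    (fun c i =>
      let s := bRun (S.step i) c.1
      (Sum.elim (s ∘ Sum.inl) (t i), R.respond i (s ∘ Sum.inr) (t i) c.2))
    (Sum.elim (Sum.elim x (Sum.elim r fun _ => false)) (fun _ => false), ket fun _ => false)

/-- The sender's output in such an execution. -/
noncomputable def senderOut (S : Sender q T ι ο) (R : Receiver q T κ) (x : Bits ι)
    (r : Bits (Fin S.coins)) (t : Fin T → Bits (Fin q)) : Bits ο :=
  fun o => bRun S.final (execute S R x r t).1 (S.out o)

/-- The operator `|v⟩⟨v| ⊗ I` on the qubits `κ` and further qubits `β`. -/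
noncomputable def projOnto {β : Type} (v : QVec κ) (ψ : QVec (κ ⊕ β)) : QVec (κ ⊕ β) :=
  fun s => v (s ∘ Sum.inl) * ∑ o, star (v o) * ψ (Sum.elim o (s ∘ Sum.inr))

/-- The expectation of `‖(|v_a⟩⟨v_a| ⊗ I) |ψ⟩‖`, where `a` is the sender's output and `|ψ⟩` the
receiver's final (normalised) state. For orthonormal `|a⟩`, this is the expectation of
`‖Π |a⟩|ψ⟩‖` for `Π = ∑ a, |a⟩⟨a| ⊗ |v_a⟩⟨v_a|`. -/
noncomputable def expectedOverlap (S : Sender q T ι ο) (R : Receiver q T κ) (x : Bits ι)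
    (v : Bits ο → QVec κ) : ℝ :=
  𝔼 r : Bits (Fin S.coins), ∑ t : Fin T → Bits (Fin q),
    let ψ := (execute S R x r t).2
    qNorm ψ ^ 2 *
      qNorm (projOnto (v (senderOut S R x r t)) (((qNorm ψ)⁻¹ : ℂ) • ψ))

open Classical in
/-- The probability that `E a o` holds, where `a` is the sender's output and `o` is the result of
measuring the receiver's output qubits. -/
noncomputable def eventProb (S : Sender q T ι ο) (R : Receiver q T κ) (x : Bits ι)
    (E : Bits ο → Bits κ → Prop) : ℝ :=
  𝔼 r : Bits (Fin S.coins), ∑ t : Fin T → Bits (Fin q), ∑ w : Bits R.Work,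
    if E (senderOut S R x r t) (w ∘ Sum.inl) then ‖(execute S R x r t).2 w‖ ^ 2 else 0

end Protocols

/-- A protocol: for each security parameter, a sender and an honest receiver. -/
structure Protocol (ι ο κ : ℕ → Type) where
  q : ℕ → ℕ
  T : ℕ → ℕ
  S : ∀ k, Sender (q k) (T k) (ι k) (ο k)
  R : ∀ k, Receiver (q k) (T k) (κ k)

/-- The sender is PPT and the honest receiver is QPT. -/
def Protocol.Efficient {ι ο κ : ℕ → Type} [∀ k, Fintype (ι k)] [∀ k, Fintype (ο k)]
    [∀ k, Fintype (κ k)] (P : Protocol ι ο κ) : Prop :=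
  (PolyBounded fun k => ((P.S k).size : ℝ)) ∧ (PolyBounded fun k => ((P.R k).size : ℝ))

/-- The malicious QPT receivers for `P` with output bits `κ'`. -/
structure Protocol.Adversary {ι ο κ : ℕ → Type} (P : Protocol ι ο κ) (κ' : ℕ → Type)
    [∀ k, Fintype (κ' k)] where
  R : ∀ k, Receiver (P.q k) (P.T k) (κ' k)
  qpt : PolyBounded fun k => ((R k).size : ℝ)

/-! ### Oblivious state preparation -/

/-- The single-qubit state `H^b |s⟩`. -/
noncomputable def hadamardKet (b s : Bool) : QVec Unit := fun o =>
  if b then ((√2 : ℝ) : ℂ)⁻¹ * (if s && o () then -1 else 1) else if o () = s then 1 else 0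

/-- The shape of (chosen-input) OSP: the sender has an input bit and an output bit, and the
receiver outputs a qubit. -/
abbrev OSPProtocol : Type := Protocol (fun _ => Unit) (fun _ => Unit) (fun _ => Unit)

/-- (Chosen-input) oblivious state preparation. -/
structure IsOSP (P : OSPProtocol) : Prop where
  efficient : P.Efficient
  correct : ∀ b : Bool, Negligible fun k =>
    1 - expectedOverlap (P.S k) (P.R k) (fun _ => b) fun a => hadamardKet b (a ())
  secure : ∀ A : P.Adversary fun _ => Unit, Negligible fun k =>
    |eventProb (P.S k) (A.R k) (fun _ => false) (fun _ o => o () = false) -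
      eventProb (P.S k) (A.R k) (fun _ => true) (fun _ o => o () = false)|

/-- The shape of random-input OSP: the sender outputs two bits `(s, b)`. -/
abbrev RandomOSPProtocol : Type := Protocol (fun _ => Empty) (fun _ => Fin 2) (fun _ => Unit)

/-- Random-input oblivious state preparation. -/
structure IsRandomOSP (P : RandomOSPProtocol) : Prop where
  efficient : P.Efficient
  correct : Negligible fun k =>
    1 - expectedOverlap (P.S k) (P.R k) Empty.elim fun a => hadamardKet (a 1) (a 0)
  secure : ∀ A : P.Adversary fun _ => Unit, Negligible fun k =>
    |eventProb (P.S k) (A.R k) Empty.elim (fun a o => o () = a 1) - 1 / 2|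

/-! ### Claw-state generators -/

/-- The state `(|x₀⟩ + (-1)^z |x₁⟩) / √2`, replaced by `0` if `x₀ = x₁`. -/
noncomputable def clawKet {n : ℕ} (x₀ x₁ : Bits (Fin n)) (z : Bool) : QVec (Fin n) :=
  if x₀ = x₁ then 0
  else ((√2 : ℝ) : ℂ)⁻¹ • (ket x₀ + (if z then (-1 : ℂ) else 1) • ket x₁)

/-- The shape of a claw-state generator: the sender outputs `x₀, x₁ ∈ {0,1}^n` and a bit `z`,
and the receiver outputs `n` qubits. -/
abbrev CSGProtocol (n : ℕ → ℕ) : Type :=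
  Protocol (fun _ => Empty) (fun k => Fin (n k) ⊕ Fin (n k) ⊕ Unit) (fun k => Fin (n k))

/-- A claw-state generator with search security. -/
structure IsSearchSecureCSG {n : ℕ → ℕ} (P : CSGProtocol n) : Prop where
  efficient : P.Efficient
  correct : Negligible fun k =>
    1 - expectedOverlap (P.S k) (P.R k) Empty.elim fun a =>
      clawKet (fun i => a (Sum.inl i)) (fun i => a (Sum.inr (Sum.inl i)))
        (a (Sum.inr (Sum.inr ())))
  search_secure : ∀ A : P.Adversary fun k => Fin (n k) ⊕ Fin (n k), Negligible fun k =>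
    eventProb (P.S k) (A.R k) Empty.elim fun a o =>
      (∀ i, o (Sum.inl i) = a (Sum.inl i)) ∧ ∀ i, o (Sum.inr i) = a (Sum.inr (Sum.inl i))

set_option linter.unusedSectionVars false

/-! ### Asymptotics -/

/-! The two implications to OSP are compositions of three constructions, each of which adds one or
two rounds to a protocol.

From a TCF to a claw state (`IsTCF.exists_isSearchSecureCSG`): the sender draws `k ^ (c + 1)`
independent keys and sends all public parameters. The receiver prepares the input superpositions,
evaluates the functions and returns the measured images, so that each register collapses to its
preimages. The sender inverts, announces the first instance with a verified claw, and the receiver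
outputs that register. It is close to `(|x₀⟩ + |x₁⟩)/√2` because accepted images have exactly two
preimages of nearly equal weight (`sub_le_clawWeight`); all instances fail only with exponentially
small probability (`Negligible.one_sub_pow`), and then the sender outputs fresh random strings. An
adversary who finds the claw of instance `j` gives a collision finder: hard-wire the announcement of
`j`, plant the challenge key there and fix the other keys (`exists_collision_finder`). The random
strings are guessed with probability `2 ^ (-2n)`, which claw-freeness itself forces to be
negligible.

From a claw state to random-input OSP (`IsSearchSecureCSG.exists_isRandomOSP`): the sender publishes
masks `c₀, c₁` and a selector telling `x₀` from `x₁`. The receiver computes `F(x)`, the inner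
product of `x` with the mask of its part, into a new qubit and measures the claw register in the
Hadamard basis with outcome `d`. If `F(x₀) = F(x₁)`, the qubit is `|F(x₀)⟩`; otherwise it is `H|z ⊕
d·(x₀ ⊕ x₁)⟩` (`clawKet_overlap_le`). The basis bit `b = F(x₀) ⊕ F(x₁)` is the inner product of the
mask with `(x₀, x₁)`, so predicting it gives the search problem by the quantum Goldreich–Levin
argument (`goldreichLevin`). The selector depends on the claw, but takes only `2(n + 1)` values and
can be guessed.

From random-input to chosen-input OSP (`IsRandomOSP.exists_isOSP`): on input `b` the sender reveals
`b ⊕ b'`, and the receiver applies `H` if this bit is `1`. A distinguisher run on a fixed message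
bit becomes a predictor of `b'`.

Three devices are shared. `Sender.Extends`, `Receiver.exists_extends` and
`Receiver.exists_reduction` handle the addition of a round once and for all; in reductions the
additional replies of the adversary stay unmeasured, which does not change any outcome probability.
Since receivers apply gates only within rounds, reductions need a round, and the
`eventually_rounds_pos` lemmas provide it. Classical computations are bounded as straight-line
programs (`BComp`) and compiled either to Boolean gates or to reversible quantum gates. Correctness
is compared through squared overlaps (`sqOverlap`), at the cost of a factor `2` in the error.
Circuit families are non-uniform, so favourable coins and guesses may be fixed by averaging. -/

theorem exists_forall_gt_iff_eventually {p : ℕ → Prop} :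
    (∃ N : ℕ, ∀ k : ℕ, N < k → p k) ↔ ∀ᶠ k in Filter.atTop, p k := by
  rw [Filter.eventually_atTop]
  constructor
  · rintro ⟨N, h⟩
    exact ⟨N + 1, fun k hk => h k hk⟩
  · rintro ⟨N, h⟩
    exact ⟨N, fun k hk => h k hk.le⟩

theorem negligible_iff {f : ℕ → ℝ} :
    Negligible f ↔ ∀ c : ℕ, ∀ᶠ k : ℕ in Filter.atTop, f k < ((k : ℝ) ^ c)⁻¹ :=
  forall_congr' fun _ => exists_forall_gt_iff_eventually

/-- Polynomial boundedness of natural-number valued functions. -/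
def PolyNat (f : ℕ → ℕ) : Prop := ∃ c : ℕ, ∀ᶠ k : ℕ in Filter.atTop, f k < k ^ c

theorem polyBounded_iff {f : ℕ → ℕ} : (PolyBounded fun k => (f k : ℝ)) ↔ PolyNat f := by
  refine exists_congr fun c => ?_
  rw [exists_forall_gt_iff_eventually]
  refine Filter.eventually_congr (Filter.Eventually.of_forall fun k => ?_)
  simp only [← Nat.cast_pow, Nat.cast_lt]

namespace PolyNat

theorem mono_eventually {f g : ℕ → ℕ} (hg : PolyNat g) (h : ∀ᶠ k in Filter.atTop, f k ≤ g k) :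
    PolyNat f := by
  obtain ⟨c, hc⟩ := hg
  exact ⟨c, by filter_upwards [hc, h] with k h1 h2 using h2.trans_lt h1⟩

theorem mono {f g : ℕ → ℕ} (hg : PolyNat g) (h : ∀ k, f k ≤ g k) : PolyNat f :=
  hg.mono_eventually (Filter.Eventually.of_forall h)

theorem const (a : ℕ) : PolyNat fun _ => a :=
  ⟨1, by filter_upwards [Filter.eventually_gt_atTop a] with k hk; simpa using hk⟩

theorem id : PolyNat fun k => k :=
  ⟨2, by
    filter_upwards [Filter.eventually_gt_atTop 1] with k hk
    nlinarith⟩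

theorem mul {f g : ℕ → ℕ} (hf : PolyNat f) (hg : PolyNat g) : PolyNat fun k => f k * g k := by
  obtain ⟨c, hc⟩ := hf
  obtain ⟨d, hd⟩ := hg
  refine ⟨c + d, ?_⟩
  filter_upwards [hc, hd] with k h1 h2
  rw [pow_add]
  exact Nat.mul_lt_mul'' h1 h2

theorem add {f g : ℕ → ℕ} (hf : PolyNat f) (hg : PolyNat g) : PolyNat fun k => f k + g k := by
  obtain ⟨c, hc⟩ := hf
  obtain ⟨d, hd⟩ := hg
  refine ⟨max c d + 1, ?_⟩
  filter_upwards [hc, hd, Filter.eventually_gt_atTop 1] with k h1 h2 hk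
  have e1 : k ^ c ≤ k ^ max c d := Nat.pow_le_pow_right (by lia) (le_max_left _ _)
  have e2 : k ^ d ≤ k ^ max c d := Nat.pow_le_pow_right (by lia) (le_max_right _ _)
  rw [pow_succ]
  nlinarith

theorem pow {f : ℕ → ℕ} (hf : PolyNat f) (n : ℕ) : PolyNat fun k => f k ^ n := by
  induction n with
  | zero => simpa using const 1
  | succ n ih => simpa [pow_succ] using ih.mul hf

end PolyNat

namespace Negligible

/-- Negligibility is a bound from above only, so the signs of `f` and `g` play no role. -/
theorem mono {f g : ℕ → ℝ} (hg : Negligible g) (h : ∀ᶠ k in Filter.atTop, f k ≤ g k) :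
    Negligible f := by
  rw [negligible_iff] at *
  intro c
  filter_upwards [hg c, h] with k h1 h2 using h2.trans_lt h1

theorem poly_mul {f : ℕ → ℝ} {p : ℕ → ℕ} (hf : Negligible f) (hp : PolyNat p) :
    Negligible fun k => p k * f k := by
  obtain ⟨d, hd⟩ := hp
  rw [negligible_iff] at *
  intro c
  filter_upwards [hf (c + d), hd, Filter.eventually_gt_atTop 0] with k h1 h2 h3
  have hk : (0 : ℝ) < k := by exact_mod_cast h3
  have h2' : (p k : ℝ) < (k : ℝ) ^ d := by exact_mod_cast h2
  calc (p k : ℝ) * f k ≤ p k * ((k : ℝ) ^ (c + d))⁻¹ := by gcongr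
    _ < (k : ℝ) ^ d * ((k : ℝ) ^ (c + d))⁻¹ := by gcongr
    _ = ((k : ℝ) ^ c)⁻¹ := by rw [pow_add]; field_simp

theorem add {f g : ℕ → ℝ} (hf : Negligible f) (hg : Negligible g) :
    Negligible fun k => f k + g k := by
  rw [negligible_iff] at *
  intro c
  filter_upwards [hf (c + 1), hg (c + 1), Filter.eventually_gt_atTop 1] with k h1 h2 h3
  have hk : (2 : ℝ) ≤ k := by exact_mod_cast h3
  calc f k + g k < ((k : ℝ) ^ (c + 1))⁻¹ + ((k : ℝ) ^ (c + 1))⁻¹ := add_lt_add h1 h2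
    _ = 2 / k * ((k : ℝ) ^ c)⁻¹ := by rw [pow_succ]; field_simp; ring
    _ ≤ 1 * ((k : ℝ) ^ c)⁻¹ := by
        gcongr
        rw [div_le_one (by linarith)]; exact hk
    _ = _ := one_mul _

theorem const_mul {f : ℕ → ℝ} (hf : Negligible f) (a : ℕ) : Negligible fun k => a * f k :=
  hf.poly_mul (PolyNat.const a)

/-- Exponent `2 * c` for `g` yields exponent `c` for `f`. This absorbs the square that the
Goldreich–Levin argument puts on the advantage. -/
theorem of_sq_le {f g : ℕ → ℝ} (hg : Negligible g) (h : ∀ᶠ k in Filter.atTop, f k ^ 2 ≤ g k) :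
    Negligible f := by
  rw [negligible_iff] at *
  intro c
  filter_upwards [hg (2 * c), h, Filter.eventually_gt_atTop 0] with k h1 h2 h3
  have hk : (0 : ℝ) < k := by exact_mod_cast h3
  refine lt_of_pow_lt_pow_left₀ 2 (by positivity) (h2.trans_lt ?_)
  calc g k < _ := h1
    _ = _ := by rw [inv_pow, ← pow_mul, mul_comm]

theorem eventually_lt {f : ℕ → ℝ} (hf : Negligible f) {a : ℝ} (ha : 0 < a) :
    ∀ᶠ k in Filter.atTop, f k < a := by
  rw [negligible_iff] at hf
  obtain ⟨N, hN⟩ := exists_nat_gt a⁻¹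
  filter_upwards [hf 1, Filter.eventually_gt_atTop N] with k h1 h2
  refine h1.trans ?_
  rw [pow_one]
  exact inv_lt_of_inv_lt₀ ha (hN.trans (by exact_mod_cast h2))

/-- By `1 - S ≤ exp (-S)`, repeating an experiment of success probability at least `k ^ (-c) / 2`
independently `k ^ (c + 1)` times leaves a failure probability of at most `exp (-k / 2)`. -/
theorem one_sub_pow {S : ℕ → ℝ} {c : ℕ} (h1 : ∀ k, S k ≤ 1)
    (h : ∀ᶠ k : ℕ in Filter.atTop, ((k : ℝ) ^ c)⁻¹ / 2 ≤ S k) :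
    Negligible fun k => (1 - S k) ^ (k ^ (c + 1)) := by
  have key : Negligible fun k : ℕ => Real.exp (-(k : ℝ) / 2) := by
    rw [negligible_iff]
    intro d
    have := (Real.tendsto_pow_mul_exp_neg_atTop_nhds_zero d).comp
      ((tendsto_natCast_atTop_atTop (R := ℝ)).atTop_mul_const (show (0 : ℝ) < 1 / 2 by norm_num))
    filter_upwards [this.eventually_lt_const (show (0 : ℝ) < (1 / 2) ^ d by positivity),
      Filter.eventually_gt_atTop 0] with k h1 h2
    have hk : (0 : ℝ) < k := by exact_mod_cast h2
    simp only [Function.comp, mul_pow] at h1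
    have h3 : (-(k * (1 / 2)) : ℝ) = -(k : ℝ) / 2 := by ring
    rw [h3] at h1
    rw [lt_inv_comm₀ (Real.exp_pos _) (by positivity), lt_inv_comm₀ (by positivity) (by positivity)]
    rw [← one_div, lt_div_iff₀ (by positivity)]
    have h4 : (0 : ℝ) < (1 / 2) ^ d := by positivity
    by_contra hc
    push Not at hc
    nlinarith
  refine key.mono ?_
  filter_upwards [h, Filter.eventually_gt_atTop 0] with k hk h2
  have hk0 : (0 : ℝ) < k := by exact_mod_cast h2
  calc (1 - S k) ^ (k ^ (c + 1)) ≤ (Real.exp (-S k)) ^ (k ^ (c + 1)) := by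
        refine pow_le_pow_left₀ (by linarith [h1 k]) ?_ _
        have := Real.add_one_le_exp (-S k)
        linarith
    _ = Real.exp (-(S k * (k : ℝ) ^ (c + 1))) := by
        rw [← Real.exp_nat_mul]; push_cast; ring_nf
    _ ≤ _ := by
        rw [Real.exp_le_exp, neg_div, neg_le_neg_iff]
        calc (k : ℝ) / 2 = ((k : ℝ) ^ c)⁻¹ / 2 * (k : ℝ) ^ (c + 1) := by
              rw [pow_succ]; field_simp
          _ ≤ _ := by gcongr

end Negligible

/-! ### The trace norm -/

section
open scoped MatrixOrder ComplexOrder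

/-- Both `|A| - A` and `|A| + A` are positive, so `|Tr (L A)| ≤ Tr (L |A|)`; positivity of the
complementary projector `1 - L` then gives `Tr (L |A|) ≤ Tr |A|`. This turns trace distance into a
bound on the acceptance probability of a projective test. -/
theorem abs_re_trace_mul_le_traceNorm {σ : Type} [Fintype σ] [DecidableEq σ]
    {A L : Matrix σ σ ℂ} (hA : A.IsHermitian) (hL : L.IsHermitian) (hL2 : L * L = L) :
    |(L * A).trace.re| ≤ traceNorm A := by
  have hsa : IsSelfAdjoint A := hA
  have habs : CFC.sqrt (A.conjTranspose * A) = CFC.abs A := rfl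
  have h0 : (0 : Matrix σ σ ℂ) ≤ CFC.abs A := CFC.abs_nonneg A
  -- For a projector, `Tr (P B) = Tr (P* B P)`.
  have key : ∀ (P B : Matrix σ σ ℂ), P.IsHermitian → P * P = P → 0 ≤ B → 0 ≤ (P * B).trace.re := by
    intro P B hP hP2 hB
    have h1 : (P * B).trace = (P.conjTranspose * B * P).trace := by
      rw [hP.eq, Matrix.trace_mul_comm, ← hP2, ← mul_assoc, hP2, Matrix.trace_mul_comm, ← mul_assoc]
    have h2 := (Matrix.nonneg_iff_posSemidef.1 hB).conjTranspose_mul_mul_same P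
    have h3 := h2.trace_nonneg
    rw [h1]
    exact (Complex.le_def.1 h3).1
  have hpos : 0 ≤ CFC.abs A - A := by
    have e : CFC.abs A - A = A⁻ + A⁻ := by
      rw [← CFC.posPart_add_negPart A hsa]
      nth_rw 3 [← CFC.posPart_sub_negPart A hsa]
      abel
    rw [e]
    exact add_nonneg (CFC.negPart_nonneg A) (CFC.negPart_nonneg A)
  have hneg : 0 ≤ CFC.abs A + A := by
    have e : CFC.abs A + A = A⁺ + A⁺ := by
      rw [← CFC.posPart_add_negPart A hsa]
      nth_rw 3 [← CFC.posPart_sub_negPart A hsa]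
      abel
    rw [e]
    exact add_nonneg (CFC.posPart_nonneg A) (CFC.posPart_nonneg A)
  have h1 := key L _ hL hL2 hpos
  have h2 := key L _ hL hL2 hneg
  have h3 := key (1 - L) (CFC.abs A) (Matrix.isHermitian_one.sub hL)
    (by rw [sub_mul, mul_sub, mul_sub, hL2]; simp) h0
  have h4 : traceNorm A = (CFC.abs A).trace.re := rfl
  rw [h4, abs_le]
  simp only [mul_add, mul_sub, sub_mul, one_mul, Matrix.trace_add, Matrix.trace_sub,
    Complex.add_re, Complex.sub_re] at h1 h2 h3
  constructor <;> linarith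

end

/-! ### Straight-line programs -/

section SLP
variable {α β γ : Type}

/-- `u` is an input bit, the constant `false`, or one of the functions in `L`. -/
def Avail (L : List (Bits α → Bool)) (u : Bits α → Bool) : Prop :=
  (∃ a, u = fun x => x a) ∨ u = (fun _ => false) ∨ u ∈ L

theorem Avail.mono {L L' : List (Bits α → Bool)} {u : Bits α → Bool} (h : Avail L u)
    (hL : L ⊆ L') : Avail L' u := by
  rcases h with h | h | h
  · exact Or.inl h
  · exact Or.inr (Or.inl h)
  · exact Or.inr (Or.inr (hL h))

/-- `L` lists (latest first) the functions computed by a straight-line program. -/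
inductive SL {α : Type} : List (Bits α → Bool) → Prop
  | nil : SL []
  | cons {L : List (Bits α → Bool)} (op : Bool → Bool → Bool) (u v : Bits α → Bool) (hL : SL L)
      (hu : Avail L u) (hv : Avail L v) : SL ((fun x => op (u x) (v x)) :: L)

theorem SL.append {L₁ L₂ : List (Bits α → Bool)} (h₁ : SL L₁) (h₂ : SL L₂) : SL (L₁ ++ L₂) := by
  induction h₁ with
  | nil => exact h₂
  | cons op u v _ hu hv ih =>
    exact SL.cons op u v ih (hu.mono (List.subset_append_left _ _))
      (hv.mono (List.subset_append_left _ _))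

theorem Avail.comp {f : Bits α → Bits β} {L : List (Bits α → Bool)} {L' : List (Bits β → Bool)}
    (hf : ∀ b, Avail L fun x => f x b) {u : Bits β → Bool} (hu : Avail L' u) :
    Avail (L'.map (fun g => g ∘ f) ++ L) (u ∘ f) := by
  rcases hu with ⟨b, rfl⟩ | rfl | h
  · exact (hf b).mono (List.subset_append_right _ _)
  · exact Or.inr (Or.inl rfl)
  · exact Or.inr (Or.inr (List.mem_append_left _ (List.mem_map_of_mem h)))

/-- Substitution: the steps of the second program are precomposed with `f`, and whatever they read
from its inputs is already available from the first program. -/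
theorem SL.comp {f : Bits α → Bits β} {L : List (Bits α → Bool)} {L' : List (Bits β → Bool)}
    (hL : SL L) (hf : ∀ b, Avail L fun x => f x b) (hL' : SL L') :
    SL (L'.map (fun g => g ∘ f) ++ L) := by
  induction hL' with
  | nil => exact hL
  | cons op u v _ hu hv ih => exact SL.cons op (u ∘ f) (v ∘ f) ih (hu.comp hf) (hv.comp hf)

/-- `f` is computed by a straight-line program with at most `N` steps. -/
def BComp (f : Bits α → Bits β) (N : ℕ) : Prop :=
  ∃ L, SL L ∧ (∀ b, Avail L fun x => f x b) ∧ L.length ≤ N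

/-- The Boolean function `f` is computed by a straight-line program with at most `N` steps. -/
def Cx (f : Bits α → Bool) (N : ℕ) : Prop := ∃ L, SL L ∧ Avail L f ∧ L.length ≤ N

namespace Cx

theorem mono {f : Bits α → Bool} {N M : ℕ} (h : Cx f N) (hNM : N ≤ M) : Cx f M := by
  obtain ⟨L, h1, h2, h3⟩ := h
  exact ⟨L, h1, h2, h3.trans hNM⟩

theorem proj (a : α) (N : ℕ) : Cx (fun x => x a) N := ⟨[], SL.nil, Or.inl ⟨a, rfl⟩, by simp⟩

theorem const_false (N : ℕ) : Cx (fun _ : Bits α => false) N :=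
  ⟨[], SL.nil, Or.inr (Or.inl rfl), by simp⟩

/-- The two programs are concatenated without sharing steps, hence the sum of the costs. Polynomial
bounds tolerate this. -/
theorem op₂ (op : Bool → Bool → Bool) {u v : Bits α → Bool} {N M : ℕ} (hu : Cx u N) (hv : Cx v M) :
    Cx (fun x => op (u x) (v x)) (N + M + 1) := by
  obtain ⟨L, h1, h2, h3⟩ := hu
  obtain ⟨L', h1', h2', h3'⟩ := hv
  refine ⟨_, SL.cons op u v (h1.append h1') (h2.mono (List.subset_append_left _ _))
    (h2'.mono (List.subset_append_right _ _)), Or.inr (Or.inr List.mem_cons_self), ?_⟩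
  simp only [List.length_cons, List.length_append]
  lia

theorem not {u : Bits α → Bool} {N : ℕ} (hu : Cx u N) : Cx (fun x => !(u x)) (N + 1) :=
  op₂ (fun a _ => !a) hu (const_false 0)

theorem const (c : Bool) : Cx (fun _ : Bits α => c) 1 :=
  op₂ (fun _ _ => c) (const_false 0) (const_false 0)

/-- Folding a family of Boolean functions with a binary operation. -/
theorem foldr {ι : Type} (op : Bool → Bool → Bool) (c : Bool) {f : ι → Bits α → Bool} {N : ℕ}
    (hf : ∀ i, Cx (f i) N) (l : List ι) :
    Cx (fun x => l.foldr (fun i b => op (f i x) b) c) (l.length * (N + 1) + 1) := by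
  induction l with
  | nil => simpa using const c
  | cons i l ih =>
    refine (op₂ op (hf i) ih).mono ?_
    simp only [List.length_cons]
    lia

theorem any {ι : Type} [Fintype ι] {f : ι → Bits α → Bool} {N : ℕ} (hf : ∀ i, Cx (f i) N) :
    Cx (fun x => decide (∃ i, f i x = true)) (Fintype.card ι * (N + 1) + 1) := by
  have h := foldr (fun a b => a || b) false hf (Finset.univ : Finset ι).toList
  rw [Finset.length_toList, Finset.card_univ] at h
  convert h using 2 with x
  have key : ∀ l : List ι, l.foldr (fun i b => f i x || b) false = decide (∃ i ∈ l, f i x = true) := by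
    intro l
    induction l with
    | nil => simp
    | cons i l ih => simp [ih]
  rw [key]
  simp

theorem all {ι : Type} [Fintype ι] {f : ι → Bits α → Bool} {N : ℕ} (hf : ∀ i, Cx (f i) N) :
    Cx (fun x => decide (∀ i, f i x = true)) (Fintype.card ι * (N + 2) + 2) := by
  convert (any fun i => (hf i).not).not using 2 with x
  rw [← decide_not]
  simp

end Cx

namespace BComp

theorem mono {f : Bits α → Bits β} {N M : ℕ} (h : BComp f N) (hNM : N ≤ M) : BComp f M := by
  obtain ⟨L, h1, h2, h3⟩ := h
  exact ⟨L, h1, h2, h3.trans hNM⟩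

theorem cx {f : Bits α → Bits β} {N : ℕ} (h : BComp f N) (b : β) : Cx (fun x => f x b) N := by
  obtain ⟨L, h1, h2, h3⟩ := h
  exact ⟨L, h1, h2 b, h3⟩

theorem of_cx [Fintype β] {f : Bits α → Bits β} {N : ℕ} (h : ∀ b, Cx (fun x => f x b) N) :
    BComp f (Fintype.card β * N) := by
  choose L h1 h2 h3 using h
  have key : ∀ l : List β, SL (l.flatMap L) ∧ (l.flatMap L).length ≤ l.length * N := by
    intro l
    induction l with
    | nil => exact ⟨SL.nil, by simp⟩
    | cons b l ih =>
      rw [List.flatMap_cons]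
      refine ⟨(h1 b).append ih.1, ?_⟩
      rw [List.length_append, List.length_cons]
      have := h3 b
      have := ih.2
      lia
  refine ⟨(Finset.univ : Finset β).toList.flatMap L, (key _).1, fun b => (h2 b).mono ?_, ?_⟩
  · exact fun u hu => List.mem_flatMap.2 ⟨b, by simp, hu⟩
  · have := (key (Finset.univ : Finset β).toList).2
    rwa [Finset.length_toList, Finset.card_univ] at this

theorem reindex (e : β → α) (N : ℕ) : BComp (fun x => x ∘ e) N :=
  ⟨[], SL.nil, fun b => Or.inl ⟨e b, rfl⟩, by simp⟩

theorem comp {f : Bits α → Bits β} {g : Bits β → Bits γ} {N M : ℕ} (hg : BComp g M)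
    (hf : BComp f N) : BComp (fun x => g (f x)) (M + N) := by
  obtain ⟨L, h1, h2, h3⟩ := hf
  obtain ⟨L', h1', h2', h3'⟩ := hg
  refine ⟨_, h1.comp h2 h1', fun c => (h2' c).comp h2, ?_⟩
  simp only [List.length_append, List.length_map]
  lia

theorem sumElim {f : Bits α → Bits β} {g : Bits α → Bits γ} {N M : ℕ} (hf : BComp f N)
    (hg : BComp g M) : BComp (fun x => Sum.elim (f x) (g x)) (N + M) := by
  obtain ⟨L, h1, h2, h3⟩ := hf
  obtain ⟨L', h1', h2', h3'⟩ := hg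
  refine ⟨L ++ L', h1.append h1', ?_, by rw [List.length_append]; lia⟩
  rintro (b | c)
  · exact (h2 b).mono (List.subset_append_left _ _)
  · exact (h2' c).mono (List.subset_append_right _ _)

/-- A straight-line program never forgets, so overwriting a wire just means that the wire refers to
a later step from then on. Each gate costs one step. -/
theorem bRun {W : Type} [DecidableEq W] (gs : List (BGate W)) {f : Bits α → Bits W} {N : ℕ}
    (hf : BComp f N) : BComp (fun x => _root_.bRun gs (f x)) (gs.length + N) := by
  induction gs generalizing f N with
  | nil => exact hf.mono (by simp)
  | cons g gs ih =>
    have : BComp (fun x => Function.update (f x) g.dst (g.op (f x g.l) (f x g.r))) (N + 1) := by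
      obtain ⟨L, h1, h2, h3⟩ := hf
      refine ⟨_, SL.cons g.op _ _ h1 (h2 g.l) (h2 g.r), fun w => ?_, by simpa using h3⟩
      by_cases hw : w = g.dst
      · subst hw
        simp only [Function.update_self]
        exact Or.inr (Or.inr List.mem_cons_self)
      · simp only [Function.update_of_ne hw]
        exact (h2 w).mono (List.subset_cons_self _ _)
    refine (ih this).mono ?_
    simp only [List.length_cons]
    lia

/-- The function computed by a randomized circuit, the coins being inputs. -/
theorem randCircuit {ι ο : Type} [DecidableEq ι] (C : RandCircuit ι ο) :
    BComp (fun x : Bits (ι ⊕ Fin C.coins) => C.run (x ∘ Sum.inl) (x ∘ Sum.inr)) C.gates.length := by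
  have h0 : BComp (fun x : Bits (ι ⊕ Fin C.coins) =>
      (Sum.elim (x ∘ Sum.inl) (Sum.elim (x ∘ Sum.inr) fun _ => false) :
        Bits (ι ⊕ Fin C.coins ⊕ Fin C.anc))) 0 := by
    refine ⟨[], SL.nil, ?_, le_rfl⟩
    rintro (a | a | a)
    · exact Or.inl ⟨Sum.inl a, rfl⟩
    · exact Or.inl ⟨Sum.inr a, rfl⟩
    · exact Or.inr (Or.inl rfl)
  exact ((reindex C.out 0).comp (bRun C.gates h0)).mono (by lia)

/-- Every output may be assumed to be the result of a step. -/
theorem exists_loc [Fintype β] {f : Bits α → Bits β} {N : ℕ} (h : BComp f N) :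
    ∃ L : List (Bits α → Bool), SL L ∧ L.length ≤ N + Fintype.card β ∧
      ∃ loc : β → Fin L.length, ∀ b, L.get (loc b) = fun x => f x b := by
  obtain ⟨L, h1, h2, h3⟩ := h
  have key : ∀ l : List β, SL (l.map (fun b x => f x b) ++ L) := by
    intro l
    induction l with
    | nil => exact h1
    | cons b l ih =>
      exact SL.cons (fun a _ => a) _ _ ih ((h2 b).mono (List.subset_append_right _ _))
        ((h2 b).mono (List.subset_append_right _ _))
  refine ⟨_, key (Finset.univ : Finset β).toList, ?_, ?_⟩
  · simp only [List.length_append, List.length_map, Finset.length_toList, Finset.card_univ]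
    lia
  · have : ∀ b, ∃ i, ((Finset.univ : Finset β).toList.map (fun b x => f x b) ++ L).get i
        = fun x => f x b := by
      intro b
      rw [← List.mem_iff_get]
      exact List.mem_append_left _ (List.mem_map.2 ⟨b, by simp, rfl⟩)
    choose loc hloc using this
    exact ⟨loc, hloc⟩

end BComp

end SLP

/-! ### Compilation to Boolean gates -/

section Compile
variable {α β W : Type} [DecidableEq W]

@[simp] theorem bRun_nil (s : Bits W) : bRun [] s = s := rfl

theorem bRun_append (gs hs : List (BGate W)) (s : Bits W) :
    bRun (gs ++ hs) s = bRun hs (bRun gs s) := List.foldl_append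

theorem bRun_cons (g : BGate W) (gs : List (BGate W)) (s : Bits W) :
    bRun (g :: gs) s = bRun gs (Function.update s g.dst (g.op (s g.l) (s g.r))) := rfl

theorem bRun_singleton (g : BGate W) (s : Bits W) :
    bRun [g] s = Function.update s g.dst (g.op (s g.l) (s g.r)) := rfl

/-- Each step gets a wire of its own that is initially zero; input wires are only read. -/
theorem SL.exists_bgates {L : List (Bits α → Bool)} (hL : SL L) (rd : α → W)
    (anc : Fin L.length → W) (hinj : Function.Injective anc) (hdisj : ∀ a i, rd a ≠ anc i) :
    ∃ gs : List (BGate W), gs.length = L.length ∧ ∀ s : Bits W, (∀ i, s (anc i) = false) →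
      (∀ w, (∀ i, w ≠ anc i) → bRun gs s w = s w) ∧
      ∀ i, bRun gs s (anc i) = L.get i (s ∘ rd) := by
  induction hL with
  | nil => exact ⟨[], rfl, fun s _ => ⟨fun _ _ => rfl, fun i => i.elim0⟩⟩
  | @cons L op u v hL hu hv ih =>
    obtain ⟨gs, hlen, hgs⟩ := ih (fun i => anc i.succ)
      (fun i j h => Fin.succ_injective _ (hinj h)) (fun a i => hdisj a i.succ)
    have loc : ∀ u, Avail L u → ∃ w, ∀ s : Bits W, (∀ i, s (anc i) = false) →
        bRun gs s w = u (s ∘ rd) := by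
      rintro u (⟨a, rfl⟩ | rfl | hu)
      · exact ⟨rd a, fun s hs => (hgs s fun i => hs _).1 _ fun i => hdisj a i.succ⟩
      -- The constant `false` is read from the wire about to be written, which still holds its
      -- initial zero.
      · refine ⟨anc 0, fun s hs => ((hgs s fun i => hs _).1 _ fun i h => ?_).trans (hs 0)⟩
        exact absurd (hinj h) (Fin.succ_ne_zero i).symm
      · obtain ⟨i, rfl⟩ := List.mem_iff_get.1 hu
        exact ⟨anc i.succ, fun s hs => (hgs s fun i => hs _).2 i⟩
    obtain ⟨wu, hwu⟩ := loc u hu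
    obtain ⟨wv, hwv⟩ := loc v hv
    refine ⟨gs ++ [⟨op, wu, wv, anc 0⟩], by simp [hlen], fun s hs => ⟨fun w hw => ?_, fun i => ?_⟩⟩
    · rw [bRun_append, bRun_singleton, Function.update_of_ne (hw 0)]
      exact (hgs s fun i => hs _).1 w fun i => hw _
    · rw [bRun_append, bRun_singleton]
      refine Fin.cases ?_ (fun i => ?_) i
      · simp only [Function.update_self, hwu s hs, hwv s hs]
        rfl
      · rw [Function.update_of_ne fun h => absurd (hinj h) (Fin.succ_ne_zero i)]
        exact (hgs s fun i => hs _).2 i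

/-- The number of ancillas and the output positions are fixed before the wires are chosen, so that a
sender can be laid out with the right number of wires. -/
theorem BComp.exists_bgates [Fintype β] {f : Bits α → Bits β} {N : ℕ} (h : BComp f N) :
    ∃ n ≤ N + Fintype.card β, ∃ loc : β → Fin n, ∀ {W : Type} [DecidableEq W] (rd : α → W)
      (anc : Fin n → W), Function.Injective anc → (∀ a i, rd a ≠ anc i) →
      ∃ gs : List (BGate W), gs.length = n ∧ ∀ s : Bits W, (∀ i, s (anc i) = false) →
        (∀ w, (∀ i, w ≠ anc i) → _root_.bRun gs s w = s w) ∧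
        ∀ b, _root_.bRun gs s (anc (loc b)) = f (s ∘ rd) b := by
  obtain ⟨L, hL, hlen, loc, hloc⟩ := h.exists_loc
  refine ⟨L.length, hlen, loc, fun rd anc hinj hdisj => ?_⟩
  obtain ⟨gs, hg, hgs⟩ := hL.exists_bgates rd anc hinj hdisj
  refine ⟨gs, hg, fun s hs => ⟨(hgs s hs).1, fun b => ?_⟩⟩
  rw [(hgs s hs).2, hloc]

/-- Renaming the wires of a gate. -/
def BGate.map {V : Type} (f : W → V) (g : BGate W) : BGate V := ⟨g.op, f g.l, f g.r, f g.dst⟩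

theorem bRun_map {V : Type} [DecidableEq V] {f : W → V} (hf : Function.Injective f)
    (gs : List (BGate W)) (s : Bits V) :
    bRun (gs.map (BGate.map f)) s = Function.extend f (bRun gs (s ∘ f)) s := by
  induction gs generalizing s with
  | nil =>
    ext v
    by_cases hv : ∃ w, f w = v
    · obtain ⟨w, rfl⟩ := hv
      simp [hf.extend_apply]
    · simp [Function.extend_apply' _ _ _ hv]
  | cons g gs ih =>
    rw [List.map_cons]
    change bRun _ (Function.update s (f g.dst) (g.op (s (f g.l)) (s (f g.r)))) =
      Function.extend f (bRun gs (Function.update (s ∘ f) g.dst (g.op (s (f g.l)) (s (f g.r))))) s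
    rw [ih, Function.update_comp_eq_of_injective _ hf]
    ext v
    by_cases hv : ∃ w, f w = v
    · obtain ⟨w, rfl⟩ := hv
      simp only [hf.extend_apply]
    · simp only [Function.extend_apply' _ _ _ hv]
      exact Function.update_of_ne (fun h => hv ⟨_, h.symm⟩) _ _

/-- Simultaneous assignment of the bits computed by `op` from the bits at `src` to distinct
targets. -/
theorem exists_bgates_assign [Fintype β] (op : Bool → Bool) (tgt src : β → W)
    (hinj : Function.Injective tgt) (hdisj : ∀ b b', b ≠ b' → src b ≠ tgt b') :
    ∃ gs : List (BGate W), gs.length = Fintype.card β ∧ ∀ s : Bits W,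
      bRun gs s = Function.extend tgt (fun b => op (s (src b))) s := by
  classical
  have key : ∀ l : List β, l.Nodup → ∀ s : Bits W,
      (∀ b ∈ l, bRun (l.map fun b => (⟨fun a _ => op a, src b, src b, tgt b⟩ : BGate W)) s (tgt b)
        = op (s (src b))) ∧
      ∀ w, (∀ b ∈ l, w ≠ tgt b) →
        bRun (l.map fun b => (⟨fun a _ => op a, src b, src b, tgt b⟩ : BGate W)) s w = s w := by
    intro l
    induction l with
    | nil => intro _ s; simp
    | cons b l ih =>
      intro hl s
      rw [List.nodup_cons] at hl
      rw [List.map_cons, bRun_cons]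
      obtain ⟨h1, h2⟩ := ih hl.2 (Function.update s (tgt b) (op (s (src b))))
      constructor
      · intro b' hb'
        by_cases hm : b' ∈ l
        · rw [h1 b' hm]
          rw [Function.update_of_ne (hdisj b' b (by rintro rfl; exact hl.1 hm))]
        · obtain rfl : b' = b := by simpa [hm] using hb'
          rw [h2 _ fun c hc h => hm (by rwa [hinj h]), Function.update_self]
      · intro w hw
        rw [h2 w fun c hc => hw c (List.mem_cons_of_mem _ hc),
          Function.update_of_ne (hw b List.mem_cons_self)]
  refine ⟨(Finset.univ : Finset β).toList.map fun b => ⟨fun a _ => op a, src b, src b, tgt b⟩,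
    by simp, fun s => ?_⟩
  · ext w
    by_cases hw : ∃ b, tgt b = w
    · obtain ⟨b, rfl⟩ := hw
      rw [hinj.extend_apply]
      exact (key _ (Finset.nodup_toList _) s).1 b (by simp)
    · rw [Function.extend_apply' _ _ _ hw]
      exact (key _ (Finset.nodup_toList _) s).2 w fun b _ h => hw ⟨b, h.symm⟩

end Compile

/-! ### Quantum circuits: renaming, linearity -/

section Quantum
variable {α β W : Type} [DecidableEq α] [DecidableEq β] [DecidableEq W]

@[simp] theorem qRun_nil (ψ : QVec α) : qRun [] ψ = ψ := rfl

theorem qRun_cons (g : QGate α) (gs : List (QGate α)) (ψ : QVec α) :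
    qRun (g :: gs) ψ = qRun gs (g.apply ψ) := rfl

theorem qRun_append (gs hs : List (QGate α)) (ψ : QVec α) :
    qRun (gs ++ hs) ψ = qRun hs (qRun gs ψ) := List.foldl_append

theorem QGate.apply_smul (g : QGate α) (c : ℂ) (ψ : QVec α) :
    g.apply (c • ψ) = c • g.apply ψ := by
  cases g <;> ext s <;> simp only [QGate.apply, Pi.smul_apply, smul_eq_mul] <;> ring

theorem qRun_smul (gs : List (QGate α)) (c : ℂ) (ψ : QVec α) :
    qRun gs (c • ψ) = c • qRun gs ψ := by
  induction gs generalizing ψ with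
  | nil => rfl
  | cons g gs ih => rw [qRun_cons, qRun_cons, QGate.apply_smul, ih]

theorem qRun_zero (gs : List (QGate α)) : qRun gs (0 : QVec α) = 0 := by
  simpa using qRun_smul gs 0 (0 : QVec α)

/-- Renaming the qubits of a gate. -/
def QGate.map (f : α ↪ β) : QGate α → QGate β
  | .pauliX t => .pauliX (f t)
  | .hadamard t => .hadamard (f t)
  | .phaseT t => .phaseT (f t)
  | .cnot c t h => .cnot (f c) (f t) (f.injective.ne h)
  | .toffoli c₁ c₂ t h12 h1 h2 => .toffoli (f c₁) (f c₂) (f t) (f.injective.ne h12)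
      (f.injective.ne h1) (f.injective.ne h2)

theorem extend_update_comp (f : α ↪ β) (s : Bits β) (t : α) (b : Bool) :
    Function.extend f (Function.update (s ∘ f) t b) s = Function.update s (f t) b := by
  ext v
  by_cases hv : ∃ w, f w = v
  · obtain ⟨w, rfl⟩ := hv
    rw [f.injective.extend_apply]
    by_cases h : w = t
    · subst h; simp
    · rw [Function.update_of_ne h, Function.update_of_ne (f.injective.ne h)]; rfl
  · rw [Function.extend_apply' _ _ _ hv, Function.update_of_ne fun h => hv ⟨_, h.symm⟩]

theorem extend_extend {γ : Type} (f : α ↪ β) (a a' : α → γ) (s : β → γ) :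
    Function.extend f a (Function.extend f a' s) = Function.extend f a s := by
  ext v
  by_cases hv : ∃ w, f w = v
  · obtain ⟨w, rfl⟩ := hv
    simp [f.injective.extend_apply]
  · simp [Function.extend_apply' _ _ _ hv]

theorem extend_comp_self {γ : Type} (f : α ↪ β) (a : α → γ) (s : β → γ) :
    Function.extend f a s ∘ f = a := by
  ext w
  simp [f.injective.extend_apply]

theorem extend_self {γ : Type} (f : α ↪ β) (s : β → γ) : Function.extend f (s ∘ f) s = s := by
  ext v
  by_cases hv : ∃ w, f w = v
  · obtain ⟨w, rfl⟩ := hv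
    simp [f.injective.extend_apply]
  · simp [Function.extend_apply' _ _ _ hv]

theorem QGate.apply_map (f : α ↪ β) (g : QGate α) (ψ : QVec β) (s : Bits β) :
    (g.map f).apply ψ s = g.apply (fun a => ψ (Function.extend f a s)) (s ∘ f) := by
  cases g <;> simp only [QGate.map, QGate.apply, extend_update_comp, Function.comp_apply]
  rw [extend_self]

/-- Qubits outside the range of `f` are spectators: for each of their assignments, the circuit acts
on the corresponding slice of the state. -/
theorem qRun_map (f : α ↪ β) (gs : List (QGate α)) (ψ : QVec β) (s : Bits β) :
    qRun (gs.map (QGate.map f)) ψ s = qRun gs (fun a => ψ (Function.extend f a s)) (s ∘ f) := by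
  induction gs generalizing ψ with
  | nil => simp [extend_self]
  | cons g gs ih =>
    rw [List.map_cons, qRun_cons, qRun_cons, ih]
    congr 1
    ext a
    rw [QGate.apply_map]
    simp only [extend_extend, extend_comp_self]

theorem qRun_map_equiv (f : α ≃ β) (gs : List (QGate α)) (ψ : QVec β) (s : Bits β) :
    qRun (gs.map (QGate.map f.toEmbedding)) ψ s = qRun gs (fun a => ψ (a ∘ f.symm)) (s ∘ f) := by
  rw [qRun_map]
  congr 1
  ext a
  congr 1
  ext v
  obtain ⟨w, rfl⟩ := f.surjective v
  rw [Equiv.coe_toEmbedding, f.injective.extend_apply]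
  simp

/-! ### Classical reversible gates -/

/-- The action on basis states of the gates other than `H` and `T`. -/
def QGate.act : QGate α → Bits α → Bits α
  | .pauliX t, s => Function.update s t (!(s t))
  | .hadamard _, s => s
  | .phaseT _, s => s
  | .cnot c t _, s => Function.update s t (xor (s t) (s c))
  | .toffoli c₁ c₂ t _ _ _, s => Function.update s t (xor (s t) (s c₁ && s c₂))

/-- The gates permuting the computational basis. -/
def QGate.IsPerm : QGate α → Prop
  | .hadamard _ => False
  | .phaseT _ => False
  | _ => True

theorem QGate.act_act (g : QGate α) (s : Bits α) : g.act (g.act s) = s := by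
  cases g with
  | pauliX t => simp [QGate.act]
  | hadamard t => rfl
  | phaseT t => rfl
  | cnot c t h => simp [QGate.act, Function.update_of_ne h]
  | toffoli c₁ c₂ t h12 h1 h2 =>
    simp [QGate.act, Function.update_of_ne h1, Function.update_of_ne h2]

theorem QGate.IsPerm.apply_eq {g : QGate α} (hg : g.IsPerm) (ψ : QVec α) (s : Bits α) :
    g.apply ψ s = ψ (g.act s) := by
  cases g <;> first | rfl | exact hg.elim

/-- The action of a list of reversible gates on basis states. -/
def cRun (gs : List (QGate α)) (s : Bits α) : Bits α := gs.foldl (fun s g => g.act s) s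

theorem cRun_append (gs hs : List (QGate α)) (s : Bits α) :
    cRun (gs ++ hs) s = cRun hs (cRun gs s) := List.foldl_append

theorem cRun_cons (g : QGate α) (gs : List (QGate α)) (s : Bits α) :
    cRun (g :: gs) s = cRun gs (g.act s) := rfl

theorem cRun_reverse_cRun (gs : List (QGate α)) (s : Bits α) :
    cRun gs.reverse (cRun gs s) = s := by
  induction gs generalizing s with
  | nil => rfl
  | cons g gs ih =>
    rw [List.reverse_cons, cRun_append, cRun_cons g gs, ih]
    exact g.act_act s

theorem cRun_cRun_reverse (gs : List (QGate α)) (s : Bits α) :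
    cRun gs (cRun gs.reverse s) = s := by
  simpa using cRun_reverse_cRun gs.reverse s

/-- A reversible gate carries the amplitude of a basis state to its image. As each of these gates is
an involution, reversing the list inverts the circuit. -/
theorem qRun_cRun {gs : List (QGate α)} (hgs : ∀ g ∈ gs, g.IsPerm) (ψ : QVec α) (s : Bits α) :
    qRun gs ψ (cRun gs s) = ψ s := by
  induction gs generalizing ψ s with
  | nil => rfl
  | cons g gs ih =>
    rw [cRun_cons, qRun_cons, ih fun g hg => hgs g (List.mem_cons_of_mem _ hg),
      (hgs g List.mem_cons_self).apply_eq, g.act_act]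

theorem qRun_eq_cRun_reverse {gs : List (QGate α)} (hgs : ∀ g ∈ gs, g.IsPerm) (ψ : QVec α)
    (s : Bits α) : qRun gs ψ s = ψ (cRun gs.reverse s) := by
  conv_lhs => rw [← cRun_cRun_reverse gs s]
  exact qRun_cRun hgs _ _

/-- `φ` can be added (mod 2) to the qubit `h` by at most `n` reversible gates. -/
def Toggles (h : W) (φ : Bits W → Bool) (n : ℕ) : Prop :=
  (∀ s b, φ (Function.update s h b) = φ s) ∧ ∃ gs : List (QGate W), (∀ g ∈ gs, g.IsPerm) ∧
    gs.length ≤ n ∧ ∀ s, cRun gs s = Function.update s h (s h ^^ φ s)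

namespace Toggles

theorem zero (h : W) : Toggles h (fun _ => false) 0 :=
  ⟨fun _ _ => rfl, [], by simp, by simp, fun s => by simp [cRun]⟩

theorem one (h : W) : Toggles h (fun _ => true) 1 :=
  ⟨fun _ _ => rfl, [.pauliX h], by simp [QGate.IsPerm], by simp, fun s => by simp [cRun, QGate.act]⟩

theorem wire {h w : W} (hw : w ≠ h) : Toggles h (fun s => s w) 1 :=
  ⟨fun s b => Function.update_of_ne hw _ _, [.cnot w h hw], by simp [QGate.IsPerm], by simp,
    fun s => by simp [cRun, QGate.act]⟩

theorem and_wire {h w v : W} (hw : w ≠ h) (hv : v ≠ h) : Toggles h (fun s => s w && s v) 1 := by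
  by_cases hwv : w = v
  · subst hwv
    simpa using wire hw
  · exact ⟨fun s b => by simp only [Function.update_of_ne hw, Function.update_of_ne hv],
      [.toffoli w v h hwv hw hv], by simp [QGate.IsPerm], by simp,
      fun s => by simp [cRun, QGate.act]⟩

theorem xor {h : W} {φ χ : Bits W → Bool} {m n : ℕ} (hφ : Toggles h φ m) (hχ : Toggles h χ n) :
    Toggles h (fun s => φ s ^^ χ s) (m + n) := by
  obtain ⟨h1, gs, h2, h3, h4⟩ := hφ
  obtain ⟨h1', gs', h2', h3', h4'⟩ := hχ
  refine ⟨fun s b => by simp only [h1, h1'], gs ++ gs', ?_, by rw [List.length_append]; lia, fun s => ?_⟩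
  · intro g hg
    rcases List.mem_append.1 hg with hg | hg
    exacts [h2 g hg, h2' g hg]
  · rw [cRun_append, h4, h4', h1']
    simp

theorem and_const {h : W} {φ : Bits W → Bool} {n : ℕ} (c : Bool) (hφ : Toggles h φ n) :
    Toggles h (fun s => c && φ s) n := by
  cases c with
  | true => simpa using hφ
  | false =>
    obtain ⟨h1, gs, h2, h3, h4⟩ := zero h
    exact ⟨by simp, gs, h2, h3.trans (Nat.zero_le _), by simpa using h4⟩

/-- Any Boolean gate can be toggled into a further qubit. -/
theorem op (op : Bool → Bool → Bool) {h : W} {φ χ : Bits W → Bool}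
    (hφ : Toggles h φ 1) (hχ : Toggles h χ 1) (hφχ : Toggles h (fun s => φ s && χ s) 1) :
    Toggles h (fun s => op (φ s) (χ s)) 4 := by
  -- The algebraic normal form of `op` over the field with two elements: a constant, two linear
  -- terms and a product, each costing at most one gate.
  have := (((one h).and_const (op false false)).xor (hφ.and_const (op true false ^^ op false false))).xor
    ((hχ.and_const (op false true ^^ op false false)).xor
      (hφχ.and_const (op true true ^^ op true false ^^ op false true ^^ op false false)))
  convert this using 2 with s
  cases φ s <;> cases χ s <;> simp <;>
    cases op false false <;> cases op true false <;> cases op false true <;> cases op true true <;> rfl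

end Toggles

/-- Reversible version of `SL.exists_bgates`: adding the value of a step to a zero qubit writes it
there. The normal form of the gate makes this four reversible gates per step. -/
theorem SL.exists_qgates {α : Type} {L : List (Bits α → Bool)} (hL : SL L) (rd : α → W)
    (anc : Fin L.length → W) (hinj : Function.Injective anc) (hdisj : ∀ a i, rd a ≠ anc i) :
    ∃ gs : List (QGate W), (∀ g ∈ gs, g.IsPerm) ∧ gs.length ≤ 4 * L.length ∧
      ∀ s : Bits W, (∀ i, s (anc i) = false) →
        (∀ w, (∀ i, w ≠ anc i) → cRun gs s w = s w) ∧
        ∀ i, cRun gs s (anc i) = L.get i (s ∘ rd) := by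
  induction hL with
  | nil => exact ⟨[], by simp, by simp, fun s _ => ⟨fun _ _ => rfl, fun i => i.elim0⟩⟩
  | @cons L op u v hL hu hv ih =>
    obtain ⟨gs, hperm, hlen, hgs⟩ := ih (fun i => anc i.succ)
      (fun i j h => Fin.succ_injective _ (hinj h)) (fun a i => hdisj a i.succ)
    have loc : ∀ u, Avail L u → (∃ w, w ≠ anc 0 ∧ ∀ s : Bits W, (∀ i, s (anc i) = false) →
        cRun gs s w = u (s ∘ rd)) ∨ u = fun _ => false := by
      rintro u (⟨a, rfl⟩ | rfl | hu)
      · exact Or.inl ⟨rd a, hdisj a _, fun s hs => (hgs s fun i => hs _).1 _ fun i => hdisj a i.succ⟩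
      · exact Or.inr rfl
      · obtain ⟨i, rfl⟩ := List.mem_iff_get.1 hu
        exact Or.inl ⟨anc i.succ, fun h => absurd (hinj h) (Fin.succ_ne_zero i),
          fun s hs => (hgs s fun i => hs _).2 i⟩
    -- The constant `false` is not read from a qubit here, since `anc 0` is the target of the gates
    -- and a control must differ from it.
    have tog : ∃ φ χ : Bits W → Bool, (∀ s : Bits W, (∀ i, s (anc i) = false) →
        φ (cRun gs s) = u (s ∘ rd) ∧ χ (cRun gs s) = v (s ∘ rd)) ∧
        Toggles (anc 0) (fun s => op (φ s) (χ s)) 4 := by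
      have z : Toggles (anc 0) (fun _ => false) 1 := by
        obtain ⟨h1, gs, h2, h3, h4⟩ := Toggles.zero (anc 0)
        exact ⟨h1, gs, h2, h3.trans (Nat.zero_le _), h4⟩
      rcases loc u hu with ⟨wu, hwu, hu'⟩ | rfl <;> rcases loc v hv with ⟨wv, hwv, hv'⟩ | rfl
      · exact ⟨fun s => s wu, fun s => s wv, fun s hs => ⟨hu' s hs, hv' s hs⟩,
          Toggles.op op (.wire hwu) (.wire hwv) (.and_wire hwu hwv)⟩
      · exact ⟨fun s => s wu, fun _ => false, fun s hs => ⟨hu' s hs, rfl⟩,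
          Toggles.op op (.wire hwu) z (by simpa using z)⟩
      · exact ⟨fun _ => false, fun s => s wv, fun s hs => ⟨rfl, hv' s hs⟩,
          Toggles.op op z (.wire hwv) (by simpa using z)⟩
      · exact ⟨fun _ => false, fun _ => false, fun s hs => ⟨rfl, rfl⟩,
          Toggles.op op z z (by simpa using z)⟩
    obtain ⟨φ, χ, hval, -, hs, hp, hl, hrun⟩ := tog
    refine ⟨gs ++ hs, ?_, ?_, fun s hs => ⟨fun w hw => ?_, fun i => ?_⟩⟩
    · intro g hg
      rcases List.mem_append.1 hg with hg | hg
      exacts [hperm g hg, hp g hg]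
    · simp only [List.length_append, List.length_cons]
      lia
    · rw [cRun_append, hrun, Function.update_of_ne (hw 0)]
      exact (hgs s fun i => hs _).1 w fun i => hw _
    · rw [cRun_append, hrun]
      refine Fin.cases ?_ (fun i => ?_) i
      · simp only [(hval s hs).1, (hval s hs).2]
        rw [Function.update_self, (hgs s fun i => hs _).1 _ fun i h => absurd (hinj h) (Fin.succ_ne_zero i).symm, hs]
        simp only [Bool.false_bne]
        rfl
      · rw [Function.update_of_ne fun h => absurd (hinj h) (Fin.succ_ne_zero i)]
        exact (hgs s fun i => hs _).2 i

/-- Simultaneous addition (mod 2) of qubits to distinct other qubits. -/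
theorem exists_qgates_toggle {β : Type} [Fintype β] {tgt : β → W} {φ : β → Bits W → Bool} {n : ℕ}
    (hinj : Function.Injective tgt) (hφ : ∀ b, Toggles (tgt b) (φ b) n)
    (hind : ∀ b b' s c, φ b (Function.update s (tgt b') c) = φ b s) :
    ∃ gs : List (QGate W), (∀ g ∈ gs, g.IsPerm) ∧ gs.length ≤ Fintype.card β * n ∧ ∀ s : Bits W,
      cRun gs s = Function.extend tgt (fun b => s (tgt b) ^^ φ b s) s := by
  classical
  choose _ G hG hlen hrun using hφ
  have key : ∀ l : List β, l.Nodup → (l.flatMap G).length ≤ l.length * n ∧ ∀ s : Bits W,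
      (∀ b ∈ l, cRun (l.flatMap G) s (tgt b) = (s (tgt b) ^^ φ b s)) ∧
      ∀ w, (∀ b ∈ l, w ≠ tgt b) → cRun (l.flatMap G) s w = s w := by
    intro l
    induction l with
    | nil => intro _; simp [cRun]
    | cons b l ih =>
      intro hl
      rw [List.nodup_cons] at hl
      obtain ⟨h0, ih⟩ := ih hl.2
      refine ⟨?_, fun s => ?_⟩
      · have := hlen b
        rw [List.flatMap_cons, List.length_append, List.length_cons]
        lia
      rw [List.flatMap_cons, cRun_append, hrun]
      obtain ⟨h1, h2⟩ := ih (Function.update s (tgt b) (s (tgt b) ^^ φ b s))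
      constructor
      · intro b' hb'
        by_cases hm : b' ∈ l
        · rw [h1 b' hm, hind, Function.update_of_ne]
          exact fun h => hl.1 (by rwa [← hinj h])
        · obtain rfl : b' = b := by simpa [hm] using hb'
          rw [h2 _ fun c hc h => hm (by rwa [hinj h]), Function.update_self]
      · intro w hw
        rw [h2 w fun c hc => hw c (List.mem_cons_of_mem _ hc),
          Function.update_of_ne (hw b List.mem_cons_self)]
  refine ⟨(Finset.univ : Finset β).toList.flatMap G, ?_, ?_, fun s => ?_⟩
  · intro g hg
    obtain ⟨b, -, hb⟩ := List.mem_flatMap.1 hg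
    exact hG b g hb
  · simpa using (key _ (Finset.nodup_toList (Finset.univ : Finset β))).1
  ext w
  by_cases hw : ∃ b, tgt b = w
  · obtain ⟨b, rfl⟩ := hw
    rw [hinj.extend_apply]
    exact ((key _ (Finset.nodup_toList _)).2 s).1 b (by simp)
  · rw [Function.extend_apply' _ _ _ hw]
    exact ((key _ (Finset.nodup_toList _)).2 s).2 w fun b _ h => hw ⟨b, h.symm⟩

theorem exists_qgates_xor {β : Type} [Fintype β] (tgt src : β → W) (hinj : Function.Injective tgt)
    (hdisj : ∀ b b', src b ≠ tgt b') :
    ∃ gs : List (QGate W), (∀ g ∈ gs, g.IsPerm) ∧ gs.length ≤ Fintype.card β ∧ ∀ s : Bits W,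
      cRun gs s = Function.extend tgt (fun b => s (tgt b) ^^ s (src b)) s := by
  have := exists_qgates_toggle hinj (fun b => Toggles.wire (hdisj b b))
    fun b b' s c => Function.update_of_ne (hdisj b b') _ _
  rwa [mul_one] at this

/-- Toggling target qubits is an involution on state vectors. -/
theorem qRun_of_cRun_toggle {β : Type} {tgt : β → W} {φ : β → Bits W → Bool}
    (hinj : Function.Injective tgt)
    (hind : ∀ b s s', (∀ w, (∀ b', w ≠ tgt b') → s w = s' w) → φ b s = φ b s')
    {gs : List (QGate W)} (hgs : ∀ g ∈ gs, g.IsPerm)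
    (hrun : ∀ s : Bits W, cRun gs s = Function.extend tgt (fun b => s (tgt b) ^^ φ b s) s)
    (ψ : QVec W) (s : Bits W) :
    qRun gs ψ s = ψ (Function.extend tgt (fun b => s (tgt b) ^^ φ b s) s) := by
  conv_rhs => rw [← hrun, ← qRun_cRun hgs ψ]
  congr 1
  rw [hrun, hrun]
  ext w
  by_cases hw : ∃ b, tgt b = w
  · obtain ⟨b, rfl⟩ := hw
    have h := hind b (Function.extend tgt (fun b => s (tgt b) ^^ φ b s) s) s fun w hw =>
      Function.extend_apply' _ _ _ fun ⟨b, hb⟩ => hw b hb.symm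
    rw [hinj.extend_apply, hinj.extend_apply, h]
    simp
  · rw [Function.extend_apply' _ _ _ hw, Function.extend_apply' _ _ _ hw]

/-- Reversible evaluation `|x⟩|y⟩ ↦ |x⟩|y ⊕ f x⟩` with clean ancillas. -/
theorem BComp.exists_qgates {α β : Type} [Fintype β] {f : Bits α → Bits β} {N : ℕ}
    (h : BComp f N) :
    ∃ n ≤ N + Fintype.card β, ∀ {W : Type} [DecidableEq W] (rd : α → W) (tgt : β → W)
      (anc : Fin n → W), Function.Injective tgt → Function.Injective anc →
      (∀ a b, rd a ≠ tgt b) → (∀ a i, rd a ≠ anc i) → (∀ b i, tgt b ≠ anc i) →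
      ∃ gs : List (QGate W), (∀ g ∈ gs, g.IsPerm) ∧ gs.length ≤ 8 * n + Fintype.card β ∧
        ∀ s : Bits W, (∀ i, s (anc i) = false) →
          cRun gs s = Function.extend tgt (fun b => s (tgt b) ^^ f (s ∘ rd) b) s := by
  obtain ⟨L, hL, hlen, loc, hloc⟩ := h.exists_loc
  refine ⟨L.length, hlen, fun rd tgt anc htgt hanc hrt hra hta => ?_⟩
  obtain ⟨C, hC, hClen, hCrun⟩ := hL.exists_qgates rd anc hanc hra
  obtain ⟨X, hX, hXlen, hXrun⟩ := exists_qgates_xor tgt (fun b => anc (loc b)) htgt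
    (fun b b' h => hta b' _ h.symm)
  refine ⟨C ++ X ++ C.reverse, ?_, ?_, fun s hs => ?_⟩
  · intro g hg
    simp only [List.mem_append, List.mem_reverse] at hg
    rcases hg with (hg | hg) | hg
    exacts [hC g hg, hX g hg, hC g hg]
  · simp only [List.length_append, List.length_reverse]
    lia
  · rw [cRun_append, cRun_append]
    set s' := Function.extend tgt (fun b => s (tgt b) ^^ f (s ∘ rd) b) s with hs'
    have hoff : ∀ w, (∀ b, tgt b ≠ w) → s' w = s w := fun w hw =>
      Function.extend_apply' _ _ _ fun ⟨b, hb⟩ => hw b hb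
    have hs'0 : ∀ i, s' (anc i) = false := fun i => by rw [hoff _ fun b => hta b i, hs]
    have hrd : s' ∘ rd = s ∘ rd := funext fun a => hoff _ fun b h => hrt a b h.symm
    -- Compute, copy, uncompute: the targets are neither read nor written by `C`, so copying after
    -- `C` agrees with running `C` on the state with the targets already updated. The reversed `C`
    -- then returns to `s'`.
    suffices hh : cRun X (cRun C s) = cRun C s' by rw [hh, cRun_reverse_cRun]
    rw [hXrun]
    ext w
    by_cases hw : ∃ b, tgt b = w
    · obtain ⟨b, rfl⟩ := hw
      rw [htgt.extend_apply, (hCrun s hs).1 _ fun i => hta b i, (hCrun s hs).2, hloc,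
        (hCrun s' hs'0).1 _ fun i => hta b i, hs', htgt.extend_apply]
    · rw [Function.extend_apply' _ _ _ hw]
      by_cases hw' : ∃ i, anc i = w
      · obtain ⟨i, rfl⟩ := hw'
        rw [(hCrun s hs).2, (hCrun s' hs'0).2, hrd]
      · push Not at hw hw'
        rw [(hCrun s hs).1 _ fun i => (hw' i).symm, (hCrun s' hs'0).1 _ fun i => (hw' i).symm,
          hoff w hw]

/-- The effect on state vectors of a reversible evaluation. -/
theorem qRun_of_cRun_xor {α β A : Type} {f : Bits α → Bits β} {rd : α → W} {tgt : β → W}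
    {anc : A → W} (htgt : Function.Injective tgt) (hrt : ∀ a b, rd a ≠ tgt b)
    (hta : ∀ b i, tgt b ≠ anc i) {gs : List (QGate W)} (hgs : ∀ g ∈ gs, g.IsPerm)
    (hrun : ∀ s : Bits W, (∀ i, s (anc i) = false) →
      cRun gs s = Function.extend tgt (fun b => s (tgt b) ^^ f (s ∘ rd) b) s)
    {ψ : QVec W} (hψ : ∀ s, ψ s ≠ 0 → ∀ i, s (anc i) = false) (s : Bits W) :
    qRun gs ψ s = ψ (Function.extend tgt (fun b => s (tgt b) ^^ f (s ∘ rd) b) s) := by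
  set s' := Function.extend tgt (fun b => s (tgt b) ^^ f (s ∘ rd) b) s with hs'
  have hoff : ∀ w, (∀ b, tgt b ≠ w) → s' w = s w := fun w hw =>
    Function.extend_apply' _ _ _ fun ⟨b, hb⟩ => hw b hb
  rw [qRun_eq_cRun_reverse hgs]
  by_cases hs : ∀ i, s (anc i) = false
  · congr 1
    have h0 : ∀ i, s' (anc i) = false := fun i => by rw [hoff _ fun b => hta b i, hs]
    have hrd : s' ∘ rd = s ∘ rd := funext fun a => hoff _ fun b h => hrt a b h.symm
    rw [← cRun_reverse_cRun gs s', hrun s' h0]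
    congr 1
    ext w
    by_cases hw : ∃ b, tgt b = w
    · obtain ⟨b, rfl⟩ := hw
      rw [htgt.extend_apply, hrd, hs', htgt.extend_apply]
      simp
    · rw [Function.extend_apply' _ _ _ hw, hoff w fun b h => hw ⟨b, h⟩]
  -- On unclean ancillas nothing is known about the gates, but both sides vanish: the circuit
  -- permutes basis states and maps those with clean ancillas to such states, and `ψ` lives on
  -- these.
  · rw [show ψ s' = 0 from ?_]
    · by_contra hne
      have h1 := hψ _ hne
      apply hs
      intro i
      have h2 := hrun _ h1
      rw [cRun_cRun_reverse] at h2
      rw [h2, Function.extend_apply', h1]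
      exact fun ⟨b, hb⟩ => hta b i hb
    · by_contra hne
      exact hs fun i => by rw [← hoff _ fun b => hta b i]; exact hψ _ hne i

end Quantum

/-! ### Unitarity -/

section Unitary
variable {α : Type} [Fintype α] [DecidableEq α]

/-- The inner product of state vectors. -/
noncomputable def ip (a b : QVec α) : ℂ := ∑ s, star (a s) * b s

/-- The left side counts each string twice. It splits a sum over all strings into pairs differing at
`t`, on which a Hadamard gate acts as a two-by-two block. -/
theorem sum_update_add (F : Bits α → ℂ) (t : α) :
    ∑ s, (F (Function.update s t false) + F (Function.update s t true)) = 2 * ∑ s, F s := by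
  have hflip : ∑ s, F (Function.update s t (!(s t))) = ∑ s, F s := by
    refine Fintype.sum_equiv (Function.Involutive.toPerm
      (fun s : Bits α => Function.update s t (!(s t))) fun s => ?_) _ _ fun s => rfl
    simp
  rw [two_mul]
  nth_rw 2 [← hflip]
  rw [← Finset.sum_add_distrib]
  refine Finset.sum_congr rfl fun s _ => ?_
  cases hs : s t
  · have : Function.update s t false = s := by rw [← hs, Function.update_eq_self]
    simp [this]
  · have : Function.update s t true = s := by rw [← hs, Function.update_eq_self]
    simp [this, add_comm]

theorem sqrt_two_inv_mul_self : ((√2 : ℝ) : ℂ)⁻¹ * ((√2 : ℝ) : ℂ)⁻¹ = 1 / 2 := by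
  rw [← mul_inv, ← Complex.ofReal_mul, Real.mul_self_sqrt (by norm_num)]
  norm_num

theorem star_exp_mul_self : star (Complex.exp (Complex.I * (Real.pi / 4 : ℝ))) *
    Complex.exp (Complex.I * (Real.pi / 4 : ℝ)) = 1 := by
  rw [Complex.star_def, ← Complex.exp_conj, ← Complex.exp_add, map_mul, Complex.conj_I,
    Complex.conj_ofReal, neg_mul, neg_add_cancel, Complex.exp_zero]

theorem QGate.ip_apply (g : QGate α) (a b : QVec α) : ip (g.apply a) (g.apply b) = ip a b := by
  have hperm : g.IsPerm → ip (g.apply a) (g.apply b) = ip a b := fun hg => by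
    refine Fintype.sum_equiv (Function.Involutive.toPerm g.act g.act_act) _ _ fun s => ?_
    simp only [hg.apply_eq]
    rfl
  cases g with
  | pauliX t => exact hperm trivial
  | cnot c t h => exact hperm trivial
  | toffoli c₁ c₂ t h12 h1 h2 => exact hperm trivial
  | phaseT t =>
    refine Finset.sum_congr rfl fun s _ => ?_
    simp only [QGate.apply]
    split_ifs
    · rw [star_mul', mul_mul_mul_comm, star_exp_mul_self, one_mul]
    · simp
  | hadamard t =>
    have h2 : (2 : ℂ) ≠ 0 := by norm_num
    apply mul_left_cancel₀ h2
    unfold ip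
    rw [← sum_update_add _ t, ← sum_update_add (fun s => star (a s) * b s) t]
    refine Finset.sum_congr rfl fun s _ => ?_
    simp only [QGate.apply, Function.update_self, Function.update_idem, star_mul', star_add,
      Bool.false_eq_true, if_true, if_false, one_mul, neg_mul, star_neg]
    have hs : star (((√2 : ℝ) : ℂ)⁻¹) = ((√2 : ℝ) : ℂ)⁻¹ := by
      rw [star_inv₀]; simp
    rw [hs]
    have h := sqrt_two_inv_mul_self
    generalize ((√2 : ℝ) : ℂ)⁻¹ = c at h
    generalize star (a (Function.update s t false)) = p
    generalize star (a (Function.update s t true)) = q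
    generalize b (Function.update s t false) = p'
    generalize b (Function.update s t true) = q'
    linear_combination (2 * (p * p' + q * q')) * h

theorem ip_qRun (gs : List (QGate α)) (a b : QVec α) : ip (qRun gs a) (qRun gs b) = ip a b := by
  induction gs generalizing a b with
  | nil => rfl
  | cons g gs ih => rw [qRun_cons, qRun_cons, ih, g.ip_apply]

theorem ip_self (a : QVec α) : ip a a = ((∑ s, ‖a s‖ ^ 2 : ℝ) : ℂ) := by
  rw [ip, Complex.ofReal_sum]
  refine Finset.sum_congr rfl fun s _ => ?_
  rw [Complex.star_def, Complex.conj_mul']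
  norm_cast

theorem sum_norm_sq_qRun (gs : List (QGate α)) (ψ : QVec α) :
    ∑ s, ‖qRun gs ψ s‖ ^ 2 = ∑ s, ‖ψ s‖ ^ 2 := by
  have h := ip_qRun gs ψ ψ
  rw [ip_self, ip_self] at h
  exact_mod_cast h

theorem norm_ip_sq_le (a b : QVec α) : ‖ip a b‖ ^ 2 ≤ (∑ s, ‖a s‖ ^ 2) * ∑ s, ‖b s‖ ^ 2 := by
  have h : ‖ip a b‖ ≤ ∑ s, ‖a s‖ * ‖b s‖ := by
    refine (norm_sum_le _ _).trans (le_of_eq ?_)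
    simp
  calc ‖ip a b‖ ^ 2 ≤ (∑ s, ‖a s‖ * ‖b s‖) ^ 2 := by gcongr
    _ ≤ _ := Finset.sum_mul_sq_le_sq_mul_sq _ _ _

/-- Gates implementing the inverse of a gate. -/
def QGate.inv (g : QGate α) : List (QGate α) :=
  match g with
  | .phaseT t => List.replicate 7 (.phaseT t)
  | g => [g]

theorem exp_pow_eight : Complex.exp (Complex.I * (Real.pi / 4 : ℝ)) ^ 8 = 1 := by
  rw [← Complex.exp_nat_mul]
  rw [show ((8 : ℕ) : ℂ) * (Complex.I * (Real.pi / 4 : ℝ)) = 2 * Real.pi * Complex.I by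
    push_cast; ring]
  exact Complex.exp_two_pi_mul_I

theorem qRun_replicate_phaseT (t : α) (n : ℕ) (ψ : QVec α) (s : Bits α) :
    qRun (List.replicate n (.phaseT t)) ψ s =
      (if s t then Complex.exp (Complex.I * (Real.pi / 4 : ℝ)) else 1) ^ n * ψ s := by
  induction n generalizing ψ with
  | zero => simp
  | succ n ih =>
    rw [List.replicate_succ, qRun_cons, ih, QGate.apply, pow_succ, mul_assoc]

theorem QGate.apply_qRun_inv (g : QGate α) (ψ : QVec α) : g.apply (qRun g.inv ψ) = ψ := by
  have hperm : g.IsPerm → g.inv = [g] → g.apply (qRun g.inv ψ) = ψ := fun hg hi => by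
    ext s
    rw [hi, hg.apply_eq, qRun_cons, qRun_nil, hg.apply_eq, g.act_act]
  cases g with
  | pauliX t => exact hperm trivial rfl
  | cnot c t h => exact hperm trivial rfl
  | toffoli c₁ c₂ t h12 h1 h2 => exact hperm trivial rfl
  | phaseT t =>
    ext s
    simp only [QGate.inv, QGate.apply, qRun_replicate_phaseT]
    rw [← mul_assoc, ← pow_succ']
    split_ifs
    · rw [exp_pow_eight, one_mul]
    · simp
  | hadamard t =>
    ext s
    simp only [QGate.inv, qRun_cons, qRun_nil, QGate.apply, Function.update_self,
      Function.update_idem, Bool.false_eq_true, if_true, if_false, one_mul]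
    have h := sqrt_two_inv_mul_self
    cases hs : s t
    · have : Function.update s t false = s := by rw [← hs, Function.update_eq_self]
      rw [this]
      simp only [Bool.false_eq_true, if_false]
      linear_combination (2 * ψ s) * h
    · have : Function.update s t true = s := by rw [← hs, Function.update_eq_self]
      rw [this]
      simp only [if_true]
      linear_combination (2 * ψ s) * h

/-- Gates implementing the inverse of a circuit. -/
def qInv (gs : List (QGate α)) : List (QGate α) := gs.reverse.flatMap QGate.inv

theorem length_qInv_le (gs : List (QGate α)) : (qInv gs).length ≤ 7 * gs.length := by
  unfold qInv
  induction gs with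
  | nil => simp
  | cons g gs ih =>
    simp only [List.reverse_cons, List.flatMap_append, List.length_append, List.length_cons,
      List.flatMap_cons, List.flatMap_nil, List.append_nil]
    have : g.inv.length ≤ 7 := by cases g <;> simp [QGate.inv]
    lia

theorem qRun_qRun_qInv (gs : List (QGate α)) (ψ : QVec α) : qRun gs (qRun (qInv gs) ψ) = ψ := by
  unfold qInv
  induction gs generalizing ψ with
  | nil => rfl
  | cons g gs ih =>
    simp only [List.reverse_cons, List.flatMap_append, List.flatMap_cons, List.flatMap_nil,
      List.append_nil]
    rw [qRun_append, qRun_cons, g.apply_qRun_inv, ih]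

theorem ip_qRun_qInv (gs : List (QGate α)) (a b : QVec α) :
    ip a (qRun (qInv gs) b) = ip (qRun gs a) b := by
  rw [← ip_qRun gs, qRun_qRun_qInv]

/-! ### Hadamard gates on all qubits -/

/-- The sign `(-1)^b`. -/
def sgn (b : Bool) : ℂ := if b then -1 else 1

@[simp] theorem sgn_false : sgn false = 1 := rfl

@[simp] theorem sgn_true : sgn true = -1 := rfl

theorem sgn_xor (a b : Bool) : sgn (a ^^ b) = sgn a * sgn b := by cases a <;> cases b <;> simp

theorem sgn_mul_self (a : Bool) : sgn a * sgn a = 1 := by cases a <;> simp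

theorem norm_sgn (a : Bool) : ‖sgn a‖ = 1 := by cases a <;> simp

theorem star_sgn (a : Bool) : star (sgn a) = sgn a := by cases a <;> simp

theorem sgn_injective : Function.Injective sgn := by
  intro a b h
  cases a <;> cases b <;> first | rfl | (exfalso; norm_num [sgn] at h)

/-- The inner product of two bit strings modulo 2. -/
noncomputable def dot (x y : Bits α) : Bool :=
  (Finset.univ : Finset α).toList.foldr (fun i b => (x i && y i) ^^ b) false

theorem sgn_dot (x y : Bits α) : sgn (dot x y) = ∏ i, sgn (x i && y i) := by
  rw [← Finset.prod_map_toList, dot]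
  induction (Finset.univ : Finset α).toList with
  | nil => simp
  | cons i l ih => rw [List.foldr_cons, List.map_cons, List.prod_cons, sgn_xor, ih]

theorem dot_comm (x y : Bits α) : dot x y = dot y x := by
  unfold dot
  simp only [Bool.and_comm]

theorem dot_xor_left (x y z : Bits α) : dot (fun i => x i ^^ y i) z = (dot x z ^^ dot y z) := by
  apply sgn_injective
  rw [sgn_xor, sgn_dot, sgn_dot, sgn_dot, ← Finset.prod_mul_distrib]
  refine Finset.prod_congr rfl fun i _ => ?_
  rw [← sgn_xor]
  cases x i <;> cases y i <;> cases z i <;> rfl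

theorem dot_xor_right (x y z : Bits α) : dot z (fun i => x i ^^ y i) = (dot z x ^^ dot z y) := by
  rw [dot_comm, dot_xor_left, dot_comm x, dot_comm y]

/-- Hadamard gates on all qubits. -/
noncomputable def hadamardAll (α : Type) [Fintype α] : List (QGate α) :=
  (Finset.univ : Finset α).toList.map .hadamard

theorem length_hadamardAll : (hadamardAll α).length = Fintype.card α := by
  simp [hadamardAll]

theorem qRun_hadamardAll (ψ : QVec α) (y : Bits α) :
    qRun (hadamardAll α) ψ y =
      (((√2 : ℝ) : ℂ)⁻¹) ^ Fintype.card α * ∑ x, sgn (dot x y) * ψ x := by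
  set h : ℂ := ((√2 : ℝ) : ℂ)⁻¹ with hh
  -- After the gates on `l`, the kernel is a product over the qubits: a Hadamard entry for those in
  -- `l` and a Kronecker delta for the others.
  have key : ∀ l : List α, l.Nodup → ∀ (ψ : QVec α) (y : Bits α), qRun (l.map .hadamard) ψ y =
      ∑ x, (∏ i, if i ∈ l then h * sgn (x i && y i) else if x i = y i then 1 else 0) * ψ x := by
    intro l
    induction l with
    | nil =>
      intro _ ψ y
      rw [Finset.sum_eq_single y]
      · simp
      · intro x _ hx
        obtain ⟨i, hi⟩ := Function.ne_iff.1 hx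
        rw [Finset.prod_eq_zero (Finset.mem_univ i) (by simp [hi]), zero_mul]
      · simp
    | cons a l ih =>
      intro hl ψ y
      rw [List.nodup_cons] at hl
      rw [List.map_cons, qRun_cons, ih hl.2]
      have hsplit : ∀ (G : Bits α → ℂ), (∑ x, G x) =
          (1 / 2) * ∑ x, (G (Function.update x a false) + G (Function.update x a true)) := by
        intro G; rw [sum_update_add]; ring
      rw [hsplit, hsplit (fun x => _ * ψ x)]
      congr 1
      refine Finset.sum_congr rfl fun x _ => ?_
      have hprod : ∀ (b : Bool), (∏ i, if i ∈ l then h * sgn (Function.update x a b i && y i)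
          else if Function.update x a b i = y i then 1 else 0) = (if b = y a then 1 else 0) *
          ∏ i ∈ Finset.univ.erase a, if i ∈ l then h * sgn (x i && y i)
          else if x i = y i then 1 else 0 := by
        intro b
        rw [← Finset.mul_prod_erase _ _ (Finset.mem_univ a), if_neg hl.1, Function.update_self]
        congr 1
        refine Finset.prod_congr rfl fun i hi => ?_
        rw [Function.update_of_ne (Finset.ne_of_mem_erase hi)]
      have hprod' : ∀ (b : Bool), (∏ i, if i ∈ a :: l then h * sgn (Function.update x a b i && y i)
          else if Function.update x a b i = y i then 1 else 0) = (h * sgn (b && y a)) *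
          ∏ i ∈ Finset.univ.erase a, if i ∈ l then h * sgn (x i && y i)
          else if x i = y i then 1 else 0 := by
        intro b
        rw [← Finset.mul_prod_erase _ _ (Finset.mem_univ a), if_pos List.mem_cons_self,
          Function.update_self]
        congr 1
        refine Finset.prod_congr rfl fun i hi => ?_
        rw [Function.update_of_ne (Finset.ne_of_mem_erase hi)]
        simp [Finset.ne_of_mem_erase hi]
      rw [hprod, hprod, hprod', hprod']
      simp only [QGate.apply, Function.update_self, Function.update_idem, ← hh]
      cases y a <;> simp <;> ring
  rw [hadamardAll, key _ (Finset.nodup_toList _), Finset.mul_sum]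
  refine Finset.sum_congr rfl fun x _ => ?_
  simp only [Finset.mem_toList, Finset.mem_univ, if_true]
  rw [Finset.prod_mul_distrib, Finset.prod_const, Finset.card_univ, sgn_dot]
  ring

end Unitary

/-! ### Executions of protocols -/

theorem sum_bits_sum {α β M : Type} [Fintype α] [DecidableEq α] [Fintype β] [DecidableEq β]
    [AddCommMonoid M] (F : Bits (α ⊕ β) → M) :
    ∑ s, F s = ∑ a : Bits α, ∑ b : Bits β, F (Sum.elim a b) := by
  rw [← Fintype.sum_prod_type']
  refine Fintype.sum_equiv (Equiv.sumArrowEquivProdArrow α β Bool) _ _ fun s => ?_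
  congr 1
  exact (Sum.elim_comp_inl_inr s).symm

theorem Fin.foldl_eq_of_step {A : Type} {T : ℕ} (f : A → Fin T → A) (F : ℕ → A)
    (h : ∀ i : Fin T, F (i + 1) = f (F i) i) : Fin.foldl T f (F 0) = F T := by
  induction T with
  | zero => simp
  | succ T ih =>
    rw [Fin.foldl_succ_last, ih (fun a i => f a i.castSucc) fun i => h i.castSucc]
    exact (h (Fin.last T)).symm

section Respond
variable {M W : Type} [Fintype M] [DecidableEq M] [Fintype W] [DecidableEq W]

/-- The state `|m⟩ ⊗ |ψ⟩`. -/
def initMsg (m : Bits M) (ψ : QVec W) : QVec (M ⊕ W) :=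
  fun s => if s ∘ Sum.inl = m then ψ (s ∘ Sum.inr) else 0

theorem sum_norm_sq_initMsg (m : Bits M) (ψ : QVec W) :
    ∑ s, ‖initMsg m ψ s‖ ^ 2 = ∑ w, ‖ψ w‖ ^ 2 := by
  rw [sum_bits_sum, Finset.sum_eq_single m]
  · simp [initMsg]
  · intro b _ hb
    simp [initMsg, hb]
  · simp

/-- The state after receiving `m`, applying a circuit, and measuring `reply`. -/
noncomputable def gResp (gs : List (QGate (M ⊕ W))) (m reply : Bits M) (ψ : QVec W) : QVec W :=
  fun w => qRun gs (initMsg m ψ) (Sum.elim reply w)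

theorem sum_norm_sq_gResp (gs : List (QGate (M ⊕ W))) (m : Bits M) (ψ : QVec W) :
    ∑ reply, ∑ w, ‖gResp gs m reply ψ w‖ ^ 2 = ∑ w, ‖ψ w‖ ^ 2 := by
  rw [← sum_norm_sq_initMsg m, ← sum_norm_sq_qRun gs, sum_bits_sum]
  rfl

end Respond

section Protocols
variable {q T : ℕ} {ι ο κ : Type} [DecidableEq ι] [Fintype κ] [DecidableEq κ]

/-- The contents of the sender's wires after `j` rounds, if the replies are `t`. -/
def Sender.wiresN (S : Sender q T ι ο) (x : Bits ι) (r : Bits (Fin S.coins))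
    (t : Fin T → Bits (Fin q)) : ℕ → Bits S.Wires
  | 0 => Sum.elim (Sum.elim x (Sum.elim r fun _ => false)) (fun _ => false)
  | j + 1 => if h : j < T then
      Sum.elim (bRun (S.step ⟨j, h⟩) (S.wiresN x r t j) ∘ Sum.inl) (t ⟨j, h⟩)
    else S.wiresN x r t j

/-- The sender's message in round `i`. -/
def Sender.msg (S : Sender q T ι ο) (x : Bits ι) (r : Bits (Fin S.coins))
    (t : Fin T → Bits (Fin q)) (i : Fin T) : Bits (Fin q) :=
  bRun (S.step i) (S.wiresN x r t i) ∘ Sum.inr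

/-- The sender's output. -/
def Sender.result (S : Sender q T ι ο) (x : Bits ι) (r : Bits (Fin S.coins))
    (t : Fin T → Bits (Fin q)) : Bits ο :=
  fun o => bRun S.final (S.wiresN x r t T) (S.out o)

/-- The receiver's unnormalised state after `j` rounds with messages `ms` and replies `ts`. -/
noncomputable def Receiver.stateN (R : Receiver q T κ) (ms ts : Fin T → Bits (Fin q)) :
    ℕ → QVec R.Work
  | 0 => ket fun _ => false
  | j + 1 => if h : j < T then
      gResp (R.step ⟨j, h⟩) (ms ⟨j, h⟩) (ts ⟨j, h⟩) (R.stateN ms ts j)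
    else R.stateN ms ts j

theorem Sender.wiresN_succ (S : Sender q T ι ο) (x : Bits ι) (r : Bits (Fin S.coins))
    (t : Fin T → Bits (Fin q)) (i : Fin T) : S.wiresN x r t (i + 1) =
      Sum.elim (bRun (S.step i) (S.wiresN x r t i) ∘ Sum.inl) (t i) := by
  rw [Sender.wiresN, dif_pos i.2]

theorem Receiver.stateN_succ (R : Receiver q T κ) (ms ts : Fin T → Bits (Fin q)) (i : Fin T) :
    R.stateN ms ts (i + 1) = gResp (R.step i) (ms i) (ts i) (R.stateN ms ts i) := by
  rw [Receiver.stateN, dif_pos i.2]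

theorem execute_eq (S : Sender q T ι ο) (R : Receiver q T κ) (x : Bits ι)
    (r : Bits (Fin S.coins)) (t : Fin T → Bits (Fin q)) :
    execute S R x r t = (S.wiresN x r t T, R.stateN (S.msg x r t) t T) := by
  rw [execute]
  refine Fin.foldl_eq_of_step _ (fun j => (S.wiresN x r t j, R.stateN (S.msg x r t) t j))
    fun i => ?_
  rw [S.wiresN_succ, R.stateN_succ]
  rfl

theorem senderOut_eq (S : Sender q T ι ο) (R : Receiver q T κ) (x : Bits ι)
    (r : Bits (Fin S.coins)) (t : Fin T → Bits (Fin q)) :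
    senderOut S R x r t = S.result x r t := by
  ext o
  rw [senderOut, execute_eq]
  rfl

theorem Sender.wiresN_congr (S : Sender q T ι ο) (x : Bits ι) (r : Bits (Fin S.coins))
    {t t' : Fin T → Bits (Fin q)} {j : ℕ} (h : ∀ i : Fin T, i.1 < j → t i = t' i) :
    S.wiresN x r t j = S.wiresN x r t' j := by
  induction j with
  | zero => rfl
  | succ j ih =>
    rw [Sender.wiresN, Sender.wiresN, ih fun i hi => h i (by lia)]
    split_ifs with hj
    · rw [h ⟨j, hj⟩ (by simp)]
    · rfl

theorem Sender.msg_congr (S : Sender q T ι ο) (x : Bits ι) (r : Bits (Fin S.coins))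
    {t t' : Fin T → Bits (Fin q)} {j : Fin T} (h : ∀ i : Fin T, i < j → t i = t' i) :
    S.msg x r t j = S.msg x r t' j := by
  rw [Sender.msg, Sender.msg, S.wiresN_congr x r fun i hi => h i hi]

theorem Receiver.stateN_congr (R : Receiver q T κ) {ms ms' ts ts' : Fin T → Bits (Fin q)} {j : ℕ}
    (hm : ∀ i : Fin T, i.1 < j → ms i = ms' i) (ht : ∀ i : Fin T, i.1 < j → ts i = ts' i) :
    R.stateN ms ts j = R.stateN ms' ts' j := by
  induction j with
  | zero => rfl
  | succ j ih =>
    rw [Receiver.stateN, Receiver.stateN, ih (fun i hi => hm i (by lia)) fun i hi => ht i (by lia)]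
    split_ifs with hj
    · rw [hm ⟨j, hj⟩ (by simp), ht ⟨j, hj⟩ (by simp)]
    · rfl

theorem sum_sum_update {I B : Type} [Fintype I] [DecidableEq I] [Fintype B]
    (F : (I → B) → ℝ) (i : I) :
    ∑ t, ∑ b, F (Function.update t i b) = Fintype.card B * ∑ t, F t := by
  classical
  rw [← Equiv.sum_comp (Equiv.funSplitAt i B).symm fun t => ∑ b, F (Function.update t i b),
    ← Equiv.sum_comp (Equiv.funSplitAt i B).symm F, Fintype.sum_prod_type, Fintype.sum_prod_type]
  have h : ∀ (b b' : B) (t : {j // j ≠ i} → B),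
      Function.update ((Equiv.funSplitAt i B).symm (b, t)) i b' =
        (Equiv.funSplitAt i B).symm (b', t) := by
    intro b b' t
    ext j
    by_cases hj : j = i
    · subst hj; simp [Equiv.funSplitAt, Equiv.piSplitAt]
    · simp [Equiv.funSplitAt, Equiv.piSplitAt, hj]
  simp only [h]
  rw [Finset.sum_const, Finset.card_univ, nsmul_eq_mul, Finset.sum_comm]

/-- The probabilities of all sequences of replies add up to `1`, even for messages chosen
adaptively, as long as the message of a round depends only on earlier replies. -/
theorem sum_norm_sq_stateN (R : Receiver q T κ) (ms : (Fin T → Bits (Fin q)) → Fin T → Bits (Fin q))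
    (hms : ∀ t t' j, (∀ i : Fin T, i < j → t i = t' i) → ms t j = ms t' j) :
    ∑ t, ∑ w, ‖R.stateN (ms t) t T w‖ ^ 2 = 1 := by
  classical
  set B : ℝ := (Fintype.card (Bits (Fin q)) : ℝ) with hB
  have hB0 : B ≠ 0 := by rw [hB]; exact_mod_cast Fintype.card_ne_zero
  -- The state after `j` rounds ignores the later replies, so the sum over full reply sequences
  -- counts every prefix `B ^ (T - j)` times.
  have key : ∀ j, j ≤ T → B ^ j * ∑ t, ∑ w, ‖R.stateN (ms t) t j w‖ ^ 2 = B ^ T := by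
    intro j
    induction j with
    | zero =>
      intro _
      have : ∀ t, ∑ w, ‖R.stateN (ms t) t 0 w‖ ^ 2 = 1 := by
        intro t
        simp [Receiver.stateN, ket, apply_ite]
      simp only [this]
      simp [hB]
    | succ j ih =>
      intro hj
      rw [← ih (by lia), pow_succ, mul_assoc, ← sum_sum_update _ (⟨j, hj⟩ : Fin T)]
      congr 1
      refine Finset.sum_congr rfl fun t _ => ?_
      rw [← sum_norm_sq_gResp (R.step ⟨j, hj⟩) (ms t ⟨j, hj⟩)]
      refine Finset.sum_congr rfl fun b _ => Finset.sum_congr rfl fun w _ => ?_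
      have hne : ∀ i : Fin T, i.1 < j → Function.update t ⟨j, hj⟩ b i = t i := fun i hi =>
        Function.update_of_ne (fun h => by rw [h] at hi; exact lt_irrefl _ hi) _ _
      rw [R.stateN_succ _ _ ⟨j, hj⟩, Function.update_self,
        hms _ t ⟨j, hj⟩ fun i hi => hne i hi, R.stateN_congr (ms' := ms t) (ts' := t)]
      · intro i hi
        exact hms _ _ _ fun i' hi' => hne i' (lt_trans hi' hi)
      · exact hne
  have := key T le_rfl
  exact mul_left_cancel₀ (pow_ne_zero T hB0) (this.trans (mul_one _).symm)

theorem Sender.sum_norm_sq_stateN (S : Sender q T ι ο) (R : Receiver q T κ) (x : Bits ι)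
    (r : Bits (Fin S.coins)) : ∑ t, ∑ w, ‖R.stateN (S.msg x r t) t T w‖ ^ 2 = 1 :=
  _root_.sum_norm_sq_stateN R (S.msg x r) fun _ _ _ h => S.msg_congr x r h

open Classical in
theorem eventProb_eq (S : Sender q T ι ο) (R : Receiver q T κ) (x : Bits ι)
    (E : Bits ο → Bits κ → Prop) : eventProb S R x E = 𝔼 r : Bits (Fin S.coins), ∑ t,
      ∑ w : Bits R.Work, if E (S.result x r t) (w ∘ Sum.inl) then
        ‖R.stateN (S.msg x r t) t T w‖ ^ 2 else 0 := by
  simp only [eventProb, senderOut_eq, execute_eq]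

/-! ### Squared overlaps -/

/-- The squared norm of the projection of `ψ` onto the unit vector `v`. -/
noncomputable def ov {β : Type} [Fintype β] [DecidableEq β] (v : QVec κ) (ψ : QVec (κ ⊕ β)) : ℝ :=
  ∑ b : Bits β, ‖∑ o, star (v o) * ψ (Sum.elim o b)‖ ^ 2

theorem ov_nonneg {β : Type} [Fintype β] [DecidableEq β] (v : QVec κ) (ψ : QVec (κ ⊕ β)) :
    0 ≤ ov v ψ := Finset.sum_nonneg fun _ _ => by positivity

/-- `v` is a unit vector or zero. -/
def UnitOrZero (v : QVec κ) : Prop := ∑ o, ‖v o‖ ^ 2 = 1 ∨ v = 0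

theorem UnitOrZero.sum_projOnto {β : Type} [Fintype β] [DecidableEq β] {v : QVec κ}
    (hv : UnitOrZero v) (ψ : QVec (κ ⊕ β)) : ∑ s, ‖projOnto v ψ s‖ ^ 2 = ov v ψ := by
  rw [sum_bits_sum, Finset.sum_comm]
  simp only [projOnto, norm_mul, mul_pow, Sum.elim_comp_inl, Sum.elim_comp_inr]
  rcases hv with hv | rfl
  · refine Finset.sum_congr rfl fun b _ => ?_
    rw [← Finset.sum_mul, hv, one_mul]
  · simp [ov]

theorem UnitOrZero.ov_le {β : Type} [Fintype β] [DecidableEq β] {v : QVec κ}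
    (hv : UnitOrZero v) (ψ : QVec (κ ⊕ β)) : ov v ψ ≤ ∑ s, ‖ψ s‖ ^ 2 := by
  rw [sum_bits_sum, Finset.sum_comm]
  refine Finset.sum_le_sum fun b _ => ?_
  refine (norm_ip_sq_le v fun o => ψ (Sum.elim o b)).trans ?_
  rcases hv with hv | rfl
  · rw [hv, one_mul]
  · simp only [Pi.zero_apply, norm_zero]
    rw [show ∑ s : Bits κ, (0 : ℝ) ^ 2 = 0 by simp, zero_mul]
    exact Finset.sum_nonneg fun _ _ => by positivity

/-- The expected squared overlap of the receiver's state with the vector `v a` depending on the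
sender's output `a`. -/
noncomputable def sqOverlap (S : Sender q T ι ο) (R : Receiver q T κ) (x : Bits ι)
    (v : Bits ο → QVec κ) : ℝ :=
  𝔼 r : Bits (Fin S.coins), ∑ t, ov (v (S.result x r t)) (R.stateN (S.msg x r t) t T)

theorem qNorm_sq {α : Type} [Fintype α] [DecidableEq α] (ψ : QVec α) :
    qNorm ψ ^ 2 = ∑ s, ‖ψ s‖ ^ 2 := Real.sq_sqrt (Finset.sum_nonneg fun _ _ => by positivity)

theorem qNorm_nonneg {α : Type} [Fintype α] [DecidableEq α] (ψ : QVec α) : 0 ≤ qNorm ψ :=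
  Real.sqrt_nonneg _

theorem qNorm_smul {α : Type} [Fintype α] [DecidableEq α] (c : ℂ) (ψ : QVec α) :
    qNorm (c • ψ) = ‖c‖ * qNorm ψ := by
  have h : qNorm (c • ψ) ^ 2 = (‖c‖ * qNorm ψ) ^ 2 := by
    rw [mul_pow, qNorm_sq, qNorm_sq, Finset.mul_sum]
    simp [mul_pow]
  exact (pow_left_inj₀ (qNorm_nonneg _) (mul_nonneg (norm_nonneg _) (qNorm_nonneg _))
    two_ne_zero).1 h

theorem projOnto_smul {β : Type} (v : QVec κ) (c : ℂ) (ψ : QVec (κ ⊕ β)) :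
    projOnto v (c • ψ) = c • projOnto v ψ := by
  ext s
  simp only [projOnto, Pi.smul_apply, smul_eq_mul, Finset.mul_sum]
  refine Finset.sum_congr rfl fun o _ => by ring

theorem expectedOverlap_eq (S : Sender q T ι ο) (R : Receiver q T κ) (x : Bits ι)
    (v : Bits ο → QVec κ) : expectedOverlap S R x v = 𝔼 r : Bits (Fin S.coins), ∑ t,
      qNorm (R.stateN (S.msg x r t) t T) *
        qNorm (projOnto (v (S.result x r t)) (R.stateN (S.msg x r t) t T)) := by
  simp only [expectedOverlap, senderOut_eq, execute_eq]
  refine Finset.expect_congr rfl fun r _ => Finset.sum_congr rfl fun t _ => ?_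
  rw [projOnto_smul, qNorm_smul]
  set n := qNorm (R.stateN (S.msg x r t) t T)
  by_cases hn : n = 0
  · simp [hn]
  · have : ‖(n⁻¹ : ℂ)‖ = n⁻¹ := by
      rw [norm_inv, Complex.norm_real, Real.norm_of_nonneg (qNorm_nonneg _)]
    rw [this]
    field_simp

/-- Projecting does not increase the norm, so `‖Πψ‖² ≤ ‖ψ‖ ‖Πψ‖`, and the right side is the
contribution of an unnormalised `ψ` to the expected overlap. -/
theorem sqOverlap_le_expectedOverlap (S : Sender q T ι ο) (R : Receiver q T κ) (x : Bits ι)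
    {v : Bits ο → QVec κ} (hv : ∀ a, UnitOrZero (v a)) :
    sqOverlap S R x v ≤ expectedOverlap S R x v := by
  rw [expectedOverlap_eq, sqOverlap]
  refine Finset.expect_le_expect fun r _ => Finset.sum_le_sum fun t _ => ?_
  have h1 := (hv (S.result x r t)).ov_le (R.stateN (S.msg x r t) t T)
  have h2 := (hv (S.result x r t)).sum_projOnto (R.stateN (S.msg x r t) t T)
  rw [← qNorm_sq] at h1 h2
  rw [← h2, sq]
  refine mul_le_mul_of_nonneg_right ?_ (qNorm_nonneg _)
  rw [← h2] at h1
  exact (pow_le_pow_iff_left₀ (qNorm_nonneg _) (qNorm_nonneg _) two_ne_zero).1 h1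

/-- This is `2 ‖ψ‖ ‖Πψ‖ ≤ ‖ψ‖² + ‖Πψ‖²` averaged. Together with the previous bound it lets
correctness be transferred between protocols by comparing squared overlaps, which are sums over
basis states; the error at most doubles. -/
theorem two_mul_expectedOverlap_le (S : Sender q T ι ο) (R : Receiver q T κ) (x : Bits ι)
    {v : Bits ο → QVec κ} (hv : ∀ a, UnitOrZero (v a)) :
    2 * expectedOverlap S R x v ≤ 1 + sqOverlap S R x v := by
  have h1 : (1 : ℝ) = 𝔼 _r : Bits (Fin S.coins), (1 : ℝ) := by
    rw [Finset.expect_const Finset.univ_nonempty]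
  rw [expectedOverlap_eq, sqOverlap, h1, ← Finset.expect_add_distrib, Finset.mul_expect]
  refine Finset.expect_le_expect fun r _ => ?_
  rw [← S.sum_norm_sq_stateN R x r, ← Finset.sum_add_distrib, Finset.mul_sum]
  refine Finset.sum_le_sum fun t _ => ?_
  rw [← (hv (S.result x r t)).sum_projOnto, ← qNorm_sq, ← qNorm_sq]
  nlinarith [sq_nonneg (qNorm (R.stateN (S.msg x r t) t T) -
    qNorm (projOnto (v (S.result x r t)) (R.stateN (S.msg x r t) t T)))]

end Protocols

theorem unitOrZero_hadamardKet (b s : Bool) : UnitOrZero (hadamardKet b s) := by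
  left
  rw [← Equiv.sum_comp (Equiv.funUnique Unit Bool).symm]
  have h := sqrt_two_inv_mul_self
  have h' : ‖((√2 : ℝ) : ℂ)⁻¹‖ ^ 2 = 1 / 2 := by
    rw [sq, ← norm_mul, h]; norm_num
  have h'' : (|(√2 : ℝ)| ^ 2)⁻¹ = 1 / 2 := by
    rw [sq_abs, Real.sq_sqrt (by norm_num)]; norm_num
  cases b <;> cases s <;> simp [hadamardKet]; norm_num

theorem unitOrZero_clawKet {n : ℕ} (x₀ x₁ : Bits (Fin n)) (z : Bool) :
    UnitOrZero (clawKet x₀ x₁ z) := by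
  by_cases h : x₀ = x₁
  · rw [clawKet, if_pos h]
    exact Or.inr rfl
  · rw [clawKet, if_neg h]
    left
    have h' : ‖((√2 : ℝ) : ℂ)⁻¹‖ ^ 2 = 1 / 2 := by
      rw [sq, ← norm_mul, sqrt_two_inv_mul_self]; norm_num
    simp only [Pi.smul_apply, Pi.add_apply, smul_eq_mul, norm_mul, mul_pow, h', ← Finset.mul_sum]
    rw [← Finset.add_sum_erase _ _ (Finset.mem_univ x₀), ← Finset.add_sum_erase _ _
      (Finset.mem_erase.2 ⟨Ne.symm h, Finset.mem_univ x₁⟩), Finset.sum_eq_zero]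
    · cases z <;> simp [ket, h, Ne.symm h] <;> norm_num
    · intro x hx
      simp only [Finset.mem_erase] at hx
      simp [ket, hx.1, hx.2.1]

/-! ### Extending a protocol by one round -/

section Extension
variable {q q' T : ℕ} {ι' ο ο' κ κ' C M : Type}

/-- The message with parts `lo` and `hi`. -/
def msgJoin (e : Fin q ⊕ M ≃ Fin q') (lo : Bits (Fin q)) (hi : Bits M) : Bits (Fin q') :=
  fun i => Sum.elim lo hi (e.symm i)

/-- The first part of a message. -/
def msgLow (e : Fin q ⊕ M ≃ Fin q') (m : Bits (Fin q')) : Bits (Fin q) := fun i => m (e (Sum.inl i))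

/-- The second part of a message. -/
def msgHigh (e : Fin q ⊕ M ≃ Fin q') (m : Bits (Fin q')) : Bits M := fun i => m (e (Sum.inr i))

@[simp] theorem msgLow_msgJoin (e : Fin q ⊕ M ≃ Fin q') (lo : Bits (Fin q)) (hi : Bits M) :
    msgLow e (msgJoin e lo hi) = lo := by
  ext i; simp [msgLow, msgJoin]

@[simp] theorem msgHigh_msgJoin (e : Fin q ⊕ M ≃ Fin q') (lo : Bits (Fin q)) (hi : Bits M) :
    msgHigh e (msgJoin e lo hi) = hi := by
  ext i; simp [msgHigh, msgJoin]

theorem msgJoin_low_high (e : Fin q ⊕ M ≃ Fin q') (m : Bits (Fin q')) :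
    msgJoin e (msgLow e m) (msgHigh e m) = m := by
  ext i
  obtain ⟨j | j, rfl⟩ := e.surjective i <;> simp [msgJoin, msgLow, msgHigh]

/-- Splitting messages into two parts. -/
def msgEquiv (e : Fin q ⊕ M ≃ Fin q') : Bits (Fin q) × Bits M ≃ Bits (Fin q') where
  toFun p := msgJoin e p.1 p.2
  invFun m := (msgLow e m, msgHigh e m)
  left_inv p := by simp
  right_inv m := msgJoin_low_high e m

/-- The sender `S'` extends `S` by one round, in which it sends `μ` of its input, further coins and
the output of `S`, and then outputs `out` of these and the reply. In the first rounds the additional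
message bits are zero, and so are the other message bits in the last round. -/
structure Sender.Extends (S' : Sender q' (T + 1) ι' ο') (S : Sender q T Empty ο)
    (e : Fin q ⊕ M ≃ Fin q') (ec : Fin S.coins ⊕ C ≃ Fin S'.coins)
    (μ : Bits (ι' ⊕ C ⊕ ο) → Bits M) (out : Bits ((ι' ⊕ C ⊕ ο) ⊕ M) → Bits ο')
    [DecidableEq ι'] : Prop where
  msg_castSucc : ∀ x r t (i : Fin T), S'.msg x r t i.castSucc =
    msgJoin e (S.msg Empty.elim (fun i => r (ec (Sum.inl i))) (fun i => msgLow e (t i.castSucc)) i)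
      fun _ => false
  msg_last : ∀ x r t, S'.msg x r t (Fin.last T) = msgJoin e (fun _ => false)
    (μ (Sum.elim x (Sum.elim (fun i => r (ec (Sum.inr i)))
      (S.result Empty.elim (fun i => r (ec (Sum.inl i))) fun i => msgLow e (t i.castSucc)))))
  result : ∀ x r t, S'.result x r t = out (Sum.elim (Sum.elim x (Sum.elim (fun i => r (ec (Sum.inr i)))
      (S.result Empty.elim (fun i => r (ec (Sum.inl i))) fun i => msgLow e (t i.castSucc))))
    (msgHigh e (t (Fin.last T))))

/-- The wires of the extended sender. -/
abbrev ExtWires (S : Sender q T Empty ο) (ι' C M : Type) (n₁ n₂ : ℕ) : Type :=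
  (ι' ⊕ (Fin S.coins ⊕ C) ⊕ (Fin S.anc ⊕ ο ⊕ Fin n₁ ⊕ Fin n₂)) ⊕ (Fin q ⊕ M)

variable [Fintype ι'] [DecidableEq ι'] [Fintype ο] [DecidableEq ο] [Fintype ο'] [DecidableEq ο']
  [Fintype C] [DecidableEq C] [Fintype M] [DecidableEq M]

set_option synthInstance.maxSize 1000 in
set_option synthInstance.maxHeartbeats 200000 in
set_option maxHeartbeats 1000000 in
-- The old sender runs on an embedded copy of its wires, which the new gates leave alone until its
-- output is known. New wires hold the new input and coins, a copy of the old output, and the zero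
-- ancillas for computing `μ` and `out`.
theorem Sender.exists_extends (S : Sender q T Empty ο) (e : Fin q ⊕ M ≃ Fin q')
    {μ : Bits (ι' ⊕ C ⊕ ο) → Bits M} {out : Bits ((ι' ⊕ C ⊕ ο) ⊕ M) → Bits ο'} {N₁ N₂ : ℕ}
    (hμ : BComp μ N₁) (hout : BComp out N₂) :
    ∃ (S' : Sender q' (T + 1) ι' ο') (ec : Fin S.coins ⊕ C ≃ Fin S'.coins),
      S'.Extends S e ec μ out ∧
      S'.size ≤ 10 * S.size + S.size * Fintype.card M + 10 * Fintype.card M + 3 * N₁ + 3 * N₂ +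
        Fintype.card ι' + 5 * Fintype.card ο' + Fintype.card C + 10 := by
  obtain ⟨n₁, hn₁, loc₁, hμ⟩ := hμ.exists_bgates
  obtain ⟨n₂, hn₂, loc₂, hout⟩ := hout.exists_bgates
  let uI : ι' → ExtWires S ι' C M n₁ n₂ := fun i => .inl (.inl i)
  let uR : Fin S.coins → ExtWires S ι' C M n₁ n₂ := fun i => .inl (.inr (.inl (.inl i)))
  let uC : C → ExtWires S ι' C M n₁ n₂ := fun i => .inl (.inr (.inl (.inr i)))
  let uA : Fin S.anc → ExtWires S ι' C M n₁ n₂ := fun i => .inl (.inr (.inr (.inl i)))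
  let uO : ο → ExtWires S ι' C M n₁ n₂ := fun i => .inl (.inr (.inr (.inr (.inl i))))
  let u₁ : Fin n₁ → ExtWires S ι' C M n₁ n₂ := fun i => .inl (.inr (.inr (.inr (.inr (.inl i)))))
  let u₂ : Fin n₂ → ExtWires S ι' C M n₁ n₂ := fun i => .inl (.inr (.inr (.inr (.inr (.inr i)))))
  let uL : Fin q → ExtWires S ι' C M n₁ n₂ := fun i => .inr (.inl i)
  let uM : M → ExtWires S ι' C M n₁ n₂ := fun i => .inr (.inr i)
  let em : S.Wires → ExtWires S ι' C M n₁ n₂ := Sum.elim (Sum.elim Empty.elim (Sum.elim uR uA)) uL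
  have hem : Function.Injective em := by
    rintro ((a | a | a) | a) ((b | b | b) | b) h <;>
      first | exact a.elim | exact b.elim | (simp [em, uR, uA, uL] at h; try rw [h])
  have hne : ∀ v, (∀ i, em v ≠ uI i) ∧ (∀ i, em v ≠ uC i) ∧ (∀ i, em v ≠ uO i) ∧
      (∀ i, em v ≠ u₁ i) ∧ (∀ i, em v ≠ u₂ i) ∧ ∀ i, em v ≠ uM i := by
    rintro ((a | a | a) | a)
    · exact a.elim
    all_goals simp [em, uI, uC, uO, u₁, u₂, uM, uR, uA, uL]
  let rd : ι' ⊕ C ⊕ ο → ExtWires S ι' C M n₁ n₂ := Sum.elim uI (Sum.elim uC uO)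
  let ec := Fintype.equivFin (Fin S.coins ⊕ C)
  let ea := Fintype.equivFin (Fin S.anc ⊕ ο ⊕ Fin n₁ ⊕ Fin n₂)
  let E : ExtWires S ι' C M n₁ n₂ ≃ (ι' ⊕ Fin _ ⊕ Fin _) ⊕ Fin q' :=
    Equiv.sumCongr (Equiv.sumCongr (Equiv.refl _) (Equiv.sumCongr ec ea)) e
  obtain ⟨clrM, hclrM, rclrM⟩ := exists_bgates_assign (fun _ => false) uM uM
    (fun a b h => by simpa [uM] using h) (fun a b h => by simpa [uM] using h)
  obtain ⟨clrL, hclrL, rclrL⟩ := exists_bgates_assign (fun _ => false) uL uL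
    (fun a b h => by simpa [uL] using h) (fun a b h => by simpa [uL] using h)
  obtain ⟨cpO, hcpO, rcpO⟩ := exists_bgates_assign (fun b => b) uO (fun o => em (S.out o))
    (fun a b h => by simpa [uO] using h) (fun a b _ => (hne _).2.2.1 b)
  obtain ⟨gμ, hgμ, rgμ⟩ := hμ rd u₁ (fun a b h => by simpa [u₁] using h)
    (by rintro (a | a | a) i <;> simp [rd, uI, uC, uO, u₁])
  obtain ⟨cpM, hcpM, rcpM⟩ := exists_bgates_assign (fun b => b) uM (fun m => u₁ (loc₁ m))
    (fun a b h => by simpa [uM] using h) (fun a b _ h => by simp [uM, u₁] at h)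
  obtain ⟨gout, hgout, rgout⟩ := hout (Sum.elim rd uM) u₂ (fun a b h => by simpa [u₂] using h)
    (by rintro ((a | a | a) | a) i <;> simp [rd, uI, uC, uO, uM, u₂])
  let st : Fin T → List (BGate (ExtWires S ι' C M n₁ n₂)) := fun i => (S.step i).map (BGate.map em) ++ clrM
  -- The old output is copied before the low message wires are cleared, because it may be read off
  -- those wires.
  let lst : List (BGate (ExtWires S ι' C M n₁ n₂)) :=
    S.final.map (BGate.map em) ++ (cpO ++ (gμ ++ (clrL ++ cpM)))
  let S' : Sender q' (T + 1) ι' ο' :=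
    { coins := _
      anc := _
      step := Fin.lastCases (lst.map (BGate.map E)) fun i => (st i).map (BGate.map E)
      final := gout.map (BGate.map E)
      out := fun o => E (u₂ (loc₂ o)) }
  have hrunE : ∀ (gs : List (BGate (ExtWires S ι' C M n₁ n₂))) (s : Bits S'.Wires) (u : ExtWires S ι' C M n₁ n₂),
      bRun (gs.map (BGate.map E)) s (E u) = bRun gs (fun v => s (E v)) u := by
    intro gs s u
    rw [bRun_map E.injective, E.injective.extend_apply]
    rfl
  have hst : ∀ i (s : Bits (ExtWires S ι' C M n₁ n₂)), (∀ v, bRun (st i) s (em v) = bRun (S.step i) (s ∘ em) v) ∧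
      (∀ m, bRun (st i) s (uM m) = false) ∧
      ∀ w, (∀ v, em v ≠ w) → (∀ m, uM m ≠ w) → bRun (st i) s w = s w := by
    intro i s
    have h : bRun (st i) s = Function.extend uM (fun _ => false)
        (Function.extend em (bRun (S.step i) (s ∘ em)) s) := by
      rw [bRun_append, rclrM, bRun_map hem]
    rw [h]
    have huM : Function.Injective uM := fun a b h => by simpa [uM] using h
    refine ⟨fun v => ?_, fun m => huM.extend_apply _ _ _, fun w h1 h2 => ?_⟩
    · rw [Function.extend_apply', hem.extend_apply]
      rintro ⟨m, hm⟩
      exact (hne v).2.2.2.2.2 m hm.symm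
    · rw [Function.extend_apply' _ _ _ fun ⟨m, hm⟩ => h2 m hm,
        Function.extend_apply' _ _ _ fun ⟨m, hm⟩ => h1 m hm]
  -- Before the last round, the embedded wires evolve as in the old protocol, since the additional
  -- reply bits sit on wires that its gates do not touch; all other wires still have their initial
  -- contents.
  have hinv : ∀ (x : Bits ι') (r : Bits (Fin S'.coins)) (t : Fin (T + 1) → Bits (Fin q')) (j : ℕ),
      j ≤ T →
      (∀ v, S'.wiresN x r t j (E (em v)) = S.wiresN Empty.elim (fun i => r (ec (Sum.inl i)))
        (fun i => msgLow e (t i.castSucc)) j v) ∧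
      (∀ i, S'.wiresN x r t j (E (uI i)) = x i) ∧
      (∀ i, S'.wiresN x r t j (E (uC i)) = r (ec (Sum.inr i))) ∧
      (∀ i, S'.wiresN x r t j (E (uO i)) = false) ∧
      (∀ i, S'.wiresN x r t j (E (u₁ i)) = false) ∧
      (∀ i, S'.wiresN x r t j (E (u₂ i)) = false) := by
    intro x r t j
    induction j with
    | zero =>
      intro _
      refine ⟨?_, fun _ => rfl, fun _ => rfl, fun _ => rfl, fun _ => rfl, fun _ => rfl⟩
      rintro ((a | a | a) | a)
      · exact a.elim
      · rfl
      · rfl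
      · rfl
    | succ j ih =>
      intro hj
      obtain ⟨h1, h2, h3, h4, h5, h6⟩ := ih (by lia)
      have hstep : S'.wiresN x r t (j + 1) =
          Sum.elim (bRun ((st ⟨j, hj⟩).map (BGate.map E)) (S'.wiresN x r t j) ∘ Sum.inl)
            (t (Fin.castSucc ⟨j, hj⟩)) := by
        have := S'.wiresN_succ x r t (Fin.castSucc ⟨j, hj⟩)
        simp only [S', Fin.lastCases_castSucc] at this
        exact this
      have hstep0 := S.wiresN_succ Empty.elim (fun i => r (ec (Sum.inl i)))
        (fun i => msgLow e (t i.castSucc)) ⟨j, hj⟩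
      simp only at hstep0
      obtain ⟨k1, k2, k3⟩ := hst ⟨j, hj⟩ (fun v => S'.wiresN x r t j (E v))
      have hcomp : (fun v => S'.wiresN x r t j (E v)) ∘ em = S.wiresN Empty.elim
          (fun i => r (ec (Sum.inl i))) (fun i => msgLow e (t i.castSucc)) j := funext h1
      rw [hcomp] at k1
      have hl : ∀ v, S'.wiresN x r t (j + 1) (E (.inl v)) =
          bRun (st ⟨j, hj⟩) (fun v => S'.wiresN x r t j (E v)) (.inl v) := by
        intro v
        rw [hstep, ← hrunE]
        rfl
      refine ⟨?_, fun i => ?_, fun i => ?_, fun i => ?_, fun i => ?_, fun i => ?_⟩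
      · rintro ((a | a | a) | a)
        · exact a.elim
        · exact (hl _).trans ((k1 (.inl (.inr (.inl a)))).trans (by rw [hstep0]; rfl))
        · exact (hl _).trans ((k1 (.inl (.inr (.inr a)))).trans (by rw [hstep0]; rfl))
        · rw [hstep, hstep0]; rfl
      all_goals
        refine (hl _).trans ((k3 _ ?_ ?_).trans
          (by first | exact h2 i | exact h3 i | exact h4 i | exact h5 i | exact h6 i))
        · intro v h
          obtain ⟨g1, g2, g3, g4, g5, -⟩ := hne v
          first | exact g1 _ h | exact g2 _ h | exact g3 _ h | exact g4 _ h | exact g5 _ h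
        · intro m h; simp [uM] at h
  have hlst : ∀ s : Bits (ExtWires S ι' C M n₁ n₂), (∀ i, s (u₁ i) = false) →
      (∀ m, bRun lst s (uM m) = μ (Sum.elim (s ∘ uI) (Sum.elim (s ∘ uC)
        fun o => bRun S.final (s ∘ em) (S.out o))) m) ∧
      (∀ i, bRun lst s (uL i) = false) ∧
      (∀ i, bRun lst s (uI i) = s (uI i)) ∧ (∀ i, bRun lst s (uC i) = s (uC i)) ∧
      (∀ o, bRun lst s (uO o) = bRun S.final (s ∘ em) (S.out o)) ∧
      ∀ i, bRun lst s (u₂ i) = s (u₂ i) := by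
    intro s h0
    have huM : Function.Injective uM := fun a b h => by simpa [uM] using h
    have huL : Function.Injective uL := fun a b h => by simpa [uL] using h
    have huO : Function.Injective uO := fun a b h => by simpa [uO] using h
    set s₁ := Function.extend em (bRun S.final (s ∘ em)) s with hs₁
    have h₁ : ∀ w, (∀ v, em v ≠ w) → s₁ w = s w := fun w hw =>
      Function.extend_apply' _ _ _ fun ⟨v, hv⟩ => hw v hv
    set s₂ := Function.extend uO (fun o => s₁ (em (S.out o))) s₁ with hs₂
    have h₂ : ∀ w, (∀ v, uO v ≠ w) → s₂ w = s₁ w := fun w hw =>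
      Function.extend_apply' _ _ _ fun ⟨v, hv⟩ => hw v hv
    have h₂O : ∀ o, s₂ (uO o) = bRun S.final (s ∘ em) (S.out o) := fun o => by
      rw [hs₂, huO.extend_apply, hs₁, hem.extend_apply]
    have h₂₁ : ∀ i, s₂ (u₁ i) = false := fun i => by
      rw [h₂ _ fun v => by simp [uO, u₁], h₁ _ fun v => (hne v).2.2.2.1 i, h0]
    have h₂I : ∀ i, s₂ (uI i) = s (uI i) := fun i => by
      rw [h₂ _ fun v => by simp [uO, uI], h₁ _ fun v => (hne v).1 i]
    have h₂C : ∀ i, s₂ (uC i) = s (uC i) := fun i => by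
      rw [h₂ _ fun v => by simp [uO, uC], h₁ _ fun v => (hne v).2.1 i]
    have h₂₂ : ∀ i, s₂ (u₂ i) = s (u₂ i) := fun i => by
      rw [h₂ _ fun v => by simp [uO, u₂], h₁ _ fun v => (hne v).2.2.2.2.1 i]
    obtain ⟨h₃, h₃μ⟩ := rgμ s₂ h₂₁
    have hrd : s₂ ∘ rd = Sum.elim (s ∘ uI) (Sum.elim (s ∘ uC)
        fun o => bRun S.final (s ∘ em) (S.out o)) := by
      ext (a | a | a)
      · exact h₂I a
      · exact h₂C a
      · exact h₂O a
    set s₃ := bRun gμ s₂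
    set s₄ := Function.extend uL (fun _ => false) s₃ with hs₄
    have h₄ : ∀ w, (∀ v, uL v ≠ w) → s₄ w = s₃ w := fun w hw =>
      Function.extend_apply' _ _ _ fun ⟨v, hv⟩ => hw v hv
    have hrun : bRun lst s = Function.extend uM (fun m => s₄ (u₁ (loc₁ m))) s₄ := by
      simp only [lst, bRun_append, bRun_map hem, rcpO, rclrL, rcpM]
      rfl
    have h₅ : ∀ w, (∀ v, uM v ≠ w) → bRun lst s w = s₄ w := fun w hw => by
      rw [hrun]
      exact Function.extend_apply' _ _ _ fun ⟨v, hv⟩ => hw v hv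
    refine ⟨fun m => ?_, fun i => ?_, fun i => ?_, fun i => ?_, fun i => ?_, fun i => ?_⟩
    · rw [hrun, huM.extend_apply, h₄ _ fun v => by simp [uL, u₁], h₃μ, hrd]
    · rw [h₅ _ fun v => by simp [uM, uL], hs₄, huL.extend_apply]
    · rw [h₅ _ fun v => by simp [uM, uI], h₄ _ fun v => by simp [uL, uI],
        h₃ _ fun v => by simp [u₁, uI], h₂I]
    · rw [h₅ _ fun v => by simp [uM, uC], h₄ _ fun v => by simp [uL, uC],
        h₃ _ fun v => by simp [u₁, uC], h₂C]
    · rw [h₅ _ fun v => by simp [uM, uO], h₄ _ fun v => by simp [uL, uO],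
        h₃ _ fun v => by simp [u₁, uO], h₂O]
    · rw [h₅ _ fun v => by simp [uM, u₂], h₄ _ fun v => by simp [uL, u₂],
        h₃ _ fun v => by simp [u₁, u₂], h₂₂]
  have hD : ∀ (x : Bits ι') (r : Bits (Fin S'.coins)) (t : Fin (T + 1) → Bits (Fin q')),
      (Sum.elim ((fun v => S'.wiresN x r t T (E v)) ∘ uI)
        (Sum.elim ((fun v => S'.wiresN x r t T (E v)) ∘ uC)
        fun o => bRun S.final ((fun v => S'.wiresN x r t T (E v)) ∘ em) (S.out o)) :
          Bits (ι' ⊕ C ⊕ ο)) =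
      Sum.elim x (Sum.elim (fun i => r (ec (Sum.inr i)))
        (S.result Empty.elim (fun i => r (ec (Sum.inl i))) fun i => msgLow e (t i.castSucc))) := by
    intro x r t
    obtain ⟨k1, k2, k3, k4, k5, k6⟩ := hinv x r t T le_rfl
    have hcomp : (fun v => S'.wiresN x r t T (E v)) ∘ em = S.wiresN Empty.elim
          (fun i => r (ec (Sum.inl i))) (fun i => msgLow e (t i.castSucc)) T := funext k1
    ext (i | i | o)
    · exact k2 i
    · exact k3 i
    · simp only [Sum.elim_inr, hcomp]
      rfl
  refine ⟨S', ec, ⟨fun x r t i => ?_, fun x r t => ?_, fun x r t => ?_⟩, ?_⟩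
  · have hmsg : ∀ j, S'.msg x r t i.castSucc (e j) =
        bRun (st i) (fun v => S'.wiresN x r t i (E v)) (.inr j) := by
      intro j
      rw [← hrunE]
      simp only [Sender.msg, S', Fin.lastCases_castSucc]
      rfl
    have hcomp : (fun v => S'.wiresN x r t i (E v)) ∘ em = S.wiresN Empty.elim
          (fun i => r (ec (Sum.inl i))) (fun i => msgLow e (t i.castSucc)) i :=
      funext (hinv x r t i i.2.le).1
    obtain ⟨k1, k2, -⟩ := hst i (fun v => S'.wiresN x r t i (E v))
    rw [hcomp] at k1
    ext j
    obtain ⟨j | j, rfl⟩ := e.surjective j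
    · rw [hmsg]
      refine (k1 (.inr j)).trans ?_
      simp [msgJoin, Sender.msg]
    · rw [hmsg]
      refine (k2 j).trans ?_
      simp [msgJoin]
  · have hmsg : ∀ j, S'.msg x r t (Fin.last T) (e j) =
        bRun lst (fun v => S'.wiresN x r t T (E v)) (.inr j) := by
      intro j
      rw [← hrunE]
      simp only [Sender.msg, S', Fin.lastCases_last]
      rfl
    obtain ⟨k1, k2, -⟩ := hlst (fun v => S'.wiresN x r t T (E v)) (hinv x r t T le_rfl).2.2.2.2.1
    ext j
    obtain ⟨j | j, rfl⟩ := e.surjective j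
    · rw [hmsg]
      refine (k2 j).trans ?_
      simp [msgJoin]
    · rw [hmsg]
      refine (k1 j).trans ?_
      rw [hD]
      simp [msgJoin]
  · obtain ⟨-, -, k3, k4, k5, k6⟩ := hlst (fun v => S'.wiresN x r t T (E v)) (hinv x r t T le_rfl).2.2.2.2.1
    have hw : S'.wiresN x r t (T + 1) =
        Sum.elim (bRun (lst.map (BGate.map E)) (S'.wiresN x r t T) ∘ Sum.inl)
          (t (Fin.last T)) := by
      have := S'.wiresN_succ x r t (Fin.last T)
      simp only [S', Fin.lastCases_last] at this
      exact this
    have hl : ∀ v, S'.wiresN x r t (T + 1) (E (.inl v)) =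
        bRun lst (fun v => S'.wiresN x r t T (E v)) (.inl v) := by
      intro v
      rw [hw, ← hrunE]
      rfl
    have h2 : ∀ i, S'.wiresN x r t (T + 1) (E (u₂ i)) = false := fun i =>
      (hl _).trans ((k6 i).trans ((hinv x r t T le_rfl).2.2.2.2.2 i))
    have hres : ∀ o, S'.result x r t o =
        bRun gout (fun v => S'.wiresN x r t (T + 1) (E v)) (u₂ (loc₂ o)) := by
      intro o
      rw [← hrunE]
      rfl
    ext o
    rw [hres, (rgout _ h2).2, ← hD]
    congr 1
    ext ((i | i | i) | i)
    · exact (hl _).trans (k3 i)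
    · exact (hl _).trans (k4 i)
    · exact (hl _).trans (k5 i)
    · simp only [Function.comp_apply, hw]
      rfl
  · have hq' : q' = q + Fintype.card M := by
      have := Fintype.card_congr e
      simpa using this.symm
    have hsteps : ∑ i, (S'.step i).length =
        (∑ i, (S.step i).length + T * Fintype.card M) + (S.final.length + (Fintype.card ο +
          (n₁ + (q + Fintype.card M)))) := by
      rw [Fin.sum_univ_castSucc]
      simp only [S', Fin.lastCases_castSucc, Fin.lastCases_last, st, lst, List.length_map,
        List.length_append, hclrM, hclrL, hcpO, hgμ, hcpM, Finset.sum_add_distrib,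
        Finset.sum_const, Finset.card_univ, Fintype.card_fin, smul_eq_mul]
    have hTm : T * Fintype.card M ≤ S.size * Fintype.card M :=
      Nat.mul_le_mul_right _ (by unfold Sender.size; lia)
    have hco : S'.coins = S.coins + Fintype.card C := by simp [S']
    have han : S'.anc = S.anc + (Fintype.card ο + (n₁ + n₂)) := by simp [S']
    have hfin : S'.final.length = n₂ := by simp [S', hgout]
    have hsz : S'.size = q' + (T + 1) + Fintype.card ι' + Fintype.card ο' + S'.coins + S'.anc +
      ∑ i, (S'.step i).length + S'.final.length := rfl
    have hS : S.size = q + T + 0 + Fintype.card ο + S.coins + S.anc +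
      ∑ i, (S.step i).length + S.final.length := by simp [Sender.size]
    lia

end Extension

/-! ### Receivers for extended protocols -/

section ExtReceivers
variable {q q' T : ℕ} {ι ι' ο ο' κ κ' κ'' C M X Y : Type}

/-- The sequence of messages with parts `lo`, `hi` in the first rounds and `last` in the last. -/
def joinSeq (e : Fin q ⊕ M ≃ Fin q') (lo : Fin T → Bits (Fin q)) (hi : Bits (Fin T × M))
    (last : Bits (Fin q')) : Fin (T + 1) → Bits (Fin q') :=
  Fin.lastCases last fun i => msgJoin e (lo i) fun m => hi (i, m)

@[simp] theorem joinSeq_castSucc (e : Fin q ⊕ M ≃ Fin q') (lo : Fin T → Bits (Fin q))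
    (hi : Bits (Fin T × M)) (last : Bits (Fin q')) (i : Fin T) :
    joinSeq e lo hi last i.castSucc = msgJoin e (lo i) fun m => hi (i, m) := by
  simp [joinSeq]

@[simp] theorem joinSeq_last (e : Fin q ⊕ M ≃ Fin q') (lo : Fin T → Bits (Fin q))
    (hi : Bits (Fin T × M)) (last : Bits (Fin q')) :
    joinSeq e lo hi last (Fin.last T) = last := by
  simp [joinSeq]

/-- Decomposition of the replies in an extended protocol. -/
def joinSeqEquiv (T : ℕ) (e : Fin q ⊕ M ≃ Fin q') :
    (Fin T → Bits (Fin q)) × Bits (Fin T × M) × Bits (Fin q') ≃ (Fin (T + 1) → Bits (Fin q')) where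
  toFun p := joinSeq e p.1 p.2.1 p.2.2
  invFun t := (fun i => msgLow e (t i.castSucc), fun p => msgHigh e (t p.1.castSucc) p.2,
    t (Fin.last T))
  left_inv p := by simp
  right_inv t := by
    ext1 i
    refine Fin.lastCases ?_ (fun i => ?_) i
    · simp
    · simp only [joinSeq_castSucc]
      exact msgJoin_low_high e _

variable [DecidableEq ι] [DecidableEq ι'] [Fintype κ] [DecidableEq κ]
  [Fintype κ'] [DecidableEq κ'] [Fintype κ''] [DecidableEq κ'']
  [Fintype C] [DecidableEq C] [Fintype M] [DecidableEq M]
  [Fintype X] [DecidableEq X] [Fintype Y] [DecidableEq Y]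

theorem sum_joinSeq (e : Fin q ⊕ M ≃ Fin q') (F : (Fin (T + 1) → Bits (Fin q')) → ℝ) :
    ∑ t, F t = ∑ t, ∑ h, ∑ l, F (joinSeq e t h l) := by
  rw [← Equiv.sum_comp (joinSeqEquiv T e), Fintype.sum_prod_type]
  refine Finset.sum_congr rfl fun t _ => ?_
  rw [Fintype.sum_prod_type]
  rfl

/-- The coins of an extended sender. -/
def joinCoins {n n' : ℕ} (ec : Fin n ⊕ C ≃ Fin n') (r : Bits (Fin n)) (c : Bits C) : Bits (Fin n') :=
  fun i => Sum.elim r c (ec.symm i)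

theorem expect_joinCoins {n n' : ℕ} (ec : Fin n ⊕ C ≃ Fin n') (F : Bits (Fin n') → ℝ) :
    𝔼 r, F r = 𝔼 r : Bits (Fin n), 𝔼 c : Bits C, F (joinCoins ec r c) := by
  rw [← Finset.expect_product', Finset.univ_product_univ]
  refine (Fintype.expect_equiv ((Equiv.sumArrowEquivProdArrow _ _ Bool).symm.trans
    (Equiv.arrowCongr ec (Equiv.refl Bool))) _ _ fun p => ?_).symm
  congr 1

namespace Sender.Extends

variable {S' : Sender q' (T + 1) ι' ο'} {S : Sender q T Empty ο}
    {e : Fin q ⊕ M ≃ Fin q'} {ec : Fin S.coins ⊕ C ≃ Fin S'.coins}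
    {μ : Bits (ι' ⊕ C ⊕ ο) → Bits M} {out : Bits ((ι' ⊕ C ⊕ ο) ⊕ M) → Bits ο'}

theorem msg_eq (hS : S'.Extends S e ec μ out) (x : Bits ι') (r : Bits (Fin S.coins)) (c : Bits C)
    (t : Fin T → Bits (Fin q)) (h : Bits (Fin T × M)) (l : Bits (Fin q')) :
    S'.msg x (joinCoins ec r c) (joinSeq e t h l) =
      joinSeq e (S.msg Empty.elim r t) (fun _ => false) (msgJoin e (fun _ => false)
        (μ (Sum.elim x (Sum.elim c (S.result Empty.elim r t))))) := by
  ext1 i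
  refine Fin.lastCases ?_ (fun i => ?_) i
  · rw [hS.msg_last]
    simp [joinCoins]
  · rw [hS.msg_castSucc]
    simp [joinCoins]

theorem result_eq (hS : S'.Extends S e ec μ out) (x : Bits ι') (r : Bits (Fin S.coins))
    (c : Bits C) (t : Fin T → Bits (Fin q)) (h : Bits (Fin T × M)) (l : Bits (Fin q')) :
    S'.result x (joinCoins ec r c) (joinSeq e t h l) =
      out (Sum.elim (Sum.elim x (Sum.elim c (S.result Empty.elim r t))) (msgHigh e l)) := by
  rw [hS.result]
  simp [joinCoins]

end Sender.Extends

theorem gResp_map {M₁ W₁ M₂ W₂ : Type} [DecidableEq M₁] [DecidableEq W₁] [Fintype M₂]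
    [DecidableEq M₂] [Fintype W₂] [DecidableEq W₂]
    (φ : M₁ ⊕ W₁ ↪ M₂ ⊕ W₂) (gs : List (QGate (M₁ ⊕ W₁))) (m r : Bits M₂) (ψ : QVec W₂)
    (z : Bits W₂) : gResp (gs.map (QGate.map φ)) m r ψ z =
      qRun gs (fun a => initMsg m ψ (Function.extend φ a (Sum.elim r z))) (Sum.elim r z ∘ φ) :=
  qRun_map _ _ _ _

theorem extend_inr {A B : Type} [DecidableEq A] [DecidableEq B] (a : Bits B) (r : Bits A)
    (z : Bits B) : Function.extend (Function.Embedding.inr : B ↪ A ⊕ B) a (Sum.elim r z) =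
      Sum.elim r a := by
  ext (i | i)
  · rw [Function.extend_apply' _ _ _ (by simp)]; rfl
  · exact Function.Embedding.inr.injective.extend_apply _ _ _

theorem extend_inl {A B : Type} [DecidableEq A] [DecidableEq B] (a : Bits A) (r : Bits A)
    (z : Bits B) : Function.extend (Function.Embedding.inl : A ↪ A ⊕ B) a (Sum.elim r z) =
      Sum.elim a z := by
  ext (i | i)
  · exact Function.Embedding.inl.injective.extend_apply _ _ _
  · rw [Function.extend_apply' _ _ _ (by simp)]; rfl

/-- Further gates on the receiver's own qubits, to be applied in the last round. -/
def Receiver.post (R : Receiver q T κ) (gs : List (QGate R.Work)) : Receiver q T κ where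
  anc := R.anc
  step i := R.step i ++ if i.1 + 1 = T then gs.map (QGate.map .inr) else []

/-- A receiver applies gates only while responding to a message; hence `0 < T`. -/
theorem Receiver.stateN_post (R : Receiver q T κ) (gs : List (QGate R.Work)) (hT : 0 < T)
    (ms ts : Fin T → Bits (Fin q)) : (R.post gs).stateN ms ts T = qRun gs (R.stateN ms ts T) := by
  have key : ∀ j, j < T → (R.post gs).stateN ms ts j = R.stateN ms ts j := by
    intro j
    induction j with
    | zero => intro _; rfl
    | succ j ih =>
      intro hj
      have h1 := (R.post gs).stateN_succ ms ts ⟨j, by lia⟩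
      have h2 := R.stateN_succ ms ts ⟨j, by lia⟩
      simp only [Receiver.post, if_neg hj.ne, List.append_nil] at h1
      rw [h2]
      refine h1.trans ?_
      congr 1
      exact ih (by lia)
  obtain ⟨T, rfl⟩ : ∃ n, T = n + 1 := ⟨T - 1, by lia⟩
  have h1 := (R.post gs).stateN_succ ms ts (Fin.last T)
  have h2 := R.stateN_succ ms ts (Fin.last T)
  simp only [Fin.val_last] at h1 h2
  rw [h1, h2, key T (by lia)]
  have h3 : (R.post gs).step (Fin.last T) =
      R.step (Fin.last T) ++ gs.map (QGate.map .inr) := by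
    simp [Receiver.post]
  rw [h3]
  refine funext fun (w : Bits R.Work) => ?_
  refine (congrFun (qRun_append _ _ _) _).trans ((qRun_map _ _ _ _).trans ?_)
  change qRun gs _ w = qRun gs _ w
  congr 1
  ext1 a
  exact congrArg _ (extend_inr a _ w)

/-- The qubits of a reduction: a message register, those of a receiver for the extended protocol,
a register for its additional replies, and further qubits. -/
abbrev RedQubits (A : Receiver q' (T + 1) κ') (M X : Type) : Type :=
  ((Fin q' ⊕ A.Work) ⊕ (Fin T × M)) ⊕ X

/-- The state of the receiver `A` before the last round of the extended protocol, its additional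
replies being left in superposition. -/
noncomputable def Receiver.baseState (A : Receiver q' (T + 1) κ') (e : Fin q ⊕ M ≃ Fin q')
    (ms ts : Fin T → Bits (Fin q)) (h : Bits (Fin T × M)) : QVec A.Work :=
  A.stateN (joinSeq e ms (fun _ => false) fun _ => false) (joinSeq e ts h fun _ => false) T

/-- The state `|m⟩ ⊗ A.baseState`. -/
noncomputable def Receiver.baseMsg (A : Receiver q' (T + 1) κ') (e : Fin q ⊕ M ≃ Fin q')
    (ms ts : Fin T → Bits (Fin q)) (m : Bits (Fin q')) : QVec ((Fin q' ⊕ A.Work) ⊕ (Fin T × M)) :=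
  fun z => initMsg m (A.baseState e ms ts (z ∘ Sum.inr)) (z ∘ Sum.inl)

theorem sum_baseMsg (A : Receiver q' (T + 1) κ') (e : Fin q ⊕ M ≃ Fin q')
    (ms ts : Fin T → Bits (Fin q)) (m : Bits (Fin q')) :
    ∑ z, ‖A.baseMsg e ms ts m z‖ ^ 2 = ∑ h, ∑ w, ‖A.baseState e ms ts h w‖ ^ 2 := by
  rw [sum_bits_sum, Finset.sum_comm]
  refine Finset.sum_congr rfl fun h _ => ?_
  rw [← sum_norm_sq_initMsg m (A.baseState e ms ts h)]
  simp [Receiver.baseMsg]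

theorem Receiver.stateN_joinSeq (A : Receiver q' (T + 1) κ') (e : Fin q ⊕ M ≃ Fin q')
    (ms ts : Fin T → Bits (Fin q)) (h : Bits (Fin T × M)) (m l : Bits (Fin q')) :
    A.stateN (joinSeq e ms (fun _ => false) m) (joinSeq e ts h l) T = A.baseState e ms ts h := by
  refine A.stateN_congr (fun i hi => ?_) fun i hi => ?_
  all_goals
    obtain ⟨i, rfl⟩ : ∃ k : Fin T, i = k.castSucc := ⟨⟨i, hi⟩, rfl⟩
    simp

open Classical in
-- The sender of the extension ignores the additional replies of the first rounds and the low bits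
-- of the last one. Their measurement can therefore be deferred: summing over these outcomes and the
-- receiver's qubits is the same as summing over all basis states `z` of one coherent run.
theorem Sender.Extends.eventProb_eq {S' : Sender q' (T + 1) ι' ο'} {S : Sender q T Empty ο}
    {e : Fin q ⊕ M ≃ Fin q'} {ec : Fin S.coins ⊕ C ≃ Fin S'.coins}
    {μ : Bits (ι' ⊕ C ⊕ ο) → Bits M} {out : Bits ((ι' ⊕ C ⊕ ο) ⊕ M) → Bits ο'}
    (hS : S'.Extends S e ec μ out) (A : Receiver q' (T + 1) κ') (x : Bits ι')
    (E : Bits ο' → Bits κ' → Prop) (E' : Bits C → Bits ο → Bits κ' → Prop)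
    (hE : ∀ c a d o, E (out (Sum.elim (Sum.elim x (Sum.elim c a)) d)) o ↔ E' c a o) :
    eventProb S' A x E = 𝔼 r : Bits (Fin S.coins), 𝔼 c : Bits C, ∑ t, ∑ z,
      if E' c (S.result Empty.elim r t) (fun k => z (Sum.inl (Sum.inr (Sum.inl k)))) then
        ‖qRun ((A.step (Fin.last T)).map (QGate.map .inl)) (A.baseMsg e (S.msg Empty.elim r t) t
          (msgJoin e (fun _ => false) (μ (Sum.elim x (Sum.elim c (S.result Empty.elim r t)))))) z‖ ^ 2
      else 0 := by
  rw [_root_.eventProb_eq, expect_joinCoins ec]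
  refine Finset.expect_congr rfl fun r _ => Finset.expect_congr rfl fun c _ => ?_
  rw [sum_joinSeq e]
  refine Finset.sum_congr rfl fun t _ => ?_
  refine Eq.trans ?_ (((sum_bits_sum _).trans Finset.sum_comm).symm)
  refine Finset.sum_congr rfl fun h _ => ?_
  refine Eq.trans ?_ (sum_bits_sum _).symm
  refine Finset.sum_congr rfl fun l _ => Finset.sum_congr rfl fun w _ => ?_
  rw [hS.result_eq, hS.msg_eq]
  have h2 := A.stateN_succ (joinSeq e (S.msg Empty.elim r t) (fun _ => false)
    (msgJoin e (fun _ => false) (μ (Sum.elim x (Sum.elim c (S.result Empty.elim r t))))))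
    (joinSeq e t h l) (Fin.last T)
  simp only [Fin.val_last] at h2
  rw [h2, qRun_map]
  simp only [hE, extend_inl, A.stateN_joinSeq, joinSeq_last]
  rfl

/-- `B` plays the shorter protocol by running `A` with its additional replies stored in a register
instead of being measured. In its last round it also applies an arbitrary circuit `gs` to everything
it holds, typically the last response of `A` to a message made up by `B`. The equivalence `f` says
which qubits count as output. -/
theorem Receiver.exists_reduction (A : Receiver q' (T + 1) κ') (e : Fin q ⊕ M ≃ Fin q')
    (f : RedQubits A M X ≃ κ'' ⊕ Y) (gs : List (QGate (RedQubits A M X))) :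
    ∃ B : Receiver q T κ'', B.size ≤ q + T + Fintype.card κ'' + Fintype.card Y + A.size +
        T * gs.length ∧
      (0 < T → ∀ (ms ts : Fin T → Bits (Fin q)), ∃ w : Bits (RedQubits A M X) ≃ Bits B.Work,
        (∀ z k, w z (Sum.inl k) = z (f.symm (Sum.inl k))) ∧ ∀ z, B.stateN ms ts T (w z) =
          qRun gs (fun z => if ∀ i, z (Sum.inr i) = false then
            A.baseMsg e ms ts (fun _ => false) (z ∘ Sum.inl) else 0) z) := by
  let fB : RedQubits A M X ≃ κ'' ⊕ Fin (Fintype.card Y) :=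
    f.trans (Equiv.sumCongr (Equiv.refl _) (Fintype.equivFin Y))
  -- In round `i` the high half of the message register of `A` is the block `(i, ·)`. It is still
  -- zero then, just like the high message bits sent by the extended sender.
  obtain ⟨φ, hφl, hφm, hφw⟩ : ∃ φ : Fin T → (Fin q' ⊕ A.Work ↪ Fin q ⊕ (κ'' ⊕ Fin (Fintype.card Y))),
      (∀ i l, φ i (.inl (e (.inl l))) = .inl l) ∧
      (∀ i m, φ i (.inl (e (.inr m))) = .inr (fB (.inl (.inr (i, m))))) ∧
      ∀ i w, φ i (.inr w) = .inr (fB (.inl (.inl (.inr w)))) := by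
    refine ⟨fun i => ⟨Sum.elim (fun k => Sum.elim (fun l => Sum.inl l)
      (fun m => Sum.inr (fB (.inl (.inr (i, m))))) (e.symm k))
      (fun w => Sum.inr (fB (.inl (.inl (.inr w))))), ?_⟩, ?_, ?_, ?_⟩
    · rintro (a | a) (b | b) h
      · obtain ⟨a, rfl⟩ := e.surjective a
        obtain ⟨b, rfl⟩ := e.surjective b
        rcases a with a | a <;> rcases b with b | b <;> simp at h <;> rw [h]
      · obtain ⟨a, rfl⟩ := e.surjective a
        rcases a with a | a <;> simp at h
      · obtain ⟨b, rfl⟩ := e.surjective b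
        rcases b with b | b <;> simp at h
      · simp at h; rw [h]
    · intro i l
      refine (congrArg (Sum.elim _ _) (e.symm_apply_apply _)).trans ?_
      rfl
    · intro i l
      refine (congrArg (Sum.elim _ _) (e.symm_apply_apply _)).trans ?_
      rfl
    · intro i l
      rfl
  let B₀ : Receiver q T κ'' :=
    { anc := Fintype.card Y
      step := fun i => (A.step i.castSucc).map (QGate.map (φ i)) }
  -- After `j` rounds, the blocks of the first `j` rounds contain the additional replies in
  -- superposition, while later blocks, the spare message register and the further qubits are zero.
  have key : ∀ (ms ts : Fin T → Bits (Fin q)) (j : ℕ), j ≤ T → ∀ z : Bits B₀.Work,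
      B₀.stateN ms ts j z = if (∀ i, z (fB (.inr i)) = false) ∧
          (∀ i, z (fB (.inl (.inl (.inl i)))) = false) ∧
          (∀ i : Fin T, j ≤ i.1 → ∀ m, z (fB (.inl (.inr (i, m)))) = false) then
        A.stateN (joinSeq e ms (fun _ => false) fun _ => false)
          (joinSeq e ts (fun p => z (fB (.inl (.inr p)))) fun _ => false) j
          (fun w => z (fB (.inl (.inl (.inr w))))) else 0 := by
    intro ms ts j
    induction j with
    | zero =>
      intro _ z
      simp only [Receiver.stateN, ket]
      rw [← ite_and]
      refine if_congr ⟨?_, ?_⟩ rfl rfl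
      · rintro rfl; simp
      · rintro ⟨⟨h1, h2, h3⟩, h4⟩
        ext i
        obtain ⟨((i | i) | ⟨i, m⟩) | i, rfl⟩ := fB.surjective i
        · exact h2 i
        · exact congrFun h4 i
        · exact h3 i (Nat.zero_le _) m
        · exact h1 i
    | succ j ih =>
      intro hj z
      have h1 := B₀.stateN_succ ms ts ⟨j, hj⟩
      have h2 := A.stateN_succ (joinSeq e ms (fun _ => false) fun _ => false)
          (joinSeq e ts (fun p => z (fB (.inl (.inr p)))) fun _ => false) (Fin.castSucc ⟨j, hj⟩)
      simp only [Fin.val_castSucc] at h1 h2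
      rw [h1, h2, gResp_map]
      have hφ1 : ∀ (a : Bits (Fin q' ⊕ A.Work)) s l,
          Function.extend (φ ⟨j, hj⟩) a s (Sum.inl l) = a (.inl (e (.inl l))) := by
        intro a s l
        rw [← hφl ⟨j, hj⟩, (φ ⟨j, hj⟩).injective.extend_apply]
      have hφ2 : ∀ (a : Bits (Fin q' ⊕ A.Work)) s m,
          Function.extend (φ ⟨j, hj⟩) a s (Sum.inr (fB (.inl (.inr (⟨j, hj⟩, m))))) =
            a (.inl (e (.inr m))) := by
        intro a s m
        rw [← hφm, (φ ⟨j, hj⟩).injective.extend_apply]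
      have hφ3 : ∀ (a : Bits (Fin q' ⊕ A.Work)) s w,
          Function.extend (φ ⟨j, hj⟩) a s (Sum.inr (fB (.inl (.inl (.inr w))))) = a (.inr w) :=
        fun a s w => by rw [← hφw ⟨j, hj⟩, (φ ⟨j, hj⟩).injective.extend_apply]
      have hφ4 : ∀ (a : Bits (Fin q' ⊕ A.Work)) s y,
          ((∃ i, y = .inr i) ∨ (∃ i, y = .inl (.inl (.inl i))) ∨
            ∃ i m, i ≠ ⟨j, hj⟩ ∧ y = .inl (.inr (i, m))) →
          Function.extend (φ ⟨j, hj⟩) a s (Sum.inr (fB y)) = s (Sum.inr (fB y)) := by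
        intro a s y hy
        rw [Function.extend_apply']
        rintro ⟨b | b, hb⟩
        · obtain ⟨b, rfl⟩ := e.surjective b
          rcases b with b | b
          · simp [hφl] at hb
          · rw [hφm, Sum.inr.injEq, fB.injective.eq_iff] at hb
            subst hb
            rcases hy with ⟨i, h⟩ | ⟨i, h⟩ | ⟨i, m, him, h⟩ <;> cases h
            exact him rfl
        · rw [hφw, Sum.inr.injEq, fB.injective.eq_iff] at hb
          subst hb
          rcases hy with ⟨i, h⟩ | ⟨i, h⟩ | ⟨i, m, him, h⟩ <;> cases h
      have hφ5 : ∀ a s i, Function.extend (φ ⟨j, hj⟩) a s (Sum.inr (fB (.inr i))) =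
          s (Sum.inr (fB (.inr i))) := fun a s i => hφ4 a s _ (Or.inl ⟨i, rfl⟩)
      have hφ6 : ∀ a s i, Function.extend (φ ⟨j, hj⟩) a s (Sum.inr (fB (.inl (.inl (.inl i))))) =
          s (Sum.inr (fB (.inl (.inl (.inl i))))) := fun a s i => hφ4 a s _ (Or.inr (Or.inl ⟨i, rfl⟩))
      have hφ7 : ∀ a s i m, i ≠ ⟨j, hj⟩ →
          Function.extend (φ ⟨j, hj⟩) a s (Sum.inr (fB (.inl (.inr (i, m))))) =
          s (Sum.inr (fB (.inl (.inr (i, m))))) := fun a s i m hi =>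
        hφ4 a s _ (Or.inr (Or.inr ⟨i, m, hi, rfl⟩))
      have harg : (Sum.elim (ts ⟨j, hj⟩) z ∘ φ ⟨j, hj⟩ : Bits (Fin q' ⊕ A.Work)) =
          Sum.elim (msgJoin e (ts ⟨j, hj⟩) fun m => z (fB (.inl (.inr (⟨j, hj⟩, m)))))
            (fun w => z (fB (.inl (.inl (.inr w))))) := by
        ext (i | w)
        · obtain ⟨i | i, rfl⟩ := e.surjective i <;> simp [hφl, hφm, msgJoin]
        · simp [hφw]
      rw [harg]
      simp only [joinSeq_castSucc, gResp]
      have hst : ∀ a : Bits (Fin q' ⊕ A.Work), initMsg (ms ⟨j, hj⟩) (B₀.stateN ms ts j)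
          (Function.extend (φ ⟨j, hj⟩) a (Sum.elim (ts ⟨j, hj⟩) z)) =
          if (∀ i, z (fB (.inr i)) = false) ∧
            (∀ i, z (fB (.inl (.inl (.inl i)))) = false) ∧
            (∀ i : Fin T, j + 1 ≤ i.1 → ∀ m, z (fB (.inl (.inr (i, m)))) = false) then
          initMsg (msgJoin e (ms ⟨j, hj⟩) fun _ => false) (A.stateN
            (joinSeq e ms (fun _ => false) fun _ => false)
            (joinSeq e ts (fun p => z (fB (.inl (.inr p)))) fun _ => false) j) a else 0 := by
        intro a
        simp only [initMsg]
        rw [ih (by lia), ← ite_and, ← ite_and]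
        simp only [Function.comp_def, hφ3, hφ5, hφ6, Sum.elim_inr]
        have hA : A.stateN (joinSeq e ms (fun _ => false) fun _ => false)
            (joinSeq e ts (fun p => Function.extend (φ ⟨j, hj⟩) a (Sum.elim (ts ⟨j, hj⟩) z)
              (.inr (fB (.inl (.inr p))))) fun _ => false) j =
            A.stateN (joinSeq e ms (fun _ => false) fun _ => false)
            (joinSeq e ts (fun p => z (fB (.inl (.inr p)))) fun _ => false) j := by
          refine A.stateN_congr (fun _ _ => rfl) fun i hi => ?_
          obtain ⟨i, rfl⟩ : ∃ k : Fin T, i = k.castSucc := ⟨⟨i, by lia⟩, rfl⟩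
          simp only [joinSeq_castSucc]
          congr 1
          ext m
          rw [hφ7]
          · rfl
          · rintro rfl
            exact lt_irrefl _ hi
        rw [hA]
        refine if_congr ⟨?_, ?_⟩ rfl rfl
        · rintro ⟨g0, g1, g2, g3⟩
          refine ⟨⟨g1, g2, fun i hi m => ?_⟩, ?_⟩
          · have := g3 i (by lia) m
            rwa [hφ7 _ _ _ _ (by rintro rfl; simp at hi)] at this
          · ext i
            obtain ⟨i | i, rfl⟩ := e.surjective i
            · have := congrFun g0 i
              simp only [hφ1] at this
              simpa [msgJoin] using this
            · have := g3 ⟨j, hj⟩ le_rfl i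
              rw [hφ2] at this
              simpa [msgJoin] using this
        · rintro ⟨⟨g1, g2, g3⟩, g0⟩
          refine ⟨?_, g1, g2, fun i hi m => ?_⟩
          · ext i
            simp only [hφ1]
            simpa [msgJoin] using congrFun g0 (e (.inl i))
          · by_cases hij : i = ⟨j, hj⟩
            · subst hij
              rw [hφ2]
              simpa [msgJoin] using congrFun g0 (e (.inr m))
            · rw [hφ7 _ _ _ _ hij]
              exact g3 i (by
                have : i.1 ≠ j := fun h => hij (Fin.ext h)
                lia) m
      simp only [hst]
      split_ifs with hc
      · rfl
      · exact congrFun (qRun_zero _) _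
  refine ⟨B₀.post (gs.map (QGate.map fB.toEmbedding)), ?_, fun hT ms ts => ?_⟩
  · have h1 : ∀ i, ((B₀.post (gs.map (QGate.map fB.toEmbedding))).step i).length ≤
        (A.step i.castSucc).length + gs.length := by
      intro i
      simp only [Receiver.post, List.length_append, B₀, List.length_map]
      split_ifs <;> simp
    have h2 : ∑ i, ((B₀.post (gs.map (QGate.map fB.toEmbedding))).step i).length ≤
        ∑ i : Fin T, (A.step i.castSucc).length + T * gs.length := by
      refine (Finset.sum_le_sum fun i _ => h1 i).trans ?_
      rw [Finset.sum_add_distrib]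
      simp
    have h3 : ∑ i : Fin T, (A.step i.castSucc).length ≤ A.size := by
      rw [Receiver.size, Fin.sum_univ_castSucc]
      lia
    have h4 : (B₀.post (gs.map (QGate.map fB.toEmbedding))).size = q + T + Fintype.card κ'' +
      Fintype.card Y + ∑ i, ((B₀.post (gs.map (QGate.map fB.toEmbedding))).step i).length := rfl
    lia
  · refine ⟨Equiv.arrowCongr fB (Equiv.refl Bool), fun z k => ?_, fun z => ?_⟩
    · change z (fB.symm (Sum.inl k)) = _
      simp [fB]
    · have hst := B₀.stateN_post (gs.map (QGate.map fB.toEmbedding)) hT ms ts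
      refine (congrFun hst _).trans ((qRun_map_equiv fB gs _ _).trans ?_)
      have harg : (Equiv.arrowCongr fB (Equiv.refl Bool)) z ∘ fB = z := by
        ext i; simp
      refine (congrArg _ harg).trans ?_
      congr 1
      ext a
      rw [key ms ts T le_rfl]
      simp only [Function.comp_apply, Equiv.symm_apply_apply]
      rw [ite_and]
      refine if_congr Iff.rfl ?_ rfl
      simp only [Receiver.baseMsg, initMsg, Receiver.baseState]
      refine if_congr ⟨fun h => ?_, fun h => ⟨fun i => congrFun h i, fun i hi => ?_⟩⟩ rfl rfl
      · ext i; exact h.1 i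
      · exact absurd i.2 (by lia)

end ExtReceivers

/-! ### Honest receivers for extended protocols -/

section ExtHonest
variable {q q' T : ℕ} {ι' ο ο' κ κ' C M Y : Type}
variable [DecidableEq ι'] [Fintype κ] [DecidableEq κ] [Fintype κ'] [DecidableEq κ']
  [Fintype C] [DecidableEq C] [Fintype M] [DecidableEq M] [Fintype Y] [DecidableEq Y]

/-- The final state of `R`, together with further qubits `κ'` and `Y` in the state `|0⟩`. -/
noncomputable def Receiver.padState (R : Receiver q T κ) (κ' Y : Type) (ms ts : Fin T → Bits (Fin q)) :
    QVec (κ' ⊕ (R.Work ⊕ Y)) :=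
  open Classical in
  fun s => if (∀ k, s (Sum.inl k) = false) ∧ ∀ y, s (Sum.inr (Sum.inr y)) = false then
    R.stateN ms ts T (fun w => s (Sum.inr (Sum.inl w))) else 0

/-- In the first rounds the old receiver acts on its embedded qubits and returns the additional
message bits unchanged; `last` is then applied to the additional message and all own qubits. Only
the branch with zero spare replies needs to be described. -/
theorem Receiver.exists_extends (R : Receiver q T κ) (e : Fin q ⊕ M ≃ Fin q')
    (last : List (QGate (M ⊕ κ' ⊕ (R.Work ⊕ Y)))) :
    ∃ (R' : Receiver q' (T + 1) κ') (eA : R.Work ⊕ Y ≃ Fin R'.anc),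
      R'.size ≤ q' + 1 + Fintype.card κ' + Fintype.card Y + R.size + last.length ∧
      ∀ ms ts μ d z, R'.stateN (joinSeq e ms (fun _ => false) (msgJoin e (fun _ => false) μ))
          (joinSeq e ts (fun _ => false) (msgJoin e (fun _ => false) d)) (T + 1) z =
        qRun last (initMsg μ (R.padState κ' Y ms ts))
          (Sum.elim d (Sum.elim (fun k => z (Sum.inl k)) fun w => z (Sum.inr (eA w)))) := by
  classical
  obtain ⟨N, hN⟩ : ∃ N, N = Fintype.card (R.Work ⊕ Y) := ⟨_, rfl⟩
  let eA : R.Work ⊕ Y ≃ Fin N := (Fintype.equivFin _).trans (finCongr hN.symm)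
  obtain ⟨φ, φl, φw⟩ : ∃ φ : Fin q ⊕ R.Work ↪ Fin q' ⊕ (κ' ⊕ Fin N),
      (∀ l, φ (.inl l) = .inl (e (.inl l))) ∧ ∀ w, φ (.inr w) = .inr (.inr (eA (.inl w))) :=
    ⟨⟨Sum.elim (fun l => .inl (e (.inl l))) fun w => .inr (.inr (eA (.inl w))), by
      rintro (a | a) (b | b) h <;> simp at h <;> rw [h]⟩, fun _ => rfl, fun _ => rfl⟩
  obtain ⟨φL, φLm, φLk, φLw⟩ : ∃ φ : M ⊕ κ' ⊕ (R.Work ⊕ Y) ↪ Fin q' ⊕ (κ' ⊕ Fin N),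
      (∀ m, φ (.inl m) = .inl (e (.inr m))) ∧ (∀ k, φ (.inr (.inl k)) = .inr (.inl k)) ∧
      ∀ w, φ (.inr (.inr w)) = .inr (.inr (eA w)) :=
    ⟨⟨Sum.elim (fun m => .inl (e (.inr m))) (Sum.elim (fun k => .inr (.inl k))
      fun w => .inr (.inr (eA w))), by
      rintro (a | a | a) (b | b | b) h <;> simp at h <;> rw [h]⟩, fun _ => rfl, fun _ => rfl,
      fun _ => rfl⟩
  let R' : Receiver q' (T + 1) κ' :=
    { anc := N
      step := Fin.lastCases (last.map (QGate.map φL)) fun i => (R.step i).map (QGate.map φ) }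
  have hstep : ∀ i : Fin T, R'.step i.castSucc = (R.step i).map (QGate.map φ) := fun i => by
    simp only [R', Fin.lastCases_castSucc]
  have hlast : R'.step (Fin.last T) = last.map (QGate.map φL) := by
    simp only [R', Fin.lastCases_last]
  refine ⟨R', eA, ?_, fun ms ts μ d z => ?_⟩
  · have h1 : R'.size = q' + (T + 1) + Fintype.card κ' + N + ∑ i, (R'.step i).length := rfl
    have h2 : R.size = q + T + Fintype.card κ + R.anc + ∑ i, (R.step i).length := rfl
    rw [Fin.sum_univ_castSucc, hlast] at h1
    simp only [hstep, List.length_map] at h1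
    simp only [Fintype.card_sum, Fintype.card_fin] at hN
    lia
  have key : ∀ j, j ≤ T → ∀ z : Bits R'.Work,
      R'.stateN (joinSeq e ms (fun _ => false) (msgJoin e (fun _ => false) μ))
        (joinSeq e ts (fun _ => false) (msgJoin e (fun _ => false) d)) j z =
      if (∀ k, z (Sum.inl k) = false) ∧ ∀ y, z (Sum.inr (eA (Sum.inr y))) = false then
        R.stateN ms ts j (fun w => z (Sum.inr (eA (Sum.inl w)))) else 0 := by
    intro j
    induction j with
    | zero =>
      intro _ z
      simp only [Receiver.stateN, ket]
      rw [← ite_and]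
      refine if_congr ⟨?_, ?_⟩ rfl rfl
      · rintro rfl; simp
      · rintro ⟨⟨h1, h2⟩, h3⟩
        ext (i | i)
        · exact h1 i
        · obtain ⟨i | i, rfl⟩ := eA.surjective i
          · exact congrFun h3 i
          · exact h2 i
    | succ j ih =>
      intro hj z
      have h1 := R'.stateN_succ (joinSeq e ms (fun _ => false) (msgJoin e (fun _ => false) μ))
        (joinSeq e ts (fun _ => false) (msgJoin e (fun _ => false) d)) (Fin.castSucc ⟨j, hj⟩)
      have h2 := R.stateN_succ ms ts ⟨j, hj⟩
      simp only [Fin.val_castSucc, hstep, joinSeq_castSucc] at h1 h2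
      rw [h1, h2]
      refine (gResp_map φ _ _ _ _ z).trans ?_
      have hφl : ∀ (a : Bits (Fin q ⊕ R.Work)) s l,
          Function.extend φ a s (.inl (e (.inl l))) = a (.inl l) := fun a s l => by
        rw [← φl, φ.injective.extend_apply]
      have hφw : ∀ (a : Bits (Fin q ⊕ R.Work)) s w,
          Function.extend φ a s (.inr (.inr (eA (.inl w)))) = a (.inr w) := fun a s w => by
        rw [← φw, φ.injective.extend_apply]
      have hφm : ∀ (a : Bits (Fin q ⊕ R.Work)) s m,
          Function.extend φ a s (.inl (e (.inr m))) = s (.inl (e (.inr m))) := by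
        intro a s m
        rw [Function.extend_apply']
        rintro ⟨b | b, hb⟩ <;> simp [φl, φw] at hb
      have hφk : ∀ (a : Bits (Fin q ⊕ R.Work)) s k,
          Function.extend φ a s (.inr (.inl k)) = s (.inr (.inl k)) := by
        intro a s m
        rw [Function.extend_apply']
        rintro ⟨b | b, hb⟩ <;> simp [φl, φw] at hb
      have hφy : ∀ (a : Bits (Fin q ⊕ R.Work)) s y,
          Function.extend φ a s (.inr (.inr (eA (.inr y)))) = s (.inr (.inr (eA (.inr y)))) := by
        intro a s m
        rw [Function.extend_apply']
        rintro ⟨b | b, hb⟩ <;> simp [φl, φw] at hb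
      have harg : (Sum.elim (msgJoin e (ts ⟨j, hj⟩) fun _ => false) z ∘ φ : Bits (Fin q ⊕ R.Work)) =
          Sum.elim (ts ⟨j, hj⟩) fun w => z (.inr (eA (.inl w))) := by
        ext (i | w)
        · simp [φl, msgJoin]
        · simp [φw]
      rw [harg]
      have hst : ∀ a : Bits (Fin q ⊕ R.Work),
          initMsg (msgJoin e (ms ⟨j, hj⟩) fun _ => false)
            (R'.stateN (joinSeq e ms (fun _ => false) (msgJoin e (fun _ => false) μ))
              (joinSeq e ts (fun _ => false) (msgJoin e (fun _ => false) d)) j)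
            (Function.extend φ a (Sum.elim (msgJoin e (ts ⟨j, hj⟩) fun _ => false) z)) =
          if (∀ k, z (Sum.inl k) = false) ∧ ∀ y, z (Sum.inr (eA (Sum.inr y))) = false then
            initMsg (ms ⟨j, hj⟩) (R.stateN ms ts j) a else 0 := by
        intro a
        simp only [initMsg]
        rw [ih (by lia), ← ite_and, ← ite_and]
        simp only [Function.comp_def, hφk, hφy, hφw, Sum.elim_inr]
        refine if_congr ⟨fun ⟨g0, g1, g2⟩ => ⟨⟨g1, g2⟩, ?_⟩, fun ⟨⟨g1, g2⟩, g0⟩ => ⟨?_, g1, g2⟩⟩ rfl rfl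
        · ext i
          have := congrFun g0 (e (.inl i))
          simpa only [hφl, msgJoin, Equiv.symm_apply_apply, Sum.elim_inl] using this
        · ext i
          obtain ⟨i | i, rfl⟩ := e.surjective i
          · simpa only [hφl, msgJoin, Equiv.symm_apply_apply, Sum.elim_inl] using congrFun g0 i
          · simp only [hφm, msgJoin, Equiv.symm_apply_apply, Sum.elim_inl, Sum.elim_inr]
      refine (congrArg (fun f => qRun (R.step ⟨j, hj⟩) f _) (funext hst)).trans ?_
      split_ifs with hc
      · rfl
      · exact congrFun (qRun_zero _) _
  have h1 := R'.stateN_succ (joinSeq e ms (fun _ => false) (msgJoin e (fun _ => false) μ))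
    (joinSeq e ts (fun _ => false) (msgJoin e (fun _ => false) d)) (Fin.last T)
  simp only [Fin.val_last, hlast, joinSeq_last] at h1
  rw [h1]
  refine (gResp_map φL _ _ _ _ z).trans ?_
  have harg : (Sum.elim (msgJoin e (fun _ => false) d) z ∘ φL : Bits (M ⊕ κ' ⊕ (R.Work ⊕ Y))) =
      Sum.elim d (Sum.elim (fun k => z (Sum.inl k)) fun w => z (Sum.inr (eA w))) := by
    ext (i | i | i) <;> simp [φLm, φLk, φLw, msgJoin]
  rw [harg]
  refine congrArg (fun f => qRun last f _) (funext fun a => ?_)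
  have hφ : ∀ s i, Function.extend φL a s (φL i) = a i := fun s i =>
    φL.injective.extend_apply _ _ _
  have hφl : ∀ s l, Function.extend φL a s (.inl (e (.inl l))) = s (.inl (e (.inl l))) := by
    intro s m
    rw [Function.extend_apply']
    rintro ⟨b | b | b, hb⟩ <;> simp [φLm, φLk, φLw] at hb
  simp only [initMsg]
  rw [key T le_rfl]
  have e1 : ∀ s m, Function.extend φL a s (.inl (e (.inr m))) = a (.inl m) := fun s m => by
    rw [← φLm, hφ]
  have e2 : ∀ s m, Function.extend φL a s (.inr (.inl m)) = a (.inr (.inl m)) := fun s m => by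
    rw [← φLk, hφ]
  have e3 : ∀ s m, Function.extend φL a s (.inr (.inr (eA m))) = a (.inr (.inr m)) := fun s m => by
    rw [← φLw, hφ]
  simp only [Function.comp_def, e2, e3, Receiver.padState]
  refine if_congr ⟨fun h => ?_, fun h => ?_⟩ rfl rfl
  · ext i
    have := congrFun h (e (.inr i))
    simpa only [e1, msgJoin, Equiv.symm_apply_apply, Sum.elim_inr] using this
  · ext i
    obtain ⟨i | i, rfl⟩ := e.surjective i
    · simp only [hφl, msgJoin, Equiv.symm_apply_apply, Sum.elim_inl]
    · simpa only [e1, msgJoin, Equiv.symm_apply_apply, Sum.elim_inr] using congrFun h i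

/-- A bound from below suffices for correctness, so the sum over replies is restricted to those
whose spare bits are zero. -/
theorem Sender.Extends.exists_receiver {S' : Sender q' (T + 1) ι' ο'} {S : Sender q T Empty ο}
    {e : Fin q ⊕ M ≃ Fin q'} {ec : Fin S.coins ⊕ C ≃ Fin S'.coins}
    {μ : Bits (ι' ⊕ C ⊕ ο) → Bits M} {out : Bits ((ι' ⊕ C ⊕ ο) ⊕ M) → Bits ο'}
    (hS : S'.Extends S e ec μ out) (R : Receiver q T κ)
    (last : List (QGate (M ⊕ κ' ⊕ (R.Work ⊕ Y)))) :
    ∃ R' : Receiver q' (T + 1) κ',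
      R'.size ≤ q' + 1 + Fintype.card κ' + Fintype.card Y + R.size + last.length ∧
      ∀ (x : Bits ι') (v : Bits ο' → QVec κ'), 𝔼 r, 𝔼 c, ∑ t, ∑ d : Bits M,
        ov (v (out (Sum.elim (Sum.elim x (Sum.elim c (S.result Empty.elim r t))) d)))
          (fun s => qRun last (initMsg (μ (Sum.elim x (Sum.elim c (S.result Empty.elim r t))))
            (R.padState κ' Y (S.msg Empty.elim r t) t)) (Sum.elim d s)) ≤ sqOverlap S' R' x v := by
  obtain ⟨R', eA, hsize, hst⟩ := R.exists_extends e last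
  refine ⟨R', hsize, fun x v => ?_⟩
  rw [sqOverlap, expect_joinCoins ec]
  refine Finset.expect_le_expect fun r _ => Finset.expect_le_expect fun c _ => ?_
  rw [sum_joinSeq e]
  refine Finset.sum_le_sum fun t _ => ?_
  refine le_trans ?_ (Finset.single_le_sum (fun h _ => Finset.sum_nonneg fun l _ => ov_nonneg _ _)
    (Finset.mem_univ (fun _ => false)))
  rw [← Equiv.sum_comp (msgEquiv e), Fintype.sum_prod_type]
  refine le_trans ?_ (Finset.single_le_sum (fun h _ => Finset.sum_nonneg fun l _ => ov_nonneg _ _)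
    (Finset.mem_univ (fun _ => false)))
  refine Finset.sum_le_sum fun d _ => le_of_eq ?_
  rw [hS.result_eq, hS.msg_eq]
  simp only [msgEquiv, Equiv.coe_fn_mk, msgHigh_msgJoin, ov, hst]
  refine (Fintype.sum_equiv (Equiv.arrowCongr eA (Equiv.refl Bool)) _ _ fun b => ?_)
  refine congrArg (fun y => ‖y‖ ^ 2) (Finset.sum_congr rfl fun o _ => ?_)
  congr 4
  · ext w
    simp

end ExtHonest

/-! ### From random-input to chosen-input oblivious state preparation -/

section ControlledHadamard
variable {A Y : Type} [DecidableEq A] [DecidableEq Y]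

/-- The circuit that moves a qubit to the output register, after applying a Hadamard gate to it if
the message bit is `1`. -/
def controlledHadamard (A : Type) : List (QGate (Unit ⊕ Unit ⊕ ((Unit ⊕ A) ⊕ Empty))) :=
  [.pauliX (.inl ()),
    .toffoli (.inl ()) (.inr (.inr (.inl (.inl ())))) (.inr (.inl ())) (by simp) (by simp) (by simp),
    .toffoli (.inl ()) (.inr (.inl ())) (.inr (.inr (.inl (.inl ())))) (by simp) (by simp) (by simp),
    .pauliX (.inl ()),
    .hadamard (.inr (.inr (.inl (.inl ())))),
    .toffoli (.inl ()) (.inr (.inr (.inl (.inl ())))) (.inr (.inl ())) (by simp) (by simp) (by simp),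
    .toffoli (.inl ()) (.inr (.inl ())) (.inr (.inr (.inl (.inl ())))) (by simp) (by simp) (by simp)]

/-- There is no controlled Hadamard gate among the allowed ones. The Hadamard is applied
unconditionally to the work qubit, and the message bit decides whether the content is moved out
before or after. For `d = 0` it hits an emptied qubit and leaves `|+⟩` behind, whence the factor
`1/√2` for both values of `u`. -/
theorem qRun_controlledHadamard (d : Bool) (Φ : QVec (Unit ⊕ ((Unit ⊕ A) ⊕ Empty)))
    (hΦ : ∀ u w y, Φ (Sum.elim (fun _ => true) (Sum.elim (Sum.elim u w) y)) = 0)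
    (o u : Bool) (w : Bits A) (y : Bits Empty) :
    qRun (controlledHadamard A) (initMsg (fun _ => d) Φ)
      (Sum.elim (fun _ => d) (Sum.elim (fun _ => o) (Sum.elim (Sum.elim (fun _ => u) w) y))) =
    if d then if u then 0 else ((√2 : ℝ) : ℂ)⁻¹ *
      (Φ (Sum.elim (fun _ => false) (Sum.elim (Sum.elim (fun _ => false) w) y)) +
        (if o then -1 else 1) *
          Φ (Sum.elim (fun _ => false) (Sum.elim (Sum.elim (fun _ => true) w) y)))
    else ((√2 : ℝ) : ℂ)⁻¹ *
      Φ (Sum.elim (fun _ => false) (Sum.elim (Sum.elim (fun _ => o) w) y)) := by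
  have hup : ∀ a b : Bool, Function.update (fun _ : Unit => a) () b = fun _ => b := by
    intro a b; ext; simp
  simp only [controlledHadamard, qRun_cons, qRun_nil, QGate.apply, Sum.update_elim_inl,
    Sum.update_elim_inr, Sum.elim_inl, Sum.elim_inr, hup, initMsg, Sum.elim_comp_inl,
    Sum.elim_comp_inr]
  cases d <;> cases o <;> cases u <;> simp [hΦ]

end ControlledHadamard

section Overlap
variable {q T : ℕ} {ι ο κ : Type} [DecidableEq ι] [Fintype κ] [DecidableEq κ]

/-- Without communication the receiver's state is `|0⟩`. -/
theorem sqOverlap_of_rounds_eq_zero (hT : T = 0) (S : Sender q T ι ο) (R : Receiver q T κ)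
    (x : Bits ι) (v : Bits ο → QVec κ) (t₀ : Fin T → Bits (Fin q)) : sqOverlap S R x v =
      𝔼 r : Bits (Fin S.coins), ‖v (S.result x r t₀) fun _ => false‖ ^ 2 := by
  subst hT
  refine Finset.expect_congr rfl fun r _ => ?_
  rw [Fintype.sum_eq_single t₀ fun t ht => (ht (Subsingleton.elim _ _)).elim, ov,
    Fintype.sum_eq_single fun _ => false]
  · rw [Fintype.sum_eq_single fun _ => false]
    · rw [Receiver.stateN, ket, if_pos]
      · simp
      · ext (i | i) <;> rfl
    · intro o ho
      rw [Receiver.stateN, ket, if_neg, mul_zero]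
      exact fun h => ho (congrArg (· ∘ Sum.inl) h)
  · intro b hb
    rw [Finset.sum_eq_zero, norm_zero, zero_pow two_ne_zero]
    intro o _
    rw [Receiver.stateN, ket, if_neg, mul_zero]
    exact fun h => hb (congrArg (· ∘ Sum.inr) h)

end Overlap

section OSP
variable {q q' T : ℕ}

/-- Without rounds every receiver holds `|0⟩`. The idle adversary then predicts `b` whenever `b =
0`, so by security `b` is nearly balanced; but for `b = 1` the squared overlap of `|0⟩` with `H|s⟩`
is `1/2`, so the total is about `3/4` at most, against correctness. -/
theorem IsRandomOSP.eventually_rounds_pos {P : RandomOSPProtocol} (hP : IsRandomOSP P) :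
    ∀ᶠ k in Filter.atTop, 0 < P.T k := by
  let A : P.Adversary fun _ => Unit :=
    { R := fun k => { anc := 0, step := fun _ => [] }
      qpt := by
        have := (polyBounded_iff.1 hP.efficient.1).add (PolyNat.const 1)
        refine polyBounded_iff.2 (this.mono fun k => ?_)
        simp only [Receiver.size, Sender.size]
        simp
        lia }
  filter_upwards [(hP.secure A).eventually_lt (show (0 : ℝ) < 1 / 16 by norm_num),
    hP.correct.eventually_lt (show (0 : ℝ) < 1 / 16 by norm_num)] with k h1 h2
  by_contra hT
  replace hT : P.T k = 0 := by lia
  have h3 := two_mul_expectedOverlap_le (P.S k) (P.R k) Empty.elim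
    (v := fun a => hadamardKet (a 1) (a 0)) fun a => unitOrZero_hadamardKet _ _
  rw [sqOverlap_of_rounds_eq_zero hT _ _ _ _ fun _ _ => false] at h3
  have h4 : eventProb (P.S k) (A.R k) Empty.elim (fun a o => o () = a 1) =
      𝔼 r, if (P.S k).result Empty.elim r (fun _ _ => false) 1 then 0 else 1 := by
    rw [eventProb_eq]
    refine Finset.expect_congr rfl fun r _ => ?_
    have hst : ∀ ms ts j, j = 0 → (A.R k).stateN ms ts j = ket fun _ => false := by
      rintro _ _ _ rfl
      rfl
    have : Subsingleton (Fin (P.T k) → Bits (Fin (P.q k))) := by rw [hT]; infer_instance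
    rw [Fintype.sum_eq_single (fun _ _ => false) fun t ht => (ht (Subsingleton.elim _ _)).elim,
      Fintype.sum_eq_single fun _ => false]
    · have : (A.R k).stateN ((P.S k).msg Empty.elim r fun _ _ => false) (fun _ _ => false) (P.T k) =
        ket fun _ => false := hst _ _ _ hT
      rw [this, ket, if_pos rfl]
      cases (P.S k).result Empty.elim r (fun _ _ => false) 1 <;> simp
    · intro w hw
      have : (A.R k).stateN ((P.S k).msg Empty.elim r fun _ _ => false) (fun _ _ => false) (P.T k) =
        ket fun _ => false := hst _ _ _ hT
      rw [this, ket, if_neg hw]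
      simp
  have h5 : ∀ r, ‖hadamardKet ((P.S k).result Empty.elim r (fun _ _ => false) 1)
      ((P.S k).result Empty.elim r (fun _ _ => false) 0) fun _ => false‖ ^ 2 ≤
      1 / 2 + 1 / 2 * if (P.S k).result Empty.elim r (fun _ _ => false) 1 then (0 : ℝ) else 1 := by
    intro r
    have h' : ‖((√2 : ℝ) : ℂ)⁻¹‖ ^ 2 = 1 / 2 := by
      rw [sq, ← norm_mul, sqrt_two_inv_mul_self]; norm_num
    cases (P.S k).result Empty.elim r (fun _ _ => false) 1
    · simp only [hadamardKet]
      norm_num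
      split_ifs <;> simp
    · simp only [hadamardKet, if_true, Bool.and_false, Bool.false_eq_true, if_false, mul_one, h']
      norm_num
  have h6 := Finset.expect_le_expect (s := Finset.univ) fun r _ => h5 r
  rw [Finset.expect_add_distrib, Finset.expect_const Finset.univ_nonempty, ← Finset.mul_expect,
    ← h4] at h6
  have h7 := (abs_lt.1 h1).2
  linarith

/-- The message with which chosen-input OSP is obtained from random-input OSP. -/
def ospMsg (x : Bits (Unit ⊕ Empty ⊕ Fin 2)) : Bits Unit :=
  fun _ => x (.inl ()) ^^ x (.inr (.inr 1))

/-- The sender's output in this protocol. -/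
def ospOut (x : Bits ((Unit ⊕ Empty ⊕ Fin 2) ⊕ Unit)) : Bits Unit := fun _ => x (.inl (.inr (.inr 0)))

variable {S : Sender q T Empty (Fin 2)} {S' : Sender q' (T + 1) Unit Unit} {e : Fin q ⊕ Unit ≃ Fin q'}
  {ec : Fin S.coins ⊕ Empty ≃ Fin S'.coins}

/-- The message bit is `b ⊕ b'`, and applying `H` to that power turns `H^b' |s⟩` into `H^b |s⟩`. -/
theorem Sender.Extends.exists_osp_receiver (hS : S'.Extends S e ec ospMsg ospOut)
    (R : Receiver q T Unit) : ∃ R' : Receiver q' (T + 1) Unit, R'.size ≤ q' + R.size + 9 ∧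
      ∀ b : Bool, sqOverlap S R Empty.elim (fun a => hadamardKet (a 1) (a 0)) ≤
        sqOverlap S' R' (fun _ => b) fun a => hadamardKet b (a ()) := by
  obtain ⟨R', hsize, hR'⟩ := hS.exists_receiver R (controlledHadamard (Fin R.anc))
  refine ⟨R', hsize.trans ?_, fun b => le_trans ?_ (hR' _ _)⟩
  · simp [controlledHadamard]
    lia
  rw [sqOverlap]
  refine Finset.expect_le_expect fun r _ => ?_
  have hm : ∀ c a, ospMsg (Sum.elim (fun _ => b) (Sum.elim c a)) = fun _ => b ^^ a 1 :=
    fun _ _ => rfl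
  have ho : ∀ c a d, ospOut (Sum.elim (Sum.elim (fun _ => b) (Sum.elim c a)) d) = fun _ => a 0 :=
    fun _ _ _ => rfl
  simp only [hm, ho]
  rw [Finset.expect_const Finset.univ_nonempty]
  refine Finset.sum_le_sum fun t _ => ?_
  set b' := S.result Empty.elim r t 1
  set s := S.result Empty.elim r t 0
  set ψ := R.stateN (S.msg Empty.elim r t) t T with hψ
  -- Only the branch in which the message bit is returned unchanged is kept.
  refine le_trans ?_ (Finset.single_le_sum (fun d _ => ov_nonneg _ _)
    (Finset.mem_univ fun _ => b ^^ b'))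
  simp only [ov]
  rw [sum_bits_sum (α := R.Work)]
  simp only [Fintype.sum_unique]
  rw [sum_bits_sum (α := Unit), Finset.sum_comm]
  refine Finset.sum_le_sum fun w _ => ?_
  simp only [← Equiv.sum_comp (Equiv.funUnique Unit Bool).symm]
  simp only [Equiv.funUnique_symm_apply]
  have hu : ∀ x : Bool, (uniqueElim x : Unit → Bool) = fun _ => x := fun x => by ext; simp
  have hpad : ∀ w y, R.padState Unit Empty (S.msg Empty.elim r t) t
      (Sum.elim (fun _ => false) (Sum.elim w y)) = ψ w := by
    intro w y
    simp [Receiver.padState, ψ]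
  have hpad0 : ∀ u w y, R.padState Unit Empty (S.msg Empty.elim r t) t
      (Sum.elim (fun _ => true) (Sum.elim (Sum.elim u w) y)) = 0 := by
    intro u w y
    simp [Receiver.padState]
  simp only [hu, qRun_controlledHadamard _ _ hpad0, hpad]
  generalize ψ = ψ
  have h2 := sqrt_two_inv_mul_self
  have h2' : ‖((√2 : ℝ) : ℂ)⁻¹‖ ^ 2 = 1 / 2 := by
    rw [sq, ← norm_mul, h2]; norm_num
  have hst : star ((√2 : ℝ) : ℂ)⁻¹ = ((√2 : ℝ) : ℂ)⁻¹ := by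
    rw [← Complex.ofReal_inv]
    exact Complex.conj_ofReal _
  rcases hd : b ^^ b' with _ | _
  · obtain rfl : b = b' := by simpa using hd
    simp only [Bool.false_eq_true, if_false, mul_left_comm _ ((√2 : ℝ) : ℂ)⁻¹, ← Finset.mul_sum,
      norm_mul, mul_pow, h2', Finset.sum_const, Finset.card_univ, Fintype.card_bool]
    simp
  · obtain rfl : b = !b' := by
      revert hd
      cases b <;> cases b' <;> simp
    simp only [if_true, Fintype.sum_bool, Bool.false_eq_true, if_false, mul_zero, add_zero,
      norm_zero, zero_pow two_ne_zero, zero_add]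
    refine le_of_eq (congrArg (fun y => ‖y‖ ^ 2) ?_)
    generalize ψ (Sum.elim (fun _ => true) w) = p
    generalize ψ (Sum.elim (fun _ => false) w) = p'
    cases b' <;> cases s <;> simp [hadamardKet]
    · linear_combination (-2 * p') * h2
    · linear_combination (-2 * p) * h2
    · ring
    · ring

/-- The states of the reduction, for the message bit `d`. -/
noncomputable def Receiver.ospState (A : Receiver q' (T + 1) Unit) (e : Fin q ⊕ Unit ≃ Fin q')
    (ms ts : Fin T → Bits (Fin q)) (d : Bool) : QVec ((Fin q' ⊕ A.Work) ⊕ (Fin T × Unit)) :=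
  qRun ((A.step (Fin.last T)).map (QGate.map .inl))
    (A.baseMsg e ms ts (msgJoin e (fun _ => false) fun _ => d))

open Classical in
-- `B` runs `A`, feeds it the last message bit `d`, and outputs the answer of `A` shifted by `d`.
-- This is a guess for `b'`: a distinguisher that recovers the input `x` recovers `b'` from `d = x ⊕
-- b'`.
theorem Receiver.exists_osp_reduction (A : Receiver q' (T + 1) Unit) (e : Fin q ⊕ Unit ≃ Fin q')
    (hT : 0 < T) (d : Bool) : ∃ B : Receiver q T Unit,
      B.size ≤ q + T + q' + 3 * A.size + T * (A.size + 3) + 10 ∧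
      ∀ (E : Bits (Fin 2) → Bool → Prop), eventProb S B Empty.elim (fun a o => E a (o ())) =
        𝔼 r : Bits (Fin S.coins), ∑ t, ∑ z,
          if E (S.result Empty.elim r t) (z (.inl (.inr (.inl ()))) ^^ d) then
            ‖A.ospState e (S.msg Empty.elim r t) t d z‖ ^ 2 else 0 := by
  let out : (Fin q' ⊕ A.Work) ⊕ (Fin T × Unit) := .inl (.inr (.inl ()))
  let mb : (Fin q' ⊕ A.Work) ⊕ (Fin T × Unit) := .inl (.inl (e (.inr ())))
  let pre : List (QGate ((Fin q' ⊕ A.Work) ⊕ (Fin T × Unit))) := if d then [.pauliX mb] else []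
  let pst : List (QGate ((Fin q' ⊕ A.Work) ⊕ (Fin T × Unit))) := if d then [.pauliX out] else []
  let gs := pre ++ (A.step (Fin.last T)).map (QGate.map .inl) ++ pst
  have hpre : ∀ ms ts, qRun pre (A.baseMsg e ms ts fun _ => false) =
      A.baseMsg e ms ts (msgJoin e (fun _ => false) fun _ => d) := by
    intro ms ts
    cases d
    · simp only [pre, Bool.false_eq_true, if_false, qRun_nil]
      congr 1
      ext i
      obtain ⟨i | i, rfl⟩ := e.surjective i <;> simp [msgJoin]
    · ext z
      simp only [pre, if_true, qRun_cons, qRun_nil, QGate.apply, Receiver.baseMsg, initMsg]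
      have h1 : ((Function.update z mb (!z mb) ∘ Sum.inl) ∘ Sum.inl = fun _ => false) ↔
          ((z ∘ Sum.inl) ∘ Sum.inl = msgJoin e (fun _ => false) fun _ => true) := by
        simp only [funext_iff, e.surjective.forall, Sum.forall, Function.comp_apply]
        simp [mb, msgJoin]
        exact fun _ => ⟨fun h _ => h, fun h => h ()⟩
      have h2 : (Function.update z mb (!z mb) ∘ Sum.inl) ∘ Sum.inr = (z ∘ Sum.inl) ∘ Sum.inr := by
        ext i; simp [mb]
      have h3 : Function.update z mb (!z mb) ∘ Sum.inr = z ∘ Sum.inr := by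
        ext i; simp [mb]
      rw [h2, h3]
      exact if_congr h1 rfl rfl
  let f : RedQubits A Unit Empty ≃ Unit ⊕ ((Fin q' ⊕ Fin A.anc) ⊕ (Fin T × Unit)) :=
    { toFun := Sum.elim (Sum.elim (Sum.elim (fun i => .inr (.inl (.inl i)))
        (Sum.elim .inl fun i => .inr (.inl (.inr i)))) fun i => .inr (.inr i)) Empty.elim
      invFun := Sum.elim (fun u => .inl (.inl (.inr (.inl u)))) (Sum.elim
        (Sum.elim (fun i => .inl (.inl (.inl i))) fun i => .inl (.inl (.inr (.inr i))))
        fun i => .inl (.inr i))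
      left_inv := by rintro (((i | i | i) | i) | i) <;> first | rfl | exact i.elim
      right_inv := by rintro (i | (i | i) | i) <;> rfl }
  obtain ⟨B, hsize, hB⟩ := A.exists_reduction e f (gs.map (QGate.map .inl))
  have hgs : gs.length ≤ A.size + 2 := by
    have h1 : (A.step (Fin.last T)).length ≤ A.size := by
      have := Finset.single_le_sum (f := fun i => (A.step i).length) (fun _ _ => Nat.zero_le _)
        (Finset.mem_univ (Fin.last T))
      simp only [Receiver.size]
      lia
    simp only [gs, pre, pst, List.length_append, List.length_map]
    split_ifs <;> simp <;> lia
  refine ⟨B, hsize.trans ?_, fun E => ?_⟩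
  · have h1 : A.anc + T + 1 ≤ A.size := by simp only [Receiver.size]; lia
    have h2 : T * gs.length ≤ T * (A.size + 3) := Nat.mul_le_mul_left _ (by lia)
    simp only [List.length_map, Fintype.card_sum, Fintype.card_fin, Fintype.card_unique,
      Fintype.card_prod]
    lia
  rw [eventProb_eq]
  refine Finset.expect_congr rfl fun r _ => Finset.sum_congr rfl fun t _ => ?_
  obtain ⟨w, hw1, hw2⟩ := hB hT (S.msg Empty.elim r t) t
  rw [← Equiv.sum_comp w, sum_bits_sum]
  simp only [Fintype.sum_unique, hw2, Function.comp_apply, hw1, IsEmpty.forall_iff, if_true]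
  -- The final flip of the output qubit is undone by a change of variables in the sum over `z`.
  let inv : Bits ((Fin q' ⊕ A.Work) ⊕ (Fin T × Unit)) ≃ Bits ((Fin q' ⊕ A.Work) ⊕ (Fin T × Unit)) :=
    Function.Involutive.toPerm (fun z => Function.update z out (z out ^^ d)) fun z => by
      simp
  rw [← Equiv.sum_comp inv]
  refine Finset.sum_congr rfl fun z _ => ?_
  have h1 : ∀ y, qRun (gs.map (QGate.map .inl)) (fun z =>
      A.baseMsg e (S.msg Empty.elim r t) t (fun _ => false) (z ∘ Sum.inl))
      (Sum.elim (inv z) y : Bits (RedQubits A Unit Empty)) =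
      A.ospState e (S.msg Empty.elim r t) t d z := by
    intro y
    rw [qRun_map]
    simp only [extend_inl, Sum.elim_comp_inl]
    change qRun gs (A.baseMsg e (S.msg Empty.elim r t) t fun _ => false) (inv z) = _
    rw [qRun_append, qRun_append, hpre]
    change qRun pst (A.ospState e (S.msg Empty.elim r t) t d) (inv z) = _
    cases d
    · simp only [pst, inv, Bool.false_eq_true, if_false, qRun_nil]
      simp
    · simp only [pst, inv, if_true, qRun_cons, qRun_nil, QGate.apply]
      simp
  rw [h1]
  refine if_congr ?_ rfl rfl
  have : ∀ y, (Sum.elim (inv z) y : Bits (RedQubits A Unit Empty)) (f.symm (.inl ())) =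
      (z out ^^ d) := by
    intro y
    exact Function.update_self out _ z
  rw [this]

/-- For each fixed `b'`, the inputs `0` and `1` correspond to the message bits `b'` and `1 ⊕ b'`.
Hence the signed advantage of `A` equals the sum of the prediction advantages of the reductions with
`d = 0` and `d = 1`. -/
theorem Sender.Extends.exists_osp_reductions (hS : S'.Extends S e ec ospMsg ospOut) (hT : 0 < T)
    (A : Receiver q' (T + 1) Unit) : ∃ B : Bool → Receiver q T Unit,
      (∀ d, (B d).size ≤ q + T + q' + 3 * A.size + T * (A.size + 3) + 10) ∧
      |eventProb S' A (fun _ => false) (fun _ o => o () = false) -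
        eventProb S' A (fun _ => true) (fun _ o => o () = false)| ≤
      |eventProb S (B false) Empty.elim (fun a o => o () = a 1) - 1 / 2| +
        |eventProb S (B true) Empty.elim (fun a o => o () = a 1) - 1 / 2| := by
  choose B hsize hB using A.exists_osp_reduction (S := S) e hT
  refine ⟨B, hsize, ?_⟩
  have hN : 𝔼 r : Bits (Fin S.coins), ∑ t, ∑ h, ∑ w,
      ‖A.baseState e (S.msg Empty.elim r t) t h w‖ ^ 2 = 1 := by
    have h1 := hB false fun _ _ => True
    rw [_root_.eventProb_eq] at h1
    simp only [if_true, S.sum_norm_sq_stateN, Receiver.ospState, sum_norm_sq_qRun, sum_baseMsg] at h1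
    rw [← h1, Finset.expect_const Finset.univ_nonempty]
  have hA : ∀ x : Bool, eventProb S' A (fun _ => x) (fun _ o => o () = false) =
      𝔼 r : Bits (Fin S.coins), ∑ t, ∑ z, if z (.inl (.inr (.inl ()))) = false then
        ‖A.ospState e (S.msg Empty.elim r t) t (x ^^ S.result Empty.elim r t 1) z‖ ^ 2 else 0 := by
    intro x
    rw [hS.eventProb_eq A (fun _ => x) _ (fun _ _ o => o () = false) fun _ _ _ _ => Iff.rfl]
    refine Finset.expect_congr rfl fun r _ => ?_
    have hm : ∀ c a, ospMsg (Sum.elim (fun _ => x) (Sum.elim c a)) = fun _ => x ^^ a 1 :=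
      fun _ _ => rfl
    simp only [hm]
    rw [Finset.expect_const Finset.univ_nonempty]
    rfl
  have hsplit : ∀ (r : Bits (Fin S.coins)) t d,
      (∑ z, if z (.inl (.inr (.inl ()))) = false then
          ‖A.ospState e (S.msg Empty.elim r t) t d z‖ ^ 2 else 0) +
        (∑ z, if z (.inl (.inr (.inl ()))) = true then
          ‖A.ospState e (S.msg Empty.elim r t) t d z‖ ^ 2 else 0) =
      ∑ h, ∑ w, ‖A.baseState e (S.msg Empty.elim r t) t h w‖ ^ 2 := by
    intro r t d
    rw [← sum_baseMsg A e _ _ (msgJoin e (fun _ => false) fun _ => d),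
      ← sum_norm_sq_qRun ((A.step (Fin.last T)).map (QGate.map .inl)), ← Finset.sum_add_distrib]
    refine Finset.sum_congr rfl fun z _ => ?_
    cases z (.inl (.inr (.inl ()))) <;> simp [Receiver.ospState]
  -- Per transcript this is the complement rule: for one of the two values of `d`, a correct guess
  -- means that `A` answers `1` rather than `0`.
  have key : eventProb S' A (fun _ => false) (fun _ o => o () = false) -
        eventProb S' A (fun _ => true) (fun _ o => o () = false) =
      eventProb S (B false) Empty.elim (fun a o => o () = a 1) +
        eventProb S (B true) Empty.elim (fun a o => o () = a 1) - 1 := by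
    rw [hB false fun a o => o = a 1, hB true fun a o => o = a 1, hA, hA, ← hN,
      ← Finset.expect_add_distrib, ← Finset.expect_sub_distrib, ← Finset.expect_sub_distrib]
    refine Finset.expect_congr rfl fun r _ => ?_
    rw [← Finset.sum_add_distrib, ← Finset.sum_sub_distrib, ← Finset.sum_sub_distrib]
    refine Finset.sum_congr rfl fun t _ => ?_
    have h0 := hsplit r t false
    have h1 := hsplit r t true
    cases S.result Empty.elim r t 1 <;>
      simp only [Bool.xor_false, Bool.xor_true, Bool.not_eq_true', Bool.not_eq_false',
        Bool.not_false, Bool.not_true] at h0 h1 ⊢ <;> linarith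
  rw [key, show ∀ a b : ℝ, a + b - 1 = (a - 1 / 2) + (b - 1 / 2) by intros; ring]
  exact abs_add_le _ _

theorem bComp_ospMsg : BComp ospMsg 1 :=
  (BComp.of_cx fun _ => Cx.op₂ Bool.xor (Cx.proj _ 0) (Cx.proj _ 0)).mono (by simp)

theorem bComp_ospOut : BComp ospOut 0 :=
  BComp.reindex (fun _ : Unit => (.inl (.inr (.inr 0)) : (Unit ⊕ Empty ⊕ Fin 2) ⊕ Unit)) 0

theorem IsRandomOSP.exists_isOSP {P : RandomOSPProtocol} (hP : IsRandomOSP P) :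
    ∃ P' : OSPProtocol, IsOSP P' := by
  let e : ∀ k, Fin (P.q k) ⊕ Unit ≃ Fin (P.q k + 1) := fun k =>
    Fintype.equivFinOfCardEq (by simp)
  choose S' ec hS hsize using fun k => (P.S k).exists_extends (e k) bComp_ospMsg bComp_ospOut
  choose R' hsize' hR' using fun k => (hS k).exists_osp_receiver (P.R k)
  have hPS := polyBounded_iff.1 hP.efficient.1
  have hPR := polyBounded_iff.1 hP.efficient.2
  refine ⟨{ q := fun k => P.q k + 1, T := fun k => P.T k + 1, S := S', R := R' },
    ⟨?_, ?_⟩, fun b => ?_, fun A => ?_⟩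
  · refine polyBounded_iff.2 ((((PolyNat.const 11).mul hPS).add (PolyNat.const 200)).mono fun k => ?_)
    refine (hsize k).trans ?_
    simp
    lia
  · refine polyBounded_iff.2 (((PolyNat.const 2).mul hPR).add (PolyNat.const 10) |>.mono fun k => ?_)
    refine (hsize' k).trans ?_
    have : P.q k ≤ (P.R k).size := by simp only [Receiver.size]; lia
    lia
  · refine (hP.correct.const_mul 2).mono (Filter.Eventually.of_forall fun k => ?_)
    have h1 := sqOverlap_le_expectedOverlap (S' k) (R' k) (fun _ => b)
      (v := fun a => hadamardKet b (a ())) fun _ => unitOrZero_hadamardKet _ _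
    have h2 := two_mul_expectedOverlap_le (P.S k) (P.R k) Empty.elim
      (v := fun a => hadamardKet (a 1) (a 0)) fun a => unitOrZero_hadamardKet _ _
    have h3 := hR' k b
    push_cast
    linarith
  -- For the finitely many `k` without rounds an idle receiver is used, just to have an adversary
  -- for all `k`.
  · have hex : ∀ k, ∃ B : Bool → Receiver (P.q k) (P.T k) Unit,
        (∀ d, (B d).size ≤ P.q k + P.T k + (P.q k + 1) + 3 * (A.R k).size +
          P.T k * ((A.R k).size + 3) + 11) ∧ (0 < P.T k →
        |eventProb (S' k) (A.R k) (fun _ => false) (fun _ o => o () = false) -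
          eventProb (S' k) (A.R k) (fun _ => true) (fun _ o => o () = false)| ≤
        |eventProb (P.S k) (B false) Empty.elim (fun a o => o () = a 1) - 1 / 2| +
          |eventProb (P.S k) (B true) Empty.elim (fun a o => o () = a 1) - 1 / 2|) := by
      intro k
      by_cases hT : 0 < P.T k
      · obtain ⟨B, h1, h2⟩ := (hS k).exists_osp_reductions hT (A.R k)
        exact ⟨B, fun d => (h1 d).trans (by lia), fun _ => h2⟩
      · refine ⟨fun _ => { anc := 0, step := fun _ => [] }, fun d => ?_, fun h => (hT h).elim⟩
        simp [Receiver.size]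
        lia
    choose B hBsize hB using hex
    have hB' : ∀ d, PolyBounded fun k => ((B k d).size : ℝ) := by
      intro d
      have hA := polyBounded_iff.1 A.qpt
      refine polyBounded_iff.2 (((((PolyNat.const 2).mul hPS).add ((PolyNat.const 3).mul hA)).add
        ((hPS.mul (hA.add (PolyNat.const 3))))).add (PolyNat.const 12) |>.mono fun k => ?_)
      refine (hBsize k d).trans ?_
      have h1 : P.q k + P.T k + P.q k ≤ 2 * (P.S k).size := by simp only [Sender.size]; lia
      have h2 : P.T k * ((A.R k).size + 3) ≤ (P.S k).size * ((A.R k).size + 3) :=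
        Nat.mul_le_mul_right _ (by simp only [Sender.size]; lia)
      lia
    refine ((hP.secure ⟨fun k => B k false, hB' false⟩).add
      (hP.secure ⟨fun k => B k true, hB' true⟩)).mono ?_
    filter_upwards [hP.eventually_rounds_pos] with k hk
    exact hB k hk

end OSP

/-! ### Quantum Goldreich–Levin -/

section GoldreichLevin
variable {W X : Type} [Fintype W] [DecidableEq W] [Fintype X] [DecidableEq X]

/-- The state `|a⟩ ⊗ |w⟩`. -/
def tensKet (a : QVec W) (w : Bits X) : QVec (W ⊕ X) :=
  fun s => if s ∘ Sum.inr = w then a (s ∘ Sum.inl) else 0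

/-- The Goldreich–Levin circuit: prepare a uniform query by `P`, run the predictor `U`, put its
guess into the phase, and uncompute. -/
noncomputable def glGates (P : List (QGate (W ⊕ X))) (U : List (QGate W)) (out : W) :
    List (QGate (W ⊕ X)) :=
  (hadamardAll X).map (QGate.map .inr) ++ P ++ (U.map (QGate.map .inl) ++
    (List.replicate 4 (.phaseT (.inl out)) ++ (qInv (U.map (QGate.map .inl)) ++
      qInv ((hadamardAll X).map (QGate.map .inr) ++ P))))

theorem length_glGates_le (P : List (QGate (W ⊕ X))) (U : List (QGate W)) (out : W) :
    (glGates P U out).length ≤ 8 * Fintype.card X + 8 * P.length + 8 * U.length + 4 := by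
  have h1 := length_qInv_le (U.map (QGate.map (.inl : W ↪ W ⊕ X)))
  have h2 := length_qInv_le ((hadamardAll X).map (QGate.map (.inr : X ↪ W ⊕ X)) ++ P)
  simp only [glGates, List.length_append, List.length_map, List.length_replicate,
    length_hadamardAll] at *
  lia

theorem qRun_four_phaseT (t : W) (ψ : QVec W) (s : Bits W) :
    qRun (List.replicate 4 (.phaseT t)) ψ s = sgn (s t) * ψ s := by
  rw [qRun_replicate_phaseT]
  congr 1
  cases s t
  · simp
  · rw [if_pos rfl, ← Complex.exp_nat_mul, sgn_true, ← Complex.exp_pi_mul_I]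
    congr 1
    push_cast
    ring

theorem qRun_map_inr (gs : List (QGate X)) (ψ : QVec (W ⊕ X)) (a : Bits W) (x : Bits X) :
    qRun (gs.map (QGate.map .inr)) ψ (Sum.elim a x) = qRun gs (fun x => ψ (Sum.elim a x)) x := by
  rw [qRun_map]
  simp only [extend_inr]
  rfl

theorem qRun_map_inl (gs : List (QGate W)) (ψ : QVec (W ⊕ X)) (a : Bits W) (x : Bits X) :
    qRun (gs.map (QGate.map .inl)) ψ (Sum.elim a x) = qRun gs (fun a => ψ (Sum.elim a x)) a := by
  rw [qRun_map]
  simp only [extend_inl]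
  rfl

/-- The left side is the squared bias of `U` as a predictor of `w · c` for uniform queries `c`. With
the guess in the phase, a perfect predictor would create `∑ (-1)^(w·c) |c⟩`, which the Hadamard
transform maps to `|w⟩`. In general the inner product of the final state with `a₀ ⊗ |w⟩` is the
bias, and Cauchy–Schwarz bounds it by the weight of outcome `w`. A single coherent run suffices
because the circuit uncomputes the predictor. -/
theorem goldreichLevin (P : List (QGate (W ⊕ X))) (U : List (QGate W)) (out : W) (a₀ : QVec W)
    (a : Bits X → QVec W) (hP : ∀ (φ : QVec X) s, qRun P (fun s => φ (s ∘ Sum.inr) * a₀ (s ∘ Sum.inl)) s =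
      φ (s ∘ Sum.inr) * a (s ∘ Sum.inr) (s ∘ Sum.inl)) (w : Bits X) :
    (𝔼 c, ∑ z, (if z out = dot w c then 1 else -1) * ‖qRun U (a c) z‖ ^ 2) ^ 2 ≤
      (∑ z, ‖a₀ z‖ ^ 2) * ∑ z, ‖qRun (glGates P U out) (tensKet a₀ fun _ => false) (Sum.elim z w)‖ ^ 2 := by
  set h : ℂ := ((√2 : ℝ) : ℂ)⁻¹ ^ Fintype.card X with hh
  have hprep : ∀ w z c, qRun (U.map (QGate.map .inl))
      (qRun ((hadamardAll X).map (QGate.map .inr) ++ P) (tensKet a₀ w)) (Sum.elim z c) =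
      h * sgn (dot w c) * qRun U (a c) z := by
    intro w z c
    have h1 : qRun ((hadamardAll X).map (QGate.map .inr)) (tensKet a₀ w) =
        fun s => (h * sgn (dot w (s ∘ Sum.inr))) * a₀ (s ∘ Sum.inl) := by
      ext s
      obtain ⟨z, c, rfl⟩ : ∃ z c, s = Sum.elim z c := ⟨_, _, (Sum.elim_comp_inl_inr s).symm⟩
      rw [qRun_map_inr, qRun_hadamardAll, Fintype.sum_eq_single w]
      · simp [tensKet, hh, mul_assoc]
      · intro x hx
        simp [tensKet, hx]
    rw [qRun_map_inl, qRun_append, h1]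
    have h2 : (fun z => qRun P (fun s => h * sgn (dot w (s ∘ Sum.inr)) * a₀ (s ∘ Sum.inl))
        (Sum.elim z c)) = (h * sgn (dot w c)) • a c := by
      ext z
      rw [hP (fun c => h * sgn (dot w c))]
      simp
    rw [h2, qRun_smul]
    rfl
  have hst : star ((√2 : ℝ) : ℂ)⁻¹ = ((√2 : ℝ) : ℂ)⁻¹ := by
    rw [← Complex.ofReal_inv]
    exact Complex.conj_ofReal _
  have hhh : star h * h = ((Fintype.card (Bits X) : ℝ)⁻¹ : ℝ) := by
    rw [hh, star_pow, hst, ← mul_pow, sqrt_two_inv_mul_self]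
    simp
  -- The two inverse circuits move to the other argument of the inner product. There remains the
  -- phase gate between the states prepared from `w` and from `0`, diagonal in the query `c`.
  have hip : ip (tensKet a₀ w) (qRun (glGates P U out) (tensKet a₀ fun _ => false)) =
      ((𝔼 c, ∑ z, (if z out = dot w c then 1 else -1) * ‖qRun U (a c) z‖ ^ 2 : ℝ) : ℂ) := by
    rw [glGates, qRun_append, qRun_append, qRun_append, qRun_append, ip_qRun_qInv, ip_qRun_qInv, ip,
      sum_bits_sum, Finset.sum_comm, Fintype.expect_eq_sum_div_card, div_eq_inv_mul,
      Complex.ofReal_mul, ← hhh, Complex.ofReal_sum, Finset.mul_sum]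
    refine Finset.sum_congr rfl fun c _ => ?_
    rw [Complex.ofReal_sum, Finset.mul_sum]
    refine Finset.sum_congr rfl fun z _ => ?_
    rw [hprep, qRun_four_phaseT, hprep, Complex.ofReal_mul, Complex.ofReal_pow,
      ← Complex.conj_mul', star_mul, star_mul, star_sgn]
    have hd : dot (fun _ => false) c = false := by
      rw [← sgn_injective.eq_iff, sgn_dot]; simp
    rw [hd]
    have hs : ((if z out = dot w c then 1 else -1 : ℝ) : ℂ) = sgn (dot w c) * sgn (z out) := by
      cases z out <;> cases dot w c <;> simp
    rw [hs]
    simp only [Sum.elim_inl, sgn_false, Complex.star_def]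
    ring
  -- Cauchy–Schwarz on the slice where the query register contains `w`.
  have hcs : ‖ip (tensKet a₀ w) (qRun (glGates P U out) (tensKet a₀ fun _ => false))‖ ^ 2 ≤
      (∑ z, ‖a₀ z‖ ^ 2) * ∑ z, ‖qRun (glGates P U out) (tensKet a₀ fun _ => false) (Sum.elim z w)‖ ^ 2 := by
    have : ip (tensKet a₀ w) (qRun (glGates P U out) (tensKet a₀ fun _ => false)) =
        ip a₀ fun z => qRun (glGates P U out) (tensKet a₀ fun _ => false) (Sum.elim z w) := by
      rw [ip, sum_bits_sum, Finset.sum_comm, Fintype.sum_eq_single w]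
      · simp [ip, tensKet]
      · intro x hx
        simp [tensKet, hx]
    rw [this]
    exact norm_ip_sq_le _ _
  rw [hip] at hcs
  refine le_trans (le_of_eq ?_) hcs
  rw [Complex.norm_real, Real.norm_eq_abs, sq_abs]

end GoldreichLevin

/-! ### The honest receiver's measurement -/

section Parseval
variable {n : ℕ}

theorem dot_xor_cancel (d x Δ : Bits (Fin n)) :
    sgn (dot d x) = sgn (dot d Δ) * sgn (dot d fun i => x i ^^ Δ i) := by
  rw [dot_xor_right, sgn_xor, mul_left_comm, sgn_mul_self, mul_one]

theorem sum_norm_sq_hadamard (ψ : QVec (Fin n)) :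
    ∑ d, ‖((√2 : ℝ) : ℂ)⁻¹ ^ n * ∑ x, sgn (dot d x) * ψ x‖ ^ 2 = ∑ x, ‖ψ x‖ ^ 2 := by
  rw [← sum_norm_sq_qRun (hadamardAll (Fin n)) ψ]
  refine Finset.sum_congr rfl fun d _ => ?_
  rw [qRun_hadamardAll, Fintype.card_fin]
  simp only [dot_comm d]

/-- The sender's bit `s` in random-input OSP. -/
noncomputable def ospBit (F₀ b z : Bool) (x₀ x₁ d : Bits (Fin n)) : Bool :=
  if b then z ^^ dot d (fun i => x₀ i ^^ x₁ i) else F₀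

/-- The right side is the total weight of the desired OSP qubit after computing `F` into a fresh
qubit and measuring the register in the Hadamard basis. Its phases make it a Parseval sum over
outcomes `d`, to which only the positions `x₀` and `x₁` need contribute. -/
theorem clawKet_overlap_le (F : Bits (Fin n) → Bool) (x₀ x₁ : Bits (Fin n)) (z : Bool)
    (ψ : QVec (Fin n)) : ‖∑ x, star (clawKet x₀ x₁ z x) * ψ x‖ ^ 2 ≤
      ∑ d, ‖((√2 : ℝ) : ℂ)⁻¹ ^ n * ∑ x, sgn (dot d x) * (star (hadamardKet (F x₀ ^^ F x₁)
        (ospBit (F x₀) (F x₀ ^^ F x₁) z x₀ x₁ d) fun _ : Unit => F x) * ψ x)‖ ^ 2 := by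
  by_cases hx : x₀ = x₁
  · rw [clawKet, if_pos hx]
    simp only [Pi.zero_apply, star_zero, zero_mul, Finset.sum_const_zero, norm_zero]
    rw [zero_pow two_ne_zero]
    exact Finset.sum_nonneg fun _ _ => by positivity
  have h2 := sqrt_two_inv_mul_self
  have h2' : ‖((√2 : ℝ) : ℂ)⁻¹‖ ^ 2 = 1 / 2 := by
    rw [sq, ← norm_mul, h2]; norm_num
  have hst : star ((√2 : ℝ) : ℂ)⁻¹ = ((√2 : ℝ) : ℂ)⁻¹ := by
    rw [← Complex.ofReal_inv]
    exact Complex.conj_ofReal _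
  have hclaw : ∑ x, star (clawKet x₀ x₁ z x) * ψ x = ((√2 : ℝ) : ℂ)⁻¹ * (ψ x₀ + sgn z * ψ x₁) := by
    have : ∀ x, star (clawKet x₀ x₁ z x) * ψ x = ((√2 : ℝ) : ℂ)⁻¹ *
        ((if x = x₀ then ψ x else 0) + sgn z * if x = x₁ then ψ x else 0) := by
      intro x
      rw [clawKet, if_neg hx]
      simp only [Pi.smul_apply, Pi.add_apply, smul_eq_mul, star_mul, star_add, hst, ket]
      by_cases h0 : x = x₀
      · subst h0
        rw [if_neg hx]
        cases z <;> simp [hx, mul_comm]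
      · by_cases h1 : x = x₁
        · subst h1
          cases z <;> simp [h0, mul_comm]
        · simp [h0, h1]
    simp only [this, ← Finset.mul_sum, Finset.sum_add_distrib]
    simp
  rw [hclaw, norm_mul, mul_pow, h2']
  rcases hb : F x₀ ^^ F x₁ with _ | _
  -- If `F` does not separate the claw, the qubit is classical, and the parallelogram law bounds the
  -- squared norm of `(ψ x₀ ± ψ x₁)/√2` by the sum of both weights.
  · have hF : F x₁ = F x₀ := by
      revert hb; cases F x₀ <;> cases F x₁ <;> simp
    simp only [hadamardKet, ospBit, Bool.false_eq_true, if_false]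
    rw [sum_norm_sq_hadamard fun x => star (if F x = F x₀ then (1 : ℂ) else 0) * ψ x]
    refine le_trans ?_ (Finset.sum_le_sum_of_subset_of_nonneg (Finset.subset_univ {x₀, x₁})
      fun _ _ _ => by positivity)
    rw [Finset.sum_pair hx, hF]
    simp only [if_true, star_one, one_mul]
    have h3 := parallelogram_law_with_norm ℝ (ψ x₀) (sgn z * ψ x₁)
    have h4 : ‖sgn z * ψ x₁‖ = ‖ψ x₁‖ := by rw [norm_mul, norm_sgn, one_mul]
    rw [h4] at h3
    nlinarith [mul_self_nonneg ‖ψ x₀ - sgn z * ψ x₁‖]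
  -- If `F` separates the claw, the terms with `F x = 1` are shifted by `x₀ ⊕ x₁`. The shift
  -- produces the sign `(-1)^(d·(x₀ ⊕ x₁))`, which cancels the one in `ospBit`, so that the inner
  -- vector no longer depends on `d` and Parseval applies.
  · have key : ∀ d, ∑ x, sgn (dot d x) * (star (hadamardKet true
        (ospBit (F x₀) true z x₀ x₁ d) fun _ : Unit => F x) * ψ x) =
        ∑ y, sgn (dot d y) * (((√2 : ℝ) : ℂ)⁻¹ * ((if F y then 0 else ψ y) + sgn z *
          if F (fun i => y i ^^ (x₀ i ^^ x₁ i)) then ψ (fun i => y i ^^ (x₀ i ^^ x₁ i)) else 0)) := by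
      intro d
      let sh : Bits (Fin n) ≃ Bits (Fin n) :=
        Function.Involutive.toPerm (fun y i => y i ^^ (x₀ i ^^ x₁ i)) fun y => by
          ext i; simp
      have hsh : ∀ y, sh y = fun i => y i ^^ (x₀ i ^^ x₁ i) := fun _ => rfl
      have h3 : ∀ x, sgn (dot d x) * (star (hadamardKet true
          (ospBit (F x₀) true z x₀ x₁ d) fun _ : Unit => F x) * ψ x) =
          sgn (dot d x) * (((√2 : ℝ) : ℂ)⁻¹ * (if F x then 0 else ψ x)) +
          sgn (dot d (sh x)) * (((√2 : ℝ) : ℂ)⁻¹ * (sgn z * if F x then ψ x else 0)) := by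
        intro x
        have h4 := dot_xor_cancel d (sh x) fun i => x₀ i ^^ x₁ i
        have h5 : (fun i => sh x i ^^ (x₀ i ^^ x₁ i)) = x := by
          ext i; simp [hsh]
        rw [h5] at h4
        simp only [hadamardKet, ospBit, if_true, star_mul, hst, h4]
        cases F x
        · simp
        · simp only [Bool.and_true, if_true]
          have h7 : star (if (z ^^ dot d fun i => x₀ i ^^ x₁ i) = true then (-1 : ℂ) else 1) =
              sgn z * sgn (dot d fun i => x₀ i ^^ x₁ i) := by
            rw [← sgn_xor]
            exact star_sgn _
          rw [h7]
          ring
      simp only [h3, mul_add, Finset.sum_add_distrib]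
      congr 1
      rw [← Equiv.sum_comp sh]
      refine Finset.sum_congr rfl fun y _ => ?_
      have : sh (sh y) = y := by ext i; simp [hsh]
      rw [this]
      rfl
    simp only [key]
    rw [sum_norm_sq_hadamard]
    simp only [norm_mul, mul_pow, h2']
    have e1 : (fun i => x₀ i ^^ (x₀ i ^^ x₁ i)) = x₁ := by ext i; simp
    have e2 : (fun i => x₁ i ^^ (x₀ i ^^ x₁ i)) = x₀ := by
      ext i; cases x₀ i <;> cases x₁ i <;> rfl
    -- The position kept is the point of the claw with `F = 0`; there both claw amplitudes meet.
    cases hF : F x₀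
    · have hF1 : F x₁ = true := by rw [hF] at hb; simpa using hb
      refine le_trans (le_of_eq ?_) (Finset.single_le_sum (fun _ _ => by positivity) (Finset.mem_univ x₀))
      rw [e1, hF, hF1]
      simp
    · have hF1 : F x₁ = false := by rw [hF] at hb; simpa using hb
      refine le_trans (le_of_eq ?_) (Finset.single_le_sum (fun _ _ => by positivity) (Finset.mem_univ x₁))
      rw [e2, hF, hF1]
      have : ψ x₀ + sgn z * ψ x₁ = sgn z * (ψ x₁ + sgn z * ψ x₀) := by
        linear_combination (-ψ x₀) * sgn_mul_self z
      rw [this, norm_mul, norm_sgn]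
      simp

end Parseval

/-! ### From claw-state generators to random-input oblivious state preparation -/

/-- The conjunction of a family of bits. -/
def allBits {ι : Type} [Fintype ι] (f : Bits ι) : Bool := decide (∀ i, f i = true)

/-- The disjunction of a family of bits. -/
def anyBits {ι : Type} [Fintype ι] (f : Bits ι) : Bool := decide (∃ i, f i = true)

theorem Cx.allBits {ι α : Type} [Fintype ι] {f : ι → Bits α → Bool} {N : ℕ} (hf : ∀ i, Cx (f i) N) :
    Cx (fun x => _root_.allBits fun i => f i x) (Fintype.card ι * (N + 2) + 2) := Cx.all hf

theorem Cx.anyBits {ι α : Type} [Fintype ι] {f : ι → Bits α → Bool} {N : ℕ} (hf : ∀ i, Cx (f i) N) :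
    Cx (fun x => _root_.anyBits fun i => f i x) (Fintype.card ι * (N + 1) + 1) := Cx.any hf

section ROSP
variable {n : ℕ}

/-- The additional message bits: a selector, which distinguishes the two parts of the claw, the
masks, and the result of measuring the claw register. -/
abbrev SelMsg (n : ℕ) : Type := (Fin n ⊕ Unit) ⊕ (Fin n ⊕ Fin n) ⊕ Fin n

/-- The output bits of a claw-state generator. -/
abbrev ClawOut (n : ℕ) : Type := Fin n ⊕ Fin n ⊕ Unit

/-- Whether `i` is the first position with `x₀ i ≠ x₁ i`. -/
def firstDiff (a : Bits (ClawOut n)) (i : Fin n) : Bool :=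
  allBits (fun j => if j < i then !(a (.inl j) ^^ a (.inr (.inl j))) else true) &&
    (a (.inl i) ^^ a (.inr (.inl i)))

/-- The selector: the first position `i` with `x₀ i ≠ x₁ i` (in unary), and `x₀ i`. -/
def selector (a : Bits (ClawOut n)) : Bits (Fin n ⊕ Unit) :=
  Sum.elim (firstDiff a) fun _ => anyBits fun i => firstDiff a i && a (.inl i)

/-- The part of the claw to which `x` belongs. -/
def partOf (sel : Bits (Fin n ⊕ Unit)) (x : Bits (Fin n)) : Bool :=
  (anyBits fun i => sel (.inl i) && x i) ^^ sel (.inr ())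

/-- The masked bit which the receiver computes. -/
noncomputable def maskedBit (sel : Bits (Fin n ⊕ Unit)) (c : Bits (Fin n ⊕ Fin n)) (x : Bits (Fin n)) :
    Bool :=
  dot (fun i => (partOf sel x && c (.inr i)) || (!(partOf sel x) && c (.inl i))) x

/-- The claw strings differ somewhere, so a first position exists. Its value separates the two
strings, which gives a short description of the part to which a string belongs. -/
theorem exists_selector_eq {a : Bits (ClawOut n)} (h : (fun i => a (.inl i)) ≠ fun i => a (.inr (.inl i))) :
    ∃ i, a (.inl i) ≠ a (.inr (.inl i)) ∧
      selector a = Sum.elim (fun j => decide (some i = some j)) fun _ => a (.inl i) := by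
  obtain ⟨i, hi, hlt⟩ : ∃ i, a (.inl i) ≠ a (.inr (.inl i)) ∧
      ∀ j < i, a (.inl j) = a (.inr (.inl j)) := by
    have hex : ∃ i, a (.inl i) ≠ a (.inr (.inl i)) := by
      by_contra! hc
      exact h (funext hc)
    obtain ⟨i, hi, hmin⟩ := WellFounded.has_min (wellFounded_lt (α := Fin n))
      {i | a (.inl i) ≠ a (.inr (.inl i))} hex
    exact ⟨i, hi, fun j hj => by_contra fun hc => hmin j hc hj⟩
  have hsel : ∀ j, firstDiff a j = decide (i = j) := by
    intro j
    rw [firstDiff]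
    rcases lt_trichotomy j i with hji | rfl | hij
    · rw [hlt j hji]
      simp [hji.ne']
    · have : (a (.inl j) ^^ a (.inr (.inl j))) = true := by simpa using hi
      rw [this]
      simp only [Bool.and_true, decide_true, allBits, decide_eq_true_eq]
      intro j'
      split_ifs with hj'
      · simp [hlt j' hj']
      · rfl
    · have : ¬ ∀ j', (if j' < j then !(a (.inl j') ^^ a (.inr (.inl j'))) else true) = true := by
        intro hall
        have := hall i
        rw [if_pos hij] at this
        simp at this
        exact hi this
      have h' : allBits (fun j' => if j' < j then !(a (.inl j') ^^ a (.inr (.inl j'))) else true) =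
        false := by
        rw [allBits, decide_eq_false_iff_not]
        exact this
      rw [h']
      simp [hij.ne]
  refine ⟨i, hi, ?_⟩
  ext (j | j)
  · simpa [selector] using hsel j
  · simp only [selector, hsel, Sum.elim_inr, anyBits]
    simp

/-- On the claw the selector recognises the part correctly, so each string meets its own mask.
Independent masks for the two parts make `b` an inner product with the whole pair rather than with
`x₀ ⊕ x₁`. -/
theorem maskedBit_selector {a : Bits (ClawOut n)} (c : Bits (Fin n ⊕ Fin n))
    (h : (fun i => a (.inl i)) ≠ fun i => a (.inr (.inl i))) :
    maskedBit (selector a) c (fun i => a (.inl i)) = dot (fun i => c (.inl i)) (fun i => a (.inl i)) ∧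
      maskedBit (selector a) c (fun i => a (.inr (.inl i))) =
        dot (fun i => c (.inr i)) fun i => a (.inr (.inl i)) := by
  obtain ⟨i, hi, hs⟩ := exists_selector_eq h
  have h0 : partOf (selector a) (fun i => a (.inl i)) = false := by
    rw [hs]; simp [partOf, anyBits]
  have h1 : partOf (selector a) (fun i => a (.inr (.inl i))) = true := by
    rw [hs]
    revert hi
    simp only [partOf, anyBits]
    cases h0 : a (.inl i) <;> cases h1 : a (.inr (.inl i)) <;> simp [h1]
  simp [maskedBit, h0, h1]

/-- The message of the additional round. -/
def selMsg (x : Bits (Empty ⊕ (Fin n ⊕ Fin n) ⊕ ClawOut n)) : Bits (SelMsg n) :=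
  Sum.elim (selector fun i => x (.inr (.inr i))) (Sum.elim (fun i => x (.inr (.inl i))) fun _ => false)

/-- The sender's output bit `b`. -/
noncomputable def roleBit (c : Bits (Fin n ⊕ Fin n)) (a : Bits (ClawOut n)) : Bool :=
  dot (fun i => c (.inl i)) (fun i => a (.inl i)) ^^
    dot (fun i => c (.inr i)) fun i => a (.inr (.inl i))

/-- The sender's output bits `(s, b)`. -/
noncomputable def roleOut (x : Bits ((Empty ⊕ (Fin n ⊕ Fin n) ⊕ ClawOut n) ⊕ SelMsg n)) : Bits (Fin 2) :=
  fun j => if j = 0 then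
    ospBit (dot (fun i => x (.inl (.inr (.inl (.inl i))))) (fun i => x (.inl (.inr (.inr (.inl i))))))
      (roleBit (fun i => x (.inl (.inr (.inl i)))) fun i => x (.inl (.inr (.inr i))))
      (x (.inl (.inr (.inr (.inr (.inr ())))))) (fun i => x (.inl (.inr (.inr (.inl i)))))
      (fun i => x (.inl (.inr (.inr (.inr (.inl i)))))) fun i => x (.inr (.inr (.inr i)))
  else roleBit (fun i => x (.inl (.inr (.inl i)))) fun i => x (.inl (.inr (.inr i)))

theorem Cx.dot {α : Type} {u v : Fin n → Bits α → Bool} {N M : ℕ} (hu : ∀ i, Cx (u i) N)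
    (hv : ∀ i, Cx (v i) M) :
    Cx (fun x => _root_.dot (fun i => u i x) fun i => v i x) (n * (N + M + 2) + 1) := by
  have h := Cx.foldr Bool.xor false (fun i => Cx.op₂ Bool.and (hu i) (hv i))
    (Finset.univ : Finset (Fin n)).toList
  rw [Finset.length_toList, Finset.card_univ, Fintype.card_fin] at h
  exact h

theorem bComp_selMsg : BComp (selMsg (n := n)) (100 * (n + 1) ^ 3) := by
  have h1 : ∀ i : Fin n, Cx (fun x : Bits (Empty ⊕ (Fin n ⊕ Fin n) ⊕ ClawOut n) =>
      firstDiff (fun i => x (.inr (.inr i))) i) (4 * n + 4) := by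
    intro i
    have h2 := Cx.allBits (N := 2) (f := fun (j : Fin n) (x : Bits (Empty ⊕ (Fin n ⊕ Fin n) ⊕ ClawOut n)) =>
      if j < i then !(x (.inr (.inr (.inl j))) ^^ x (.inr (.inr (.inr (.inl j))))) else true) fun j => by
        split_ifs
        · exact (Cx.op₂ Bool.xor (Cx.proj _ 0) (Cx.proj _ 0)).not
        · exact (Cx.const true).mono (by lia)
    refine Cx.mono (Cx.op₂ Bool.and h2 (Cx.op₂ Bool.xor (Cx.proj _ 0) (Cx.proj _ 0))) ?_
    rw [Fintype.card_fin]
    lia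
  have h2 := Cx.anyBits fun i => Cx.op₂ Bool.and (h1 i) (Cx.proj (.inr (.inr (.inl i))) 0)
  refine (BComp.of_cx (N := n * (4 * n + 6) + 5) ?_).mono ?_
  · rintro ((i | i) | i | i)
    · exact (h1 i).mono (by nlinarith [i.2])
    · refine h2.mono ?_
      rw [Fintype.card_fin]
      lia
    · exact Cx.proj _ _
    · exact Cx.const_false _
  · simp only [Fintype.card_sum, Fintype.card_fin, Fintype.card_unique]
    nlinarith [sq_nonneg n, Nat.zero_le (n ^ 3)]

theorem bComp_roleOut : BComp (roleOut (n := n)) (100 * (n + 1) ^ 3) := by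
  have h1 : Cx (fun x : Bits ((Empty ⊕ (Fin n ⊕ Fin n) ⊕ ClawOut n) ⊕ SelMsg n) =>
      dot (fun i => x (.inl (.inr (.inl (.inl i))))) fun i => x (.inl (.inr (.inr (.inl i)))))
      (2 * n + 1) := (Cx.dot (fun i => Cx.proj _ 0) fun i => Cx.proj _ 0).mono (by lia)
  have h2 : Cx (fun x : Bits ((Empty ⊕ (Fin n ⊕ Fin n) ⊕ ClawOut n) ⊕ SelMsg n) =>
      roleBit (fun i => x (.inl (.inr (.inl i)))) fun i => x (.inl (.inr (.inr i))))
      (4 * n + 3) := (Cx.op₂ Bool.xor h1 (Cx.dot (fun i => Cx.proj _ 0) fun i => Cx.proj _ 0)).mono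
        (by lia)
  have h3 : Cx (fun x : Bits ((Empty ⊕ (Fin n ⊕ Fin n) ⊕ ClawOut n) ⊕ SelMsg n) =>
      dot (fun i => x (.inr (.inr (.inr i)))) fun i => x (.inl (.inr (.inr (.inl i)))) ^^
        x (.inl (.inr (.inr (.inr (.inl i)))))) (3 * n + 1) :=
    (Cx.dot (fun i => Cx.proj _ 0) fun i => Cx.op₂ Bool.xor (Cx.proj _ 0) (Cx.proj _ 0)).mono (by lia)
  refine (BComp.of_cx (N := 20 * n + 20) ?_).mono ?_
  · intro j
    by_cases hj : j = 0
    · have hmux : ∀ b t f : Bool, (if b then t else f) = ((b && t) || (!b && f)) := by decide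
      simp only [roleOut, if_pos hj, ospBit, hmux]
      exact Cx.mono (Cx.op₂ Bool.or (Cx.op₂ Bool.and h2 (Cx.op₂ Bool.xor (Cx.proj _ 0) h3))
        (Cx.op₂ Bool.and h2.not h1)) (by lia)
    · simp only [roleOut, if_neg hj]
      exact h2.mono (by lia)
  · simp only [Fintype.card_fin]
    nlinarith [sq_nonneg n, Nat.zero_le (n ^ 3)]

theorem bComp_maskedBit : BComp (fun (x : Bits (SelMsg n ⊕ Fin n)) (_ : Unit) =>
    maskedBit (fun i => x (.inl (.inl i))) (fun i => x (.inl (.inr (.inl i)))) fun i => x (.inr i))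
    (100 * (n + 1) ^ 3) := by
  have h1 : Cx (fun x : Bits (SelMsg n ⊕ Fin n) =>
      partOf (fun i => x (.inl (.inl i))) fun i => x (.inr i)) (2 * n + 2) :=
    (Cx.op₂ Bool.xor (Cx.any fun i => Cx.op₂ Bool.and (Cx.proj _ 0) (Cx.proj _ 0)) (Cx.proj _ 0)).mono
      (by rw [Fintype.card_fin]; lia)
  refine (BComp.of_cx (N := n * (4 * n + 11) + 1) fun _ => ?_).mono ?_
  · exact (Cx.dot (fun i => Cx.op₂ Bool.or (Cx.op₂ Bool.and h1 (Cx.proj _ 0))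
      (Cx.op₂ Bool.and h1.not (Cx.proj _ 0))) fun i => Cx.proj _ 0).mono (by
        apply Nat.add_le_add_right
        apply Nat.mul_le_mul_left
        lia)
  · simp only [Fintype.card_unique]
    nlinarith [sq_nonneg n, Nat.zero_le (n ^ 3)]

variable {q q' T : ℕ} {S : Sender q T Empty (ClawOut n)} {S' : Sender q' (T + 1) Empty (Fin 2)}
  {e : Fin q ⊕ SelMsg n ≃ Fin q'} {ec : Fin S.coins ⊕ (Fin n ⊕ Fin n) ≃ Fin S'.coins}

/-- The qubits of the honest receiver: message, output, the claw-state receiver's qubits and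
ancillas. -/
abbrev ClawQubits (n anc N : ℕ) : Type := SelMsg n ⊕ Unit ⊕ ((Fin n ⊕ Fin anc) ⊕ Fin N)

/-- The gates of the honest receiver in the additional round. -/
theorem exists_claw_gates (n : ℕ) : ∃ N ≤ 100 * (n + 1) ^ 3 + 1, ∀ anc : ℕ,
    ∃ gs : List (QGate (ClawQubits n anc N)),
      gs.length ≤ 8 * N + 1 + 2 * n ∧
      ∀ (Φ : QVec (Unit ⊕ ((Fin n ⊕ Fin anc) ⊕ Fin N))),
        (∀ o w y, Φ (Sum.elim o (Sum.elim w y)) ≠ 0 → y = fun _ => false) →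
        ∀ sel c d o w y, qRun gs (initMsg (Sum.elim sel (Sum.elim c fun _ => false)) Φ)
          (Sum.elim (Sum.elim sel (Sum.elim c d)) (Sum.elim o (Sum.elim (Sum.elim d w) y))) =
        ((√2 : ℝ) : ℂ)⁻¹ ^ n * ∑ x, sgn (dot d x) *
          Φ (Sum.elim (fun _ => o () ^^ maskedBit sel c x) (Sum.elim (Sum.elim x w) y)) := by
  obtain ⟨N, hN, hgs⟩ := (bComp_maskedBit (n := n)).exists_qgates
  refine ⟨N, by simpa using hN, fun anc => ?_⟩
  let rd : SelMsg n ⊕ Fin n → ClawQubits n anc N := Sum.elim .inl fun i => .inr (.inr (.inl (.inl i)))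
  let tgt : Unit → ClawQubits n anc N := fun u => .inr (.inl u)
  let an : Fin N → ClawQubits n anc N := fun i => .inr (.inr (.inr i))
  let ex : Fin n ↪ ClawQubits n anc N := ⟨fun i => .inr (.inr (.inl (.inl i))), fun a b h => by simpa using h⟩
  let dt : Fin n → ClawQubits n anc N := fun i => .inl (.inr (.inr i))
  have hdt : Function.Injective dt := fun a b h => by simpa [dt] using h
  have htgt : Function.Injective tgt := fun a b _ => rfl
  have hrt : ∀ a b, rd a ≠ tgt b := by rintro (a | a) b <;> simp [rd, tgt]
  have hta : ∀ b i, tgt b ≠ an i := by intro b i; simp [tgt, an]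
  have hex : ∀ j, ex j = .inr (.inr (.inl (.inl j))) := fun _ => rfl
  obtain ⟨g₁, hg₁, hl₁, hr₁⟩ := hgs rd tgt an htgt
    (fun a b h => by simpa [an] using h) hrt (by rintro (a | a) b <;> simp [rd, an]) hta
  -- After the Hadamard gates the claw register is copied to the message, where it is measured as
  -- `d` and returned to the sender.
  obtain ⟨g₃, hg₃, hl₃, hr₃⟩ := exists_qgates_xor dt ex hdt (fun a b => by simp [ex, dt])
  refine ⟨g₁ ++ ((hadamardAll (Fin n)).map (QGate.map ex) ++ g₃), ?_, fun Φ hΦ sel c d o w y => ?_⟩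
  · simp only [List.length_append, List.length_map, length_hadamardAll, Fintype.card_fin,
      Fintype.card_unique] at *
    lia
  rw [qRun_append, qRun_append, qRun_of_cRun_toggle hdt (φ := fun b s => s (ex b)) _ hg₃ hr₃]
  swap
  · intro b s s' h
    exact h _ fun b' => by simp [ex, dt]
  have h3 : (Function.extend dt (fun b => (Sum.elim (Sum.elim sel (Sum.elim c d))
      (Sum.elim o (Sum.elim (Sum.elim d w) y)) : Bits (ClawQubits n anc N)) (dt b) ^^
        (Sum.elim (Sum.elim sel (Sum.elim c d)) (Sum.elim o (Sum.elim (Sum.elim d w) y)) :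
          Bits (ClawQubits n anc N)) (ex b))
      (Sum.elim (Sum.elim sel (Sum.elim c d)) (Sum.elim o (Sum.elim (Sum.elim d w) y)) : Bits (ClawQubits n anc N))) =
      (Sum.elim (Sum.elim sel (Sum.elim c fun _ => false))
        (Sum.elim o (Sum.elim (Sum.elim d w) y)) : Bits (ClawQubits n anc N)) := by
    ext i
    by_cases hi : ∃ j, dt j = i
    · obtain ⟨j, rfl⟩ := hi
      rw [hdt.extend_apply]
      simp [dt, hex]
    · rw [Function.extend_apply' _ _ _ hi]
      rcases i with (i | i | i) | i
      · rfl
      · rfl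
      · exact absurd ⟨i, rfl⟩ hi
      · rfl
  rw [h3, qRun_map, qRun_hadamardAll, Fintype.card_fin]
  congr 1
  refine Finset.sum_congr rfl fun x _ => ?_
  have h2 : Function.extend ex x (Sum.elim (Sum.elim sel (Sum.elim c fun _ => false))
      (Sum.elim o (Sum.elim (Sum.elim d w) y)) : Bits (ClawQubits n anc N)) =
      (Sum.elim (Sum.elim sel (Sum.elim c fun _ => false))
        (Sum.elim o (Sum.elim (Sum.elim x w) y)) : Bits (ClawQubits n anc N)) := by
    ext i
    by_cases hi : ∃ j, ex j = i
    · obtain ⟨j, rfl⟩ := hi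
      rw [ex.injective.extend_apply]
      simp [hex]
    · rw [Function.extend_apply' _ _ _ hi]
      rcases i with i | i | (i | i) | i
      · rfl
      · rfl
      · exact absurd ⟨i, rfl⟩ hi
      · rfl
      · rfl
  have h2' : ((Sum.elim (Sum.elim sel (Sum.elim c fun _ => false))
      (Sum.elim o (Sum.elim (Sum.elim d w) y)) : Bits (ClawQubits n anc N)) ∘ ex) = d := by
    ext i; simp [hex]
  rw [h2, h2', dot_comm x d, qRun_of_cRun_xor (f := fun (x : Bits (SelMsg n ⊕ Fin n)) (_ : Unit) =>
    maskedBit (fun i => x (.inl (.inl i))) (fun i => x (.inl (.inr (.inl i)))) fun i => x (.inr i))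
    htgt hrt hta hg₁ hr₁]
  · congr 1
    have h1 : Function.extend tgt (fun b => (Sum.elim (Sum.elim sel (Sum.elim c fun _ => false))
        (Sum.elim o (Sum.elim (Sum.elim x w) y)) : Bits (ClawQubits n anc N)) (tgt b) ^^ maskedBit sel c x)
        (Sum.elim (Sum.elim sel (Sum.elim c fun _ => false))
          (Sum.elim o (Sum.elim (Sum.elim x w) y)) : Bits (ClawQubits n anc N)) =
        (Sum.elim (Sum.elim sel (Sum.elim c fun _ => false)) (Sum.elim (fun _ => o () ^^ maskedBit sel c x)
          (Sum.elim (Sum.elim x w) y)) : Bits (ClawQubits n anc N)) := by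
      ext i
      by_cases hi : ∃ j, tgt j = i
      · obtain ⟨j, rfl⟩ := hi
        rw [htgt.extend_apply]
        simp [tgt]
      · rw [Function.extend_apply' _ _ _ hi]
        rcases i with i | i | i
        · rfl
        · exact absurd ⟨i, rfl⟩ hi
        · rfl
    refine (congrArg _ h1).trans ?_
    simp [initMsg]
  · intro s hs i
    have h4 : Φ (s ∘ Sum.inr) ≠ 0 := by
      intro h0
      apply hs
      simp [initMsg, h0]
    rw [show s ∘ Sum.inr = Sum.elim (fun u => s (.inr (.inl u))) (Sum.elim
      (fun w => s (.inr (.inr (.inl w)))) fun y => s (.inr (.inr (.inr y)))) by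
        ext (i | i | i) <;> rfl] at h4
    exact congrFun (hΦ _ _ _ h4) i

/-- The claw state determined by the output of a claw-state generator. -/
noncomputable def clawVec (a : Bits (ClawOut n)) : QVec (Fin n) :=
  clawKet (fun i => a (.inl i)) (fun i => a (.inr (.inl i))) (a (.inr (.inr ())))

/-- For each coin value, transcript and assignment of the other qubits this is `clawKet_overlap_le`
with `F` the masked bit. If the strings coincide, the claw vector is zero and there is nothing to
show. -/
theorem Sender.Extends.exists_role_receiver (hS : S'.Extends S e ec selMsg roleOut)
    (R : Receiver q T (Fin n)) : ∃ R' : Receiver q' (T + 1) Unit,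
      R'.size ≤ q' + R.size + 1000 * (n + 1) ^ 3 ∧
      sqOverlap S R Empty.elim clawVec ≤ sqOverlap S' R' Empty.elim fun a => hadamardKet (a 1) (a 0) := by
  obtain ⟨N, hN, hgs⟩ := exists_claw_gates n
  obtain ⟨gs, hlen, hrun⟩ := hgs R.anc
  obtain ⟨R', hsize, hR'⟩ := hS.exists_receiver R gs
  refine ⟨R', hsize.trans ?_, le_trans ?_ (hR' _ _)⟩
  · have : n + 1 ≤ (n + 1) ^ 3 := Nat.le_self_pow (by norm_num) _
    simp only [Fintype.card_unique, Fintype.card_fin]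
    lia
  rw [sqOverlap]
  refine Finset.expect_le_expect fun r _ => ?_
  rw [← Finset.expect_const (s := (Finset.univ : Finset (Bits (Fin n ⊕ Fin n)))) Finset.univ_nonempty
    (∑ t, ov (clawVec (S.result Empty.elim r t)) (R.stateN (S.msg Empty.elim r t) t T))]
  refine Finset.expect_le_expect fun c _ => Finset.sum_le_sum fun t _ => ?_
  set a := S.result Empty.elim r t
  set ψ := R.stateN (S.msg Empty.elim r t) t T with hψ
  rw [sum_bits_sum]
  -- Only replies that return the selector and the masks unchanged are kept; the remaining part of
  -- the reply is `d`.
  refine le_trans ?_ (Finset.single_le_sum (fun _ _ => Finset.sum_nonneg fun _ _ => ov_nonneg _ _)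
    (Finset.mem_univ (selector a)))
  rw [sum_bits_sum]
  refine le_trans ?_ (Finset.single_le_sum (fun _ _ => Finset.sum_nonneg fun _ _ => ov_nonneg _ _)
    (Finset.mem_univ c))
  have hm : selMsg (Sum.elim Empty.elim (Sum.elim c a)) =
      Sum.elim (selector a) (Sum.elim c fun _ => false) := rfl
  have ho : ∀ d, hadamardKet (roleOut (Sum.elim (Sum.elim Empty.elim (Sum.elim c a))
      (Sum.elim (selector a) (Sum.elim c d))) 1) (roleOut (Sum.elim (Sum.elim Empty.elim (Sum.elim c a))
      (Sum.elim (selector a) (Sum.elim c d))) 0) = hadamardKet (roleBit c a)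
        (ospBit (dot (fun i => c (.inl i)) fun i => a (.inl i)) (roleBit c a) (a (.inr (.inr ())))
          (fun i => a (.inl i)) (fun i => a (.inr (.inl i))) d) := fun _ => rfl
  have hpad : ∀ o w y, R.padState Unit (Fin N) (S.msg Empty.elim r t) t (Sum.elim o (Sum.elim w y)) =
      if (o = fun _ => false) ∧ y = fun _ => false then ψ w else 0 := by
    intro o w y
    rw [Receiver.padState]
    by_cases h : (o = fun _ => false) ∧ y = fun _ => false
    · rw [if_pos h, if_pos]
      · rfl
      · obtain ⟨rfl, rfl⟩ := h
        exact ⟨fun _ => rfl, fun _ => rfl⟩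
    · rw [if_neg h, if_neg]
      exact fun h' => h ⟨funext h'.1, funext h'.2⟩
  have hamp : ∀ d o w, qRun gs (initMsg (Sum.elim (selector a) (Sum.elim c fun _ => false))
      (R.padState Unit (Fin N) (S.msg Empty.elim r t) t)) (Sum.elim (Sum.elim (selector a) (Sum.elim c d))
        (Sum.elim o (Sum.elim (Sum.elim d w) fun _ => false))) =
      ((√2 : ℝ) : ℂ)⁻¹ ^ n * ∑ x, sgn (dot d x) *
        if (o = fun _ => maskedBit (selector a) c x) then ψ (Sum.elim x w) else 0 := by
    intro d o w
    rw [hrun]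
    · congr 1
      refine Finset.sum_congr rfl fun x _ => ?_
      rw [hpad]
      congr 1
      refine if_congr ?_ rfl rfl
      simp only [funext_iff, and_true]
      refine forall_congr' fun _ => ?_
      cases o () <;> cases maskedBit (selector a) c x <;> simp
    · intro o w y h
      rw [hpad] at h
      by_contra hy
      exact h (if_neg fun h' => hy h'.2)
  have hlow : ∀ d, ∑ w, ‖((√2 : ℝ) : ℂ)⁻¹ ^ n * ∑ x, sgn (dot d x) * (star (hadamardKet (roleBit c a)
        (ospBit (dot (fun i => c (.inl i)) fun i => a (.inl i)) (roleBit c a) (a (.inr (.inr ())))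
          (fun i => a (.inl i)) (fun i => a (.inr (.inl i))) d)
          fun _ => maskedBit (selector a) c x) * ψ (Sum.elim x w))‖ ^ 2 ≤
      ov (hadamardKet (roleBit c a)
        (ospBit (dot (fun i => c (.inl i)) fun i => a (.inl i)) (roleBit c a) (a (.inr (.inr ())))
          (fun i => a (.inl i)) (fun i => a (.inr (.inl i))) d)) (fun s =>
        qRun gs (initMsg (Sum.elim (selector a) (Sum.elim c fun _ => false))
      (R.padState Unit (Fin N) (S.msg Empty.elim r t) t)) (Sum.elim (Sum.elim (selector a) (Sum.elim c d)) s)) := by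
    intro d
    rw [ov, sum_bits_sum, sum_bits_sum]
    refine le_trans ?_ (Finset.single_le_sum (fun _ _ => Finset.sum_nonneg fun _ _ =>
      Finset.sum_nonneg fun _ _ => by positivity) (Finset.mem_univ d))
    refine Finset.sum_le_sum fun w _ => ?_
    refine le_trans (le_of_eq ?_) (Finset.single_le_sum (fun _ _ => by positivity)
      (Finset.mem_univ fun _ => false))
    refine congrArg (fun y => ‖y‖ ^ 2) ?_
    simp only [hamp, Finset.mul_sum]
    rw [Finset.sum_comm]
    refine Finset.sum_congr rfl fun x _ => ?_
    rw [Fintype.sum_eq_single fun _ => maskedBit (selector a) c x]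
    · rw [if_pos rfl]; ring
    · intro o ho
      rw [if_neg ho]; ring
  simp only [hm, ho]
  refine le_trans ?_ (Finset.sum_le_sum fun d _ => hlow d)
  rw [ov, Finset.sum_comm]
  refine Finset.sum_le_sum fun w _ => ?_
  by_cases hx : (fun i => a (.inl i)) = fun i => a (.inr (.inl i))
  · have : clawVec a = 0 := by rw [clawVec, clawKet, if_pos hx]
    rw [this]
    simp only [Pi.zero_apply, star_zero, zero_mul, Finset.sum_const_zero, norm_zero]
    rw [zero_pow two_ne_zero]
    exact Finset.sum_nonneg fun _ _ => by positivity
  · obtain ⟨h0, h1⟩ := maskedBit_selector c hx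
    have := clawKet_overlap_le (maskedBit (selector a) c) (fun i => a (.inl i))
      (fun i => a (.inr (.inl i))) (a (.inr (.inr ()))) fun x => ψ (Sum.elim x w)
    rw [h0, h1] at this
    exact this

end ROSP

/-! ### Security of random-input OSP from search security -/

section ROSPSecurity
variable {n q q' T : ℕ} {S : Sender q T Empty (ClawOut n)} {S' : Sender q' (T + 1) Empty (Fin 2)}
  {e : Fin q ⊕ SelMsg n ≃ Fin q'} {ec : Fin S.coins ⊕ (Fin n ⊕ Fin n) ≃ Fin S'.coins}

/-- The possible selectors. -/
def selectorOf (σ : Option (Fin n) × Bool) : Bits (Fin n ⊕ Unit) :=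
  Sum.elim (fun i => decide (σ.1 = some i)) fun _ => σ.2

/-- A selector is a position or none, together with a bit. There are only `2 (n + 1)` of them, few
enough to be guessed. -/
theorem exists_selectorOf_eq (a : Bits (ClawOut n)) : ∃ σ, selector a = selectorOf σ := by
  by_cases h : (fun i => a (.inl i)) = fun i => a (.inr (.inl i))
  · refine ⟨(none, false), ?_⟩
    have : ∀ i, firstDiff a i = false := by
      intro i
      rw [firstDiff, ← congrFun h i]
      simp
    ext (i | i)
    · simp [selector, selectorOf, this]
    · simp [selector, selectorOf, this, anyBits]
  · obtain ⟨i, -, hi⟩ := exists_selector_eq h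
    exact ⟨(some i, a (.inl i)), hi⟩

/-- The two strings output by a claw-state generator. -/
def clawPair (a : Bits (ClawOut n)) : Bits (Fin n ⊕ Fin n) :=
  Sum.elim (fun i => a (.inl i)) fun i => a (.inr (.inl i))

/-- This puts the secret bit in Goldreich–Levin form, with the masks as query and the pair of
strings as hidden word. -/
theorem roleBit_eq_dot (c : Bits (Fin n ⊕ Fin n)) (a : Bits (ClawOut n)) :
    roleBit c a = dot (clawPair a) c := by
  rw [← sgn_injective.eq_iff, roleBit, sgn_xor, sgn_dot, sgn_dot, sgn_dot, Fintype.prod_sum_type]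
  simp only [clawPair, Sum.elim_inl, Sum.elim_inr, Bool.and_comm]

open Classical in
-- The Goldreich–Levin circuit is run on the last response of `A` with a hard-wired selector `σ` and
-- the masks as query register. The bound is stated for each transcript, since the hidden word and
-- the correct `σ` depend on it.
theorem Receiver.exists_search_reduction (A : Receiver q' (T + 1) Unit) (e : Fin q ⊕ SelMsg n ≃ Fin q')
    (hT : 0 < T) (σ : Option (Fin n) × Bool) : ∃ B : Receiver q T (Fin n ⊕ Fin n),
      B.size ≤ q + T + q' + 2 * A.size + 20 * (T + 1) * (A.size + n + 1) * 4 ∧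
      ∀ (S : Sender q T Empty (ClawOut n)) r t,
        (𝔼 c, ∑ z, (if z (.inl (.inr (.inl ()))) = dot (clawPair (S.result Empty.elim r t)) c then
          (1 : ℝ) else -1) * ‖qRun ((A.step (Fin.last T)).map (QGate.map .inl))
            (A.baseMsg e (S.msg Empty.elim r t) t (msgJoin e (fun _ => false)
              (Sum.elim (selectorOf σ) (Sum.elim c fun _ => false)))) z‖ ^ 2) ^ 2 ≤
        (∑ h, ∑ w, ‖A.baseState e (S.msg Empty.elim r t) t h w‖ ^ 2) *
          ∑ w, if w ∘ Sum.inl = clawPair (S.result Empty.elim r t) then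
            ‖B.stateN (S.msg Empty.elim r t) t T w‖ ^ 2 else 0 := by
  let tgt : SelMsg n → RedQubits A (SelMsg n) (Fin n ⊕ Fin n) := fun m => .inl (.inl (.inl (e (.inr m))))
  have htgt : Function.Injective tgt := fun a b h => by
    simpa only [tgt, Sum.inl.injEq, e.injective.eq_iff, Sum.inr.injEq] using h
  -- The bits loaded into the message: the guessed selector, the query as masks, and zeros for the
  -- outcome. Each costs at most one gate.
  let φ : SelMsg n → Bits (RedQubits A (SelMsg n) (Fin n ⊕ Fin n)) → Bool := fun m s =>
    (Sum.elim (selectorOf σ) (Sum.elim (fun c => s (.inr c)) fun _ => false) : Bits (SelMsg n)) m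
  have hind : ∀ b s s', (∀ w, (∀ b', w ≠ tgt b') → s w = s' w) → φ b s = φ b s' := by
    rintro (b | b | b) s s' h
    · rfl
    · exact h _ fun b' => by simp [tgt]
    · rfl
  obtain ⟨P, hP, hlen, hrun⟩ := exists_qgates_toggle (φ := φ) (n := 1) htgt (by
    rintro (b | b | b)
    · rcases hb : selectorOf σ b with _ | _
      · have := Toggles.zero (W := RedQubits A (SelMsg n) (Fin n ⊕ Fin n)) (tgt (.inl b))
        refine ⟨fun s b => rfl, ?_⟩
        obtain ⟨-, gs, h1, h2, h3⟩ := this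
        refine ⟨gs, h1, by lia, fun s => ?_⟩
        rw [h3]
        simp [φ, hb]
      · have := Toggles.one (W := RedQubits A (SelMsg n) (Fin n ⊕ Fin n)) (tgt (.inl b))
        refine ⟨fun s b => rfl, ?_⟩
        obtain ⟨-, gs, h1, h2, h3⟩ := this
        refine ⟨gs, h1, by lia, fun s => ?_⟩
        rw [h3]
        simp [φ, hb]
    · exact Toggles.wire (W := RedQubits A (SelMsg n) (Fin n ⊕ Fin n)) (w := .inr b) (by simp [tgt])
    · obtain ⟨-, gs, h1, h2, h3⟩ := Toggles.zero (W := RedQubits A (SelMsg n) (Fin n ⊕ Fin n)) (tgt (.inr (.inr b)))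
      exact ⟨fun _ _ => rfl, gs, h1, by lia, h3⟩)
    fun b b' s c => hind b _ _ fun w hw => Function.update_of_ne (hw b') _ _
  obtain ⟨B, hsize, hB⟩ := A.exists_reduction e (Equiv.sumComm _ _)
    (glGates P ((A.step (Fin.last T)).map (QGate.map .inl)) (.inl (.inr (.inl ()))))
  refine ⟨B, hsize.trans ?_, fun S r t => ?_⟩
  · have h1 := length_glGates_le P ((A.step (Fin.last T)).map (QGate.map .inl)) (.inl (.inr (.inl ())))
    have h2 : (A.step (Fin.last T)).length ≤ A.size := by
      have := Finset.single_le_sum (f := fun i => (A.step i).length) (fun _ _ => Nat.zero_le _)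
        (Finset.mem_univ (Fin.last T))
      simp only [Receiver.size]
      lia
    have h3 : A.anc + T + 1 ≤ A.size := by simp only [Receiver.size]; lia
    simp only [List.length_map, Fintype.card_sum, Fintype.card_fin, Fintype.card_unique,
      Fintype.card_prod] at *
    have h4 := Nat.mul_le_mul_left T (h1.trans (show _ ≤ 70 * (A.size + n + 1) by lia))
    nlinarith
  · obtain ⟨w, hw1, hw2⟩ := hB hT (S.msg Empty.elim r t) t
    have hgl := goldreichLevin P ((A.step (Fin.last T)).map (QGate.map .inl)) (.inl (.inr (.inl ())))
      (A.baseMsg e (S.msg Empty.elim r t) t fun _ => false)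
      (fun c => A.baseMsg e (S.msg Empty.elim r t) t (msgJoin e (fun _ => false)
        (Sum.elim (selectorOf σ) (Sum.elim c fun _ => false)))) (by
        intro ψ s
        rw [qRun_of_cRun_toggle htgt hind hP hrun]
        have h1 : ∀ v, (∀ m, tgt m ≠ v) → Function.extend tgt (fun b => s (tgt b) ^^ φ b s) s v = s v :=
          fun v hv => Function.extend_apply' _ _ _ fun ⟨m, hm⟩ => hv m hm
        have h2 : Function.extend tgt (fun b => s (tgt b) ^^ φ b s) s ∘ Sum.inr = s ∘ Sum.inr := by
          ext i
          exact h1 _ fun m => by simp [tgt]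
        have h3 : (Function.extend tgt (fun b => s (tgt b) ^^ φ b s) s ∘ Sum.inl) ∘ Sum.inr =
            (s ∘ Sum.inl) ∘ Sum.inr := by
          ext i
          exact h1 _ fun m => by simp [tgt]
        have h4 : ((Function.extend tgt (fun b => s (tgt b) ^^ φ b s) s ∘ Sum.inl) ∘ Sum.inl) ∘ Sum.inr =
            ((s ∘ Sum.inl) ∘ Sum.inl) ∘ Sum.inr := by
          ext i
          exact h1 _ fun m => by simp [tgt]
        rw [h2]
        congr 1
        simp only [Receiver.baseMsg, initMsg]
        rw [h3, h4]
        refine if_congr ?_ rfl rfl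
        have hl : ∀ l, Function.extend tgt (fun b => s (tgt b) ^^ φ b s) s
            (.inl (.inl (.inl (e (.inl l))))) = s (.inl (.inl (.inl (e (.inl l))))) :=
          fun l => h1 _ fun m => by simp [tgt]
        have hm : ∀ m, Function.extend tgt (fun b => s (tgt b) ^^ φ b s) s
            (.inl (.inl (.inl (e (.inr m))))) = (s (.inl (.inl (.inl (e (.inr m))))) ^^ φ m s) :=
          fun m => htgt.extend_apply _ _ _
        have hxor : ∀ a b : Bool, (a ^^ b) = false ↔ a = b := by decide
        refine ⟨fun h => ?_, fun h => ?_⟩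
        · ext i
          obtain ⟨i | i, rfl⟩ := e.surjective i
          · have := congrFun h (e (.inl i))
            simp only [Function.comp_apply, hl] at this
            simpa [msgJoin] using this
          · have := congrFun h (e (.inr i))
            simp only [Function.comp_apply, hm, hxor] at this
            simp only [Function.comp_apply, this, msgJoin, Equiv.symm_apply_apply, Sum.elim_inr]
            rfl
        · ext i
          have := congrFun h i
          obtain ⟨i | i, rfl⟩ := e.surjective i
          · simp only [Function.comp_apply, msgJoin, Equiv.symm_apply_apply, Sum.elim_inl] at this
            simp only [Function.comp_apply, hl, this]
          · simp only [Function.comp_apply, msgJoin, Equiv.symm_apply_apply, Sum.elim_inr] at this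
            simp only [Function.comp_apply, hm, hxor, this]
            rfl)
      (clawPair (S.result Empty.elim r t))
    refine hgl.trans (mul_le_mul (le_of_eq ?_) (le_of_eq ?_) (Finset.sum_nonneg fun _ _ => by positivity)
      (Finset.sum_nonneg fun _ _ => Finset.sum_nonneg fun _ _ => by positivity))
    · exact sum_baseMsg A e _ _ _
    · rw [← Equiv.sum_comp w]
      refine Eq.trans ?_ (sum_bits_sum _).symm
      refine Finset.sum_congr rfl fun z _ => ?_
      rw [Fintype.sum_eq_single (clawPair (S.result Empty.elim r t))]
      · rw [if_pos, hw2]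
        · exact congrArg (fun χ => ‖qRun _ χ _‖ ^ 2) (funext fun z => if_congr funext_iff rfl rfl)
        · ext i
          simp [hw1]
      · intro x hx
        rw [if_neg]
        intro h
        apply hx
        rw [← h]
        ext i
        simp [hw1]

theorem Sender.eventProb_true {ι ο κ : Type} [DecidableEq ι] [Fintype κ] [DecidableEq κ]
    (S : Sender q T ι ο) (R : Receiver q T κ) (x : Bits ι) :
    eventProb S R x (fun _ _ => True) = 1 := by
  rw [_root_.eventProb_eq]
  simp only [if_true, S.sum_norm_sq_stateN]
  exact Finset.expect_const Finset.univ_nonempty _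

/-- Cauchy–Schwarz over coins and transcripts, combining the transcript-wise bounds into one on the
average bias. -/
theorem sq_expect_sum_le {R I : Type} [Fintype R] [Fintype I] (β N P : R → I → ℝ)
    (hN : ∀ r i, 0 ≤ N r i) (hP : ∀ r i, 0 ≤ P r i) (h : ∀ r i, β r i ^ 2 ≤ N r i * P r i) :
    (𝔼 r, ∑ i, β r i) ^ 2 ≤ (𝔼 r, ∑ i, N r i) * 𝔼 r, ∑ i, P r i := by
  have key := Finset.sum_sq_le_sum_mul_sum_of_sq_le_mul (Finset.univ : Finset (R × I))
    (r := fun p => β p.1 p.2) (fun p _ => hN p.1 p.2) (fun p _ => hP p.1 p.2) fun p _ => h p.1 p.2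
  simp only [Fintype.sum_prod_type] at key
  simp only [Fintype.expect_eq_sum_div_card]
  rw [div_pow, div_mul_div_comm, ← sq]
  exact div_le_div_of_nonneg_right key (sq_nonneg _)

/-- On every transcript one of the reductions uses the true selector. Bounding its success by the
sum over all selectors removes the dependence on the transcript. -/
theorem Sender.Extends.exists_search_reductions (hS : S'.Extends S e ec selMsg roleOut) (hT : 0 < T)
    (A : Receiver q' (T + 1) Unit) : ∃ B : Option (Fin n) × Bool → Receiver q T (Fin n ⊕ Fin n),
      (∀ σ, (B σ).size ≤ q + T + q' + 2 * A.size + 20 * (T + 1) * (A.size + n + 1) * 4) ∧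
      (2 * eventProb S' A Empty.elim (fun a o => o () = a 1) - 1) ^ 2 ≤
        ∑ σ, eventProb S (B σ) Empty.elim fun a o => o = clawPair a := by
  classical
  choose B hsize hB using A.exists_search_reduction e hT
  refine ⟨B, hsize, ?_⟩
  have hm : ∀ (c : Bits (Fin n ⊕ Fin n)) (a : Bits (ClawOut n)), selMsg (Sum.elim Empty.elim (Sum.elim c a)) =
      Sum.elim (selector a) (Sum.elim c fun _ => false) := fun _ _ => rfl
  choose σ hσ using exists_selectorOf_eq (n := n)
  have hN : 𝔼 r : Bits (Fin S.coins), ∑ t, ∑ h, ∑ w,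
      ‖A.baseState e (S.msg Empty.elim r t) t h w‖ ^ 2 = 1 := by
    have h1 := S'.eventProb_true A Empty.elim
    rw [hS.eventProb_eq A _ _ (fun _ _ _ => True) fun _ _ _ _ => Iff.rfl] at h1
    rw [← h1]
    refine Finset.expect_congr rfl fun r _ => ?_
    simp only [if_true, sum_norm_sq_qRun, sum_baseMsg]
    exact (Finset.expect_const Finset.univ_nonempty _).symm
  set β : Bits (Fin S.coins) → (Fin T → Bits (Fin q)) → ℝ := fun r t =>
    𝔼 c, ∑ z, (if z (.inl (.inr (.inl ()))) = dot (clawPair (S.result Empty.elim r t)) c then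
      (1 : ℝ) else -1) * ‖qRun ((A.step (Fin.last T)).map (QGate.map .inl))
        (A.baseMsg e (S.msg Empty.elim r t) t (msgJoin e (fun _ => false)
          (Sum.elim (selector (S.result Empty.elim r t)) (Sum.elim c fun _ => false)))) z‖ ^ 2 with hβ
  -- Twice the probability of a correct guess minus the total weight is the signed average of the
  -- bias.
  have h2 : 2 * eventProb S' A Empty.elim (fun a o => o () = a 1) - 1 = 𝔼 r, ∑ t, β r t := by
    rw [hS.eventProb_eq A _ _ (fun c a o => o () = dot (clawPair a) c) fun c a d o => by
      rw [← roleBit_eq_dot]; rfl, ← hN, Finset.mul_expect, ← Finset.expect_sub_distrib]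
    refine Finset.expect_congr rfl fun r _ => ?_
    simp only [hβ]
    rw [← Finset.expect_sum_comm, Finset.mul_expect,
      ← Finset.expect_const (s := (Finset.univ : Finset (Bits (Fin n ⊕ Fin n)))) Finset.univ_nonempty
        (∑ t, ∑ h, ∑ w, ‖A.baseState e (S.msg Empty.elim r t) t h w‖ ^ 2), ← Finset.expect_sub_distrib]
    refine Finset.expect_congr rfl fun c _ => ?_
    rw [Finset.mul_sum, ← Finset.sum_sub_distrib]
    refine Finset.sum_congr rfl fun t _ => ?_
    rw [hm, ← sum_baseMsg A e _ _ (msgJoin e (fun _ => false) (Sum.elim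
      (selector (S.result Empty.elim r t)) (Sum.elim c fun _ => false))),
      ← sum_norm_sq_qRun ((A.step (Fin.last T)).map (QGate.map .inl)), Finset.mul_sum,
      ← Finset.sum_sub_distrib]
    refine Finset.sum_congr rfl fun z _ => ?_
    split_ifs <;> ring
  rw [h2]
  have h3 := sq_expect_sum_le β (fun r t => ∑ h, ∑ w, ‖A.baseState e (S.msg Empty.elim r t) t h w‖ ^ 2)
    (fun r t => ∑ σ, ∑ w, if w ∘ Sum.inl = clawPair (S.result Empty.elim r t) then
      ‖(B σ).stateN (S.msg Empty.elim r t) t T w‖ ^ 2 else 0)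
    (fun _ _ => Finset.sum_nonneg fun _ _ => Finset.sum_nonneg fun _ _ => by positivity)
    (fun _ _ => Finset.sum_nonneg fun _ _ => Finset.sum_nonneg fun _ _ => by split_ifs <;> positivity)
    fun r t => by
      have h4 := hB (σ (S.result Empty.elim r t)) S r t
      rw [← hσ] at h4
      refine h4.trans (mul_le_mul_of_nonneg_left ?_ (Finset.sum_nonneg fun _ _ =>
        Finset.sum_nonneg fun _ _ => by positivity))
      exact Finset.single_le_sum (f := fun σ => ∑ w, if w ∘ Sum.inl = clawPair (S.result Empty.elim r t) then
        ‖(B σ).stateN (S.msg Empty.elim r t) t T w‖ ^ 2 else 0) (fun _ _ => Finset.sum_nonneg fun _ _ => by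
        split_ifs <;> positivity) (Finset.mem_univ _)
  rw [hN, one_mul] at h3
  refine h3.trans (le_of_eq ?_)
  simp only [_root_.eventProb_eq]
  rw [← Finset.expect_sum_comm]
  refine Finset.expect_congr rfl fun r _ => ?_
  rw [Finset.sum_comm]
  refine Finset.sum_congr rfl fun y _ => Finset.sum_congr rfl fun t _ =>
    Finset.sum_congr rfl fun w _ => ?_
  by_cases h : w ∘ Sum.inl = clawPair (S.result Empty.elim r t)
  · rw [if_pos h, if_pos h]
  · rw [if_neg h, if_neg h]

/-- Without rounds the receiver holds `|0⟩`, whose squared overlap with a claw state is at most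
`1/2`; correctness would require more. -/
theorem IsSearchSecureCSG.eventually_rounds_pos {n : ℕ → ℕ} {P : CSGProtocol n}
    (hP : IsSearchSecureCSG P) : ∀ᶠ k in Filter.atTop, 0 < P.T k := by
  filter_upwards [hP.correct.eventually_lt (show (0 : ℝ) < 1 / 4 by norm_num)] with k h2
  by_contra hT
  replace hT : P.T k = 0 := by lia
  have h3 := two_mul_expectedOverlap_le (P.S k) (P.R k) Empty.elim
    (v := clawVec) fun a => unitOrZero_clawKet _ _ _
  rw [sqOverlap_of_rounds_eq_zero hT _ _ _ _ fun _ _ => false] at h3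
  have h5 : ∀ a : Bits (ClawOut (n k)), ‖clawVec a fun _ => false‖ ^ 2 ≤ 1 / 2 := by
    intro a
    have h' : ‖((√2 : ℝ) : ℂ)⁻¹‖ ^ 2 = 1 / 2 := by
      rw [sq, ← norm_mul, sqrt_two_inv_mul_self]; norm_num
    rw [clawVec, clawKet]
    by_cases h : (fun i => a (.inl i)) = fun i => a (.inr (.inl i))
    · simp [if_pos h]
    · rw [if_neg h]
      simp only [Pi.smul_apply, Pi.add_apply, smul_eq_mul, norm_mul, mul_pow, h', ket]
      refine mul_le_of_le_one_right (by norm_num) (pow_le_one₀ (norm_nonneg _) ?_)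
      by_cases h1 : (fun _ => false) = fun i => a (.inl i)
      · rw [if_pos h1, if_neg fun h2 => h (h1.symm.trans h2)]
        simp
      · rw [if_neg h1]
        split_ifs <;> simp
  have h6 := Finset.expect_le_expect (s := Finset.univ) fun r (_ : r ∈ Finset.univ) =>
    h5 ((P.S k).result Empty.elim r fun _ _ => false)
  rw [Finset.expect_const Finset.univ_nonempty] at h6
  have h7 : 1 - expectedOverlap (P.S k) (P.R k) Empty.elim clawVec < 1 / 4 := h2
  linarith

theorem IsSearchSecureCSG.exists_isRandomOSP {n : ℕ → ℕ} {P : CSGProtocol n}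
    (hP : IsSearchSecureCSG P) : ∃ P' : RandomOSPProtocol, IsRandomOSP P' := by
  let e : ∀ k, Fin (P.q k) ⊕ SelMsg (n k) ≃ Fin (P.q k + (4 * n k + 1)) := fun k =>
    Fintype.equivFinOfCardEq (by simp; ring)
  choose S' ec hS hsize using fun k => (P.S k).exists_extends (e k) bComp_selMsg bComp_roleOut
  choose R' hsize' hR' using fun k => (hS k).exists_role_receiver (P.R k)
  have hPS := polyBounded_iff.1 hP.efficient.1
  have hPR := polyBounded_iff.1 hP.efficient.2
  have hcl : ∀ k, 2 * n k + P.q k + P.T k ≤ (P.S k).size := fun k => by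
    simp only [Sender.size, Fintype.card_sum, Fintype.card_fin]
    lia
  have hn : PolyNat fun k => n k := hPS.mono fun k => by have := hcl k; lia
  have hn3 : PolyNat fun k => (n k + 1) ^ 3 := (hn.add (PolyNat.const 1)).pow 3
  have hle : ∀ k, n k + 1 ≤ (n k + 1) ^ 3 := fun k => Nat.le_self_pow (by norm_num) _
  refine ⟨{ q := fun k => P.q k + (4 * n k + 1), T := fun k => P.T k + 1, S := S', R := R' },
    ⟨?_, ?_⟩, ?_, fun A => ?_⟩
  · refine polyBounded_iff.2 (((((PolyNat.const 10).mul hPS).add (hPS.mul ((PolyNat.const 4).mul hn3))).add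
      ((PolyNat.const 1000).mul hn3)).mono fun k => ?_)
    refine (hsize k).trans ?_
    have h1 := Nat.mul_le_mul_left (P.S k).size (show 4 * n k + 1 ≤ 4 * (n k + 1) ^ 3 by
      have := hle k; lia)
    have h2 := hle k
    simp only [Fintype.card_sum, Fintype.card_fin, Fintype.card_unique, Fintype.card_empty]
    rw [show n k + 1 + (n k + n k + n k) = 4 * n k + 1 by ring]
    lia
  · refine polyBounded_iff.2 (((hPR.mul (PolyNat.const 2)).add ((PolyNat.const 1010).mul hn3)).mono
      fun k => ?_)
    refine (hsize' k).trans ?_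
    have h1 : P.q k ≤ (P.R k).size := by simp only [Receiver.size]; lia
    have h2 := hle k
    lia
  · refine (hP.correct.const_mul 2).mono (Filter.Eventually.of_forall fun k => ?_)
    have h1 := sqOverlap_le_expectedOverlap (S' k) (R' k) Empty.elim
      (v := fun a => hadamardKet (a 1) (a 0)) fun _ => unitOrZero_hadamardKet _ _
    have h2 := two_mul_expectedOverlap_le (P.S k) (P.R k) Empty.elim
      (v := clawVec) fun a => unitOrZero_clawKet _ _ _
    have h3 := hR' k
    change _ ≤ ((2 : ℕ) : ℝ) * (1 - expectedOverlap (P.S k) (P.R k) Empty.elim clawVec)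
    push_cast
    linarith
  · have hex : ∀ k, ∃ B : Receiver (P.q k) (P.T k) (Fin (n k) ⊕ Fin (n k)),
        B.size ≤ P.q k + P.T k + (P.q k + (4 * n k + 1)) + 2 * (A.R k).size +
          20 * (P.T k + 1) * ((A.R k).size + n k + 1) * 4 ∧ (0 < P.T k →
        |eventProb (S' k) (A.R k) Empty.elim (fun a o => o () = a 1) - 1 / 2| ^ 2 ≤
        ((n k + 1 : ℕ) : ℝ) * eventProb (P.S k) B Empty.elim fun a o => o = clawPair a) := by
      intro k
      by_cases hT : 0 < P.T k
      · obtain ⟨B, h1, h2⟩ := (hS k).exists_search_reductions hT (A.R k)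
        obtain ⟨σ, hσ⟩ := Finite.exists_max fun σ => eventProb (P.S k) (B σ) Empty.elim fun a o =>
          o = clawPair a
        refine ⟨B σ, h1 σ, fun _ => ?_⟩
        -- The best of the `2 (n + 1)` selectors is fixed for each `k`; half of this factor remains
        -- after division by `4`, which is less than `n + 1`.
        have h3 := h2.trans (Finset.sum_le_card_nsmul _ _ _ fun σ' _ => hσ σ')
        simp only [Finset.card_univ, Fintype.card_prod, Fintype.card_option, Fintype.card_fin,
          Fintype.card_bool, nsmul_eq_mul] at h3
        rw [sq_abs]
        push_cast at h3 ⊢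
        nlinarith
      · refine ⟨{ anc := 0, step := fun _ => [] }, ?_, fun h => (hT h).elim⟩
        simp [Receiver.size]
        lia
    choose B hBsize hB using hex
    have hB' : PolyBounded fun k => ((B k).size : ℝ) := by
      have hA := polyBounded_iff.1 A.qpt
      refine polyBounded_iff.2 ((((((PolyNat.const 5).mul hPS).add (PolyNat.const 5)).add
        ((PolyNat.const 2).mul hA)).add (((PolyNat.const 80).mul (hPS.add (PolyNat.const 1))).mul
          ((hA.add hPS).add (PolyNat.const 1)))).mono fun k => ?_)
      refine (hBsize k).trans ?_
      have h1 := hcl k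
      have h2 : (P.T k + 1) * ((A.R k).size + n k + 1) ≤
          ((P.S k).size + 1) * ((A.R k).size + (P.S k).size + 1) := Nat.mul_le_mul (by lia) (by lia)
      lia
    have hsec := (hP.search_secure ⟨B, hB'⟩).poly_mul (hn.add (PolyNat.const 1))
    refine Negligible.of_sq_le hsec ?_
    filter_upwards [hP.eventually_rounds_pos] with k hk
    refine (hB k hk).trans (le_of_eq ?_)
    congr 1
    refine congrArg _ (funext fun a => funext fun o => propext ?_)
    simp only [funext_iff, Sum.forall]
    rfl

end ROSPSecurity

/-! ### Expectations over independent instances -/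

theorem sum_bits_prod {I A R : Type} [Fintype I] [DecidableEq I] [Fintype A] [DecidableEq A]
    [CommSemiring R] (g : I → Bits A → R) :
    ∑ s : Bits (I × A), ∏ i, g i (fun a => s (i, a)) = ∏ i, ∑ w, g i w := by
  rw [Finset.prod_univ_sum, Fintype.piFinset_univ]
  exact Fintype.sum_equiv (Equiv.curry I A Bool) _ _ fun s => rfl

/-- Independence of the instances: expectations of products factor. -/
theorem expect_sum_bits_prod {I A B : Type} [Fintype I] [DecidableEq I] [Fintype A] [DecidableEq A]
    [Fintype B] [DecidableEq B] (f : I → Bits A → Bits B → ℝ) :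
    𝔼 r : Bits (I × A), ∑ y : Bits (I × B), ∏ i, f i (fun a => r (i, a)) (fun b => y (i, b)) =
      ∏ i, 𝔼 r, ∑ y, f i r y := by
  have h : ∀ r : Bits (I × A), ∑ y : Bits (I × B), ∏ i, f i (fun a => r (i, a)) (fun b => y (i, b)) =
      ∏ i, ∑ y, f i (fun a => r (i, a)) y := fun r =>
    sum_bits_prod fun i y => f i (fun a => r (i, a)) y
  simp only [h, Fintype.expect_eq_sum_div_card, Finset.prod_div_distrib, Finset.prod_const]
  rw [sum_bits_prod fun i r => ∑ y, f i r y]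
  congr 1
  simp [← pow_mul, mul_comm]

/-- The contribution of the `i`-th instance to the event that the `j`-th is the first success. -/
def firstFactor {K Y : Type} {M : ℕ} (ok : K → Y → Bool) (p o : K → Y → ℝ) (j i : Fin M) (r : K)
    (y : Y) : ℝ :=
  if i < j then (if ok r y then 0 else p r y) else if i = j then (if ok r y then o r y else 0)
  else p r y

/-- That `j` is the first success means failure of the instances before `j`, success at `j` and no
condition afterwards, with respective factors `1 - S`, `O` and `1`. Here `O` replaces the
probability of success by the weight of the correct output. -/
theorem expect_firstFactor {A B : Type} [Fintype A] [DecidableEq A] [Fintype B] [DecidableEq B]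
    (ok : Bits A → Bits B → Bool) (p o : Bits A → Bits B → ℝ) (hp : ∀ r, ∑ y, p r y = 1) {S O : ℝ}
    (hS : 𝔼 r, ∑ y, (if ok r y then p r y else 0) = S)
    (hO : 𝔼 r, ∑ y, (if ok r y then o r y else 0) = O) (M : ℕ) :
    𝔼 r : Bits (Fin M × A), ∑ y : Bits (Fin M × B), ∑ j : Fin M,
      ∏ i, firstFactor ok p o j i (fun a => r (i, a)) (fun b => y (i, b)) =
      ∑ j ∈ Finset.range M, (1 - S) ^ j * O := by
  have h1 : ∀ j i : Fin M, 𝔼 r, ∑ y, firstFactor ok p o j i r y =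
      if i < j then 1 - S else if i = j then O else 1 := by
    intro j i
    unfold firstFactor
    split_ifs with h h'
    · rw [← hS, show (1 : ℝ) = 𝔼 r : Bits A, ∑ y, p r y by
        simp only [hp]; exact (Finset.expect_const Finset.univ_nonempty _).symm,
        ← Finset.expect_sub_distrib]
      refine Finset.expect_congr rfl fun r _ => ?_
      rw [← Finset.sum_sub_distrib]
      refine Finset.sum_congr rfl fun y _ => ?_
      split_ifs <;> simp
    · exact hO
    · simp only [hp]
      exact Finset.expect_const Finset.univ_nonempty _
  simp only [Finset.sum_comm (s := Finset.univ (α := Bits (Fin M × B)))]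
  rw [Finset.expect_sum_comm, ← Fin.sum_univ_eq_sum_range (fun j => (1 - S) ^ j * O)]
  refine Finset.sum_congr rfl fun j _ => ?_
  rw [expect_sum_bits_prod fun i => firstFactor ok p o j i]
  simp only [h1, Finset.prod_ite, Finset.prod_const, one_pow, mul_one]
  congr 1
  · congr 1
    rw [show (Finset.univ.filter fun i => i < j) = Finset.Iio j by ext; simp, Fin.card_Iio]
  · rw [Finset.card_eq_one.2 ⟨j, by ext i; simp; rintro rfl; exact le_rfl⟩, pow_one]

/-- With `S` in place of `O` the sum is geometric and equals `1 - (1 - S) ^ M`. Each of the `M`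
terms loses at most `δ` by the replacement. -/
theorem one_sub_sum_firstSuccess_le {S O δ : ℝ} (hS0 : 0 ≤ S) (hS1 : S ≤ 1) (h : S - O ≤ δ)
    (hδ : 0 ≤ δ) (M : ℕ) :
    1 - ∑ j ∈ Finset.range M, (1 - S) ^ j * O ≤ (1 - S) ^ M + M * δ := by
  have h1 : ∑ j ∈ Finset.range M, (1 - S) ^ j * S = 1 - (1 - S) ^ M := by
    have := mul_neg_geom_sum (1 - S) M
    rw [← Finset.sum_mul]
    linarith
  have h2 : ∑ j ∈ Finset.range M, ((1 - S) ^ j * S - (1 - S) ^ j * O) ≤ ∑ j ∈ Finset.range M, δ := by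
    refine Finset.sum_le_sum fun j _ => ?_
    have h3 : (1 - S) ^ j ≤ 1 := pow_le_one₀ (by linarith) (by linarith)
    have h4 : 0 ≤ (1 - S) ^ j := pow_nonneg (by linarith) _
    nlinarith
  rw [Finset.sum_sub_distrib, h1] at h2
  simp at h2
  linarith

/-! ### Claw states close to the ideal superposition -/

section Balanced
variable {n : ℕ} {β : Type} [Fintype β] [DecidableEq β]

theorem clawKet_false_apply {x₀ x₁ : Bits (Fin n)} (h : x₀ ≠ x₁) (x : Bits (Fin n)) :
    clawKet x₀ x₁ false x = if x = x₀ ∨ x = x₁ then ((√2 : ℝ) : ℂ)⁻¹ else 0 := by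
  rw [clawKet, if_neg h]
  by_cases h0 : x = x₀
  · subst h0
    simp [ket, h]
  · by_cases h1 : x = x₁
    · subst h1
      simp [ket, Ne.symm h]
    · simp [ket, h0, h1]

/-- `y` has exactly the two preimages `x₀` and `x₁`. -/
structure IsTwoPreimage (F : Bits (Fin n) → β) (y : β) (x₀ x₁ : Bits (Fin n)) : Prop where
  ne : x₀ ≠ x₁
  left : F x₀ = y
  right : F x₁ = y
  eq_or_eq : ∀ x, F x = y → x = x₀ ∨ x = x₁

theorem IsTwoPreimage.clawKet_apply {F : Bits (Fin n) → β} {y : β} {x₀ x₁ : Bits (Fin n)}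
    (h : IsTwoPreimage F y x₀ x₁) (x : Bits (Fin n)) :
    clawKet x₀ x₁ false x = if F x = y then ((√2 : ℝ) : ℂ)⁻¹ else 0 := by
  rw [clawKet_false_apply h.ne]
  refine if_congr ⟨?_, h.eq_or_eq x⟩ rfl rfl
  rintro (rfl | rfl)
  exacts [h.left, h.right]

theorem IsTwoPreimage.sum_ite {M : Type} [AddCommMonoid M] {F : Bits (Fin n) → β} {y : β}
    {x₀ x₁ : Bits (Fin n)} (h : IsTwoPreimage F y x₀ x₁) (g : Bits (Fin n) → M) :
    ∑ x, (if F x = y then g x else 0) = g x₀ + g x₁ := by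
  rw [← Finset.sum_filter, show (Finset.univ.filter fun x => F x = y) = {x₀, x₁} by
    ext x
    simp only [Finset.mem_filter, Finset.mem_univ, true_and, Finset.mem_insert, Finset.mem_singleton]
    exact ⟨h.eq_or_eq x, by rintro (rfl | rfl); exacts [h.left, h.right]⟩, Finset.sum_pair h.ne]

theorem traceNorm_nonneg {σ : Type} [Fintype σ] [DecidableEq σ] {A : Matrix σ σ ℂ}
    (hA : A.IsHermitian) : 0 ≤ traceNorm A :=
  (abs_nonneg _).trans (abs_re_trace_mul_le_traceNorm (L := 0) hA (by simp) (by simp))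

variable {ρ : Matrix (Bits (Fin n)) (Bits (Fin n)) ℂ} {D : Bits (Fin n) → ℝ} {ε₁ ε₂ : ℝ}

theorem isHermitian_vecMulVec_star {σ : Type} (ψ : σ → ℂ) :
    (Matrix.vecMulVec ψ (star ψ)).IsHermitian := by
  rw [Matrix.IsHermitian, Matrix.conjTranspose_vecMulVec, star_star]

/-- The test projector is diagonal, and the diagonal of the ideal state is `D`. The factor `2` is
that between trace norm and trace distance. -/
theorem abs_sum_diag_sub_le (hρ : ρ.IsHermitian) (hD : ∀ x, 0 ≤ D x)
    (hd : traceDist ρ (Matrix.vecMulVec (fun x => ((√(D x) : ℝ) : ℂ))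
      (star fun x => ((√(D x) : ℝ) : ℂ))) ≤ ε₁) (P : Bits (Fin n) → Bool) :
    |∑ x, (if P x then (ρ x x).re else 0) - ∑ x, if P x then D x else 0| ≤ 2 * ε₁ := by
  have hA := hρ.sub (isHermitian_vecMulVec_star fun x => ((√(D x) : ℝ) : ℂ))
  have h1 := abs_re_trace_mul_le_traceNorm hA (L := Matrix.diagonal fun x => if P x then 1 else 0)
    (Matrix.isHermitian_diagonal_of_self_adjoint _ (by
      ext x; by_cases h : P x <;> simp [h])) (by
      rw [Matrix.diagonal_mul_diagonal]
      congr 1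
      ext x
      by_cases h : P x <;> simp [h])
  rw [traceDist] at hd
  have h2 : (Matrix.diagonal (fun x => if P x then (1 : ℂ) else 0) * (ρ - Matrix.vecMulVec
      (fun x => ((√(D x) : ℝ) : ℂ)) (star fun x => ((√(D x) : ℝ) : ℂ)))).trace.re =
      ∑ x, (if P x then (ρ x x).re else 0) - ∑ x, if P x then D x else 0 := by
    simp only [Matrix.trace, Matrix.diag_apply, Matrix.diagonal_mul, Complex.re_sum,
      ← Finset.sum_sub_distrib]
    refine Finset.sum_congr rfl fun x _ => ?_
    by_cases h : P x
    · simp [h, Matrix.vecMulVec_apply, ← Complex.ofReal_mul, Real.mul_self_sqrt (hD x)]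
    · simp [h]
  rw [h2] at h1
  linarith

/-- The weight of the claw states in `ρ`. -/
noncomputable def clawWeight (ρ : Matrix (Bits (Fin n)) (Bits (Fin n)) ℂ) (good : β → Bool)
    (x₀ x₁ : β → Bits (Fin n)) : ℝ :=
  ∑ y, if good y then (star (clawKet (x₀ y) (x₁ y) false) ⬝ᵥ
    (ρ.mulVec (clawKet (x₀ y) (x₁ y) false))).re else 0

/-- Claw states of different images have disjoint supports, so their projectors add up to a
projector `L`. On the ideal state, `L` accepts with probability at least `1 - ε₂ / 2` times the mass
of the good images; passing to `ρ` costs `2 * ε₁`. -/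
theorem sub_le_clawWeight (hρ : ρ.IsHermitian) (hD : ∀ x, 0 ≤ D x) (hD1 : ∑ x, D x = 1)
    (hd : traceDist ρ (Matrix.vecMulVec (fun x => ((√(D x) : ℝ) : ℂ))
      (star fun x => ((√(D x) : ℝ) : ℂ))) ≤ ε₁)
    {F : Bits (Fin n) → β} {good : β → Bool} {x₀ x₁ : β → Bits (Fin n)}
    (h2 : ∀ y, good y = true → IsTwoPreimage F y (x₀ y) (x₁ y)) (hε₂ : 0 ≤ ε₂)
    (hbal : ∀ y, good y = true → |D (x₀ y) / (D (x₀ y) + D (x₁ y)) -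
      D (x₁ y) / (D (x₀ y) + D (x₁ y))| ≤ ε₂) :
    ∑ x, (if good (F x) then D x else 0) - ε₂ / 2 - 2 * ε₁ ≤ clawWeight ρ good x₀ x₁ := by
  set ψ : Bits (Fin n) → ℂ := fun x => ((√(D x) : ℝ) : ℂ) with hψ
  have hA := hρ.sub (isHermitian_vecMulVec_star ψ)
  set v : β → Bits (Fin n) → ℂ := fun y => if good y then clawKet (x₀ y) (x₁ y) false else 0 with hv
  have hs2 := sqrt_two_inv_mul_self
  have hst : star ((√2 : ℝ) : ℂ)⁻¹ = ((√2 : ℝ) : ℂ)⁻¹ := by simp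
  -- Fibres of `F` over different images are disjoint; each good fibre consists of two points of
  -- weight `1/2`.
  have horth : ∀ y y', star (v y) ⬝ᵥ v y' = if y = y' ∧ good y then 1 else 0 := by
    intro y y'
    by_cases hy : good y
    · by_cases hy' : good y'
      · simp only [hv, if_pos hy, if_pos hy', dotProduct, Pi.star_apply, (h2 y hy).clawKet_apply,
          (h2 y' hy').clawKet_apply]
        by_cases hyy : y = y'
        · subst hyy
          rw [if_pos ⟨rfl, hy⟩]
          have : ∀ x, star (if F x = y then ((√2 : ℝ) : ℂ)⁻¹ else 0) *
              (if F x = y then ((√2 : ℝ) : ℂ)⁻¹ else 0) = if F x = y then (1 / 2 : ℂ) else 0 := by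
            intro x
            split_ifs
            · rw [hst, hs2]
            · simp
          simp only [this]
          rw [(h2 y hy).sum_ite fun _ => (1 / 2 : ℂ)]
          norm_num
        · rw [if_neg fun h => hyy h.1]
          refine Finset.sum_eq_zero fun x _ => ?_
          by_cases hx : F x = y
          · rw [if_neg (show ¬ F x = y' from fun h => hyy (hx.symm.trans h)), mul_zero]
          · rw [if_neg hx, star_zero, zero_mul]
      · simp [hv, hy', show ¬ (y = y' ∧ good y = true) from fun h => hy' (h.1 ▸ h.2)]
    · simp [hv, hy]
  set L : Matrix (Bits (Fin n)) (Bits (Fin n)) ℂ := ∑ y, Matrix.vecMulVec (v y) (star (v y)) with hL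
  have hLh : L.IsHermitian := by
    rw [Matrix.IsHermitian, hL, Matrix.conjTranspose_sum]
    exact Finset.sum_congr rfl fun y _ => isHermitian_vecMulVec_star _
  have hLL : L * L = L := by
    rw [hL, Finset.sum_mul]
    refine Finset.sum_congr rfl fun y _ => ?_
    rw [Finset.mul_sum, Fintype.sum_eq_single y]
    · rw [Matrix.vecMulVec_mul_vecMulVec, horth]
      by_cases hy : good y <;> simp [hy, hv]
    · intro y' hy'
      rw [Matrix.vecMulVec_mul_vecMulVec, horth, if_neg fun h => hy' h.1.symm]
      simp
  have htr : ∀ B : Matrix (Bits (Fin n)) (Bits (Fin n)) ℂ,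
      (L * B).trace = ∑ y, star (v y) ⬝ᵥ B.mulVec (v y) := by
    intro B
    rw [hL, Finset.sum_mul, Matrix.trace_sum]
    refine Finset.sum_congr rfl fun y _ => ?_
    rw [Matrix.vecMulVec_mul, Matrix.trace_vecMulVec, Matrix.dotProduct_mulVec, dotProduct_comm]
  have key := abs_re_trace_mul_le_traceNorm hA hLh hLL
  rw [mul_sub, Matrix.trace_sub, Complex.sub_re, htr, htr, Complex.re_sum, Complex.re_sum] at key
  have hw : ∑ y, (star (v y) ⬝ᵥ ρ.mulVec (v y)).re = clawWeight ρ good x₀ x₁ := by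
    rw [clawWeight]
    refine Finset.sum_congr rfl fun y _ => ?_
    by_cases hy : good y <;> simp [hv, hy]
  have hD' : ∑ x, (if good (F x) then D x else 0) = ∑ y, if good y then D (x₀ y) + D (x₁ y) else 0 := by
    rw [← Finset.sum_fiberwise Finset.univ F]
    refine Finset.sum_congr rfl fun y _ => ?_
    rw [Finset.sum_filter]
    by_cases hy : good y
    · rw [if_pos hy, ← (h2 y hy).sum_ite D]
      refine Finset.sum_congr rfl fun x _ => ?_
      by_cases hx : F x = y
      · rw [if_pos hx, if_pos hx, hx, if_pos hy]
      · rw [if_neg hx, if_neg hx]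
    · rw [if_neg hy]
      refine Finset.sum_eq_zero fun x _ => ?_
      by_cases hx : F x = y
      · rw [if_pos hx, hx, if_neg hy]
      · rw [if_neg hx]
  have hD1' : ∑ x, (if good (F x) then D x else 0) ≤ 1 := by
    rw [← hD1]
    refine Finset.sum_le_sum fun x _ => ?_
    split_ifs
    exacts [le_rfl, hD x]
  have hψv : ∀ y, good y = true → (D (x₀ y) + D (x₁ y)) * (1 - ε₂ / 2) ≤
      (star (v y) ⬝ᵥ (Matrix.vecMulVec ψ (star ψ)).mulVec (v y)).re := by
    intro y hy
    have h3 : star ψ ⬝ᵥ v y = ((√2 : ℝ) : ℂ)⁻¹ * ((√(D (x₀ y)) + √(D (x₁ y)) : ℝ) : ℂ) := by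
      simp only [hv, if_pos hy, dotProduct, (h2 y hy).clawKet_apply, Pi.star_apply, mul_ite, mul_zero]
      rw [(h2 y hy).sum_ite]
      simp [hψ]
      ring
    have h4 : star (v y) ⬝ᵥ ψ = star (star ψ ⬝ᵥ v y) := by
      rw [← Matrix.star_dotProduct_star, star_star, dotProduct_comm]
    rw [Matrix.vecMulVec_mulVec]
    have h5 : star (v y) ⬝ᵥ (MulOpposite.op (star ψ ⬝ᵥ v y) • ψ) = (star ψ ⬝ᵥ v y) * star (star ψ ⬝ᵥ v y) := by
      rw [dotProduct_smul, h4]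
      simp [mul_comm]
    rw [h5, h3, star_mul', hst, mul_mul_mul_comm, hs2]
    have h6 : star ((√(D (x₀ y)) + √(D (x₁ y)) : ℝ) : ℂ) = ((√(D (x₀ y)) + √(D (x₁ y)) : ℝ) : ℂ) :=
      Complex.conj_ofReal _
    rw [h6, ← Complex.ofReal_mul, show (1 / 2 : ℂ) = ((1 / 2 : ℝ) : ℂ) by norm_num, ← Complex.ofReal_mul,
      Complex.ofReal_re]
    have e0 := Real.mul_self_sqrt (hD (x₀ y))
    have e1 := Real.mul_self_sqrt (hD (x₁ y))
    have n0 := Real.sqrt_nonneg (D (x₀ y))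
    have n1 := Real.sqrt_nonneg (D (x₁ y))
    have hb : |D (x₀ y) - D (x₁ y)| ≤ ε₂ * (D (x₀ y) + D (x₁ y)) := by
      -- If both masses are zero, the quotients in the balance condition are zero by convention and
      -- say nothing, but the bound is then trivial.
      rcases eq_or_lt_of_le (add_nonneg (hD (x₀ y)) (hD (x₁ y))) with h0 | h0
      · have : D (x₀ y) = 0 ∧ D (x₁ y) = 0 := by
          constructor <;> linarith [hD (x₀ y), hD (x₁ y)]
        rw [this.1, this.2]
        simp
      · have := hbal y hy
        rwa [← sub_div, abs_div, abs_of_pos h0, div_le_iff₀ h0] at this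
    -- The overlap is `(√D₀ + √D₁)² / 2 = (D₀ + D₁) - (√D₀ - √D₁)² / 2`, and the last square is at
    -- most `|D₀ - D₁|`.
    have hsq : (√(D (x₀ y)) - √(D (x₁ y))) ^ 2 ≤ |D (x₀ y) - D (x₁ y)| := by
      rw [le_abs]
      rcases le_total (√(D (x₀ y))) (√(D (x₁ y))) with h | h
      · right; nlinarith
      · left; nlinarith
    nlinarith
  have hsum : ∑ x, (if good (F x) then D x else 0) * (1 - ε₂ / 2) ≤
      ∑ y, (star (v y) ⬝ᵥ (Matrix.vecMulVec ψ (star ψ)).mulVec (v y)).re := by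
    rw [← Finset.sum_mul, hD', Finset.sum_mul]
    refine Finset.sum_le_sum fun y _ => ?_
    by_cases hy : good y
    · rw [if_pos hy]; exact hψv y hy
    · simp [hv, hy]
  rw [hw] at key
  rw [← Finset.sum_mul] at hsum
  rw [traceDist] at hd
  have := (abs_le.1 key).1
  nlinarith

end Balanced

/-! ### Parallel instances of a circuit -/

/-- Circuits on disjoint blocks of qubits act factor by factor on a product state; `c` is a further
factor that ignores these blocks. -/
theorem qRun_parallel {I U V : Type} [Fintype I] [DecidableEq I] [DecidableEq U] [DecidableEq V]
    (φ : I → V ↪ U) (hφ : ∀ i j a b, φ i a = φ j b → i = j) (gs : List (QGate V))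
    (c : Bits U → ℂ) (hc : ∀ i a s, c (Function.extend (φ i) a s) = c s) (ψ : I → QVec V) (s : Bits U) :
    qRun ((Finset.univ : Finset I).toList.flatMap fun i => gs.map (QGate.map (φ i)))
      (fun s => c s * ∏ i, ψ i (s ∘ φ i)) s = c s * ∏ i, qRun gs (ψ i) (s ∘ φ i) := by
  have key : ∀ l : List I, l.Nodup → ∀ ψ : I → QVec V,
      qRun (l.flatMap fun i => gs.map (QGate.map (φ i))) (fun s => c s * ∏ i, ψ i (s ∘ φ i)) =
        fun s => c s * ∏ i, (if i ∈ l then qRun gs (ψ i) else ψ i) (s ∘ φ i) := by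
    intro l
    induction l with
    | nil => intro _ ψ; simp [qRun_nil]
    | cons j l ih =>
      intro hl ψ
      rw [List.flatMap_cons, qRun_append]
      have h1 : qRun (gs.map (QGate.map (φ j))) (fun s => c s * ∏ i, ψ i (s ∘ φ i)) =
          fun s => c s * ∏ i, Function.update ψ j (qRun gs (ψ j)) i (s ∘ φ i) := by
        ext s
        rw [qRun_map]
        have h2 : (fun a => c (Function.extend (φ j) a s) *
            ∏ i, ψ i (Function.extend (φ j) a s ∘ φ i)) =
            (c s * ∏ i ∈ Finset.univ.erase j, ψ i (s ∘ φ i)) • ψ j := by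
          ext a
          rw [hc, ← Finset.mul_prod_erase _ _ (Finset.mem_univ j), extend_comp_self, Pi.smul_apply,
            smul_eq_mul, mul_comm (ψ j a), mul_assoc]
          refine congrArg (fun x => c s * (x * ψ j a)) (Finset.prod_congr rfl fun i hi => ?_)
          congr 1
          ext b
          refine Function.extend_apply' _ _ _ ?_
          rintro ⟨a, ha⟩
          exact (Finset.ne_of_mem_erase hi) (hφ _ _ _ _ ha).symm
        rw [h2, qRun_smul, Pi.smul_apply, smul_eq_mul, ← Finset.mul_prod_erase _ (fun i =>
          Function.update ψ j (qRun gs (ψ j)) i (s ∘ φ i)) (Finset.mem_univ j), Function.update_self,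
          mul_comm (qRun gs (ψ j) _), mul_assoc]
        refine congrArg (fun x => c s * (x * qRun gs (ψ j) (s ∘ φ j))) (Finset.prod_congr rfl fun i hi => ?_)
        rw [Function.update_of_ne (Finset.ne_of_mem_erase hi)]
      rw [h1, ih (List.nodup_cons.1 hl).2]
      ext s
      refine congrArg (c s * ·) (Finset.prod_congr rfl fun i _ => ?_)
      by_cases hi : i = j
      · subst hi
        rw [if_neg (List.nodup_cons.1 hl).1, if_pos List.mem_cons_self, Function.update_self]
      · simp [hi]
  rw [key _ (Finset.nodup_toList _)]
  simp

theorem length_parallel {I U V : Type} [Fintype I] (φ : I → V ↪ U) (gs : List (QGate V)) :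
    ((Finset.univ : Finset I).toList.flatMap fun i => gs.map (QGate.map (φ i))).length =
      Fintype.card I * gs.length := by
  simp [List.length_flatMap, Finset.length_toList]

/-! ### Sampling an image in superposition -/

section Sampling
variable {p n m : ℕ}

/-- The qubits used for one instance: public parameters and image, circuit, work space. -/
abbrev InstWork (p n a N : ℕ) : Type := (Fin p ⊕ Fin n ⊕ Fin a) ⊕ Fin N

/-- The state of one instance after the honest receiver's circuit. -/
noncomputable def instState (Q : QCircuit (Fin p) (Fin n)) (ev : Bits (Fin p ⊕ Fin n) → Bits (Fin m))
    (N : ℕ) (pp : Bits (Fin p)) (y : Bits (Fin m)) : QVec (InstWork p n Q.anc N) :=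
  fun s => if (∀ i, s (.inr i) = false) ∧ ev (Sum.elim pp fun i => s (.inl (.inr (.inl i)))) = y then
    Q.final pp (s ∘ Sum.inl) else 0

/-- The parameters are copied to the input of `Q`, the superposition is prepared, and its image is
added to the message register with the ancillas uncomputed. The amplitudes are then those of `Q`,
restricted to the fibre over the image `y` in the register. -/
theorem exists_sampling_gates (Q : QCircuit (Fin p) (Fin n))
    {ev : Bits (Fin p ⊕ Fin n) → Bits (Fin m)} {N₀ : ℕ} (hev : BComp ev N₀) :
    ∃ N ≤ N₀ + m, ∃ gs : List (QGate ((Fin p ⊕ Fin m) ⊕ InstWork p n Q.anc N)),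
      gs.length ≤ p + Q.gates.length + 8 * N + m ∧ ∀ pp y w,
        qRun gs (ket (Sum.elim (Sum.elim pp fun _ => false) fun _ => false))
          (Sum.elim (Sum.elim pp y) w) = instState Q ev N pp y w := by
  obtain ⟨N, hN, hgs⟩ := hev.exists_qgates
  rw [Fintype.card_fin] at hN
  refine ⟨N, hN, ?_⟩
  obtain ⟨u, hu⟩ : ∃ u : Fin p → (Fin p ⊕ Fin m) ⊕ InstWork p n Q.anc N,
    ∀ i, u i = .inr (.inl (.inl i)) := ⟨_, fun _ => rfl⟩
  obtain ⟨src, hsrc⟩ : ∃ u : Fin p → (Fin p ⊕ Fin m) ⊕ InstWork p n Q.anc N,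
    ∀ i, u i = .inl (.inl i) := ⟨_, fun _ => rfl⟩
  obtain ⟨tgt, htgt⟩ : ∃ u : Fin m → (Fin p ⊕ Fin m) ⊕ InstWork p n Q.anc N,
    ∀ i, u i = .inl (.inr i) := ⟨_, fun _ => rfl⟩
  obtain ⟨an, han⟩ : ∃ u : Fin N → (Fin p ⊕ Fin m) ⊕ InstWork p n Q.anc N,
    ∀ i, u i = .inr (.inr i) := ⟨_, fun _ => rfl⟩
  obtain ⟨rd, hrd, hrd'⟩ : ∃ u : Fin p ⊕ Fin n → (Fin p ⊕ Fin m) ⊕ InstWork p n Q.anc N,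
    (∀ i, u (.inl i) = .inl (.inl i)) ∧ ∀ i, u (.inr i) = .inr (.inl (.inr (.inl i))) :=
    ⟨Sum.elim (fun i => .inl (.inl i)) fun i => .inr (.inl (.inr (.inl i))), fun _ => rfl, fun _ => rfl⟩
  obtain ⟨φ, hφ⟩ : ∃ φ : (Fin p ⊕ Fin n ⊕ Fin Q.anc) ↪ (Fin p ⊕ Fin m) ⊕ InstWork p n Q.anc N,
    ∀ a, φ a = .inr (.inl a) := ⟨⟨fun a => .inr (.inl a), fun a b h => by simpa using h⟩, fun _ => rfl⟩
  have hui : Function.Injective u := fun a b h => by simpa [hu] using h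
  have hti : Function.Injective tgt := fun a b h => by simpa [htgt] using h
  have hai : Function.Injective an := fun a b h => by simpa [han] using h
  obtain ⟨g₁, hp₁, hl₁, hr₁⟩ := exists_qgates_xor u src hui fun a b => by simp [hu, hsrc]
  have hrt : ∀ a b, rd a ≠ tgt b := by rintro (a | a) b <;> simp [hrd, hrd', htgt]
  have hta : ∀ b i, tgt b ≠ an i := fun a b => by simp [htgt, han]
  obtain ⟨g₂, hp₂, hl₂, hr₂⟩ := hgs rd tgt an hti hai hrt
    (by rintro (a | a) b <;> simp [hrd, hrd', han]) hta
  refine ⟨g₁ ++ (Q.gates.map (QGate.map φ) ++ g₂), ?_, fun pp y w => ?_⟩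
  · simp only [List.length_append, List.length_map, Fintype.card_fin] at *
    lia
  have h1 : qRun g₁ (ket (Sum.elim (Sum.elim pp fun _ => false) fun _ => false)) =
      ket (Sum.elim (Sum.elim pp fun _ => false) (Sum.elim (Sum.elim pp fun _ => false) fun _ => false)) := by
    ext s
    rw [qRun_of_cRun_toggle hui (φ := fun b s => s (src b)) _ hp₁ hr₁]
    swap
    · intro b s s' h
      exact h _ fun b' => by simp [hu, hsrc]
    simp only [ket]
    refine if_congr ⟨fun h => ?_, fun h => ?_⟩ rfl rfl
    · have h0 : ∀ v, (∀ b, u b ≠ v) → s v =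
          (Sum.elim (Sum.elim pp fun _ => false) fun _ => false :
            Bits ((Fin p ⊕ Fin m) ⊕ InstWork p n Q.anc N)) v := fun v hv => by
        rw [← h]
        exact (Function.extend_apply' _ _ _ fun ⟨b, hb⟩ => hv b hb).symm
      ext (i | (i | i) | i)
      · exact h0 _ fun b => by simp [hu]
      · have h2 := congrFun h (u i)
        rw [hui.extend_apply, hsrc, h0 (.inl (.inl i)) fun b => by simp [hu], hu] at h2
        simpa using h2
      · exact h0 _ fun b => by simp [hu]
      · exact h0 _ fun b => by simp [hu]
    · subst h
      ext v
      by_cases hv : ∃ b, u b = v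
      · obtain ⟨b, rfl⟩ := hv
        rw [hui.extend_apply, hsrc]
        simp [hu]
      · rw [Function.extend_apply' _ _ _ hv]
        rcases v with v | (v | v) | v
        · rfl
        · exact absurd ⟨v, hu v⟩ hv
        · rfl
        · rfl
  have h2 : ∀ s, qRun (Q.gates.map (QGate.map φ))
      (ket (Sum.elim (Sum.elim pp fun _ => false) (Sum.elim (Sum.elim pp fun _ => false) fun _ => false))) s =
      if s ∘ Sum.inl = Sum.elim pp (fun _ => false) ∧ ∀ i, s (.inr (.inr i)) = false then
        Q.final pp (s ∘ φ) else 0 := by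
    intro s
    rw [qRun_map, QCircuit.final]
    have h3 : ∀ a, ket (Sum.elim (Sum.elim pp fun _ => false)
        (Sum.elim (Sum.elim pp fun _ => false) fun _ => false)) (Function.extend φ a s) =
        if s ∘ Sum.inl = Sum.elim pp (fun _ => false) ∧ ∀ i, s (.inr (.inr i)) = false then
          ket (Sum.elim pp fun _ => false) a else 0 := by
      intro a
      have h4 : Function.extend φ a s = Sum.elim (s ∘ Sum.inl) (Sum.elim a fun i => s (.inr (.inr i))) := by
        ext v
        by_cases hv : ∃ b, φ b = v
        · obtain ⟨b, rfl⟩ := hv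
          rw [φ.injective.extend_apply, hφ]
          rfl
        · rw [Function.extend_apply' _ _ _ hv]
          rcases v with v | v | v
          · rfl
          · exact absurd ⟨v, hφ v⟩ hv
          · rfl
      rw [h4, ket, ket, ← ite_and]
      refine if_congr ⟨fun h => ⟨⟨?_, fun i => ?_⟩, ?_⟩, fun ⟨⟨h, h'⟩, h''⟩ => ?_⟩ rfl rfl
      · have := congrArg (fun t => t ∘ Sum.inl) h
        simpa using this
      · exact congrFun h (.inr (.inr i))
      · ext i
        exact congrFun h (.inr (.inl i))
      · rw [h, h'']
        congr 2
        exact funext h'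
    simp only [h3]
    split_ifs with h
    · rfl
    · exact congrFun (qRun_zero _) _
  rw [qRun_append, qRun_append, h1, qRun_of_cRun_xor hti hrt hta hp₂ hr₂, h2]
  · have h5 : ∀ v, (∀ b, tgt b ≠ v) → Function.extend tgt (fun b => (Sum.elim (Sum.elim pp y) w :
        Bits ((Fin p ⊕ Fin m) ⊕ InstWork p n Q.anc N)) (tgt b) ^^
          ev ((Sum.elim (Sum.elim pp y) w : Bits ((Fin p ⊕ Fin m) ⊕ InstWork p n Q.anc N)) ∘ rd) b)
        (Sum.elim (Sum.elim pp y) w) v =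
        (Sum.elim (Sum.elim pp y) w : Bits ((Fin p ⊕ Fin m) ⊕ InstWork p n Q.anc N)) v := fun v hv =>
      Function.extend_apply' _ _ _ fun ⟨b, hb⟩ => hv b hb
    have h6 : ((Sum.elim (Sum.elim pp y) w : Bits ((Fin p ⊕ Fin m) ⊕ InstWork p n Q.anc N)) ∘ rd) =
        Sum.elim pp fun i => w (.inl (.inr (.inl i))) := by
      ext (i | i)
      · simp [hrd]
      · simp [hrd']
    rw [instState]
    refine if_congr ⟨fun ⟨h, h'⟩ => ⟨fun i => ?_, ?_⟩, fun ⟨h, h'⟩ => ⟨?_, fun i => ?_⟩⟩ ?_ rfl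
    · have := h' i
      rwa [h5 _ fun b => by simp [htgt]] at this
    · ext i
      have h7 := congrFun h (.inr i)
      rw [Function.comp_apply, ← htgt, hti.extend_apply, htgt, h6] at h7
      simp only [Sum.elim_inl, Sum.elim_inr] at h7
      cases h8 : y i <;> simp_all
    · ext (i | i)
      · rw [Function.comp_apply, h5 _ fun b => by simp [htgt]]
        rfl
      · rw [Function.comp_apply, ← htgt, hti.extend_apply, htgt, h6, h']
        simp
    · rw [h5 _ fun b => by simp [htgt]]
      exact h i
    · congr 1
      ext a
      rw [Function.comp_apply, h5 _ fun b => by simp [htgt, hφ], hφ]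
      rfl
  · intro s hs i
    rw [h2] at hs
    rw [han]
    by_contra hi
    exact hs (if_neg fun h => hi (h.2 i))

/-- The probability that the honest receiver samples the image `y`. -/
noncomputable def imageProb (Q : QCircuit (Fin p) (Fin n)) (ev : Bits (Fin p ⊕ Fin n) → Bits (Fin m))
    (pp : Bits (Fin p)) (y : Bits (Fin m)) : ℝ :=
  ∑ u, ∑ x, ∑ v, if ev (Sum.elim pp x) = y then ‖Q.final pp (Sum.elim u (Sum.elim x v))‖ ^ 2 else 0

/-- The weight of the vector `c` in the state prepared by `Q`. -/
noncomputable def vecWeight (Q : QCircuit (Fin p) (Fin n)) (pp : Bits (Fin p)) (c : QVec (Fin n)) : ℝ :=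
  ∑ u, ∑ v, ‖∑ x, star (c x) * Q.final pp (Sum.elim u (Sum.elim x v))‖ ^ 2

theorem sum_norm_sq_instState (Q : QCircuit (Fin p) (Fin n)) (ev : Bits (Fin p ⊕ Fin n) → Bits (Fin m))
    (N : ℕ) (pp : Bits (Fin p)) (y : Bits (Fin m)) :
    ∑ w, ‖instState Q ev N pp y w‖ ^ 2 = imageProb Q ev pp y := by
  rw [sum_bits_sum, imageProb, sum_bits_sum]
  refine Finset.sum_congr rfl fun u _ => ?_
  rw [sum_bits_sum]
  refine Finset.sum_congr rfl fun x _ => Finset.sum_congr rfl fun v _ => ?_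
  rw [Fintype.sum_eq_single fun _ => false]
  · simp only [instState, Sum.elim_inr, implies_true, true_and, Sum.elim_inl, Sum.elim_comp_inl]
    split_ifs <;> simp
  · intro b hb
    rw [instState, if_neg]
    · simp
    · exact fun h => hb (funext h.1)

theorem sum_imageProb (Q : QCircuit (Fin p) (Fin n)) (ev : Bits (Fin p ⊕ Fin n) → Bits (Fin m))
    (pp : Bits (Fin p)) : ∑ y, imageProb Q ev pp y = 1 := by
  have h : ∑ s, ‖Q.final pp s‖ ^ 2 = 1 := by
    rw [QCircuit.final, sum_norm_sq_qRun]
    simp [ket, apply_ite]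
  rw [← h, sum_bits_sum]
  simp only [imageProb]
  rw [Finset.sum_comm]
  refine Finset.sum_congr rfl fun u _ => ?_
  rw [sum_bits_sum, Finset.sum_comm]
  refine Finset.sum_congr rfl fun x _ => ?_
  rw [Finset.sum_comm]
  refine Finset.sum_congr rfl fun v _ => ?_
  simp

theorem imageProb_nonneg (Q : QCircuit (Fin p) (Fin n)) (ev : Bits (Fin p ⊕ Fin n) → Bits (Fin m))
    (pp : Bits (Fin p)) (y : Bits (Fin m)) : 0 ≤ imageProb Q ev pp y :=
  Finset.sum_nonneg fun _ _ => Finset.sum_nonneg fun _ _ => Finset.sum_nonneg fun _ _ => by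
    split_ifs <;> positivity

/-- The contents of an instance's qubits with `x` in the output register. -/
def setOut {a N : ℕ} (w : Bits (InstWork p n a N)) (x : Bits (Fin n)) : Bits (InstWork p n a N) :=
  Sum.elim (Sum.elim (fun i => w (.inl (.inl i))) (Sum.elim x fun i => w (.inl (.inr (.inr i)))))
    fun i => w (.inr i)

/-- A vector `c` supported on the fibre over `y` does not see the restriction to that fibre, so its
weight can be computed in the state of `Q` itself. -/
theorem sum_instState_setOut (Q : QCircuit (Fin p) (Fin n)) (ev : Bits (Fin p ⊕ Fin n) → Bits (Fin m))
    (N : ℕ) (pp : Bits (Fin p)) (y : Bits (Fin m)) {c : QVec (Fin n)}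
    (hc : ∀ x, c x ≠ 0 → ev (Sum.elim pp x) = y) :
    ∑ w, (if ∀ i, w (.inl (.inr (.inl i))) = false then
      ‖∑ x, star (c x) * instState Q ev N pp y (setOut w x)‖ ^ 2 else 0) = vecWeight Q pp c := by
  rw [sum_bits_sum, vecWeight, sum_bits_sum]
  refine Finset.sum_congr rfl fun u _ => ?_
  rw [sum_bits_sum, Fintype.sum_eq_single fun _ => false]
  · refine Finset.sum_congr rfl fun v _ => ?_
    rw [Fintype.sum_eq_single fun _ => false]
    · refine (if_pos fun _ => rfl).trans ?_
      congr 2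
      refine Finset.sum_congr rfl fun x _ => ?_
      by_cases hx : c x = 0
      · simp [hx]
      · congr 1
        rw [instState, if_pos]
        · rfl
        · exact ⟨fun _ => rfl, hc x hx⟩
    · intro b hb
      refine (if_congr Iff.rfl ?_ rfl).trans (ite_self 0)
      rw [Finset.sum_eq_zero, norm_zero, zero_pow two_ne_zero]
      intro x _
      rw [instState, if_neg, mul_zero]
      exact fun h => hb (funext h.1)
  · intro x hx
    refine Finset.sum_eq_zero fun v _ => Finset.sum_eq_zero fun b _ => if_neg fun h => hx (funext h)

end Sampling

/-! ### The sender of the parallel repetition -/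

/-- Public parameters and a procedure finding the two preimages of an image, as functions of the
coins used to generate the parameters. -/
structure ClawSampler (g p n m : ℕ) where
  pp : Bits (Fin g) → Bits (Fin p)
  good : Bits (Fin g) → Bits (Fin m) → Bool
  x₀ : Bits (Fin g) → Bits (Fin m) → Bits (Fin n)
  x₁ : Bits (Fin g) → Bits (Fin m) → Bits (Fin n)

/-- The coins of all instances, and the output in case of failure. -/
abbrev ParCoins (M g n : ℕ) : Type := (Fin M × Fin g) ⊕ (Fin n ⊕ Fin n)

/-- The public parameters and the images of all instances. -/
abbrev ParMsg (M p m : ℕ) : Type := Fin M × (Fin p ⊕ Fin m)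

/-- The successful instance, if any, and the claw. -/
abbrev ParOut (M n : ℕ) : Type := Fin M ⊕ ClawOut n

namespace ClawSampler
variable {g p n m : ℕ} (I : ClawSampler g p n m) {M : ℕ}

/-- Whether the `i`-th instance succeeds. -/
def ok (r : Bits (Fin M × Fin g)) (y : Bits (Fin M × Fin m)) (i : Fin M) : Bool :=
  I.good (fun a => r (i, a)) fun b => y (i, b)

/-- Whether the `i`-th instance is the first success. -/
def isFirst (r : Bits (Fin M × Fin g)) (y : Bits (Fin M × Fin m)) (i : Fin M) : Bool :=
  I.ok r y i && allBits fun l => !(decide (l < i) && I.ok r y l)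

/-- The strings `x` of the first success, or `f` if there is no success. -/
def select (x : Bits (Fin g) → Bits (Fin m) → Bits (Fin n)) (r : Bits (Fin M × Fin g))
    (y : Bits (Fin M × Fin m)) (f : Bits (Fin n)) : Bits (Fin n) := fun l =>
  anyBits (fun i => I.isFirst r y i && x (fun a => r (i, a)) (fun b => y (i, b)) l) ||
    (!anyBits (I.ok r y) && f l)

/-- The mask and the claw determined by the images `y`. -/
def outcome (r : Bits (Fin M × Fin g)) (f : Bits (Fin n ⊕ Fin n)) (y : Bits (Fin M × Fin m)) :
    Bits (ParOut M n) :=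
  Sum.elim (I.isFirst r y) (Sum.elim (I.select I.x₀ r y fun l => f (.inl l))
    (Sum.elim (I.select I.x₁ r y fun l => f (.inr l)) fun _ => false))

/-- The message with public parameters `pps` and images `y`. -/
def parMsg (pps : Fin M → Bits (Fin p)) (y : Bits (Fin M × Fin m)) : Bits (ParMsg M p m) :=
  fun a => Sum.elim (pps a.1) (fun b => y (a.1, b)) a.2

/-- The first message: all public parameters. -/
def firstMsg (s : Bits (Empty ⊕ ParCoins M g n ⊕ Empty)) : Bits (ParMsg M p m) :=
  parMsg (fun i => I.pp fun a => s (.inr (.inl (.inl (i, a))))) fun _ => false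

/-- The result of the first round. -/
def firstOut (s : Bits ((Empty ⊕ ParCoins M g n ⊕ Empty) ⊕ ParMsg M p m)) : Bits (ParOut M n) :=
  I.outcome (fun a => s (.inl (.inr (.inl (.inl a))))) (fun l => s (.inl (.inr (.inl (.inr l)))))
    fun b => s (.inr (b.1, .inr b.2))

/-- The second message: the successful instance. -/
def maskMsg (s : Bits (Empty ⊕ Empty ⊕ ParOut M n)) : Bits (Fin M) := fun i => s (.inr (.inr (.inl i)))

/-- The final output: the claw. -/
def finalOut (s : Bits ((Empty ⊕ Empty ⊕ ParOut M n) ⊕ Fin M)) : Bits (ClawOut n) :=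
  fun o => s (.inl (.inr (.inr (.inr o))))

variable {I} {N : ℕ}

theorem bComp_firstMsg (hpp : BComp I.pp N) :
    BComp (I.firstMsg : Bits (Empty ⊕ ParCoins M g n ⊕ Empty) → Bits (ParMsg M p m))
      (M * (p + m) * N) := by
  have h := BComp.of_cx (f := (I.firstMsg : Bits (Empty ⊕ ParCoins M g n ⊕ Empty) → Bits (ParMsg M p m)))
    (N := N) (by
      rintro ⟨i, b | b⟩
      · exact ((hpp.comp (BComp.reindex (α := Empty ⊕ ParCoins M g n ⊕ Empty)
          (fun a => .inr (.inl (.inl (i, a)))) 0)).cx b).mono (by lia)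
      · exact Cx.const_false N)
  simpa using h

theorem bComp_firstOut (hI : BComp (fun s : Bits (Fin g ⊕ Fin m) =>
      (Sum.elim (fun _ => I.good (s ∘ Sum.inl) (s ∘ Sum.inr))
        (Sum.elim (I.x₀ (s ∘ Sum.inl) (s ∘ Sum.inr)) (I.x₁ (s ∘ Sum.inl) (s ∘ Sum.inr))) :
        Bits (Unit ⊕ Fin n ⊕ Fin n))) N) :
    BComp (I.firstOut : Bits ((Empty ⊕ ParCoins M g n ⊕ Empty) ⊕ ParMsg M p m) → Bits (ParOut M n))
      ((M + (2 * n + 1)) * ((M + 1) ^ 2 * (10 * N + 30))) := by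
  have hinst : ∀ i : Fin M, BComp (fun s : Bits ((Empty ⊕ ParCoins M g n ⊕ Empty) ⊕ ParMsg M p m) =>
      (Sum.elim (fun _ => I.good (fun a => s (.inl (.inr (.inl (.inl (i, a)))))) fun b => s (.inr (i, .inr b)))
        (Sum.elim (I.x₀ (fun a => s (.inl (.inr (.inl (.inl (i, a)))))) fun b => s (.inr (i, .inr b)))
          (I.x₁ (fun a => s (.inl (.inr (.inl (.inl (i, a)))))) fun b => s (.inr (i, .inr b)))) :
        Bits (Unit ⊕ Fin n ⊕ Fin n))) N := fun i =>
    hI.comp (BComp.reindex (α := (Empty ⊕ ParCoins M g n ⊕ Empty) ⊕ ParMsg M p m)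
      (Sum.elim (fun a => .inl (.inr (.inl (.inl (i, a))))) fun b => .inr (i, .inr b)) 0)
  have hok : ∀ i : Fin M, Cx (fun s : Bits ((Empty ⊕ ParCoins M g n ⊕ Empty) ⊕ ParMsg M p m) =>
      I.ok (fun a => s (.inl (.inr (.inl (.inl a))))) (fun b => s (.inr (b.1, .inr b.2))) i) N :=
    fun i => (hinst i).cx (.inl ())
  have hfirst : ∀ i : Fin M, Cx (fun s : Bits ((Empty ⊕ ParCoins M g n ⊕ Empty) ⊕ ParMsg M p m) =>
      I.isFirst (fun a => s (.inl (.inr (.inl (.inl a))))) (fun b => s (.inr (b.1, .inr b.2))) i)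
      ((M + 1) * (2 * N + 8)) := fun i =>
    (Cx.op₂ (fun a b => a && b) (hok i)
      (Cx.allBits fun i' => ((Cx.const (decide (i' < i))).op₂ (fun a b => a && b) (hok i')).not)).mono (by
        rw [Fintype.card_fin]; nlinarith)
  have hsel : ∀ (x : Bits (Fin g) → Bits (Fin m) → Bits (Fin n)) (l : Fin n) (f : Fin n → Fin n ⊕ Fin n),
      (∀ i : Fin M, Cx (fun s : Bits ((Empty ⊕ ParCoins M g n ⊕ Empty) ⊕ ParMsg M p m) =>
        x (fun a => s (.inl (.inr (.inl (.inl (i, a)))))) (fun b => s (.inr (i, .inr b))) l) N) →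
      Cx (fun s : Bits ((Empty ⊕ ParCoins M g n ⊕ Empty) ⊕ ParMsg M p m) =>
        I.select x (fun a => s (.inl (.inr (.inl (.inl a))))) (fun b => s (.inr (b.1, .inr b.2)))
          (fun l => s (.inl (.inr (.inl (.inr (f l)))))) l) ((M + 1) ^ 2 * (10 * N + 30)) := by
    intro x l f hx
    refine (Cx.op₂ (fun a b => a || b) (Cx.anyBits fun i => (hfirst i).op₂ (fun a b => a && b) (hx i))
      ((Cx.anyBits hok).not.op₂ (fun a b => a && b)
        (Cx.proj (.inl (.inr (.inl (.inr (f l))))) 0))).mono ?_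
    rw [Fintype.card_fin]
    nlinarith [Nat.zero_le (M * N), Nat.zero_le (M * M * N), Nat.zero_le (M * M)]
  have h := BComp.of_cx (f := (I.firstOut :
      Bits ((Empty ⊕ ParCoins M g n ⊕ Empty) ⊕ ParMsg M p m) → Bits (ParOut M n)))
    (N := (M + 1) ^ 2 * (10 * N + 30)) (by
      rintro (i | l | l | l)
      · refine (hfirst i).mono ?_
        nlinarith [Nat.zero_le (M * N), Nat.zero_le (M * M * N), Nat.zero_le (M * M)]
      · exact hsel I.x₀ l .inl fun i => (hinst i).cx (.inr (.inl l))
      · exact hsel I.x₁ l .inr fun i => (hinst i).cx (.inr (.inr l))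
      · exact Cx.const_false _)
  refine h.mono (Nat.mul_le_mul_right _ (le_of_eq ?_))
  simp
  ring

variable (I)

theorem isFirst_eq_true {r : Bits (Fin M × Fin g)} {y : Bits (Fin M × Fin m)} {i : Fin M} :
    I.isFirst r y i = true ↔ I.ok r y i = true ∧ ∀ i' < i, I.ok r y i' = false := by
  simp only [isFirst, allBits, Bool.and_eq_true, decide_eq_true_eq, Bool.not_eq_true', Bool.and_eq_false_imp]

theorem isFirst_unique {r : Bits (Fin M × Fin g)} {y : Bits (Fin M × Fin m)} {i j : Fin M}
    (hi : I.isFirst r y i = true) (hj : I.isFirst r y j = true) : i = j := by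
  rw [isFirst_eq_true] at hi hj
  rcases lt_trichotomy i j with h | h | h
  · have := hj.2 i h; rw [hi.1] at this; cases this
  · exact h
  · have := hi.2 j h; rw [hj.1] at this; cases this

theorem isFirst_eq_decide {r : Bits (Fin M × Fin g)} {y : Bits (Fin M × Fin m)} {j : Fin M}
    (hj : I.isFirst r y j = true) : I.isFirst r y = fun i => decide (i = j) := by
  ext i
  by_cases h : i = j
  · rw [h, hj]; simp
  · rw [decide_eq_false h]
    by_contra hi
    exact h (I.isFirst_unique (by simpa using hi) hj)

theorem select_of_isFirst (x : Bits (Fin g) → Bits (Fin m) → Bits (Fin n)) {r : Bits (Fin M × Fin g)}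
    {y : Bits (Fin M × Fin m)} {j : Fin M} (hj : I.isFirst r y j = true) (f : Bits (Fin n)) :
    I.select x r y f = x (fun a => r (j, a)) fun b => y (j, b) := by
  ext l
  have h1 : ∃ i, I.ok r y i = true := ⟨j, (I.isFirst_eq_true.1 hj).1⟩
  rw [select, show anyBits (I.ok r y) = true by simpa [anyBits] using h1, I.isFirst_eq_decide hj]
  simp [anyBits]

theorem select_of_forall (x : Bits (Fin g) → Bits (Fin m) → Bits (Fin n)) {r : Bits (Fin M × Fin g)}
    {y : Bits (Fin M × Fin m)} (h : ∀ i, I.ok r y i = false) (f : Bits (Fin n)) :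
    I.select x r y f = f := by
  ext l
  simp [select, isFirst, h, anyBits]

theorem exists_isFirst {r : Bits (Fin M × Fin g)} {y : Bits (Fin M × Fin m)}
    (h : ∃ i, I.ok r y i = true) : ∃ j, I.isFirst r y j = true := by
  classical
  obtain ⟨j, hj, hmin⟩ := Finset.exists_min_image (Finset.univ.filter fun i => I.ok r y i = true)
    id (h.imp fun i hi => by simpa using hi)
  refine ⟨j, I.isFirst_eq_true.2 ⟨by simpa using hj, fun i hi => ?_⟩⟩
  by_contra h'
  exact absurd (hmin i (by simpa using h')) (not_le.2 hi)

end ClawSampler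

/-! ### The first round of the honest receiver -/

/-- The sender of the empty protocol. -/
def trivialSender : Sender 0 0 Empty Empty where
  coins := 0
  anc := 0
  step := Fin.elim0
  final := []
  out := Empty.elim

/-- The receiver of the empty protocol. -/
def trivialReceiver : Receiver 0 0 Empty where
  anc := 0
  step := Fin.elim0

/-- The first round is an extension of the empty protocol, so the general extension lemma applies;
the instances act on disjoint blocks of qubits and give a product state. -/
theorem exists_parallel_receiver {M p n m q : ℕ} (e : Fin 0 ⊕ ParMsg M p m ≃ Fin q)
    (Q : QCircuit (Fin p) (Fin n)) {ev : Bits (Fin p ⊕ Fin n) → Bits (Fin m)} {N₀ : ℕ}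
    (hev : BComp ev N₀) : ∃ N ≤ N₀ + m, ∃ R : Receiver q 1 (Fin M × InstWork p n Q.anc N),
      R.size ≤ q + 1 + M * (p + n + Q.anc + N) + M * (p + Q.gates.length + 8 * N + m) ∧ R.anc = 0 ∧
      ∀ pps y z, R.stateN (fun _ => msgJoin e (fun _ => false) (ClawSampler.parMsg pps fun _ => false))
        (fun _ => msgJoin e (fun _ => false) (ClawSampler.parMsg pps y)) 1 z =
        ∏ i, instState Q ev N (pps i) (fun b => y (i, b)) fun a => z (.inl (i, a)) := by
  obtain ⟨N, hN, gs, hlen, hrun⟩ := exists_sampling_gates Q hev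
  obtain ⟨φ, hφl, hφr⟩ : ∃ φ : Fin M → (Fin p ⊕ Fin m) ⊕ InstWork p n Q.anc N ↪
      ParMsg M p m ⊕ (Fin M × InstWork p n Q.anc N) ⊕ (trivialReceiver.Work ⊕ Empty),
      (∀ i a, φ i (.inl a) = .inl (i, a)) ∧ ∀ i a, φ i (.inr a) = .inr (.inl (i, a)) :=
    ⟨fun i => ⟨Sum.elim (fun a => .inl (i, a)) fun a => .inr (.inl (i, a)), by
      rintro (a | a) (b | b) h <;> simp at h ⊢ <;> exact h⟩, fun _ _ => rfl, fun _ _ => rfl⟩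
  obtain ⟨R, eA, hsize, hst⟩ := trivialReceiver.exists_extends e
    ((Finset.univ : Finset (Fin M)).toList.flatMap fun i => gs.map (QGate.map (φ i)))
  refine ⟨N, hN, R, hsize.trans ?_, ?_, fun pps y z => ?_⟩
  · rw [length_parallel]
    have h0 : trivialReceiver.size = 0 := rfl
    rw [h0, Fintype.card_fin]
    have := Nat.mul_le_mul_left M hlen
    simp only [Fintype.card_prod, Fintype.card_sum, Fintype.card_fin, Fintype.card_empty, ← add_assoc]
    lia
  · have := Fintype.card_congr eA
    have h0 : trivialReceiver.anc = 0 := rfl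
    simp [h0] at this
    exact this.symm
  have hj : ∀ l : Bits (Fin q), (fun _ => l) = joinSeq e (T := 0) Fin.elim0 (fun _ => false) l := by
    intro l
    ext1 i
    rw [show i = Fin.last 0 from Fin.ext (by have := i.2; simp), joinSeq_last]
  rw [hj, hj, hst]
  have hpad : ∀ s : Bits (ParMsg M p m ⊕ (Fin M × InstWork p n Q.anc N) ⊕ (trivialReceiver.Work ⊕ Empty)),
      initMsg (ClawSampler.parMsg pps fun _ => false)
        (trivialReceiver.padState (Fin M × InstWork p n Q.anc N) Empty Fin.elim0 Fin.elim0) s =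
      1 * ∏ i, (ket (Sum.elim (Sum.elim (pps i) fun _ => false) fun _ => false) :
        QVec ((Fin p ⊕ Fin m) ⊕ InstWork p n Q.anc N)) (s ∘ φ i) := by
    intro s
    simp only [ket, Finset.prod_ite_zero, Finset.prod_const_one, initMsg, Receiver.padState, one_mul]
    have h1 : trivialReceiver.stateN Fin.elim0 Fin.elim0 0
        (fun w => (s ∘ Sum.inr) (Sum.inr (Sum.inl w))) = 1 := by
      rw [Receiver.stateN, ket, if_pos]
      ext (a | a)
      · exact a.elim
      · exact a.elim0
    rw [h1]
    by_cases h : ∀ i ∈ (Finset.univ : Finset (Fin M)), s ∘ φ i =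
      (Sum.elim (Sum.elim (pps i) fun _ => false) fun _ => false : Bits ((Fin p ⊕ Fin m) ⊕ InstWork p n Q.anc N))
    · rw [if_pos h, if_pos, if_pos]
      · refine ⟨?_, fun y => y.elim⟩
        rintro ⟨i, a⟩
        have := congrFun (h i (Finset.mem_univ i)) (.inr a)
        rwa [Function.comp_apply, hφr] at this
      · ext ⟨i, a | a⟩
        · have := congrFun (h i (Finset.mem_univ i)) (.inl (.inl a))
          rwa [Function.comp_apply, hφl] at this
        · have := congrFun (h i (Finset.mem_univ i)) (.inl (.inr a))
          rwa [Function.comp_apply, hφl] at this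
    · rw [if_neg h]
      refine ite_eq_right_iff.2 fun h2 => if_neg fun ⟨h3, _⟩ => h fun i _ => ?_
      ext ((a | a) | a)
      · rw [Function.comp_apply, hφl]
        exact congrFun h2 (i, .inl a)
      · rw [Function.comp_apply, hφl]
        exact congrFun h2 (i, .inr a)
      · rw [Function.comp_apply, hφr]
        exact h3 (i, a)
  rw [show initMsg (ClawSampler.parMsg pps fun _ => false)
      (trivialReceiver.padState (Fin M × InstWork p n Q.anc N) Empty Fin.elim0 Fin.elim0) = _ from
    funext hpad, qRun_parallel φ _ gs (fun _ => 1) (fun _ _ _ => rfl), one_mul]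
  · refine Finset.prod_congr rfl fun i _ => ?_
    rw [← hrun]
    congr 1
    ext ((a | a) | a)
    · rw [Function.comp_apply, hφl]; rfl
    · rw [Function.comp_apply, hφl]; rfl
    · rw [Function.comp_apply, hφr]; rfl
  · rintro i j (a | a) (b | b) h <;> simp [hφl, hφr] at h <;> exact h.1

/-! ### The second round of the honest receiver -/

theorem Toggles.foldr_xor {W I : Type} [DecidableEq W] {h : W} {w v : I → W} (hw : ∀ i, w i ≠ h)
    (hv : ∀ i, v i ≠ h) (l : List I) :
    Toggles h (fun s => l.foldr (fun i b => (s (w i) && s (v i)) ^^ b) false) l.length := by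
  induction l with
  | nil => exact Toggles.zero h
  | cons i l ih =>
    have := (Toggles.and_wire (hw i) (hv i)).xor ih
    rwa [add_comm] at this

theorem foldr_xor_oneHot {I : Type} [DecidableEq I] (j : I) (a : I → Bool) (l : List I) (hl : l.Nodup) :
    l.foldr (fun i b => (decide (i = j) && a i) ^^ b) false = (decide (j ∈ l) && a j) := by
  induction l with
  | nil => simp
  | cons i l ih =>
    rw [List.foldr_cons, ih (List.nodup_cons.1 hl).2]
    by_cases hi : i = j
    · subst hi
      simp [(List.nodup_cons.1 hl).1]
    · simp [hi, Ne.symm hi]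

/-- A swap into an empty register, controlled by the one-hot announcement of `j`: the selected block
is added to the output, and the output is then added back to the selected block, which clears it. -/
theorem exists_selection_gates {M n : ℕ} {B : Type} [DecidableEq B] (x : Fin M × Fin n → B)
    (hx : Function.Injective x) : ∃ gs : List (QGate (Fin M ⊕ Fin n ⊕ B)), gs.length ≤ 2 * (M * n) ∧
      ∀ Ψ j o b, (∀ l, b (x (j, l)) = false) →
        qRun gs Ψ (Sum.elim (fun i => decide (i = j)) (Sum.elim o b)) =
          Ψ (Sum.elim (fun i => decide (i = j)) (Sum.elim (fun _ => false)
            (Function.extend (fun l => x (j, l)) o b))) := by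
  classical
  obtain ⟨tA, htA⟩ : ∃ t : Fin n → Fin M ⊕ Fin n ⊕ B, ∀ l, t l = .inr (.inl l) := ⟨_, fun _ => rfl⟩
  obtain ⟨tB, htB⟩ : ∃ t : Fin M × Fin n → Fin M ⊕ Fin n ⊕ B, ∀ l, t l = .inr (.inr (x l)) :=
    ⟨_, fun _ => rfl⟩
  have hAi : Function.Injective tA := fun a b h => by simpa [htA] using h
  have hBi : Function.Injective tB := fun a b h => hx (by simpa [htB] using h)
  let φ : Fin n → Bits (Fin M ⊕ Fin n ⊕ B) → Bool := fun l s =>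
    (Finset.univ : Finset (Fin M)).toList.foldr (fun i b => (s (.inl i) && s (tB (i, l))) ^^ b) false
  let χ : Fin M × Fin n → Bits (Fin M ⊕ Fin n ⊕ B) → Bool := fun p s => s (.inl p.1) && s (tA p.2)
  have hφ : ∀ b s s', (∀ w, (∀ b', w ≠ tA b') → s w = s' w) → φ b s = φ b s' := by
    intro b s s' h
    simp only [φ]
    have h1 : ∀ i, s (.inl i) = s' (.inl i) := fun i => h _ fun b' => by simp [htA]
    have h2 : ∀ i, s (tB i) = s' (tB i) := fun i => h _ fun b' => by simp [htA, htB]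
    simp only [h1, h2]
  have hχ : ∀ b s s', (∀ w, (∀ b', w ≠ tB b') → s w = s' w) → χ b s = χ b s' := by
    intro b s s' h
    simp only [χ]
    rw [h _ fun b' => by simp [htB], h _ fun b' => by simp [htA, htB]]
  obtain ⟨gA, hpA, hlA, hrA⟩ := exists_qgates_toggle (tgt := tA) (φ := φ) (n := M) hAi (fun l => by
    have := Toggles.foldr_xor (h := tA l) (w := fun i : Fin M => .inl i) (v := fun i => tB (i, l))
      (by simp [htA]) (by simp [htA, htB]) (Finset.univ : Finset (Fin M)).toList
    simpa using this) fun b b' s c => hφ _ _ _ fun w hw => Function.update_of_ne (hw b') _ _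
  obtain ⟨gB, hpB, hlB, hrB⟩ := exists_qgates_toggle (tgt := tB) (φ := χ) (n := 1) hBi
    (fun l => Toggles.and_wire (by simp [htB]) (by simp [htA, htB]))
    fun b b' s c => hχ _ _ _ fun w hw => Function.update_of_ne (hw b') _ _
  refine ⟨gA ++ gB, ?_, fun Ψ j o b hb => ?_⟩
  · simp only [List.length_append, Fintype.card_fin, Fintype.card_prod] at *
    lia
  rw [qRun_append, qRun_of_cRun_toggle hBi hχ hpB hrB, qRun_of_cRun_toggle hAi hφ hpA hrA]
  set s : Bits (Fin M ⊕ Fin n ⊕ B) := Sum.elim (fun i => decide (i = j)) (Sum.elim o b) with hs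
  have h1 : Function.extend tB (fun b => s (tB b) ^^ χ b s) s = Sum.elim (fun i => decide (i = j))
      (Sum.elim o (Function.extend (fun l => x (j, l)) o b)) := by
    ext v
    by_cases hv : ∃ l, tB l = v
    · obtain ⟨⟨i, l⟩, rfl⟩ := hv
      rw [hBi.extend_apply]
      simp only [χ, htA, htB, hs, Sum.elim_inl, Sum.elim_inr]
      by_cases hi : i = j
      · subst hi
        rw [Function.Injective.extend_apply (f := fun l => x (i, l)) fun a b h => by simpa using hx h, hb]
        simp
      · rw [Function.extend_apply']
        · simp [hi]
        · rintro ⟨l', h⟩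
          exact hi (congrArg Prod.fst (hx h)).symm
    · rw [Function.extend_apply' _ _ _ hv]
      rcases v with v | v | v
      · rfl
      · rfl
      · simp only [hs, Sum.elim_inr]
        rw [Function.extend_apply']
        rintro ⟨l, h⟩
        exact hv ⟨(j, l), by rw [htB, ← h]⟩
  rw [h1]
  congr 1
  ext v
  by_cases hv : ∃ l, tA l = v
  · obtain ⟨l, rfl⟩ := hv
    rw [hAi.extend_apply]
    simp only [φ, htA, htB, Sum.elim_inl, Sum.elim_inr]
    rw [foldr_xor_oneHot j _ _ (Finset.nodup_toList _),
      Function.Injective.extend_apply (f := fun l => x (j, l)) fun a b h => by simpa using hx h]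
    simp
  · rw [Function.extend_apply' _ _ _ hv]
    rcases v with v | v | v
    · rfl
    · exact absurd ⟨v, htA v⟩ hv
    · rfl

theorem expect_bits_sum {A B : Type} [Fintype A] [DecidableEq A] [Fintype B] [DecidableEq B]
    (F : Bits (A ⊕ B) → ℝ) : 𝔼 s, F s = 𝔼 a : Bits A, 𝔼 b : Bits B, F (Sum.elim a b) := by
  rw [← Finset.expect_product', Finset.univ_product_univ]
  refine Fintype.expect_equiv (Equiv.sumArrowEquivProdArrow A B Bool) _ _ fun s => ?_
  congr 1
  exact (Sum.elim_comp_inl_inr s).symm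

section Honest
variable {M g p n m q q' : ℕ} {I : ClawSampler g p n m} {S₁ : Sender q 1 Empty (ParOut M n)}
  {S₂ : Sender q' 2 Empty (ClawOut n)} {e₁ : Fin 0 ⊕ ParMsg M p m ≃ Fin q} {e₂ : Fin q ⊕ Fin M ≃ Fin q'}
  {ec₁ : Fin trivialSender.coins ⊕ ParCoins M g n ≃ Fin S₁.coins}
  {ec₂ : Fin S₁.coins ⊕ Empty ≃ Fin S₂.coins} {Q : QCircuit (Fin p) (Fin n)}
  {ev : Bits (Fin p ⊕ Fin n) → Bits (Fin m)}

theorem joinSeq_zero {q q' : ℕ} {M : Type} (e : Fin q ⊕ M ≃ Fin q') (lo : Fin 0 → Bits (Fin q))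
    (hi : Bits (Fin 0 × M)) (l : Bits (Fin q')) : joinSeq e lo hi l = fun _ => l := by
  ext1 i
  rw [show i = Fin.last 0 from Fin.ext (by have := i.2; simp), joinSeq_last]

theorem first_msg_eq (hS₁ : S₁.Extends trivialSender e₁ ec₁ I.firstMsg I.firstOut) (r₀ r f)
    (l : Bits (Fin q)) : S₁.msg Empty.elim (joinCoins ec₁ r₀ (Sum.elim r f)) (fun _ => l) =
      fun _ => msgJoin e₁ (fun _ => false) (ClawSampler.parMsg (fun i => I.pp fun a => r (i, a))
        fun _ => false) := by
  have := hS₁.msg_eq Empty.elim r₀ (Sum.elim r f) Fin.elim0 (fun _ => false) l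
  rw [joinSeq_zero, joinSeq_zero] at this
  exact this

theorem first_result_eq (hS₁ : S₁.Extends trivialSender e₁ ec₁ I.firstMsg I.firstOut) (r₀ r f)
    (l : Bits (Fin q)) : S₁.result Empty.elim (joinCoins ec₁ r₀ (Sum.elim r f)) (fun _ => l) =
      I.outcome r f fun b => msgHigh e₁ l (b.1, .inr b.2) := by
  have := hS₁.result_eq Empty.elim r₀ (Sum.elim r f) Fin.elim0 (fun _ => false) l
  rw [joinSeq_zero] at this
  exact this

/-- The state is a product over the instances. Projecting block `j` onto `v` leaves the weight of
`v` there and the full image probability of each of the other blocks. -/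
theorem sum_selected_eq {N : ℕ} (pps : Fin M → Bits (Fin p)) (y : Bits (Fin M × Fin m))
    (j : Fin M) {v : QVec (Fin n)} (hv : ∀ x, v x ≠ 0 → ev (Sum.elim (pps j) x) = fun b => y (j, b)) :
    ∑ w : Bits (Fin M × InstWork p n Q.anc N), (if ∀ l, w (j, .inl (.inr (.inl l))) = false then
      ‖∑ x, star (v x) * ∏ i, instState Q ev N (pps i) (fun b => y (i, b)) fun a =>
        Function.extend (fun l => (j, (.inl (.inr (.inl l)) : InstWork p n Q.anc N))) x w (i, a)‖ ^ 2
      else 0) = (∏ i ∈ Finset.univ.erase j, imageProb Q ev (pps i) fun b => y (i, b)) *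
        vecWeight Q (pps j) v := by
  obtain ⟨H, hH⟩ : ∃ H : Fin M → Bits (InstWork p n Q.anc N) → ℝ, ∀ i w, H i w = if i = j then
      (if ∀ l, w (.inl (.inr (.inl l))) = false then
        ‖∑ x, star (v x) * instState Q ev N (pps j) (fun b => y (j, b)) (setOut w x)‖ ^ 2 else 0) else
      ‖instState Q ev N (pps i) (fun b => y (i, b)) w‖ ^ 2 := ⟨_, fun _ _ => rfl⟩
  have h1 : ∀ w : Bits (Fin M × InstWork p n Q.anc N),
      (if ∀ l, w (j, .inl (.inr (.inl l))) = false then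
      ‖∑ x, star (v x) * ∏ i, instState Q ev N (pps i) (fun b => y (i, b)) fun a =>
        Function.extend (fun l => (j, (.inl (.inr (.inl l)) : InstWork p n Q.anc N))) x w (i, a)‖ ^ 2
      else 0) = ∏ i, H i fun a => w (i, a) := by
    intro w
    rw [← Finset.mul_prod_erase _ _ (Finset.mem_univ j)]
    rw [hH, if_pos rfl]
    by_cases h : ∀ l, w (j, .inl (.inr (.inl l))) = false
    · rw [if_pos h, if_pos h]
      have h2 : ∀ x, ∏ i, instState Q ev N (pps i) (fun b => y (i, b)) (fun a =>
          Function.extend (fun l => (j, (.inl (.inr (.inl l)) : InstWork p n Q.anc N))) x w (i, a)) =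
          instState Q ev N (pps j) (fun b => y (j, b)) (setOut (fun a => w (j, a)) x) *
            ∏ i ∈ Finset.univ.erase j, instState Q ev N (pps i) (fun b => y (i, b)) fun a => w (i, a) := by
        intro x
        rw [← Finset.mul_prod_erase _ _ (Finset.mem_univ j)]
        congr 1
        · congr 1
          have hinj : Function.Injective fun l => (j, (.inl (.inr (.inl l)) : InstWork p n Q.anc N)) :=
            fun a b h => by simpa using h
          ext ((a | a | a) | a)
          · rw [Function.extend_apply' _ _ _ (by simp)]; rfl
          · exact hinj.extend_apply x w a
          · rw [Function.extend_apply' _ _ _ (by simp)]; rfl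
          · rw [Function.extend_apply' _ _ _ (by simp)]; rfl
        · refine Finset.prod_congr rfl fun i hi => ?_
          congr 1
          ext a
          rw [Function.extend_apply']
          rintro ⟨l, hl⟩
          exact Finset.ne_of_mem_erase hi (congrArg Prod.fst hl).symm
      simp only [h2, ← mul_assoc]
      rw [← Finset.sum_mul, norm_mul, mul_pow, norm_prod, ← Finset.prod_pow]
      congr 1
      refine Finset.prod_congr rfl fun i hi => ?_
      rw [hH, if_neg (Finset.ne_of_mem_erase hi)]
    · rw [if_neg h, if_neg h, zero_mul]
  rw [Finset.sum_congr rfl fun w _ => h1 w, sum_bits_prod, ← Finset.mul_prod_erase _ _ (Finset.mem_univ j), mul_comm]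
  congr 1
  · refine Finset.prod_congr rfl fun i hi => ?_
    simp only [hH, if_neg (Finset.ne_of_mem_erase hi)]
    exact sum_norm_sq_instState _ _ _ _ _
  · simp only [hH, if_true]
    exact sum_instState_setOut _ _ _ _ _ hv

theorem sum_comp_le_of_injective {A B : Type} [Fintype A] [Fintype B] {f : A → B}
    (hf : Function.Injective f) {G : B → ℝ} (hG : ∀ b, 0 ≤ G b) : ∑ a, G (f a) ≤ ∑ b, G b :=
  (Finset.sum_map Finset.univ ⟨f, hf⟩ G).symm.trans_le
    (Finset.sum_le_univ_sum_of_nonneg hG)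

/-- For given coins and images at most one index is the first success, so at most one summand is
nonzero. -/
theorem sum_firstFactor_le (I : ClawSampler g p n m) (r : Bits (Fin M × Fin g))
    (y : Bits (Fin M × Fin m)) (P O : Bits (Fin g) → Bits (Fin m) → ℝ) {B : ℝ} (hB : 0 ≤ B)
    (h : ∀ j, I.isFirst r y j = true → (∏ i ∈ Finset.univ.erase j,
      P (fun a => r (i, a)) fun b => y (i, b)) * O (fun a => r (j, a)) (fun b => y (j, b)) ≤ B)
    (hP : ∀ r y, 0 ≤ P r y) (hO : ∀ r y, 0 ≤ O r y) :
    ∑ j, ∏ i, firstFactor I.good P O j i (fun a => r (i, a)) (fun b => y (i, b)) ≤ B := by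
  have h0 : ∀ j, I.isFirst r y j = false →
      ∏ i, firstFactor I.good P O j i (fun a => r (i, a)) (fun b => y (i, b)) = 0 := by
    intro j hj
    rw [Finset.prod_eq_zero_iff]
    by_cases hok : I.ok r y j = true
    · obtain ⟨i, hi, hi'⟩ : ∃ i < j, I.ok r y i = true := by
        by_contra! h'
        refine absurd hj (by simp [I.isFirst_eq_true.2 ⟨hok, fun i hi => by simpa using h' i hi⟩])
      exact ⟨i, Finset.mem_univ i, by rw [firstFactor, if_pos hi]; exact if_pos hi'⟩
    · exact ⟨j, Finset.mem_univ j, by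
        rw [firstFactor, if_neg (lt_irrefl j), if_pos rfl]; exact if_neg hok⟩
  by_cases hex : ∃ j, I.isFirst r y j = true
  · obtain ⟨j, hj⟩ := hex
    rw [Fintype.sum_eq_single j fun j' hj' => h0 j' (by
      by_contra h'
      exact hj' (I.isFirst_unique (by simpa using h') hj))]
    refine le_trans ?_ (h j hj)
    rw [← Finset.mul_prod_erase _ _ (Finset.mem_univ j), mul_comm]
    have hj' := I.isFirst_eq_true.1 hj
    refine mul_le_mul (Finset.prod_le_prod (fun i _ => ?_) fun i hi => ?_) (le_of_eq ?_) ?_ ?_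
    · unfold firstFactor
      split_ifs
      exacts [le_rfl, hP _ _, hO _ _, le_rfl, hP _ _]
    · unfold firstFactor
      rw [if_neg (Finset.ne_of_mem_erase hi)]
      split_ifs
      exacts [hP _ _, le_rfl, le_rfl]
    · rw [firstFactor, if_neg (lt_irrefl j), if_pos rfl]
      exact if_pos hj'.1
    · unfold firstFactor
      split_ifs
      exacts [le_rfl, hP _ _, hO _ _, le_rfl, hP _ _]
    · exact Finset.prod_nonneg fun _ _ => hP _ _
  · rw [Finset.sum_eq_zero fun j _ => h0 j (by simpa using fun h' => hex ⟨j, h'⟩)]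
    exact hB

theorem vecWeight_nonneg (Q : QCircuit (Fin p) (Fin n)) (pp : Bits (Fin p)) (c : QVec (Fin n)) :
    0 ≤ vecWeight Q pp c := Finset.sum_nonneg fun _ _ => Finset.sum_nonneg fun _ _ => by positivity

/-- In the event that `j` is the first success, the output register holds the state of instance `j`.
Its overlap with the claw state, weighted with the probabilities of the other images, is the summand
for `j`; if no instance succeeds, the bound counts nothing. -/
theorem exists_honest_receiver (hS₁ : S₁.Extends trivialSender e₁ ec₁ I.firstMsg I.firstOut)
    (hS₂ : S₂.Extends S₁ e₂ ec₂ ClawSampler.maskMsg ClawSampler.finalOut) (Q : QCircuit (Fin p) (Fin n))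
    {N₀ : ℕ} (hev : BComp ev N₀)
    (hgood : ∀ r y, I.good r y = true → I.x₀ r y ≠ I.x₁ r y ∧ ev (Sum.elim (I.pp r) (I.x₀ r y)) = y ∧
      ev (Sum.elim (I.pp r) (I.x₁ r y)) = y) {S O : ℝ}
    (hS : 𝔼 r, ∑ y, (if I.good r y then imageProb Q ev (I.pp r) y else 0) = S)
    (hO : 𝔼 r, ∑ y, (if I.good r y then
      vecWeight Q (I.pp r) (clawKet (I.x₀ r y) (I.x₁ r y) false) else 0) = O) :
    ∃ R : Receiver q' 2 (Fin n), R.size ≤ q' + n + q + 2 + M * (2 * p + 3 * n + Q.anc + Q.gates.length +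
        9 * N₀ + 10 * m) ∧
      ∑ j ∈ Finset.range M, (1 - S) ^ j * O ≤ sqOverlap S₂ R Empty.elim clawVec := by
  obtain ⟨N, hN, R₁, hsize₁, hanc, hst⟩ := exists_parallel_receiver e₁ Q hev
  obtain ⟨x, hx⟩ : ∃ x : Fin M × Fin n → R₁.Work ⊕ Empty,
    ∀ l, x l = .inl (.inl (l.1, .inl (.inr (.inl l.2)))) := ⟨_, fun _ => rfl⟩
  obtain ⟨gs, hlen, hgs⟩ := exists_selection_gates x fun a b h => by
    simp only [hx, Sum.inl.injEq, Prod.mk.injEq, Sum.inr.injEq] at h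
    exact Prod.ext h.1 h.2
  obtain ⟨R₂, hsize₂, hR₂⟩ := hS₂.exists_receiver R₁ gs
  refine ⟨R₂, hsize₂.trans ?_, le_trans ?_ (hR₂ Empty.elim clawVec)⟩
  · simp only [Fintype.card_fin, Fintype.card_empty]
    have := Nat.mul_le_mul_left M hN
    nlinarith
  rw [expect_joinCoins ec₁, ← expect_firstFactor I.good (fun r y => imageProb Q ev (I.pp r) y)
    (fun r y => vecWeight Q (I.pp r) (clawKet (I.x₀ r y) (I.x₁ r y) false))
    (fun r => sum_imageProb Q ev (I.pp r)) hS hO M]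
  refine (Finset.expect_const (s := (Finset.univ : Finset (Bits (Fin trivialSender.coins))))
    Finset.univ_nonempty _).symm.trans_le (Finset.expect_le_expect fun r₀ _ => ?_)
  rw [expect_bits_sum]
  refine Finset.expect_le_expect fun r _ => ?_
  refine (Finset.expect_const (s := (Finset.univ : Finset (Bits (Fin n ⊕ Fin n))))
    Finset.univ_nonempty _).symm.trans_le (Finset.expect_le_expect fun f _ => ?_)
  refine (Finset.expect_const (s := (Finset.univ : Finset (Bits Empty)))
    Finset.univ_nonempty _).symm.trans_le (Finset.expect_le_expect fun c _ => ?_)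
  set pps : Fin M → Bits (Fin p) := fun i => I.pp fun a => r (i, a) with hpps
  have hinj : Function.Injective fun y : Bits (Fin M × Fin m) => (fun _ => msgJoin e₁ (fun _ => false)
      (ClawSampler.parMsg pps y) : Fin 1 → Bits (Fin q)) := by
    intro y y' h
    have h1 := congrArg (msgHigh e₁) (congrFun h 0)
    rw [msgHigh_msgJoin, msgHigh_msgJoin] at h1
    ext b
    exact congrFun h1 (b.1, .inr b.2)
  -- Only replies with the public parameters unchanged are counted; they are parametrised by the
  -- images.
  refine le_trans (Finset.sum_le_sum fun y _ => ?_) (sum_comp_le_of_injective hinj fun t =>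
    Finset.sum_nonneg fun d _ => ov_nonneg _ _)
  rw [first_msg_eq hS₁, first_result_eq hS₁, msgHigh_msgJoin]
  have hy : (fun b : Fin M × Fin m => ClawSampler.parMsg pps y (b.1, .inr b.2)) = y := rfl
  rw [hy]
  refine sum_firstFactor_le I r y _ _ (Finset.sum_nonneg fun d _ => ov_nonneg _ _)
    (fun j hj => ?_) (fun _ _ => imageProb_nonneg _ _ _ _) fun _ _ => vecWeight_nonneg _ _ _
  refine le_trans ?_ (Finset.single_le_sum (fun d _ => ov_nonneg _ _)
    (Finset.mem_univ fun i => decide (i = j)))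
  have hmask : ClawSampler.maskMsg (Sum.elim Empty.elim (Sum.elim c (I.outcome r f y))) =
      fun i => decide (i = j) := I.isFirst_eq_decide hj
  have hout : clawVec (ClawSampler.finalOut (Sum.elim (Sum.elim Empty.elim (Sum.elim c (I.outcome r f y)))
      fun i => decide (i = j))) = clawKet (I.x₀ (fun a => r (j, a)) fun b => y (j, b))
        (I.x₁ (fun a => r (j, a)) fun b => y (j, b)) false := by
    rw [← I.select_of_isFirst I.x₀ hj fun l => f (.inl l), ← I.select_of_isFirst I.x₁ hj fun l => f (.inr l)]
    rfl
  rw [hmask, hout]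
  have hg := hgood (fun a => r (j, a)) (fun b => y (j, b)) (I.isFirst_eq_true.1 hj).1
  set v := clawKet (I.x₀ (fun a => r (j, a)) fun b => y (j, b))
    (I.x₁ (fun a => r (j, a)) fun b => y (j, b)) false with hv
  refine (sum_selected_eq (N := N) pps y j (v := v) fun z hz => ?_).symm.trans_le ?_
  · rw [hv, clawKet_false_apply hg.1] at hz
    by_cases h : z = I.x₀ (fun a => r (j, a)) (fun b => y (j, b)) ∨
        z = I.x₁ (fun a => r (j, a)) (fun b => y (j, b))
    · rcases h with rfl | rfl
      exacts [hg.2.1, hg.2.2]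
    · exact absurd (if_neg h) hz
  -- Similarly, of the final basis states only those with clean ancillas are counted.
  have hw : Function.Injective fun w : Bits (Fin M × InstWork p n Q.anc N) =>
      (Sum.elim (Sum.elim w fun _ => false) Empty.elim : Bits (R₁.Work ⊕ Empty)) := by
    intro w w' h
    ext a
    exact congrFun h (.inl (.inl a))
  rw [ov]
  refine le_trans (Finset.sum_le_sum fun w _ => ?_) (sum_comp_le_of_injective hw fun _ => by positivity)
  by_cases h0 : ∀ l, w (j, .inl (.inr (.inl l))) = false
  · rw [if_pos h0]
    refine le_of_eq ?_
    congr 2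
    refine Finset.sum_congr rfl fun o _ => congrArg _ ?_
    rw [hgs _ j o _ fun l => by rw [hx]; exact h0 l]
    simp only [initMsg, Sum.elim_comp_inl, Sum.elim_comp_inr, if_true]
    rw [Receiver.padState, if_pos ⟨fun _ => rfl, fun y => y.elim⟩, hst]
    refine Finset.prod_congr rfl fun i _ => congrArg _ ?_
    ext a
    simp only [Sum.elim_inr]
    have hxi : Function.Injective fun l => x (j, l) := fun a b h => by simpa [hx] using h
    by_cases hia : ∃ l, (j, (.inl (.inr (.inl l)) : InstWork p n Q.anc N)) = (i, a)
    · obtain ⟨l, hl⟩ := hia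
      rw [← hl, Function.Injective.extend_apply (fun a b h => by simpa using h) o w l,
        show (Sum.inl (Sum.inl (j, (.inl (.inr (.inl l)) : InstWork p n Q.anc N))) : R₁.Work ⊕ Empty) =
          x (j, l) from (hx (j, l)).symm]
      exact (hxi.extend_apply _ _ l).symm
    · rw [Function.extend_apply' _ _ _ hia, Function.extend_apply']
      · rfl
      · rintro ⟨l, hl⟩
        rw [hx] at hl
        exact hia ⟨l, by simpa using hl⟩
  · rw [if_neg h0]
    positivity

end Honest

/-! ### Security of the parallel repetition -/

theorem Toggles.const {W : Type} [DecidableEq W] (h : W) (c : Bool) : Toggles h (fun _ => c) 1 := by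
  simpa using (Toggles.one h).and_const c

section MaskReduction
variable {q q' T : ℕ} {κ M : Type} [Fintype κ] [DecidableEq κ] [Fintype M] [DecidableEq M]

open Classical in
-- `B` answers the last message itself, with the hard-wired value `μ` in place of what the sender
-- would announce. The two agree on transcripts on which the announcement is `μ`.
theorem Receiver.exists_mask_reduction (A : Receiver q' (T + 1) κ) (e : Fin q ⊕ M ≃ Fin q')
    (hT : 0 < T) (μ : Bits M) : ∃ B : Receiver q T κ,
      B.size ≤ q + T + q' + T * Fintype.card M + 2 * A.size + T * (Fintype.card M + A.size) ∧
      ∀ (ms ts : Fin T → Bits (Fin q)) (E : Bits κ → Prop),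
        (∑ w, if E (w ∘ Sum.inl) then ‖B.stateN ms ts T w‖ ^ 2 else 0) =
        ∑ z, if E (fun k => z (Sum.inl (Sum.inr (Sum.inl k)))) then
          ‖qRun ((A.step (Fin.last T)).map (QGate.map .inl))
            (A.baseMsg e ms ts (msgJoin e (fun _ => false) μ)) z‖ ^ 2 else 0 := by
  let tgt : M → (Fin q' ⊕ A.Work) ⊕ (Fin T × M) := fun m => .inl (.inl (e (.inr m)))
  have htgt : Function.Injective tgt := fun a b h => by
    simpa only [tgt, Sum.inl.injEq, e.injective.eq_iff, Sum.inr.injEq] using h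
  obtain ⟨P, hP, hlen, hrun⟩ := exists_qgates_toggle (φ := fun m _ => μ m) (n := 1) htgt
    (fun m => Toggles.const _ _) fun _ _ _ _ => rfl
  let f : RedQubits A M Empty ≃ κ ⊕ (Fin q' ⊕ Fin A.anc ⊕ (Fin T × M)) :=
    { toFun := Sum.elim (Sum.elim (Sum.elim (fun a => .inr (.inl a)) (Sum.elim .inl fun a =>
        .inr (.inr (.inl a)))) fun a => .inr (.inr (.inr a))) Empty.elim
      invFun := Sum.elim (fun k => .inl (.inl (.inr (.inl k)))) (Sum.elim (fun a => .inl (.inl (.inl a)))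
        (Sum.elim (fun a => .inl (.inl (.inr (.inr a)))) fun a => .inl (.inr a)))
      left_inv := by rintro (((a | a | a) | a) | a) <;> first | rfl | exact a.elim
      right_inv := by rintro (a | a | a | a) <;> rfl }
  obtain ⟨B, hsize, hB⟩ := A.exists_reduction e f
    ((P ++ (A.step (Fin.last T)).map (QGate.map .inl)).map (QGate.map .inl))
  refine ⟨B, hsize.trans ?_, fun ms ts E => ?_⟩
  · have h2 : (A.step (Fin.last T)).length ≤ A.size := by
      have := Finset.single_le_sum (f := fun i => (A.step i).length) (fun _ _ => Nat.zero_le _)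
        (Finset.mem_univ (Fin.last T))
      simp only [Receiver.size]
      lia
    have h3 : Fintype.card κ + A.anc ≤ A.size := by simp only [Receiver.size]; lia
    simp only [List.length_map, List.length_append, Fintype.card_sum, Fintype.card_fin,
      Fintype.card_prod] at *
    have h4 := Nat.mul_le_mul_left T (show P.length + (A.step (Fin.last T)).length ≤
      Fintype.card M + A.size by lia)
    lia
  obtain ⟨w, hw1, hw2⟩ := hB hT ms ts
  have hP0 : qRun P (A.baseMsg e ms ts fun _ => false) =
      A.baseMsg e ms ts (msgJoin e (fun _ => false) μ) := by
    ext s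
    rw [qRun_of_cRun_toggle htgt (fun _ _ _ _ => rfl) hP hrun]
    have h1 : ∀ v, (∀ m, tgt m ≠ v) → Function.extend tgt (fun b => s (tgt b) ^^ μ b) s v = s v :=
      fun v hv => Function.extend_apply' _ _ _ fun ⟨m, hm⟩ => hv m hm
    have h2 : Function.extend tgt (fun b => s (tgt b) ^^ μ b) s ∘ Sum.inr = s ∘ Sum.inr := by
      ext i
      exact h1 _ fun m => by simp [tgt]
    have h3 : (Function.extend tgt (fun b => s (tgt b) ^^ μ b) s ∘ Sum.inl) ∘ Sum.inr =
        (s ∘ Sum.inl) ∘ Sum.inr := by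
      ext i
      exact h1 _ fun m => by simp [tgt]
    simp only [Receiver.baseMsg, initMsg]
    rw [h2, h3]
    refine if_congr ?_ rfl rfl
    have hl : ∀ l, Function.extend tgt (fun b => s (tgt b) ^^ μ b) s
        (.inl (.inl (e (.inl l)))) = s (.inl (.inl (e (.inl l)))) :=
      fun l => h1 _ fun m => by simp [tgt]
    have hm : ∀ m, Function.extend tgt (fun b => s (tgt b) ^^ μ b) s
        (.inl (.inl (e (.inr m)))) = (s (.inl (.inl (e (.inr m)))) ^^ μ m) :=
      fun m => htgt.extend_apply _ _ _
    have hxor : ∀ a b : Bool, (a ^^ b) = false ↔ a = b := by decide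
    simp only [funext_iff, ← e.forall_congr_right, Sum.forall, Function.comp_apply, hl, hm, hxor, msgJoin,
      Equiv.symm_apply_apply, Sum.elim_inl, Sum.elim_inr]
  rw [← Equiv.sum_comp w, sum_bits_sum]
  refine Finset.sum_congr rfl fun z _ => ?_
  rw [Fintype.sum_unique]
  have hE : ∀ d : Bits Empty, (w (Sum.elim z d) ∘ Sum.inl) = fun k => z (Sum.inl (Sum.inr (Sum.inl k))) := by
    intro d
    ext k
    rw [Function.comp_apply, hw1]
    rfl
  refine if_congr (iff_of_eq (congrArg E (hE _))) ?_ rfl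
  rw [hw2, qRun_map_inl]
  have h5 : ∀ d : Bits Empty, (fun a => if ∀ i, (Sum.elim a d : Bits (RedQubits A M Empty)) (Sum.inr i) = false then
      A.baseMsg e ms ts (fun _ => false) ((Sum.elim a d : Bits (RedQubits A M Empty)) ∘ Sum.inl) else 0) =
      A.baseMsg e ms ts fun _ => false := by
    intro d
    ext a
    rw [if_pos fun i => i.elim]
    rfl
  rw [h5, qRun_append, hP0]

open Classical in
/-- A receiver of a single message, viewed as a circuit with the same output. -/
theorem Receiver.exists_circuit {p : ℕ} (B : Receiver q 1 κ) (μ : Bits (Fin p) → Bits (Fin q))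
    (hμ : ∀ b, (∃ c, ∀ s, μ s b = c) ∨ ∃ a, ∀ s, μ s b = s a) :
    ∃ C : QCircuit (Fin p) κ, C.size ≤ p + 2 * B.size ∧ ∀ pp (E : Bits κ → Prop),
      (∑ o, if E o then C.prob pp o else 0) =
        ∑ t, ∑ w, if E (w ∘ Sum.inl) then ‖B.stateN (fun _ => μ pp) t 1 w‖ ^ 2 else 0 := by
  obtain ⟨φ, hφm, hφk, hφa⟩ : ∃ φ : Fin q ⊕ κ ⊕ Fin B.anc ↪ Fin p ⊕ κ ⊕ Fin (q + B.anc),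
      (∀ a, φ (.inl a) = .inr (.inr (finSumFinEquiv (.inl a)))) ∧ (∀ k, φ (.inr (.inl k)) = .inr (.inl k)) ∧
      ∀ a, φ (.inr (.inr a)) = .inr (.inr (finSumFinEquiv (.inr a))) :=
    ⟨⟨Sum.elim (fun a => .inr (.inr (finSumFinEquiv (.inl a)))) (Sum.elim (fun k => .inr (.inl k))
      fun a => .inr (.inr (finSumFinEquiv (.inr a)))), by
      rintro (a | a | a) (b | b | b) h <;>
        simp only [Sum.elim_inl, Sum.elim_inr, Sum.inr.injEq, Sum.inl.injEq, reduceCtorEq,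
          EmbeddingLike.apply_eq_iff_eq] at h ⊢ <;> exact h⟩, fun _ => rfl, fun _ => rfl, fun _ => rfl⟩
  let tgt : Fin q → Fin p ⊕ κ ⊕ Fin (q + B.anc) := fun a => φ (.inl a)
  have htgt : Function.Injective tgt := fun a b h => by simpa [tgt] using h
  have hne : ∀ a b, (.inl a : Fin p ⊕ κ ⊕ Fin (q + B.anc)) ≠ tgt b := fun a b => by simp [tgt, hφm]
  let χ : Fin q → Bits (Fin p ⊕ κ ⊕ Fin (q + B.anc)) → Bool := fun b s => μ (s ∘ Sum.inl) b
  have hχ : ∀ b s s', (∀ w, (∀ b', w ≠ tgt b') → s w = s' w) → χ b s = χ b s' := by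
    intro b s s' h
    simp only [χ]
    congr 1
    ext i
    exact h _ fun b' => hne i b'
  obtain ⟨P, hP, hlen, hrun⟩ := exists_qgates_toggle (φ := χ) (n := 1) htgt (by
    intro b
    simp only [χ]
    rcases hμ b with ⟨c, hc⟩ | ⟨a, ha⟩
    · simp only [hc]
      exact Toggles.const _ _
    · simp only [ha]
      exact Toggles.wire (hne a b)) fun b b' s c => hχ _ _ _ fun w hw => Function.update_of_ne (hw b') _ _
  let C : QCircuit (Fin p) κ := ⟨q + B.anc, P ++ (B.step 0).map (QGate.map φ)⟩
  refine ⟨C, ?_, fun pp E => ?_⟩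
  · simp only [QCircuit.size, Receiver.size, Fintype.card_fin, List.length_append, List.length_map, C,
      Fin.sum_univ_succ, Fin.sum_univ_zero] at *
    lia
  have hP0 : qRun P (ket (Sum.elim pp fun _ => false)) = fun s : Bits (Fin p ⊕ κ ⊕ Fin (q + B.anc)) =>
      if s ∘ Sum.inl = pp then initMsg (μ pp) (ket fun _ => false) (s ∘ φ) else 0 := by
    ext s
    rw [qRun_of_cRun_toggle htgt hχ hP hrun]
    have h1 : ∀ v, (∀ m, tgt m ≠ v) → Function.extend tgt (fun b => s (tgt b) ^^ χ b s) s v = s v :=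
      fun v hv => Function.extend_apply' _ _ _ fun ⟨m, hm⟩ => hv m hm
    have h2 : ∀ m, Function.extend tgt (fun b => s (tgt b) ^^ χ b s) s (tgt m) = (s (tgt m) ^^ χ m s) :=
      fun m => htgt.extend_apply _ _ _
    have hxor : ∀ a b : Bool, (a ^^ b) = false ↔ a = b := by decide
    simp only [ket, initMsg]
    rw [← ite_and, ← ite_and]
    refine if_congr ⟨fun h => ?_, fun ⟨⟨h, h'⟩, h''⟩ => ?_⟩ rfl rfl
    · have e1 : s ∘ Sum.inl = pp := by
        ext i
        rw [Function.comp_apply, ← h1 _ fun m => (hne i m).symm, h]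
        rfl
      refine ⟨⟨e1, ?_⟩, ?_⟩
      · ext i
        have h3 := congrFun h (tgt i)
        rw [h2] at h3
        simp only [tgt, hφm, Sum.elim_inr, hxor, χ, e1] at h3
        rw [Function.comp_apply, Function.comp_apply, hφm]
        exact h3
      · ext i
        have h3 := congrFun h (φ (.inr i))
        rw [h1 _ fun m => by simp [tgt]] at h3
        simp only [Function.comp_apply, h3]
        rcases i with i | i
        · simp [hφk]
        · simp [hφa]
    · ext v
      by_cases hv : ∃ m, tgt m = v
      · obtain ⟨m, rfl⟩ := hv
        rw [h2]
        simp only [χ, h, tgt, hφm, Sum.elim_inr, hxor]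
        have := congrFun h' m
        simpa [hφm] using this
      · rw [h1 _ fun m hm => hv ⟨m, hm⟩]
        rcases v with v | v | v
        · exact congrFun h v
        · have := congrFun h'' (.inl v)
          simpa [hφk] using this
        · obtain ⟨v | v, rfl⟩ := finSumFinEquiv.surjective v
          · exact absurd ⟨v, hφm v⟩ hv
          · have := congrFun h'' (.inr v)
            simpa [hφa] using this
  have hfin : ∀ s, C.final pp s = if s ∘ Sum.inl = pp then
      qRun (B.step 0) (initMsg (μ pp) (ket fun _ => false)) (s ∘ φ) else 0 := by
    intro s
    have h1 : C.final pp = qRun ((B.step 0).map (QGate.map φ)) (qRun P (ket (Sum.elim pp fun _ => false))) :=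
      qRun_append _ _ _
    rw [h1, hP0, qRun_map]
    have h2 : ∀ a, Function.extend φ a s ∘ Sum.inl = s ∘ Sum.inl := by
      intro a
      ext i
      refine Function.extend_apply' _ _ _ ?_
      rintro ⟨b | b | b, hb⟩ <;> simp [hφm, hφk, hφa] at hb
    simp only [h2, extend_comp_self]
    split_ifs
    · rfl
    · exact congrFun (qRun_zero _) _
  have hsum : ∀ o, C.prob pp o = ∑ t : Bits (Fin q), ∑ v : Bits (Fin B.anc),
      ‖qRun (B.step 0) (initMsg (μ pp) (ket fun _ => false)) (Sum.elim t (Sum.elim o v))‖ ^ 2 := by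
    intro o
    rw [QCircuit.prob, Fintype.sum_eq_single pp]
    · rw [← Equiv.sum_comp (Equiv.arrowCongr finSumFinEquiv (Equiv.refl Bool)), sum_bits_sum]
      refine Finset.sum_congr rfl fun t _ => Finset.sum_congr rfl fun v _ => ?_
      rw [hfin, Sum.elim_comp_inl, if_pos rfl]
      congr 3
      ext (a | a | a)
      · simp only [Function.comp_apply, hφm, Sum.elim_inr, Sum.elim_inl, Equiv.arrowCongr_apply,
          Equiv.symm_apply_apply, Equiv.refl_apply]
      · simp only [Function.comp_apply, hφk, Sum.elim_inr, Sum.elim_inl]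
      · simp only [Function.comp_apply, hφa, Sum.elim_inr, Equiv.arrowCongr_apply,
          Equiv.symm_apply_apply, Equiv.refl_apply]
    · intro u hu
      refine Finset.sum_eq_zero fun v _ => ?_
      rw [hfin, Sum.elim_comp_inl, if_neg hu]
      simp
  rw [← Equiv.sum_comp (Equiv.funUnique (Fin 1) (Bits (Fin q))).symm]
  have hB : ∀ t : Bits (Fin q), ∀ w, B.stateN (fun _ => μ pp) ((Equiv.funUnique (Fin 1) (Bits (Fin q))).symm t) 1 w =
      qRun (B.step 0) (initMsg (μ pp) (ket fun _ => false)) (Sum.elim t w) := fun t w => rfl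
  simp only [hB, hsum]
  have h6 : ∀ t : Bits (Fin q), (∑ w : Bits B.Work, if E (w ∘ Sum.inl) then
      ‖qRun (B.step 0) (initMsg (μ pp) (ket fun _ => false)) (Sum.elim t w)‖ ^ 2 else 0) =
      ∑ o, if E o then ∑ v, ‖qRun (B.step 0) (initMsg (μ pp) (ket fun _ => false))
        (Sum.elim t (Sum.elim o v))‖ ^ 2 else 0 := by
    intro t
    rw [sum_bits_sum]
    refine Finset.sum_congr rfl fun o _ => ?_
    by_cases hE : E o
    · rw [if_pos hE]
      exact Finset.sum_congr rfl fun v _ => if_pos hE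
    · rw [if_neg hE]
      exact Finset.sum_eq_zero fun v _ => if_neg hE
  simp only [h6]
  rw [Finset.sum_comm]
  refine Finset.sum_congr rfl fun o _ => ?_
  split_ifs
  · rfl
  · simp

end MaskReduction

/-! ### From a search adversary to a collision finder -/

section ParallelSecurity

/-- The coins `r` with those of the `j`-th instance replaced by `a`. -/
def setRow {M : ℕ} {A : Type} (j : Fin M) (r : Bits (Fin M × A)) (a : Bits A) : Bits (Fin M × A) :=
  fun x => if x.1 = j then a x.2 else r x

/-- Exchanging row `j` of `r` with an independent row `a` is a bijection of pairs, so resampling a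
row preserves the distribution. -/
theorem expect_setRow {M : ℕ} {A : Type} [Fintype A] [DecidableEq A] (j : Fin M)
    (F : Bits (Fin M × A) → ℝ) : 𝔼 r, 𝔼 a, F (setRow j r a) = 𝔼 r, F r := by
  have h : ∀ (r : Bits (Fin M × A)) a, setRow j (setRow j r a) (fun x => r (j, x)) = r := by
    intro r a
    ext ⟨i, x⟩
    by_cases hi : i = j
    · subst hi; simp [setRow]
    · simp [setRow, hi]
  have h' : ∀ (r : Bits (Fin M × A)) a, (fun x => setRow j r a (j, x)) = a := by
    intro r a
    ext x
    simp [setRow]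
  have h2 : 𝔼 r, 𝔼 a, F (setRow j r a) = 𝔼 r : Bits (Fin M × A), 𝔼 _a : Bits A, F r := by
    rw [← Finset.expect_product', ← Finset.expect_product', Finset.univ_product_univ]
    refine Fintype.expect_equiv ⟨fun p => (setRow j p.1 p.2, fun x => p.1 (j, x)),
      fun p => (setRow j p.1 p.2, fun x => p.1 (j, x)), fun p => ?_, fun p => ?_⟩ _ _ fun p => rfl
    all_goals exact Prod.ext (h _ _) (h' _ _)
  rw [h2]
  exact Finset.expect_congr rfl fun r _ => Finset.expect_const Finset.univ_nonempty _

theorem exists_expect_le {A : Type} [Fintype A] [Nonempty A] (F : A → ℝ) : ∃ a, 𝔼 x, F x ≤ F a := by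
  obtain ⟨a, ha⟩ := Finite.exists_max F
  exact ⟨a, (Finset.expect_le_expect fun x _ => ha x).trans_eq (Finset.expect_const Finset.univ_nonempty _)⟩

variable {M g p n m q q' : ℕ}

/-- `o` consists of two distinct strings with the same image. -/
def IsCollision (ev : Bits (Fin p ⊕ Fin n) → Bits (Fin m)) (pp : Bits (Fin p)) (o : Bits (Fin n ⊕ Fin n)) :
    Prop :=
  o ∘ Sum.inl ≠ o ∘ Sum.inr ∧ ev (Sum.elim pp (o ∘ Sum.inl)) = ev (Sum.elim pp (o ∘ Sum.inr))

open Classical in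
/-- The probability that `C` finds a collision. -/
noncomputable def ClawSampler.collisionProb (I : ClawSampler g p n m)
    (ev : Bits (Fin p ⊕ Fin n) → Bits (Fin m)) (C : QCircuit (Fin p) (Fin n ⊕ Fin n)) : ℝ :=
  𝔼 r, ∑ o, if IsCollision ev (I.pp r) o then C.prob (I.pp r) o else 0

open Classical in
-- The challenge key becomes instance `j`, and the coins of the other instances are fixed to the
-- best values. Each bit of the first message is then a constant or a bit of the challenge, as
-- `Receiver.exists_circuit` requires.
theorem ClawSampler.exists_collision_circuit (I : ClawSampler g p n m)
    (ev : Bits (Fin p ⊕ Fin n) → Bits (Fin m)) (e : Fin 0 ⊕ ParMsg M p m ≃ Fin q) (j : Fin M)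
    (B : Receiver q 1 (Fin n ⊕ Fin n)) : ∃ C : QCircuit (Fin p) (Fin n ⊕ Fin n), C.size ≤ p + 2 * B.size ∧
      (𝔼 r : Bits (Fin M × Fin g), ∑ t, ∑ w,
        if IsCollision ev (I.pp fun a => r (j, a)) (w ∘ Sum.inl) then ‖B.stateN (fun _ =>
          msgJoin e (fun _ => false) (parMsg (fun i => I.pp fun a => r (i, a)) fun _ => false)) t 1 w‖ ^ 2
        else 0) ≤ I.collisionProb ev C := by
  set F : Bits (Fin M × Fin g) → ℝ := fun r => ∑ t, ∑ w,
    if IsCollision ev (I.pp fun a => r (j, a)) (w ∘ Sum.inl) then ‖B.stateN (fun _ =>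
      msgJoin e (fun _ => false) (parMsg (fun i => I.pp fun a => r (i, a)) fun _ => false)) t 1 w‖ ^ 2
    else 0 with hF
  obtain ⟨r, hr⟩ := exists_expect_le fun r => 𝔼 a, F (setRow j r a)
  rw [expect_setRow] at hr
  obtain ⟨C, hsize, hC⟩ := B.exists_circuit (p := p) (fun s => msgJoin e (fun _ => false)
    (parMsg (fun i => if i = j then s else I.pp fun a => r (i, a)) fun _ => false)) (by
      intro b
      obtain ⟨b | ⟨i, b | b⟩, rfl⟩ := e.surjective b
      · exact b.elim0
      · by_cases hi : i = j
        · exact Or.inr ⟨b, fun s => by simp [msgJoin, parMsg, hi]⟩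
        · exact Or.inl ⟨I.pp (fun a => r (i, a)) b, fun s => by simp [msgJoin, parMsg, hi]⟩
      · exact Or.inl ⟨false, fun s => by simp [msgJoin, parMsg]⟩)
  refine ⟨C, hsize, hr.trans (le_of_eq ?_)⟩
  rw [collisionProb]
  refine Finset.expect_congr rfl fun a _ => ?_
  rw [hC]
  have h1 : (fun b => setRow j r a (j, b)) = a := by ext b; simp [setRow]
  have h2 : (fun i => I.pp fun b => setRow j r a (i, b)) = fun i => if i = j then I.pp a else
      I.pp fun b => r (i, b) := by
    ext1 i
    by_cases hi : i = j
    · rw [if_pos hi, hi, h1]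
    · rw [if_neg hi]
      congr 1
      ext b
      simp [setRow, hi]
  simp only [hF, h1, h2]

variable {I : ClawSampler g p n m} {S₁ : Sender q 1 Empty (ParOut M n)}
  {S₂ : Sender q' 2 Empty (ClawOut n)} {e₁ : Fin 0 ⊕ ParMsg M p m ≃ Fin q} {e₂ : Fin q ⊕ Fin M ≃ Fin q'}
  {ec₁ : Fin trivialSender.coins ⊕ ParCoins M g n ≃ Fin S₁.coins}
  {ec₂ : Fin S₁.coins ⊕ Empty ≃ Fin S₂.coins} {ev : Bits (Fin p ⊕ Fin n) → Bits (Fin m)}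

open Classical in
-- If `j` is the first success, then the announcement is the `j`-th unit vector and a winning
-- adversary outputs a collision for key `j`; the union bound over `j` gives the factor `M`. If
-- nothing succeeds, the target is a string `f` on which no message depends.
theorem exists_collision_finder (hS₁ : S₁.Extends trivialSender e₁ ec₁ I.firstMsg I.firstOut)
    (hS₂ : S₂.Extends S₁ e₂ ec₂ ClawSampler.maskMsg ClawSampler.finalOut)
    (hgood : ∀ r y, I.good r y = true → I.x₀ r y ≠ I.x₁ r y ∧ ev (Sum.elim (I.pp r) (I.x₀ r y)) = y ∧
      ev (Sum.elim (I.pp r) (I.x₁ r y)) = y) (A : Receiver q' 2 (Fin n ⊕ Fin n)) :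
    ∃ C : QCircuit (Fin p) (Fin n ⊕ Fin n), C.size ≤ p + 2 * n + 2 * (q + 1 + q' + 2 * M + 3 * A.size) ∧
      eventProb S₂ A Empty.elim (fun a o => o = clawPair a) ≤
        M * I.collisionProb ev C + ((2 : ℝ) ^ (2 * n))⁻¹ := by
  choose B hBsize hB using fun μ => A.exists_mask_reduction e₂ one_pos μ
  choose C hCsize hC using fun j => I.exists_collision_circuit ev e₁ j (B fun i => decide (i = j))
  set m₁ : Bits (Fin M × Fin g) → Fin 1 → Bits (Fin q) := fun r _ => msgJoin e₁ (fun _ => false)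
    (ClawSampler.parMsg (fun i => I.pp fun a => r (i, a)) fun _ => false) with hm₁
  set D : Fin M → Bits (Fin M × Fin g) → (Fin 1 → Bits (Fin q)) → ℝ := fun j r t => ∑ w,
    if IsCollision ev (I.pp fun a => r (j, a)) (w ∘ Sum.inl) then
      ‖(B fun i => decide (i = j)).stateN (m₁ r) t 1 w‖ ^ 2 else 0 with hD
  set Z : Bits (Fin M × Fin g) → Bits (Fin n ⊕ Fin n) → (Fin 1 → Bits (Fin q)) → ℝ := fun r f t => ∑ w,
    if w ∘ Sum.inl = f then ‖(B fun _ => false).stateN (m₁ r) t 1 w‖ ^ 2 else 0 with hZ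
  have hD0 : ∀ j r t, 0 ≤ D j r t := fun j r t => Finset.sum_nonneg fun _ _ => by split_ifs <;> positivity
  have hZ0 : ∀ j r t, 0 ≤ Z j r t := fun j r t => Finset.sum_nonneg fun _ _ => by split_ifs <;> positivity
  -- For each transcript, the actual announcement is replaced by the hard-wired one of the matching
  -- case; the other cases contribute nonnegative terms.
  have h1 : eventProb S₂ A Empty.elim (fun a o => o = clawPair a) ≤
      𝔼 r : Bits (Fin M × Fin g), 𝔼 f : Bits (Fin n ⊕ Fin n), ∑ t, (∑ j, D j r t + Z r f t) := by
    rw [hS₂.eventProb_eq A _ _ (fun _ a o => o = clawPair fun x => a (.inr x)) fun _ _ _ _ => Iff.rfl,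
      expect_joinCoins ec₁]
    refine (Finset.expect_le_expect fun r₀ _ => ?_).trans_eq
      (Finset.expect_const (s := (Finset.univ : Finset (Bits (Fin trivialSender.coins))))
        Finset.univ_nonempty _)
    rw [expect_bits_sum]
    refine Finset.expect_le_expect fun r _ => Finset.expect_le_expect fun f _ => ?_
    refine (Finset.expect_le_expect fun c _ => ?_).trans_eq
      (Finset.expect_const (s := (Finset.univ : Finset (Bits Empty))) Finset.univ_nonempty _)
    refine Finset.sum_le_sum fun t _ => ?_
    rw [← hB _ _ _ fun o => o = clawPair fun x => S₁.result Empty.elim (joinCoins ec₁ r₀ (Sum.elim r f)) t (.inr x)]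
    have ht : t = fun _ => t 0 := by
      ext1 i
      rw [show i = 0 from Fin.ext (by have := i.2; lia)]
    have hres := first_result_eq hS₁ r₀ r f (t 0)
    have hmsg : S₁.msg Empty.elim (joinCoins ec₁ r₀ (Sum.elim r f)) t = m₁ r := by
      rw [ht]
      exact first_msg_eq hS₁ r₀ r f (t 0)
    rw [← ht] at hres
    rw [hres, hmsg]
    set y : Bits (Fin M × Fin m) := fun b => msgHigh e₁ (t 0) (b.1, .inr b.2)
    by_cases hex : ∃ i, I.ok r y i = true
    · obtain ⟨j, hj⟩ := I.exists_isFirst hex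
      refine le_trans ?_ (le_add_of_nonneg_right (hZ0 r f t))
      refine le_trans ?_ (Finset.single_le_sum (fun j _ => hD0 j r t) (Finset.mem_univ j))
      rw [show ClawSampler.maskMsg (Sum.elim Empty.elim (Sum.elim c (I.outcome r f y))) =
        fun i => decide (i = j) from I.isFirst_eq_decide hj]
      refine Finset.sum_le_sum fun w _ => ?_
      by_cases hw : (w ∘ Sum.inl : Bits (Fin n ⊕ Fin n)) = clawPair fun x => I.outcome r f y (.inr x)
      · rw [if_pos hw, if_pos]
        have hg := hgood _ _ (I.isFirst_eq_true.1 hj).1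
        have e0 : (clawPair fun x => I.outcome r f y (.inr x)) ∘ Sum.inl =
            I.x₀ (fun a => r (j, a)) fun b => y (j, b) := I.select_of_isFirst I.x₀ hj _
        have e1 : (clawPair fun x => I.outcome r f y (.inr x)) ∘ Sum.inr =
            I.x₁ (fun a => r (j, a)) fun b => y (j, b) := I.select_of_isFirst I.x₁ hj _
        rw [hw, IsCollision, e0, e1]
        exact ⟨hg.1, hg.2.1.trans hg.2.2.symm⟩
      · rw [if_neg hw]
        split_ifs <;> positivity
    · have hno : ∀ i, I.ok r y i = false := fun i => by
        by_contra h
        exact hex ⟨i, by simpa using h⟩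
      refine le_trans (le_of_eq ?_) (le_add_of_nonneg_left (Finset.sum_nonneg fun j _ => hD0 j r t))
      have hmask : ClawSampler.maskMsg (Sum.elim Empty.elim (Sum.elim c (I.outcome r f y))) =
          fun _ => false := by
        ext i
        refine Bool.eq_false_iff.2 fun h => ?_
        have := (I.isFirst_eq_true.1 h).1
        rw [hno] at this
        cases this
      have hf : (clawPair fun x => I.outcome r f y (.inr x)) = f := by
        ext (i | i)
        · exact congrFun (I.select_of_forall I.x₀ hno fun l => f (.inl l)) i
        · exact congrFun (I.select_of_forall I.x₁ hno fun l => f (.inr l)) i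
      rw [hmask, hf]
      refine Finset.sum_congr rfl fun w _ => ?_
      by_cases hw : (w ∘ Sum.inl : Bits (Fin n ⊕ Fin n)) = f
      · rw [if_pos hw, if_pos hw]
      · rw [if_neg hw, if_neg hw]
  have h2 : ∀ r, 𝔼 f, ∑ t, (∑ j, D j r t + Z r f t) = ∑ j, ∑ t, D j r t + ((2 : ℝ) ^ (2 * n))⁻¹ := by
    intro r
    simp only [Finset.sum_add_distrib]
    rw [Finset.expect_add_distrib, Finset.expect_const Finset.univ_nonempty, Finset.sum_comm]
    congr 1
    rw [Fintype.expect_eq_sum_div_card, Finset.sum_comm]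
    -- The messages do not depend on `f`, so the events of outputting `f` are disjoint for different
    -- `f` and their probabilities add up to `1`.
    have h3 : ∑ t, ∑ w, ‖(B fun _ => false).stateN (m₁ r) t 1 w‖ ^ 2 = 1 :=
      sum_norm_sq_stateN _ (fun _ => m₁ r) fun _ _ _ _ => rfl
    have h4 : ∑ t, ∑ f, Z r f t = 1 := by
      rw [← h3]
      refine Finset.sum_congr rfl fun t _ => ?_
      simp only [hZ]
      rw [Finset.sum_comm]
      refine Finset.sum_congr rfl fun w _ => ?_
      rw [Fintype.sum_eq_single (w ∘ Sum.inl) fun f hf => if_neg (Ne.symm hf), if_pos rfl]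
    rw [h4]
    simp [two_mul]
  simp only [h2] at h1
  rw [Finset.expect_add_distrib, Finset.expect_const Finset.univ_nonempty, Finset.expect_sum_comm] at h1
  have hsz : ∀ j, (C j).size ≤ p + 2 * n + 2 * (q + 1 + q' + 2 * M + 3 * A.size) := fun j => by
    have h5 := hCsize j
    have h6 := hBsize fun i => decide (i = j)
    simp only [Fintype.card_fin] at h6
    lia
  -- Without instances there is no index to maximise over, and the empty circuit serves.
  rcases Nat.eq_zero_or_pos M with hM | hM
  · refine ⟨⟨0, []⟩, ?_, ?_⟩
    · simp [QCircuit.size]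
      lia
    · subst hM
      simpa using h1
  · have : Nonempty (Fin M) := ⟨⟨0, hM⟩⟩
    obtain ⟨j, hj⟩ := Finite.exists_max fun j => I.collisionProb ev (C j)
    refine ⟨C j, hsz j, h1.trans ?_⟩
    gcongr
    refine (Finset.sum_le_card_nsmul _ _ _ fun j' _ => (hC j').trans (hj j')).trans (le_of_eq ?_)
    simp

end ParallelSecurity

/-! ### The claw sampler of a trapdoor claw-free function -/

/-- Fixed coins are constants, at one step per coin. -/
theorem BComp.randCircuit_const {ι ο : Type} [Fintype ι] [DecidableEq ι] [Fintype ο] (C : RandCircuit ι ο)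
    (r : Bits (Fin C.coins)) : BComp (fun x => C.run x r) C.size := by
  have h : BComp (fun x : Bits ι => (Sum.elim x r : Bits (ι ⊕ Fin C.coins))) (0 + C.coins) := by
    have h1 := BComp.of_cx (f := fun (_ : Bits ι) => r) (N := 1) fun b => Cx.const _
    rw [Fintype.card_fin, mul_one] at h1
    exact (BComp.reindex id 0).sumElim h1
  refine ((BComp.randCircuit C).comp h).mono ?_
  simp only [RandCircuit.size]
  lia

/-! ### Probabilities of the honest receiver in terms of density matrices -/

section CircuitWeights
variable {p n m : ℕ} (Q : QCircuit (Fin p) (Fin n)) (pp : Bits (Fin p))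

theorem QCircuit.isHermitian_density : (Q.density pp).IsHermitian := by
  ext x x'
  simp only [Matrix.conjTranspose_apply, density, star_sum, star_mul', star_star]
  exact Finset.sum_congr rfl fun u _ => Finset.sum_congr rfl fun v _ => mul_comm _ _

theorem QCircuit.sum_imageProb_eq (ev : Bits (Fin p ⊕ Fin n) → Bits (Fin m)) (good : Bits (Fin m) → Bool) :
    ∑ y, (if good y then imageProb Q ev pp y else 0) =
      ∑ x, if good (ev (Sum.elim pp x)) then (Q.density pp x x).re else 0 := by
  have h1 : ∀ y, (if good y then imageProb Q ev pp y else 0) =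
      ∑ x, if ev (Sum.elim pp x) = y then (if good y then (Q.density pp x x).re else 0) else 0 := by
    intro y
    by_cases hy : good y
    · simp only [if_pos hy, imageProb]
      rw [Finset.sum_comm]
      refine Finset.sum_congr rfl fun x _ => ?_
      by_cases hx : ev (Sum.elim pp x) = y
      · simp only [if_pos hx, density, Complex.re_sum]
        refine Finset.sum_congr rfl fun u _ => Finset.sum_congr rfl fun v _ => ?_
        rw [Complex.star_def, Complex.mul_conj, Complex.ofReal_re, Complex.normSq_eq_norm_sq]
      · simp [hx]
    · simp [hy]
  simp only [h1]
  rw [Finset.sum_comm]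
  refine Finset.sum_congr rfl fun x _ => ?_
  rw [Finset.sum_ite_eq, if_pos (Finset.mem_univ _)]

/-- Expresses the weight through the reduced state of the output qubits, the only thing controlled
by the state preparation hypothesis. -/
theorem QCircuit.vecWeight_eq (c : QVec (Fin n)) :
    vecWeight Q pp c = (star c ⬝ᵥ (Q.density pp).mulVec c).re := by
  have h1 : ∀ u v, ‖∑ x, star (c x) * Q.final pp (Sum.elim u (Sum.elim x v))‖ ^ 2 =
      (∑ x, ∑ x', star (c x) * (Q.final pp (Sum.elim u (Sum.elim x v)) *
        star (Q.final pp (Sum.elim u (Sum.elim x' v))) * c x')).re := by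
    intro u v
    rw [← Complex.normSq_eq_norm_sq, ← Complex.ofReal_re (Complex.normSq _), ← Complex.mul_conj,
      map_sum, Finset.sum_mul_sum]
    congr 1
    refine Finset.sum_congr rfl fun x _ => Finset.sum_congr rfl fun x' _ => ?_
    rw [map_mul, ← Complex.star_def, star_star]
    ring
  simp only [vecWeight, h1, ← Complex.re_sum]
  congr 1
  simp only [dotProduct, Matrix.mulVec, density, Finset.sum_mul, Finset.mul_sum, Pi.star_apply]
  have h2 : ∀ f : Bits (Fin p) → Bits (Fin Q.anc) → Bits (Fin n) → Bits (Fin n) → ℂ,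
      ∑ u, ∑ v, ∑ x, ∑ x', f u v x x' = ∑ x, ∑ x', ∑ u, ∑ v, f u v x x' := by
    intro f
    calc _ = ∑ u, ∑ x, ∑ v, ∑ x', f u v x x' := Finset.sum_congr rfl fun u _ => Finset.sum_comm
      _ = ∑ x, ∑ u, ∑ v, ∑ x', f u v x x' := Finset.sum_comm
      _ = ∑ x, ∑ u, ∑ x', ∑ v, f u v x x' :=
        Finset.sum_congr rfl fun x _ => Finset.sum_congr rfl fun u _ => Finset.sum_comm
      _ = _ := Finset.sum_congr rfl fun x _ => Finset.sum_comm
  exact h2 _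

end CircuitWeights

namespace TCFData
variable (X : TCFData) (k : ℕ)

/-- The evaluation map computed by the circuit `E`, on fixed coins. -/
def evalMap (E : RandCircuit (Fin (X.ppLen k) ⊕ Fin (X.n k)) (Fin (X.m k))) :
    Bits (Fin (X.ppLen k) ⊕ Fin (X.n k)) → Bits (Fin (X.m k)) := fun s => E.run s fun _ => false

/-- The output of `Invert` on the coins `c`. -/
def invOut (c : Bits (Fin (X.invert k).coins)) (r : X.GenCoins k) (y : Bits (Fin (X.m k))) :
    Bits (Unit ⊕ Fin (X.n k) ⊕ Fin (X.n k)) := (X.invert k).run (Sum.elim (X.sp k r) y) c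

/-- Claw sampling by means of `Gen` and `Invert`, the latter on the coins `r'`, and the circuit `E`
for the evaluation. -/
def sampler (E : RandCircuit (Fin (X.ppLen k) ⊕ Fin (X.n k)) (Fin (X.m k)))
    (r' : Bits (Fin (X.invert k).coins)) :
    ClawSampler (X.gen k).coins (X.ppLen k) (X.n k) (X.m k) where
  pp := X.pp k
  x₀ r y := fun i => X.invOut k r' r y (.inr (.inl i))
  x₁ r y := fun i => X.invOut k r' r y (.inr (.inr i))
  -- An output of `Invert` counts only if it consists of two different strings whose images, as
  -- evaluated by `E`, are both `y`.
  good r y := (X.invOut k r' r y (.inl ()) && anyBits fun i => X.invOut k r' r y (.inr (.inl i)) ^^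
      X.invOut k r' r y (.inr (.inr i))) &&
    ((allBits fun j => !(X.evalMap k E (Sum.elim (X.pp k r) fun i => X.invOut k r' r y (.inr (.inl i))) j
        ^^ y j)) &&
      allBits fun j => !(X.evalMap k E (Sum.elim (X.pp k r) fun i => X.invOut k r' r y (.inr (.inr i))) j
        ^^ y j))

variable {X k} {E : RandCircuit (Fin (X.ppLen k) ⊕ Fin (X.n k)) (Fin (X.m k))}
  {r' : Bits (Fin (X.invert k).coins)}

theorem sampler_good_iff (hE : ∀ r x s, E.run (Sum.elim (X.pp k r) x) s = X.F k (X.pp k r) x)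
    (r : X.GenCoins k) (y : Bits (Fin (X.m k))) : (X.sampler k E r').good r y = true ↔
      X.Invert k (X.sp k r) y r' = some ((X.sampler k E r').x₀ r y, (X.sampler k E r').x₁ r y) ∧
        X.IsClaw k (X.pp k r) y ((X.sampler k E r').x₀ r y) ((X.sampler k E r').x₁ r y) := by
  have hxor : ∀ a b : Bool, (a ^^ b) = false ↔ a = b := by decide
  have hany : ∀ x x' : Bits (Fin (X.n k)), anyBits (fun i => x i ^^ x' i) = true ↔ x ≠ x' := by
    intro x x'
    simp [anyBits, funext_iff]
  have hall : ∀ x x' : Bits (Fin (X.m k)), allBits (fun i => !(x i ^^ x' i)) = true ↔ x = x' := by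
    intro x x'
    simp [allBits, hxor, funext_iff]
  have hev : ∀ x, X.evalMap k E (Sum.elim (X.pp k r) x) = X.F k (X.pp k r) x := fun x => hE r x _
  simp only [sampler, Bool.and_eq_true, hany, hall, hev, IsClaw, Invert]
  rw [show (X.invert k).run (Sum.elim (X.sp k r) y) r' = X.invOut k r' r y from rfl]
  by_cases h : X.invOut k r' r y (Sum.inl ()) = true
  · simp [h]
  · simp [h]

/-- A common bound for the sizes of the circuits for `Gen`, `Invert` and the evaluation. -/
def sizeBound (X : TCFData) (k : ℕ) (E : RandCircuit (Fin (X.ppLen k) ⊕ Fin (X.n k)) (Fin (X.m k))) : ℕ :=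
  (X.gen k).size + (X.invert k).size + E.size + 1

theorem bComp_gen : BComp (fun r : X.GenCoins k => (X.gen k).run Empty.elim r) (X.gen k).size := by
  have h : BComp (fun r : X.GenCoins k => (Sum.elim Empty.elim r : Bits (Empty ⊕ Fin (X.gen k).coins)))
      (Fintype.card (Empty ⊕ Fin (X.gen k).coins) * 0) := BComp.of_cx (by
    rintro (a | a)
    · exact a.elim
    · exact Cx.proj a 0)
  refine ((BComp.randCircuit (X.gen k)).comp h).mono ?_
  simp only [RandCircuit.size]
  lia

theorem bComp_sampler_pp : BComp (X.sampler k E r').pp (X.sizeBound k E) :=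
  ((BComp.reindex Sum.inl 0).comp bComp_gen).mono (by simp only [sizeBound]; lia)

theorem bComp_evalMap : BComp (X.evalMap k E) (X.sizeBound k E) :=
  (BComp.randCircuit_const E _).mono (by simp only [sizeBound]; lia)

theorem bComp_sampler : BComp (fun s : Bits (Fin (X.gen k).coins ⊕ Fin (X.m k)) =>
    (Sum.elim (fun _ => (X.sampler k E r').good (s ∘ Sum.inl) (s ∘ Sum.inr))
      (Sum.elim ((X.sampler k E r').x₀ (s ∘ Sum.inl) (s ∘ Sum.inr))
        ((X.sampler k E r').x₁ (s ∘ Sum.inl) (s ∘ Sum.inr))) :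
      Bits (Unit ⊕ Fin (X.n k) ⊕ Fin (X.n k)))) (100 * X.sizeBound k E ^ 2) := by
  set L := X.sizeBound k E with hL
  have hpp : BComp (fun s : Bits (Fin (X.gen k).coins ⊕ Fin (X.m k)) => X.pp k (s ∘ Sum.inl)) L :=
    (bComp_sampler_pp (E := E) (r' := r')).comp (BComp.reindex Sum.inl 0)
  have hinv : BComp (fun s : Bits (Fin (X.gen k).coins ⊕ Fin (X.m k)) =>
      X.invOut k r' (s ∘ Sum.inl) (s ∘ Sum.inr)) L :=
    ((BComp.randCircuit_const (X.invert k) r').comp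
      (((BComp.reindex Sum.inr 0).comp (bComp_gen.comp (BComp.reindex Sum.inl 0))).sumElim
        (BComp.reindex Sum.inr 0))).mono (by simp only [hL, sizeBound]; lia)
  have hx : ∀ f : Fin (X.n k) → Unit ⊕ Fin (X.n k) ⊕ Fin (X.n k),
      BComp (fun s : Bits (Fin (X.gen k).coins ⊕ Fin (X.m k)) => X.evalMap k E
        (Sum.elim (X.pp k (s ∘ Sum.inl)) fun i => X.invOut k r' (s ∘ Sum.inl) (s ∘ Sum.inr) (f i))) (3 * L) :=
    fun f => (bComp_evalMap.comp (hpp.sumElim ((BComp.reindex f 0).comp hinv))).mono (by lia)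
  have hchk : ∀ f : Fin (X.n k) → Unit ⊕ Fin (X.n k) ⊕ Fin (X.n k),
      Cx (fun s : Bits (Fin (X.gen k).coins ⊕ Fin (X.m k)) => allBits fun j => !(X.evalMap k E
        (Sum.elim (X.pp k (s ∘ Sum.inl)) fun i => X.invOut k r' (s ∘ Sum.inl) (s ∘ Sum.inr) (f i)) j ^^
          s (.inr j))) (Fintype.card (Fin (X.m k)) * (3 * L + 0 + 1 + 1 + 2) + 2) := fun f =>
    Cx.allBits fun j => (((hx f).cx j).op₂ xor (Cx.proj (.inr j) 0)).not
  have hn : X.n k + X.m k + 1 ≤ L := by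
    simp only [hL, sizeBound, RandCircuit.size, Fintype.card_sum, Fintype.card_fin, Fintype.card_unique]
    lia
  have hgood : BComp (fun (s : Bits (Fin (X.gen k).coins ⊕ Fin (X.m k))) (_ : Unit) =>
      (X.sampler k E r').good (s ∘ Sum.inl) (s ∘ Sum.inr)) (1 * (50 * L ^ 2)) := by
    have h := BComp.of_cx (β := Unit) (f := fun (s : Bits (Fin (X.gen k).coins ⊕ Fin (X.m k))) (_ : Unit) =>
      (X.sampler k E r').good (s ∘ Sum.inl) (s ∘ Sum.inr)) (N := 50 * L ^ 2) fun _ =>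
      ((((hinv.cx (.inl ())).op₂ (fun a b => a && b) (Cx.anyBits fun i =>
        (hinv.cx (.inr (.inl i))).op₂ xor (hinv.cx (.inr (.inr i))))).op₂ (fun a b => a && b)
        ((hchk fun i => .inr (.inl i)).op₂ (fun a b => a && b) (hchk fun i => .inr (.inr i))))).mono (by
          simp only [Fintype.card_fin]
          have h1 := Nat.mul_le_mul_right (3 * L + 0 + 1 + 1 + 2) (show X.m k ≤ L by lia)
          have h2 := Nat.mul_le_mul_right (L + L + 1 + 1) (show X.n k ≤ L by lia)
          nlinarith)
    rwa [Fintype.card_unique] at h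
  refine (hgood.sumElim (((BComp.reindex (fun i => .inr (.inl i)) 0).comp hinv).sumElim
    ((BComp.reindex (fun i => .inr (.inr i)) 0).comp hinv))).mono ?_
  nlinarith

end TCFData

/-- Hard-wired outputs, for the argument that a fixed pair of strings cannot be a claw too often. -/
theorem QCircuit.exists_const {κ : Type} [Fintype κ] [DecidableEq κ] (p : ℕ) (o : Bits κ) :
    ∃ C : QCircuit (Fin p) κ, C.size ≤ p + 2 * Fintype.card κ ∧ ∀ pp, 1 ≤ C.prob pp o := by
  let tgt : κ → Fin p ⊕ κ ⊕ Fin 0 := fun b => .inr (.inl b)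
  have htgt : Function.Injective tgt := fun a b h => by simpa [tgt] using h
  obtain ⟨gs, hgs, hlen, hrun⟩ := exists_qgates_toggle (φ := fun b _ => o b) (n := 1) htgt
    (fun b => Toggles.const _ _) fun _ _ _ _ => rfl
  refine ⟨⟨0, gs⟩, ?_, fun pp => ?_⟩
  · simp only [QCircuit.size, Fintype.card_fin]
    lia
  rw [QCircuit.prob]
  refine le_trans ?_ (Finset.single_le_sum (fun _ _ => Finset.sum_nonneg fun _ _ => by positivity)
    (Finset.mem_univ pp))
  refine le_trans ?_ (Finset.single_le_sum (fun _ _ => by positivity) (Finset.mem_univ fun _ => false))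
  rw [QCircuit.final, qRun_of_cRun_toggle htgt (fun _ _ _ _ => rfl) hgs hrun, ket, if_pos]
  · simp
  ext (a | a | a)
  · exact Function.extend_apply' _ _ _ fun ⟨b, hb⟩ => by simp [tgt] at hb
  · exact (htgt.extend_apply _ _ a).trans (by simp [tgt])
  · exact a.elim0

namespace TCFData
variable {X : TCFData} {k : ℕ} {E : RandCircuit (Fin (X.ppLen k) ⊕ Fin (X.n k)) (Fin (X.m k))}
  {r' : Bits (Fin (X.invert k).coins)}

theorem mass_nonneg (pp : Bits (Fin (X.ppLen k))) (x : Bits (Fin (X.n k))) : 0 ≤ X.mass k pp x :=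
  ENNReal.toReal_nonneg

theorem sum_mass (pp : Bits (Fin (X.ppLen k))) : ∑ x, X.mass k pp x = 1 := by
  simp only [mass]
  rw [← ENNReal.toReal_sum fun x _ => PMF.apply_ne_top _ _, ← tsum_fintype (L := .unconditional _),
    PMF.tsum_coe, ENNReal.toReal_one]

/-- The probability that the sampler succeeds on the image of `x ← D_pp`. -/
noncomputable def samplerProb (X : TCFData) (k : ℕ)
    (E : RandCircuit (Fin (X.ppLen k) ⊕ Fin (X.n k)) (Fin (X.m k)))
    (r' : Bits (Fin (X.invert k).coins)) : ℝ :=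
  𝔼 r, ∑ x, if (X.sampler k E r').good r (X.evalMap k E (Sum.elim (X.pp k r) x)) then
    X.mass k (X.pp k r) x else 0

/-- By averaging, some fixed coins of `Invert` do at least as well as random ones. The sender may
use them since circuits are non-uniform, and acceptance becomes a function of key and image. -/
theorem exists_invertProb_le (hE : ∀ r x s, E.run (Sum.elim (X.pp k r) x) s = X.F k (X.pp k r) x) :
    ∃ r', X.invertProb k ≤ X.samplerProb k E r' := by
  classical
  obtain ⟨r', hr'⟩ := exists_expect_le fun r' => X.samplerProb k E r'
  refine ⟨r', le_trans ?_ hr'⟩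
  simp only [samplerProb]
  rw [Finset.expect_comm, invertProb]
  refine Finset.expect_le_expect fun r _ => ?_
  rw [Finset.expect_sum_comm]
  refine Finset.sum_le_sum fun x _ => ?_
  rw [Finset.mul_expect]
  refine Finset.expect_le_expect fun s _ => ?_
  by_cases h : ∃ x₀ x₁, X.Invert k (X.sp k r) (X.F k (X.pp k r) x) s = some (x₀, x₁) ∧
      X.IsClaw k (X.pp k r) (X.F k (X.pp k r) x) x₀ x₁
  · rw [if_pos h, mul_one, if_pos]
    rw [show X.evalMap k E (Sum.elim (X.pp k r) x) = X.F k (X.pp k r) x from hE r x _,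
      sampler_good_iff hE]
    obtain ⟨x₀, x₁, h1, h2⟩ := h
    have h3 : (x₀, x₁) = ((X.sampler k E s).x₀ r (X.F k (X.pp k r) x),
        (X.sampler k E s).x₁ r (X.F k (X.pp k r) x)) := by
      simp only [Invert] at h1
      split_ifs at h1
      exact (Option.some.inj h1).symm
    rw [Prod.mk.injEq] at h3
    rw [← h3.1, ← h3.2]
    exact ⟨h1, h2⟩
  · rw [if_neg h, mul_zero]
    split_ifs
    exacts [mass_nonneg _ _, le_rfl]

/-- Since `Invert` rejects all images outside the claw set, acceptance implies two balanced
preimages. The verified pair must be these two, in one order or the other. -/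
theorem sampler_of_good {ε : ℝ} (hE : ∀ r x s, E.run (Sum.elim (X.pp k r) x) s = X.F k (X.pp k r) x)
    (hinv : ∀ r y r', y ∉ X.ClawSet k ε (X.pp k r) → X.Invert k (X.sp k r) y r' = none)
    {r : X.GenCoins k} {y : Bits (Fin (X.m k))} (h : (X.sampler k E r').good r y = true) :
    IsTwoPreimage (X.F k (X.pp k r)) y ((X.sampler k E r').x₀ r y) ((X.sampler k E r').x₁ r y) ∧
      |X.mass k (X.pp k r) ((X.sampler k E r').x₀ r y) / (X.mass k (X.pp k r) ((X.sampler k E r').x₀ r y) +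
        X.mass k (X.pp k r) ((X.sampler k E r').x₁ r y)) -
      X.mass k (X.pp k r) ((X.sampler k E r').x₁ r y) / (X.mass k (X.pp k r) ((X.sampler k E r').x₀ r y) +
        X.mass k (X.pp k r) ((X.sampler k E r').x₁ r y))| ≤ ε := by
  obtain ⟨h1, h2⟩ := (sampler_good_iff hE r y).1 h
  have h3 : y ∈ X.ClawSet k ε (X.pp k r) := by
    by_contra h3
    rw [hinv r y r' h3] at h1
    cases h1
  generalize (X.sampler k E r').x₀ r y = x₀ at *
  generalize (X.sampler k E r').x₁ r y = x₁ at *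
  obtain ⟨w₀, w₁, -, hw, hbal⟩ := h3
  rcases hw x₀ h2.2.1 with h4 | h4 <;> rcases hw x₁ h2.2.2 with h5 | h5 <;> subst h4 <;> subst h5
  · exact (h2.1 rfl).elim
  · exact ⟨⟨h2.1, h2.2.1, h2.2.2, hw⟩, hbal⟩
  · refine ⟨⟨h2.1, h2.2.1, h2.2.2, fun x hx => (hw x hx).symm⟩, ?_⟩
    rwa [abs_sub_comm, add_comm]
  · exact (h2.1 rfl).elim

section Bounds
variable {Q : QCircuit (Fin (X.ppLen k)) (Fin (X.n k))} {ε₁ : ℝ}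

/-- Success is a property of the measured image, hence a diagonal test on the prepared state; for
the ideal state it has probability `samplerProb`. -/
theorem abs_expect_imageProb_sub_le (hQ : ∀ r, traceDist (Q.density (X.pp k r))
      (Matrix.vecMulVec (X.psi k (X.pp k r)) (star (X.psi k (X.pp k r)))) ≤ ε₁) :
    |(𝔼 r, ∑ y, if (X.sampler k E r').good r y then imageProb Q (X.evalMap k E) (X.pp k r) y else 0) -
      X.samplerProb k E r'| ≤ 2 * ε₁ := by
  rw [samplerProb, ← Finset.expect_sub_distrib]
  refine (Finset.abs_expect_le _ _).trans ?_
  refine (Finset.expect_le_expect fun r _ => ?_).trans_eq (Finset.expect_const Finset.univ_nonempty _)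
  rw [Q.sum_imageProb_eq]
  exact abs_sum_diag_sub_le (Q.isHermitian_density _) (mass_nonneg _) (hQ r)
    fun x => (X.sampler k E r').good r (X.evalMap k E (Sum.elim (X.pp k r) x))

/-- Averages `sub_le_clawWeight` over the keys. The maximum with `0` is there because a negligible
function may be negative in places. -/
theorem samplerProb_sub_le_expect_vecWeight {ε₂ : ℝ}
    (hE : ∀ r x s, E.run (Sum.elim (X.pp k r) x) s = X.F k (X.pp k r) x)
    (hinv : ∀ r y r', y ∉ X.ClawSet k ε₂ (X.pp k r) → X.Invert k (X.sp k r) y r' = none)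
    (hQ : ∀ r, traceDist (Q.density (X.pp k r))
      (Matrix.vecMulVec (X.psi k (X.pp k r)) (star (X.psi k (X.pp k r)))) ≤ ε₁) :
    X.samplerProb k E r' - max ε₂ 0 / 2 - 2 * ε₁ ≤ 𝔼 r, ∑ y, if (X.sampler k E r').good r y then
      vecWeight Q (X.pp k r) (clawKet ((X.sampler k E r').x₀ r y) ((X.sampler k E r').x₁ r y) false) else 0 := by
  have h : ∀ a : ℝ, X.samplerProb k E r' - a = 𝔼 r, (∑ x, (if (X.sampler k E r').good r
      (X.evalMap k E (Sum.elim (X.pp k r) x)) then X.mass k (X.pp k r) x else 0) - a) := fun a => by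
    rw [Finset.expect_sub_distrib, Finset.expect_const Finset.univ_nonempty, samplerProb]
  rw [sub_sub, h]
  refine Finset.expect_le_expect fun r _ => ?_
  rw [← sub_sub]
  have hev : ∀ x, X.evalMap k E (Sum.elim (X.pp k r) x) = X.F k (X.pp k r) x := fun x => hE r x _
  simp only [hev, Q.vecWeight_eq]
  exact sub_le_clawWeight (Q.isHermitian_density _) (mass_nonneg _) (sum_mass _) (hQ r)
    (fun y hy => (sampler_of_good hE hinv hy).1) (le_max_right _ _)
    fun y hy => (sampler_of_good hE hinv hy).2.trans (le_max_left _ _)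

theorem traceDist_nonneg_of_le (hQ : ∀ r, traceDist (Q.density (X.pp k r))
      (Matrix.vecMulVec (X.psi k (X.pp k r)) (star (X.psi k (X.pp k r)))) ≤ ε₁) : 0 ≤ ε₁ := by
  have h := hQ fun _ => false
  have h1 := traceNorm_nonneg ((Q.isHermitian_density (X.pp k fun _ => false)).sub
    (isHermitian_vecMulVec_star (X.psi k (X.pp k fun _ => false))))
  rw [traceDist] at h
  linarith

end Bounds

theorem collisionProb_sampler (hE : ∀ r x s, E.run (Sum.elim (X.pp k r) x) s = X.F k (X.pp k r) x)
    (C : QCircuit (Fin (X.ppLen k)) (Fin (X.n k) ⊕ Fin (X.n k))) :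
    (X.sampler k E r').collisionProb (X.evalMap k E) C = X.clawProb k C := by
  classical
  rw [ClawSampler.collisionProb, clawProb]
  refine Finset.expect_congr rfl fun r _ => ?_
  rw [sum_bits_sum]
  refine Finset.sum_congr rfl fun x₀ _ => Finset.sum_congr rfl fun x₁ _ => ?_
  have hev : ∀ x, X.evalMap k E (Sum.elim (X.pp k r) x) = X.F k (X.pp k r) x := fun x => hE r x _
  have hiff : IsCollision (X.evalMap k E) ((X.sampler k E r').pp r) (Sum.elim x₀ x₁) ↔
      x₀ ≠ x₁ ∧ X.F k (X.pp k r) x₀ = X.F k (X.pp k r) x₁ := by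
    rw [IsCollision, Sum.elim_comp_inl, Sum.elim_comp_inr, ← hev, ← hev]
    rfl
  exact if_congr hiff rfl rfl

/-- Some fixed pair is a claw with probability at least `2 ^ (-2 n)` times that of successful
inversion. -/
theorem exists_invertProb_le_clawProb (X : TCFData) (k : ℕ) :
    ∃ C : QCircuit (Fin (X.ppLen k)) (Fin (X.n k) ⊕ Fin (X.n k)), C.size ≤ X.ppLen k + 4 * X.n k ∧
      X.invertProb k ≤ 2 ^ (2 * X.n k) * X.clawProb k C := by
  classical
  choose C hsize hC using QCircuit.exists_const (κ := Fin (X.n k) ⊕ Fin (X.n k)) (X.ppLen k)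
  obtain ⟨o, ho⟩ := Finite.exists_max fun o => X.clawProb k (C o)
  refine ⟨C o, (hsize o).trans ?_, ?_⟩
  · simp only [Fintype.card_sum, Fintype.card_fin]
    lia
  have hnn : ∀ (C : QCircuit (Fin (X.ppLen k)) (Fin (X.n k) ⊕ Fin (X.n k))) pp z, 0 ≤ C.prob pp z :=
    fun C pp z => Finset.sum_nonneg fun _ _ => Finset.sum_nonneg fun _ _ => by positivity
  -- A key for which inversion can succeed has some claw, and the constant circuit outputting this
  -- claw finds it with certainty.
  have h1 : X.invertProb k ≤ ∑ o, X.clawProb k (C o) := by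
    simp only [clawProb]
    rw [← Finset.expect_sum_comm, invertProb]
    refine Finset.expect_le_expect fun r _ => ?_
    have h0 : ∀ o, 0 ≤ ∑ x₀, ∑ x₁, if x₀ ≠ x₁ ∧ X.F k (X.pp k r) x₀ = X.F k (X.pp k r) x₁ then
        (C o).prob (X.pp k r) (Sum.elim x₀ x₁) else 0 := fun o =>
      Finset.sum_nonneg fun _ _ => Finset.sum_nonneg fun _ _ => by
        split_ifs
        exacts [hnn _ _ _, le_rfl]
    refine le_of_le_of_eq ?_ ((congrArg _ (sum_mass (X.pp k r))).trans (mul_one _))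
    rw [Finset.mul_sum]
    refine Finset.sum_le_sum fun x _ => ?_
    rw [mul_comm]
    refine mul_le_mul_of_nonneg_right ?_ (mass_nonneg _ _)
    refine (Finset.expect_le_expect fun s _ => ?_).trans_eq (Finset.expect_const Finset.univ_nonempty _)
    by_cases h : ∃ x₀ x₁, X.Invert k (X.sp k r) (X.F k (X.pp k r) x) s = some (x₀, x₁) ∧
        X.IsClaw k (X.pp k r) (X.F k (X.pp k r) x) x₀ x₁
    · rw [if_pos h]
      obtain ⟨x₀, x₁, -, h2⟩ := h
      refine le_trans ?_ (Finset.single_le_sum (fun o _ => h0 o) (Finset.mem_univ (Sum.elim x₀ x₁)))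
      have h3 : ∀ y y', 0 ≤ if y ≠ y' ∧ X.F k (X.pp k r) y = X.F k (X.pp k r) y' then
          (C (Sum.elim x₀ x₁)).prob (X.pp k r) (Sum.elim y y') else 0 := fun y y' => by
        split_ifs
        exacts [hnn _ _ _, le_rfl]
      refine le_trans ?_ (Finset.single_le_sum (fun y _ => Finset.sum_nonneg fun y' _ => h3 y y')
        (Finset.mem_univ x₀))
      refine le_trans ?_ (Finset.single_le_sum (fun y' _ => h3 x₀ y') (Finset.mem_univ x₁))
      rw [if_pos ⟨h2.1, h2.2.1.trans h2.2.2.symm⟩]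
      exact hC _ _
    · rw [if_neg h]
      exact Finset.sum_nonneg fun o _ => h0 o
  refine h1.trans ((Finset.sum_le_card_nsmul _ _ _ fun o' _ => ho o').trans (le_of_eq ?_))
  simp [two_mul]

end TCFData

/-! ### The claw-state generator of a trapdoor claw-free function -/

namespace TCFData
variable {X : TCFData}

theorem lengths_le (X : TCFData) (k : ℕ) : X.ppLen k ≤ (X.gen k).size ∧ (X.gen k).coins ≤ (X.gen k).size ∧
    X.n k ≤ (X.invert k).size ∧ X.m k ≤ (X.invert k).size := by
  simp only [RandCircuit.size, Fintype.card_sum, Fintype.card_fin]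
  lia

/-- Inversion succeeds with inverse polynomial probability, so claws exist that often. The best
constant pair is then a claw with probability at least `2 ^ (-2n)` times an inverse polynomial,
which claw-freeness makes negligible. -/
theorem IsTCF.negligible_inv_two_pow (hX : X.IsTCF) : Negligible fun k => ((2 : ℝ) ^ (2 * X.n k))⁻¹ := by
  choose C hsize hC using X.exists_invertProb_le_clawProb
  obtain ⟨-, -, ⟨c, N, hc⟩, -⟩ := hX.inversion
  have hpoly : PolyBounded fun k => ((C k).size : ℝ) := by
    refine polyBounded_iff.2 (((polyBounded_iff.1 hX.gen_ppt).add ((PolyNat.const 4).mul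
      (polyBounded_iff.1 hX.invert_ppt))).mono fun k => (hsize k).trans ?_)
    have := X.lengths_le k
    lia
  refine ((hX.claw_free C hpoly).poly_mul (PolyNat.id.pow c)).mono ?_
  filter_upwards [Filter.eventually_gt_atTop N, Filter.eventually_gt_atTop 0] with k h1 h2
  have hk : (0 : ℝ) < k := by exact_mod_cast h2
  have h3 := (hc k h1).trans (hC k)
  rw [inv_le_iff_one_le_mul₀ (by positivity)] at h3 ⊢
  push_cast
  linarith

/-- A trapdoor claw-free function yields a claw-state generator with search security. -/
theorem IsTCF.exists_isSearchSecureCSG (hX : X.IsTCF) :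
    ∃ (n : ℕ → ℕ) (P : CSGProtocol n), IsSearchSecureCSG P := by
  obtain ⟨E, hEppt, hE⟩ := hX.eval_ppt
  obtain ⟨Q, hQppt, ε₁, hε₁, hQ⟩ := hX.state_preparation
  obtain ⟨ε₂, hε₂, ⟨c, N, hc⟩, hinv⟩ := hX.inversion
  choose r' hr' using fun k => exists_invertProb_le (hE k)
  -- The number of instances exceeds the inverse success probability by a factor of order `k`, so
  -- that all fail with probability at most `exp (-k / 2)`.
  obtain ⟨M, hM⟩ : ∃ M : ℕ → ℕ, ∀ k, M k = k ^ (c + 1) := ⟨_, fun _ => rfl⟩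
  have hMpoly : PolyNat M := (PolyNat.id.pow (c + 1)).mono fun k => (hM k).le
  let e₁ : ∀ k, Fin 0 ⊕ ParMsg (M k) (X.ppLen k) (X.m k) ≃ Fin (M k * (X.ppLen k + X.m k)) := fun k =>
    Fintype.equivFinOfCardEq (by simp)
  choose S₁ ec₁ hS₁ hsize₁ using fun k => trivialSender.exists_extends (e₁ k)
    (ClawSampler.bComp_firstMsg (I := X.sampler k (E k) (r' k)) bComp_sampler_pp)
    (ClawSampler.bComp_firstOut bComp_sampler)
  choose S₂ ec₂ hS₂ hsize₂ using fun k => (S₁ k).exists_extends (ι' := Empty) (C := Empty)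
    (finSumFinEquiv : _ ⊕ Fin (M k) ≃ _) (μ := ClawSampler.maskMsg) (out := ClawSampler.finalOut)
    (BComp.reindex _ 0) (BComp.reindex _ 0)
  have hgood : ∀ k r y, (X.sampler k (E k) (r' k)).good r y = true →
      (X.sampler k (E k) (r' k)).x₀ r y ≠ (X.sampler k (E k) (r' k)).x₁ r y ∧
        X.evalMap k (E k) (Sum.elim (X.pp k r) ((X.sampler k (E k) (r' k)).x₀ r y)) = y ∧
        X.evalMap k (E k) (Sum.elim (X.pp k r) ((X.sampler k (E k) (r' k)).x₁ r y)) = y := by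
    intro k r y h
    have h1 := ((sampler_good_iff (hE k) r y).1 h).2
    exact ⟨h1.1, (hE k r _ _).trans h1.2.1, (hE k r _ _).trans h1.2.2⟩
  obtain ⟨S, hS⟩ : ∃ S : ℕ → ℝ, ∀ k, (𝔼 r, ∑ y, if (X.sampler k (E k) (r' k)).good r y then
      imageProb (Q k) (X.evalMap k (E k)) (X.pp k r) y else 0) = S k := ⟨_, fun _ => rfl⟩
  obtain ⟨O, hO⟩ : ∃ O : ℕ → ℝ, ∀ k, (𝔼 r, ∑ y, if (X.sampler k (E k) (r' k)).good r y then
      vecWeight (Q k) (X.pp k r) (clawKet ((X.sampler k (E k) (r' k)).x₀ r y)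
        ((X.sampler k (E k) (r' k)).x₁ r y) false) else 0) = O k := ⟨_, fun _ => rfl⟩
  choose R hsizeR hR using fun k => exists_honest_receiver (hS₁ k) (hS₂ k) (Q k) bComp_evalMap (hgood k)
    (hS k) (hO k)
  have hgen := polyBounded_iff.1 hX.gen_ppt
  have hinvert := polyBounded_iff.1 hX.invert_ppt
  have hp : PolyNat X.ppLen := hgen.mono fun k => (X.lengths_le k).1
  have hg : PolyNat fun k => (X.gen k).coins := hgen.mono fun k => (X.lengths_le k).2.1
  have hn : PolyNat X.n := hinvert.mono fun k => (X.lengths_le k).2.2.1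
  have hm : PolyNat X.m := hinvert.mono fun k => (X.lengths_le k).2.2.2
  have hL : PolyNat fun k => X.sizeBound k (E k) :=
    ((hgen.add hinvert).add (polyBounded_iff.1 hEppt)).add (PolyNat.const 1)
  have hq : PolyNat fun k => M k * (X.ppLen k + X.m k) := hMpoly.mul (hp.add hm)
  have hS₁poly : PolyNat fun k => (S₁ k).size := by
    refine ((((((PolyNat.const 10).mul hq).add ((PolyNat.const 3).mul (hq.mul hL))).add
      ((PolyNat.const 3).mul ((hMpoly.add (((PolyNat.const 2).mul hn).add (PolyNat.const 1))).mul
        (((hMpoly.add (PolyNat.const 1)).pow 2).mul (((PolyNat.const 10).mul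
          ((PolyNat.const 100).mul (hL.pow 2))).add (PolyNat.const 30)))))).add
      ((PolyNat.const 5).mul (hMpoly.add (((PolyNat.const 2).mul hn).add (PolyNat.const 1))))).add
      (((hMpoly.mul hg).add ((PolyNat.const 2).mul hn)).add (PolyNat.const 10))).mono fun k => ?_
    refine (hsize₁ k).trans (le_of_eq ?_)
    simp only [trivialSender, Sender.size, Fintype.card_sum, Fintype.card_prod, Fintype.card_fin,
      Fintype.card_empty, Fintype.card_unique, List.length_nil, Finset.univ_eq_empty, Finset.sum_empty]
    ring
  have hS₂poly : PolyNat fun k => (S₂ k).size := by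
    refine (((((PolyNat.const 10).mul hS₁poly).add (hS₁poly.mul hMpoly)).add
      ((PolyNat.const 10).mul hMpoly)).add (((PolyNat.const 10).mul hn).add (PolyNat.const 15))).mono
      fun k => (hsize₂ k).trans (le_of_eq ?_)
    simp only [Fintype.card_sum, Fintype.card_fin, Fintype.card_empty, Fintype.card_unique]
    ring
  refine ⟨X.n, { q := fun k => M k * (X.ppLen k + X.m k) + M k, T := fun _ => 2, S := S₂, R := R },
    ⟨polyBounded_iff.2 hS₂poly, ?_⟩, ?_, fun A => ?_⟩
  · refine polyBounded_iff.2 (((((((hq.add hMpoly).add hn).add hq).add (PolyNat.const 2)).add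
      (hMpoly.mul (((((PolyNat.const 2).mul hp).add ((PolyNat.const 3).mul hn)).add
        (polyBounded_iff.1 hQppt)).add (((PolyNat.const 9).mul hL).add ((PolyNat.const 10).mul hm)))))).mono
      fun k => (hsizeR k).trans ?_)
    refine Nat.add_le_add_left (Nat.mul_le_mul_left _ ?_) _
    simp only [QCircuit.size]
    lia
  · have hε₁0 : ∀ k, 0 ≤ ε₁ k := fun k => traceDist_nonneg_of_le (hQ k)
    -- State preparation costs `2 * ε₁` for the probability of success and again `2 * ε₁` for the
    -- weight of the claw state; the imbalance costs half of the balance parameter.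
    have hSO : ∀ k, S k - O k ≤ 4 * ε₁ k + max (ε₂ k) 0 / 2 := fun k => by
      have h1 := abs_le.1 (abs_expect_imageProb_sub_le (E := E k) (r' := r' k) (hQ k))
      have h2 := samplerProb_sub_le_expect_vecWeight (r' := r' k) (hE k) (hinv k) (hQ k)
      rw [hS] at h1
      rw [hO] at h2
      linarith [h1.2]
    have hS0 : ∀ k, 0 ≤ S k := fun k => by
      rw [← hS]
      refine Finset.expect_nonneg fun r _ => Finset.sum_nonneg fun y _ => ?_
      split_ifs
      exacts [imageProb_nonneg _ _ _ _, le_rfl]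
    have hS1 : ∀ k, S k ≤ 1 := fun k => by
      rw [← hS]
      refine (Finset.expect_le_expect fun r _ => ?_).trans_eq (Finset.expect_const Finset.univ_nonempty _)
      rw [← sum_imageProb (Q k) (X.evalMap k (E k)) (X.pp k r)]
      refine Finset.sum_le_sum fun y _ => ?_
      split_ifs
      exacts [le_rfl, imageProb_nonneg _ _ _ _]
    -- The error `2 * ε₁` is below half of `k ^ (-c)` once `ε₁ < k ^ (-(c + 1))` and `k ≥ 4`, so
    -- half of the success probability survives.
    have hSc : ∀ᶠ k : ℕ in Filter.atTop, ((k : ℝ) ^ c)⁻¹ / 2 ≤ S k := by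
      filter_upwards [negligible_iff.1 hε₁ (c + 1), Filter.eventually_gt_atTop N,
        Filter.eventually_ge_atTop 4] with k h1 h2 h3
      have h4 := abs_le.1 (abs_expect_imageProb_sub_le (E := E k) (r' := r' k) (hQ k))
      rw [hS] at h4
      have h5 := (hc k h2).trans (hr' k)
      have hk : (4 : ℝ) ≤ k := by exact_mod_cast h3
      have h6 : ((k : ℝ) ^ (c + 1))⁻¹ ≤ ((k : ℝ) ^ c)⁻¹ / 4 := by
        rw [pow_succ, mul_inv, div_eq_mul_inv]
        gcongr
      linarith [h4.1]
    have hδ : Negligible fun k => 4 * ε₁ k + max (ε₂ k) 0 / 2 := by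
      have hmax : Negligible fun k => max (ε₂ k) 0 := by
        refine negligible_iff.2 fun d => ?_
        filter_upwards [negligible_iff.1 hε₂ d, Filter.eventually_gt_atTop 0] with k h1 h2
        have hk : (0 : ℝ) < k := by exact_mod_cast h2
        exact max_lt h1 (by positivity)
      refine ((hε₁.const_mul 4).add hmax).mono (Filter.Eventually.of_forall fun k => ?_)
      have := le_max_right (ε₂ k) 0
      push_cast
      linarith
    refine ((Negligible.one_sub_pow hS1 hSc).add (hδ.poly_mul hMpoly)).mono
      (Filter.Eventually.of_forall fun k => ?_)
    have h1 := sqOverlap_le_expectedOverlap (S₂ k) (R k) Empty.elim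
      (v := clawVec) fun a => unitOrZero_clawKet _ _ _
    have h2 := one_sub_sum_firstSuccess_le (hS0 k) (hS1 k) (hSO k)
      (by have := hε₁0 k; have := le_max_right (ε₂ k) 0; positivity) (M k)
    have h3 := hR k
    rw [← hM]
    change 1 - expectedOverlap (S₂ k) (R k) Empty.elim clawVec ≤ _
    linarith
  · choose C hsizeC hC using fun k => exists_collision_finder (hS₁ k) (hS₂ k) (hgood k) (A.R k)
    have hCpoly : PolyBounded fun k => ((C k).size : ℝ) :=
      polyBounded_iff.2 ((((hp.add ((PolyNat.const 2).mul hn)).add ((PolyNat.const 2).mul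
        ((((hq.add (PolyNat.const 1)).add (hq.add hMpoly)).add ((PolyNat.const 2).mul hMpoly)).add
          ((PolyNat.const 3).mul (polyBounded_iff.1 A.qpt)))))).mono hsizeC)
    refine (((hX.claw_free C hCpoly).poly_mul hMpoly).add hX.negligible_inv_two_pow).mono
      (Filter.Eventually.of_forall fun k => ?_)
    have h := hC k
    rw [collisionProb_sampler (hE k)] at h
    refine (le_of_eq ?_).trans h
    refine congrArg _ (funext fun a => funext fun o => propext ?_)
    simp only [funext_iff, Sum.forall]
    rfl

end TCFData

/-! ### Composition of the implications -/

theorem mainTheorem1 :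
    (∀ X : TCFData, X.IsTCF → ∃ P : OSPProtocol, IsOSP P) ∧
    (∀ (n : ℕ → ℕ) (P : CSGProtocol n), IsSearchSecureCSG P → ∃ P' : OSPProtocol, IsOSP P') ∧
    (∀ X : TCFData, X.IsTCF → ∃ (n : ℕ → ℕ) (P : CSGProtocol n), IsSearchSecureCSG P) ∧
    (∀ (n : ℕ → ℕ) (P : CSGProtocol n), IsSearchSecureCSG P →
      ∃ P' : RandomOSPProtocol, IsRandomOSP P') ∧
    (∀ P : RandomOSPProtocol, IsRandomOSP P → ∃ P' : OSPProtocol, IsOSP P') := by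
  have hB : ∀ (n : ℕ → ℕ) (P : CSGProtocol n), IsSearchSecureCSG P → ∃ P' : OSPProtocol, IsOSP P' := by
    intro n P hP
    obtain ⟨P', hP'⟩ := hP.exists_isRandomOSP
    exact hP'.exists_isOSP
  refine ⟨fun X hX => ?_, hB, fun X hX => hX.exists_isSearchSecureCSG,
    fun n P hP => hP.exists_isRandomOSP, fun P hP => hP.exists_isOSP⟩
  obtain ⟨n, P, hP⟩ := hX.exists_isSearchSecureCSG
  exact hB n P hP
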